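/- **Setting.** An instance of Constrained Correlation Clustering is $G=(V,E^+,E^-,F,H)$, where $V$ is a finite set of $n$ nodes, $E^+\sqcup E^-$ is the set of all unordered pairs of distinct nodes, and $F$ (friendly) and $H$ (hostile) are sets of such pairs. A clustering $\mathcal C$ is feasible if $\mathcal C(u)=\mathcal C(v)$ for $uv\in F$ and $\mathcal C(u)\ne\mathcal C(v)$ for $uv\in H$; its cost is the number of $uv\in E^+$ with $\mathcal C(u)\neq\mathcal C(v)$ plus the number of $uv\in E^-$ with $\mathcal C(u)=\mathcal C(v)$. The supernode $S(u)$ is the connected component of $u$ in $(V,F)$; distinct supernodes $A,B$ are hostile if some $ab\in H$ has $a\in A$, $b\in B$; $E^{\pm}(A,B)$ is the set of edges of $E^\pm$ between $A$ and $B$. Assume that $G$ has a feasible clustering and is in consistent form: $uv\in E^+$ if $S(u)=S(v)$, $u\ne v$, and $uv\in E^-$ if $S(u),S(v)$ are hostile. Let $\varepsilon\in(0,1)$. **Algorithm ConstrainedCoverRound.** 1. A dangerous pair is a pair of edges $ab,cd\in E^+$ with $S(b)=S(c)$ and $S(a),S(d)$ hostile. Take an inclusion-maximal set $\mathcal D$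 of dangerous pairs in which every edge occurs at most once. Let $E_{\mathcal D}$ be the set of edges occurring in $\mathcal D$, and for $e\in E_{\mathcal D}$ let $\rho(e)$ be the edge paired with $e$. 2. Take a $(1+\varepsilon/3)$-approximate solution (a feasible point whose objective is at most $1+\varepsilon/3$ times that of every feasible point) of the linear program with variables $x_{uv}$ ($uv\in E^+\cup E^-$) and $X^+_{AB},X^-_{AB}\ge 0$ (unordered pairs of supernodes, $A=B$ allowed): minimize $\sum_{uv\in E^+\cup E^-}x_{uv}$ subject to - $x_{uv}=X^{+}_{S(u)S(v)}$ for $uv\in E^+$ and $x_{uv}=X^-_{S(u)S(v)}$ for $uv\in E^-$; - $X^+_{AA}=0$ and $X^-_{AA}=1$ for all $A$; $X^-_{AB}=0$ and $X^+_{AB}=1$ for hostile $A,B$; - $X^+_{AB}+X^-_{AB}\ge1$ for all $A,B$, and $X^+_{AB}+X^+_{BC}+X^-_{AC}\ge 1$ for all distinct $A,B,C$ in every order; - (HEAP) $x_{ab}+x_{bc}+x_{\rho(ac)}\ge1$ whenever $ac\in E_{\mathcal D}$, $b\notin S(a)\cup S(c)$ and $ab,bc\in E^+$. 3. Build $\hat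 G=(V,\hat E^+,\hat E^-)$: a pair $uv$ of distinct nodes is in $\hat E^+$ if $S(u)=S(v)$, or if, for $A=S(u)\ne B=S(v)$, $E^+(A,B)\not\subseteq E_{\mathcal D}$ and $X^+_{AB}<\min\{X^-_{AB},\tfrac23\}$; otherwise $uv\in\hat E^-$. 4. Run Pivot on $\hat G$: starting from $R=V$, while $R\neq\emptyset$ choose a pivot $p\in R$, output the cluster $C_p=\{p\}\cup\{v\in R: pv\in\hat E^+\}$, and replace $R$ by $R\setminus C_p$. For a set $R$ of remaining nodes and $p\in R$ let $\mathcal T_p^+$ be the set of $uv\in\hat E^+$ with $u,v\in R$, $pu\in\hat E^+$, $pv\in\hat E^-$, and let $\mathcal T_p^-$ be the set of $uv\in\hat E^-$ with $u,v\in R$, $pu,pv\in\hat E^+$. Call $e\in E_{\mathcal D}$ balanced if $e,\rho(e)\in E^+\cap\hat E^-$; let $y_{uv}=2$ if $uv$ is balanced and $y_{uv}=3x_{uv}$ otherwise. **Theorem.** For every choice of $\mathcal D$ and of the $(1+\varepsilon/3)$-approximate solution: (a) $\hat G$ is pivot-safe: if $S(i)=S(j)$ and $i\ne j$, then $ij\in\hat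 E^+$ and $i,j$ have the same positive neighbours in $\hat G$ among the other nodes; if $S(i),S(j)$ are hostile, then $ij\in\hat E^-$ and no $k$ has $ik,jk\in\hat E^+$. (b) If each pivot minimizes, over $p\in R$, the ratio $$\frac{|\mathcal T_p^+\cap E^+|+|\mathcal T_p^-\cap E^-|}{\sum_{uv\in\mathcal T_p^+\cup\mathcal T_p^-}y_{uv}}$$ ($c/0=\infty$ for $c>0$; ratios $0/0$ may be ranked arbitrarily), then the returned clustering is feasible and its cost is at most $(3+\varepsilon)$ times the cost of every feasible clustering. (c) If each pivot is chosen uniformly at random from $R$, then the returned clustering is always feasible and its expected cost is at most $(3+\varepsilon)$ times the cost of every feasible clustering. Moreover, (d) there are a program for a random access machine with unit-cost exact real arithmetic (natural-number cells, with addition and subtraction, serve as addresses; there is no rounding of reals to integers) and constants $c,k$ such that, for all $n\ge1$, every such instance on $n$ nodes and every $\varepsilon\in(0,1)$, the program returns a clustering that ConstrainedCoverRound can return, for some valid choices in steps 1 and 2, with ratio-minimizing pivots as in (b), after at most $c\,\varepsilon^{-3}n^3(1+\log n)^k$ steps; that is, it runs in time $\tilde O(n^3)$ for constant $\varepsilon$.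 -/

import Mathlib

/-! ## Instances, clusterings and cost -/

/-- An instance of Constrained Correlation Clustering on the node set `V`: a complete signed graph
with positive edges `pos` (every other pair of distinct nodes is negative), together with the
friendly edges `friendly` and the hostile edges `hostile`. -/
structure CCInstance (V : Type*) where
  pos : SimpleGraph V
  friendly : SimpleGraph V
  hostile : SimpleGraph V

namespace CCInstance

variable {V : Type*}

/-- The negative edges. -/
def neg (G : CCInstance V) : SimpleGraph V := G.posᶜ

/-- A clustering is given by its cluster assignment `𝒞`: two nodes lie in the same cluster iff they
have the same label. It is feasible if it respects all friendly and hostile edges. -/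
def IsFeasible {α : Type*} (G : CCInstance V) (𝒞 : V → α) : Prop :=
  (∀ u v, G.friendly.Adj u v → 𝒞 u = 𝒞 v) ∧ (∀ u v, G.hostile.Adj u v → 𝒞 u ≠ 𝒞 v)

/-- The unordered pairs of nodes inside the clusters of `𝒞`. -/
def inside {α : Type*} (𝒞 : V → α) : Set (Sym2 V) := {e | ∃ u v, e = s(u, v) ∧ 𝒞 u = 𝒞 v}

/-- The number of positive edges between clusters plus the number of negative edges inside
clusters. -/
noncomputable def cost {α : Type*} (G : CCInstance V) (𝒞 : V → α) : ℕ :=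
  (G.pos.edgeSet \ inside 𝒞).ncard + (G.neg.edgeSet ∩ inside 𝒞).ncard

/-- `𝒞` is an `α`-approximate clustering: it is feasible and its cost is within a factor `α` of
that of every feasible clustering (a partition of `V` needs no labels outside `V`). -/
def IsApproxClustering (G : CCInstance V) (α : ℝ) (𝒞 : V → V) : Prop :=
  G.IsFeasible 𝒞 ∧ ∀ 𝒞' : V → V, G.IsFeasible 𝒞' → (G.cost 𝒞 : ℝ) ≤ α * G.cost 𝒞'

/-! ## Supernodes and consistent form -/

/-- Supernodes are the connected components of the graph of friendly edges. -/
abbrev Supernode (G : CCInstance V) : Type _ := G.friendly.ConnectedComponent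

/-- The supernode of a node. -/
def super (G : CCInstance V) (u : V) : G.Supernode := G.friendly.connectedComponentMk u

/-- Two supernodes are hostile if some hostile edge joins them. -/
def HostilePair (G : CCInstance V) (A B : G.Supernode) : Prop :=
  ∃ a b, G.super a = A ∧ G.super b = B ∧ G.hostile.Adj a b

/-- Consistent form: edges inside a supernode are positive, edges between hostile supernodes are
negative. -/
def IsConsistent (G : CCInstance V) : Prop :=
  (∀ u v, u ≠ v → G.super u = G.super v → G.pos.Adj u v) ∧
    (∀ u v, G.HostilePair (G.super u) (G.super v) → G.neg.Adj u v)

/-! ## Dangerous pairs -/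

/-- A dangerous pair: positive edges `ab` and `cd` such that `b` and `c` share a supernode and the
supernodes of `a` and `d` are hostile. -/
def IsDangerousPair (G : CCInstance V) (q : Sym2 (Sym2 V)) : Prop :=
  ∃ a b c d, q = s(s(a, b), s(c, d)) ∧ G.pos.Adj a b ∧ G.pos.Adj c d ∧
    G.super b = G.super c ∧ G.HostilePair (G.super a) (G.super d)

/-- A set of dangerous pairs in which every edge occurs at most once. -/
def IsEdgeDisjointDangerous (G : CCInstance V) (𝒟 : Set (Sym2 (Sym2 V))) : Prop :=
  (∀ q ∈ 𝒟, G.IsDangerousPair q) ∧ ∀ q ∈ 𝒟, ∀ r ∈ 𝒟, ∀ e, e ∈ q → e ∈ r → q = r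

/-- A maximal edge-disjoint set of dangerous pairs. -/
def IsMaximalDangerous (G : CCInstance V) (𝒟 : Set (Sym2 (Sym2 V))) : Prop :=
  Maximal G.IsEdgeDisjointDangerous 𝒟

/-- The edges that occur in `𝒟`. For such an edge `e` the partner edge `ρ(e)` is the edge `f` with
`s(e, f) ∈ 𝒟`; it is unique because `𝒟` is edge-disjoint. -/
def dangerousEdges (𝒟 : Set (Sym2 (Sym2 V))) : Set (Sym2 V) := {e | ∃ f, s(e, f) ∈ 𝒟}

/-! ## The covering linear program -/

/-- An assignment of values to the variables of the linear program: `Xpos s(A, B)` and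
`Xneg s(A, B)` for supernodes `A`, `B`, and `x s(u, v)` for the edge `uv`. -/
structure LPPoint (G : CCInstance V) where
  Xpos : Sym2 G.Supernode → ℝ
  Xneg : Sym2 G.Supernode → ℝ
  x : Sym2 V → ℝ

/-- The constraints of the covering linear program that is defined by `𝒟`. The three constraints on
a triple of supernodes are obtained from `triangle` by permuting `A`, `B`, `C`. -/
structure IsLPFeasible (G : CCInstance V) (𝒟 : Set (Sym2 (Sym2 V))) (X : LPPoint G) : Prop where
  edge_pos : ∀ e ∈ G.pos.edgeSet, X.x e = X.Xpos (e.map G.super)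
  edge_neg : ∀ e ∈ G.neg.edgeSet, X.x e = X.Xneg (e.map G.super)
  diag : ∀ A, X.Xpos s(A, A) = 0 ∧ X.Xneg s(A, A) = 1
  hostile : ∀ A B, G.HostilePair A B → X.Xneg s(A, B) = 0 ∧ X.Xpos s(A, B) = 1
  triangle : ∀ A B C, A ≠ B → B ≠ C → A ≠ C →
    1 ≤ X.Xpos s(A, B) + X.Xpos s(B, C) + X.Xneg s(A, C)
  pair : ∀ A B, 1 ≤ X.Xpos s(A, B) + X.Xneg s(A, B)
  nonneg : ∀ A B, 0 ≤ X.Xpos s(A, B) ∧ 0 ≤ X.Xneg s(A, B)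
  /-- The HEAP constraints: `x_ab + x_bc + x_ρ(ac) ≥ 1`. -/
  heap : ∀ a b c f, s(s(a, c), f) ∈ 𝒟 → G.super b ≠ G.super a → G.super b ≠ G.super c →
    G.pos.Adj a b → G.pos.Adj b c → 1 ≤ X.x s(a, b) + X.x s(b, c) + X.x f

open scoped Classical in
/-- The objective: the sum of `x_uv` over all edges, that is, over all pairs of distinct nodes. -/
noncomputable def LPPoint.objective [Fintype V] {G : CCInstance V} (X : LPPoint G) : ℝ :=
  ∑ e : Sym2 V with ¬ e.IsDiag, X.x e

/-- An `α`-approximate solution of the linear program. -/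
def IsLPApprox [Fintype V] (G : CCInstance V) (𝒟 : Set (Sym2 (Sym2 V))) (α : ℝ)
    (X : LPPoint G) : Prop :=
  G.IsLPFeasible 𝒟 X ∧ ∀ X' : LPPoint G, G.IsLPFeasible 𝒟 X' → X.objective ≤ α * X'.objective

/-! ## The auxiliary graph -/

/-- The positive edges of the auxiliary graph: all edges inside supernodes, and all edges between
distinct supernodes `A`, `B` for which `E⁺(A, B)` contains an edge that does not occur in `𝒟` and
`X⁺_AB < min {X⁻_AB, 2/3}`. All other edges are negative. -/
def auxGraph (G : CCInstance V) (𝒟 : Set (Sym2 (Sym2 V))) (X : LPPoint G) : SimpleGraph V where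
  Adj u v := u ≠ v ∧ (G.super u = G.super v ∨
    ((∃ a b, G.super a = G.super u ∧ G.super b = G.super v ∧ G.pos.Adj a b ∧
        s(a, b) ∉ dangerousEdges 𝒟) ∧
      X.Xpos s(G.super u, G.super v) < min (X.Xneg s(G.super u, G.super v)) (2 / 3)))
  symm := ⟨by
    rintro u v ⟨huv, h | ⟨⟨a, b, ha, hb, hab, hd⟩, hX⟩⟩
    · exact ⟨huv.symm, Or.inl h.symm⟩
    · refine ⟨huv.symm, Or.inr ⟨⟨b, a, hb, ha, hab.symm, ?_⟩, ?_⟩⟩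
      · rwa [Sym2.eq_swap]
      · rwa [Sym2.eq_swap]⟩
  loopless := ⟨fun u h => h.1 rfl⟩

/-- An auxiliary graph with positive edges `K` (and negative edges `Kᶜ`) is pivot-safe for `G`. -/
def IsPivotSafe (G : CCInstance V) (K : SimpleGraph V) : Prop :=
  (∀ i j, i ≠ j → G.super i = G.super j →
      K.Adj i j ∧ ∀ k, k ≠ i → k ≠ j → (K.Adj i k ↔ K.Adj j k)) ∧
    (∀ i j, G.HostilePair (G.super i) (G.super j) →
      Kᶜ.Adj i j ∧ ¬ ∃ k, K.Adj i k ∧ K.Adj j k)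

/-! ## Pivot -/

open scoped Classical in
/-- The cluster `C_p` that is formed when `p` is chosen among the remaining nodes `R`. -/
noncomputable def pivotCluster (K : SimpleGraph V) (R : Finset V) (p : V) : Finset V :=
  {v ∈ R | v = p ∨ K.Adj p v}

open scoped Classical in
/-- The cluster assignment that puts the cluster `C_p` (labelled by `p`) in front of the
assignment `𝒞` of the other nodes. -/
noncomputable def assignCluster (K : SimpleGraph V) (R : Finset V) (p : V) (𝒞 : V → V) : V → V :=
  fun v => if v ∈ pivotCluster K R p then p else 𝒞 v

open scoped Classical in
/-- `PivotRun K rule R 𝒞`: Pivot on the graph with positive edges `K`, started with the remaining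
nodes `R` and choosing in each iteration some pivot that `rule` admits for the nodes then
remaining, can return the clustering `𝒞` of `R`, each node being labelled by the pivot of its
cluster (labels of nodes outside `R` are irrelevant). -/
inductive PivotRun (K : SimpleGraph V) (rule : Finset V → V → Prop) : Finset V → (V → V) → Prop
  | done : PivotRun K rule ∅ id
  | step (R : Finset V) (p : V) (𝒞 : V → V) : p ∈ R → rule R p →
      PivotRun K rule (R \ pivotCluster K R p) 𝒞 → PivotRun K rule R (assignCluster K R p 𝒞)

open scoped Classical in
/-- The distribution of the clustering that Pivot returns when each pivot is chosen uniformly at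
random among the remaining nodes. -/
noncomputable def randomPivot (K : SimpleGraph V) (R : Finset V) : PMF (V → V) :=
  if h : R.Nonempty then
    haveI : Nonempty R := h.to_subtype
    (PMF.uniformOfFintype R).bind fun p =>
      (randomPivot K (R \ pivotCluster K R p)).map (assignCluster K R p)
  else PMF.pure id
termination_by R.card
decreasing_by
  apply Finset.card_lt_card
  refine ⟨Finset.sdiff_subset, fun hsub => ?_⟩
  have hp := hsub p.2
  simp [pivotCluster] at hp

open scoped Classical in
/-- The expected cost of a random clustering. -/
noncomputable def expectedCost [Fintype V] (G : CCInstance V) (μ : PMF (V → V)) : ℝ :=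
  ∑ 𝒞 : V → V, (μ 𝒞).toReal * G.cost 𝒞

/-! ## The deterministic pivot rule -/

/-- `𝒯⁺_p`: the pairs `uv` of remaining nodes that are positive in the auxiliary graph, with `pu`
positive and `pv` negative. -/
def badPos (K : SimpleGraph V) (R : Finset V) (p : V) : Set (Sym2 V) :=
  {e | ∃ u ∈ R, ∃ v ∈ R, e = s(u, v) ∧ K.Adj u v ∧ K.Adj p u ∧ Kᶜ.Adj p v}

/-- `𝒯⁻_p`: the pairs `uv` of remaining nodes that are negative in the auxiliary graph, with `pu`
and `pv` positive. -/
def badNeg (K : SimpleGraph V) (R : Finset V) (p : V) : Set (Sym2 V) :=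
  {e | ∃ u ∈ R, ∃ v ∈ R, e = s(u, v) ∧ Kᶜ.Adj u v ∧ K.Adj p u ∧ K.Adj p v}

/-- The balanced edges: the edges `e` that occur in `𝒟` such that both `e` and its partner are
positive in `G` and negative in the auxiliary graph. -/
def balancedEdges (G : CCInstance V) (𝒟 : Set (Sym2 (Sym2 V))) (K : SimpleGraph V) :
    Set (Sym2 V) :=
  {e | e ∈ G.pos.edgeSet ∩ Kᶜ.edgeSet ∧ ∃ f, s(e, f) ∈ 𝒟 ∧ f ∈ G.pos.edgeSet ∩ Kᶜ.edgeSet}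

open scoped Classical in
/-- The budgets: `2` on balanced edges and `3 x_uv` on all other edges. -/
noncomputable def budget (G : CCInstance V) (𝒟 : Set (Sym2 (Sym2 V))) (X : LPPoint G)
    (e : Sym2 V) : ℝ :=
  if e ∈ G.balancedEdges 𝒟 (G.auxGraph 𝒟 X) then 2 else 3 * X.x e

/-- The numerator `|𝒯⁺_p ∩ E⁺| + |𝒯⁻_p ∩ E⁻|` of the pivot ratio. -/
noncomputable def ratioNum (G : CCInstance V) (K : SimpleGraph V) (R : Finset V) (p : V) : ℝ :=
  (badPos K R p ∩ G.pos.edgeSet).ncard + (badNeg K R p ∩ G.neg.edgeSet).ncard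

open scoped Classical in
/-- The denominator of the pivot ratio: the total budget `y` of `𝒯⁺_p ∪ 𝒯⁻_p`. -/
noncomputable def ratioDen [Fintype V] (K : SimpleGraph V) (y : Sym2 V → ℝ) (R : Finset V)
    (p : V) : ℝ :=
  ∑ e : Sym2 V with e ∈ badPos K R p ∪ badNeg K R p, y e

/-- Among the remaining nodes `R`, the pivot `p` minimizes the ratio with the budgets above.
Ratios are compared by cross-multiplication, because denominators can vanish: for positive
denominators this is the comparison of the quotients, a ratio `c / 0` with `c > 0` counts as
infinite, and a ratio `0 / 0` may be ranked anywhere. -/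
def MinimizesRatio [Fintype V] (G : CCInstance V) (𝒟 : Set (Sym2 (Sym2 V))) (X : LPPoint G)
    (R : Finset V) (p : V) : Prop :=
  ∀ q ∈ R,
    G.ratioNum (G.auxGraph 𝒟 X) R p * ratioDen (G.auxGraph 𝒟 X) (G.budget 𝒟 X) R q ≤
      G.ratioNum (G.auxGraph 𝒟 X) R q * ratioDen (G.auxGraph 𝒟 X) (G.budget 𝒟 X) R p

end CCInstance

/-! ## A machine model with a step count

A random access machine with real arithmetic at unit cost (a real RAM), programmed in a structured
language. The memory consists of arrays with two subscripts; there are arrays of natural numbers,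
which may be used as subscripts, and arrays of real numbers. There is no conversion from real
numbers to natural numbers, and natural numbers are only added and subtracted. A program mentions
finitely many arrays by fixed names. -/

namespace RealRAM

/-- The contents of the memory: `idx a i j` is the cell with subscripts `i`, `j` of the array `a`
of natural numbers, `num a i j` that of the array `a` of real numbers. -/
structure Mem where
  idx : ℕ → ℕ → ℕ → ℕ
  num : ℕ → ℕ → ℕ → ℝ

/-- Expressions for natural numbers. -/
inductive IExp
  | lit (k : ℕ)
  | cell (a : ℕ) (i j : IExp)
  | add (e f : IExp)
  | sub (e f : IExp)

/-- The value of an expression (with truncated subtraction). -/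
def IExp.eval (m : Mem) : IExp → ℕ
  | .lit k => k
  | .cell a i j => m.idx a (i.eval m) (j.eval m)
  | .add e f => e.eval m + f.eval m
  | .sub e f => e.eval m - f.eval m

/-- The number of steps for evaluating an expression. -/
def IExp.steps : IExp → ℕ
  | .lit _ => 1
  | .cell _ i j => i.steps + j.steps + 1
  | .add e f => e.steps + f.steps + 1
  | .sub e f => e.steps + f.steps + 1

/-- Expressions for real numbers. -/
inductive NExp
  | ofIdx (e : IExp)
  | cell (a : ℕ) (i j : IExp)
  | add (e f : NExp)
  | sub (e f : NExp)
  | mul (e f : NExp)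
  | div (e f : NExp)

/-- The value of an expression (division by zero gives zero). -/
noncomputable def NExp.eval (m : Mem) : NExp → ℝ
  | .ofIdx e => (e.eval m : ℝ)
  | .cell a i j => m.num a (i.eval m) (j.eval m)
  | .add e f => e.eval m + f.eval m
  | .sub e f => e.eval m - f.eval m
  | .mul e f => e.eval m * f.eval m
  | .div e f => e.eval m / f.eval m

/-- The number of steps for evaluating an expression. -/
def NExp.steps : NExp → ℕ
  | .ofIdx e => e.steps + 1
  | .cell _ i j => i.steps + j.steps + 1
  | .add e f => e.steps + f.steps + 1
  | .sub e f => e.steps + f.steps + 1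
  | .mul e f => e.steps + f.steps + 1
  | .div e f => e.steps + f.steps + 1

/-- Tests. -/
inductive Test
  | ltIdx (e f : IExp)
  | ltNum (e f : NExp)
  | neg (b : Test)
  | conj (b c : Test)

/-- The truth of a test. -/
def Test.holds (m : Mem) : Test → Prop
  | .ltIdx e f => e.eval m < f.eval m
  | .ltNum e f => e.eval m < f.eval m
  | .neg b => ¬ b.holds m
  | .conj b c => b.holds m ∧ c.holds m

/-- The number of steps for evaluating a test. -/
def Test.steps : Test → ℕ
  | .ltIdx e f => e.steps + f.steps + 1
  | .ltNum e f => e.steps + f.steps + 1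
  | .neg b => b.steps + 1
  | .conj b c => b.steps + c.steps + 1

/-- Programs. -/
inductive Prog
  | skip
  | setIdx (a : ℕ) (i j e : IExp)
  | setNum (a : ℕ) (i j : IExp) (e : NExp)
  | seq (P Q : Prog)
  | branch (b : Test) (P Q : Prog)
  | loop (b : Test) (P : Prog)

/-- Writing a natural number to a cell. -/
def Mem.writeIdx (m : Mem) (a i j k : ℕ) : Mem where
  idx a' i' j' := if a' = a ∧ i' = i ∧ j' = j then k else m.idx a' i' j'
  num := m.num

/-- Writing a real number to a cell. -/
noncomputable def Mem.writeNum (m : Mem) (a i j : ℕ) (r : ℝ) : Mem where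
  idx := m.idx
  num a' i' j' := if a' = a ∧ i' = i ∧ j' = j then r else m.num a' i' j'

/-- `Run P m m' T`: the program `P`, started with memory `m`, halts with memory `m'` after exactly
`T` steps. -/
inductive Run : Prog → Mem → Mem → ℕ → Prop
  | skip (m : Mem) : Run .skip m m 1
  | setIdx (a : ℕ) (i j e : IExp) (m : Mem) :
      Run (.setIdx a i j e) m (m.writeIdx a (i.eval m) (j.eval m) (e.eval m))
        (i.steps + j.steps + e.steps + 1)
  | setNum (a : ℕ) (i j : IExp) (e : NExp) (m : Mem) :
      Run (.setNum a i j e) m (m.writeNum a (i.eval m) (j.eval m) (e.eval m))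
        (i.steps + j.steps + e.steps + 1)
  | seq (P Q : Prog) (m m' m'' : Mem) (T T' : ℕ) :
      Run P m m' T → Run Q m' m'' T' → Run (.seq P Q) m m'' (T + T')
  | branch_true (b : Test) (P Q : Prog) (m m' : Mem) (T : ℕ) :
      b.holds m → Run P m m' T → Run (.branch b P Q) m m' (b.steps + T + 1)
  | branch_false (b : Test) (P Q : Prog) (m m' : Mem) (T : ℕ) :
      ¬ b.holds m → Run Q m m' T → Run (.branch b P Q) m m' (b.steps + T + 1)
  | loop_true (b : Test) (P : Prog) (m m' m'' : Mem) (T T' : ℕ) :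
      b.holds m → Run P m m' T → Run (.loop b P) m' m'' T' →
        Run (.loop b P) m m'' (b.steps + T + T' + 1)
  | loop_false (b : Test) (P : Prog) (m : Mem) :
      ¬ b.holds m → Run (.loop b P) m m (b.steps + 1)

open scoped Classical in
/-- The initial memory on input `G`, `ε`. The array `0` of natural numbers holds the number of
nodes in its first cell; the arrays `1`, `2`, `3` hold the adjacency matrices of the positive, the
friendly and the hostile edges; the array `0` of real numbers holds `ε` in its first cell. All
other cells are zero. -/
noncomputable def input {n : ℕ} (G : CCInstance (Fin n)) (ε : ℝ) : Mem where
  idx a i j :=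
    if a = 0 ∧ i = 0 ∧ j = 0 then n
    else if ∃ (hi : i < n) (hj : j < n),
        (a = 1 ∧ G.pos.Adj ⟨i, hi⟩ ⟨j, hj⟩) ∨ (a = 2 ∧ G.friendly.Adj ⟨i, hi⟩ ⟨j, hj⟩) ∨
          (a = 3 ∧ G.hostile.Adj ⟨i, hi⟩ ⟨j, hj⟩) then 1
    else 0
  num a i j := if a = 0 ∧ i = 0 ∧ j = 0 then ε else 0

/-- The final memory `m` holds the cluster assignment `𝒞` in the first column of the array `4` of
natural numbers. -/
def IsOutput {n : ℕ} (m : Mem) (𝒞 : Fin n → Fin n) : Prop :=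
  ∀ u : Fin n, m.idx 4 u 0 = 𝒞 u

end RealRAM

/-! ### Pivot-safety of the auxiliary graph and feasibility of Pivot -/

namespace CCInstance

section Basic

variable {V : Type*} {G : CCInstance V}

/-! Write K for the auxiliary graph. Its adjacency depends only on supernodes, and hostile
supernodes are never adjacent because X⁺ = 1 there. If two hostile supernodes had a common neighbour
in K, then unmatched positive edges would join each of them to it; these two edges form a dangerous
pair, against the maximality of 𝒟. So K is pivot-safe (`auxGraph_isPivotSafe`), and every run of
Pivot on K is feasible.

For the cost, let agree(e) be 1 if K and G give e the same sign and 0 otherwise, and let d(e) be 1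
if the clustering disagrees with K on e. A pair costs agree(e) if d(e) = 1 and 1 − agree(e) if d(e)
= 0. The central inequality (`cost_add_disagreeSum_le`) holds for every feasible clustering: cost +
∑ d(e)(y_e − agree(e)) ≤ 3 ∑ x_e. Outside the balanced edges it holds pair by pair, because 1 −
agree(e) ≤ 3x_e. A balanced edge contributes 1 + d(e) on the left; of two balanced partners at most
one lies inside a cluster, so together they contribute at most 3, and x_e + x_ρ(e) ≥ 1 for every
dangerous pair.

It remains to see that ∑ d(e)(y_e − agree(e)) is nonnegative, for each run or in expectation. For a
run of Pivot the pairs with d(e) = 1 are the disjoint union of the sets 𝒯_p of the chosen pivots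
(`disagreeSum_assignCluster`). Summed over all p ∈ R, the weights of the 𝒯_p give a sum over the bad
triples of K, each counted with its three pairs. Each triple has budget at least its number of
agreements (`budget_triple`); the critical case, three positive edges of which ik is matched to an
edge f of K, is what HEAP is for. Hence a uniform pivot is good on average, and a ratio-minimizing
pivot has ratio at most 1. A feasible clustering yields a 0/1 point of the linear program whose
objective is its cost, so 3(1 + ε/3) = 3 + ε is the final factor.

For the running time, the matching is found greedily with pointers that only advance. The linear
program becomes a covering program with three variables per constraint and is solved by a
multiplicative weights method. The lengths rise on violated constraints, while a lower bound α on
all constraints grows by the factor 1 + η per sweep. Every feasible point x serves as the yardstick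
in the analysis: an update raises the logarithm of the total weighted length D = ∑ w_p L_p by little
and ∑ w_p x_p log(w_p L_p) by much (`update_spec`), while the latter is at most cost(x) log D
(`Progress.le_cost`). A second potential, ∑ log(w_p L_p), bounds the number of updates. Finally, the
pivot ratios are kept up to date in O(n²) steps per removed node. -/

theorem HostilePair.symm {A B : G.Supernode} (h : G.HostilePair A B) : G.HostilePair B A := by
  obtain ⟨a, b, ha, hb, hab⟩ := h
  exact ⟨b, a, hb, ha, hab.symm⟩

theorem IsConsistent.not_pos (hG : G.IsConsistent) {u v : V}
    (h : G.HostilePair (G.super u) (G.super v)) : ¬ G.pos.Adj u v := by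
  have := hG.2 u v h
  rw [neg, SimpleGraph.compl_adj] at this
  exact this.2

theorem IsConsistent.super_ne (hG : G.IsConsistent) {u v : V}
    (h : G.HostilePair (G.super u) (G.super v)) : G.super u ≠ G.super v := by
  intro h'
  have := hG.2 u v h
  rw [neg, SimpleGraph.compl_adj] at this
  exact this.2 (hG.1 u v this.1 h')

theorem IsFeasible.eq_of_super_eq {α : Type*} {𝒞 : V → α} (h : G.IsFeasible 𝒞) {u v : V}
    (huv : G.super u = G.super v) : 𝒞 u = 𝒞 v := by
  obtain ⟨p⟩ := SimpleGraph.ConnectedComponent.exact huv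
  induction p with
  | nil => rfl
  | cons hadj _ ih => exact (h.1 _ _ hadj).trans (ih (SimpleGraph.ConnectedComponent.sound ⟨by assumption⟩))

theorem IsFeasible.ne_of_hostilePair {α : Type*} {𝒞 : V → α} (h : G.IsFeasible 𝒞) {u v : V}
    (huv : G.HostilePair (G.super u) (G.super v)) : 𝒞 u ≠ 𝒞 v := by
  obtain ⟨a, b, ha, hb, hab⟩ := huv
  rw [← h.eq_of_super_eq ha, ← h.eq_of_super_eq hb]
  exact h.2 _ _ hab

theorem auxGraph_adj_congr {𝒟 : Set (Sym2 (Sym2 V))} {X : LPPoint G} {i j k : V}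
    (hij : G.super i = G.super j) (hki : k ≠ i) (hkj : k ≠ j) :
    (G.auxGraph 𝒟 X).Adj i k ↔ (G.auxGraph 𝒟 X).Adj j k := by
  simp only [auxGraph, hij, ne_eq, hki.symm, hkj.symm, not_false_eq_true, true_and]

theorem auxGraph_adj_of_super_eq {𝒟 : Set (Sym2 (Sym2 V))} {X : LPPoint G} {i j : V}
    (h : i ≠ j) (hij : G.super i = G.super j) : (G.auxGraph 𝒟 X).Adj i j :=
  ⟨h, Or.inl hij⟩

theorem IsEdgeDisjointDangerous.insert {𝒟 : Set (Sym2 (Sym2 V))}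
    (hD : G.IsEdgeDisjointDangerous 𝒟) {e f : Sym2 V} (h : G.IsDangerousPair s(e, f))
    (he : e ∉ dangerousEdges 𝒟) (hf : f ∉ dangerousEdges 𝒟) :
    G.IsEdgeDisjointDangerous (insert s(e, f) 𝒟) := by
  simp only [dangerousEdges, Set.mem_ofPred_eq, not_exists] at he hf
  have hno : ∀ q ∈ 𝒟, ∀ g, g ∈ q → g ∈ s(e, f) → False := by
    intro q hq g hgq hg
    obtain ⟨g', rfl⟩ := Sym2.mem_iff_exists.1 hgq
    rcases Sym2.mem_iff.1 hg with rfl | rfl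
    · exact he _ hq
    · exact hf _ hq
  refine ⟨?_, ?_⟩
  · rintro q (rfl | hq)
    · exact h
    · exact hD.1 q hq
  · rintro q (rfl | hq) r (rfl | hr) g hgq hgr
    · rfl
    · exact (hno r hr g hgr hgq).elim
    · exact (hno q hq g hgq hgr).elim
    · exact hD.2 q hq r hr g hgq hgr

/-- Otherwise the pair could be added to 𝒟. -/
theorem mem_dangerousEdges_of_maximal {𝒟 : Set (Sym2 (Sym2 V))}
    (hD : G.IsMaximalDangerous 𝒟) {e f : Sym2 V} (h : G.IsDangerousPair s(e, f)) :
    e ∈ dangerousEdges 𝒟 ∨ f ∈ dangerousEdges 𝒟 := by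
  by_contra hc
  rw [not_or] at hc
  have := hD.le_of_ge (hD.prop.insert h hc.1 hc.2) (Set.subset_insert _ _) (Set.mem_insert _ _)
  exact hc.1 ⟨f, this⟩

/-- In a larger edge-disjoint set, a pair with an edge that already occurs in 𝒟 must coincide with
the pair of 𝒟 containing that edge. This certifies the result of the greedy program. -/
theorem isMaximalDangerous_of_forall {𝒟 : Set (Sym2 (Sym2 V))}
    (hD : G.IsEdgeDisjointDangerous 𝒟)
    (h : ∀ e f, G.IsDangerousPair s(e, f) → e ∈ dangerousEdges 𝒟 ∨ f ∈ dangerousEdges 𝒟) :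
    G.IsMaximalDangerous 𝒟 := by
  refine ⟨hD, fun 𝒟' hD' hle q hq => ?_⟩
  induction q with
  | _ e f =>
    rcases h e f (hD'.1 _ hq) with ⟨g, hg⟩ | ⟨g, hg⟩
    · rw [hD'.2 _ hq _ (hle hg) e (by simp) (by simp)]; exact hg
    · rw [hD'.2 _ hq _ (hle hg) f (by simp) (by simp)]; exact hg

theorem mem_dangerousEdges_insert {𝒟 : Set (Sym2 (Sym2 V))} {e f g : Sym2 V} :
    g ∈ dangerousEdges (insert s(e, f) 𝒟) ↔ g = e ∨ g = f ∨ g ∈ dangerousEdges 𝒟 := by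
  simp only [dangerousEdges, Set.mem_ofPred_eq, Set.mem_insert_iff, exists_or]
  rw [← or_assoc]
  refine or_congr ⟨?_, ?_⟩ Iff.rfl
  · rintro ⟨x, hx⟩
    rcases Sym2.eq_iff.1 hx with ⟨rfl, -⟩ | ⟨rfl, -⟩ <;> simp
  · rintro (rfl | rfl)
    · exact ⟨f, rfl⟩
    · exact ⟨e, Sym2.eq_swap⟩

/-- The threshold 2/3 excludes edges between hostile supernodes, where X⁺ = 1. A common neighbour k
that shares its supernode with i or j reduces to this case. Otherwise the two unmatched positive
edges that justify ik and jk meet in S(k) and form a dangerous pair, of which 𝒟 must contain one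
edge. -/
theorem auxGraph_isPivotSafe (hG : G.IsConsistent) {𝒟 : Set (Sym2 (Sym2 V))}
    (hD : G.IsMaximalDangerous 𝒟) {X : LPPoint G} (hX : G.IsLPFeasible 𝒟 X) :
    G.IsPivotSafe (G.auxGraph 𝒟 X) := by
  have hnot : ∀ i j, G.HostilePair (G.super i) (G.super j) → ¬ (G.auxGraph 𝒟 X).Adj i j := by
    rintro i j h ⟨-, h' | ⟨-, h'⟩⟩
    · exact hG.super_ne h h'
    · have h1 := (hX.hostile _ _ h).2
      have := h'.trans_le (min_le_right _ _)
      rw [h1] at this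
      norm_num at this
  refine ⟨fun i j hij hs => ⟨auxGraph_adj_of_super_eq hij hs, fun k hki hkj =>
    auxGraph_adj_congr hs hki hkj⟩, fun i j h => ⟨?_, ?_⟩⟩
  · rw [SimpleGraph.compl_adj]
    exact ⟨fun h' => hG.super_ne h (by rw [h']), hnot i j h⟩
  · rintro ⟨k, ⟨hik, h1⟩, ⟨hjk, h2⟩⟩
    rcases h1 with h1 | ⟨⟨a, b, ha, hb, hab, habD⟩, hlt⟩
    · refine hnot j i h.symm ⟨fun h' => hG.super_ne h (by rw [h']), ?_⟩
      rw [h1]; exact h2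
    rcases h2 with h2 | ⟨⟨d, c, hd, hc, hdc, hdcD⟩, -⟩
    · exact hnot i k (h2 ▸ h) ⟨hik, Or.inr ⟨⟨a, b, ha, hb, hab, habD⟩, hlt⟩⟩
    have hdan : G.IsDangerousPair s(s(a, b), s(c, d)) :=
      ⟨a, b, c, d, rfl, hab, hdc.symm, hb.trans hc.symm, by rw [ha, hd]; exact h⟩
    rcases mem_dangerousEdges_of_maximal hD hdan with h' | h'
    · exact habD h'
    · rw [Sym2.eq_swap] at h'; exact hdcD h'

theorem PivotRun.mem {K : SimpleGraph V} {rule : Finset V → V → Prop} {R : Finset V} {𝒞 : V → V}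
    (h : PivotRun K rule R 𝒞) : ∀ v ∈ R, 𝒞 v ∈ R := by
  classical
  induction h with
  | done => simp
  | step R p 𝒞 hp _ _ ih =>
    intro v hv
    rw [assignCluster]
    split_ifs with h
    · exact hp
    · exact (Finset.mem_sdiff.1 (ih v (by simp [hv, h]))).1

theorem mem_pivotCluster {K : SimpleGraph V} {R : Finset V} {p v : V} :
    v ∈ pivotCluster K R p ↔ v ∈ R ∧ (v = p ∨ K.Adj p v) := by
  simp [pivotCluster]

/-- Later labels are later pivots, and p itself has left the remaining nodes. Hence the label of the
cluster of p is never reused. -/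
theorem PivotRun.ne_pivot {K : SimpleGraph V} {rule : Finset V → V → Prop} {R : Finset V} {p : V}
    {𝒞 : V → V} [DecidableEq V] (hp : p ∈ R)
    (h : PivotRun K rule (R \ pivotCluster K R p) 𝒞) {v : V} (hv : v ∈ R)
    (hvp : v ∉ pivotCluster K R p) : 𝒞 v ≠ p := by
  intro h'
  have := h.mem v (by simp [hv, hvp])
  rw [h'] at this
  simp [mem_pivotCluster, hp] at this

/-- Nodes of one supernode are adjacent and have the same other neighbours, so the cluster of p
takes both or neither. Two hostile nodes in this cluster would be adjacent, if one of them is p, or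
would have p as a common neighbour. -/
theorem PivotRun.respects {K : SimpleGraph V} {rule : Finset V → V → Prop} {R : Finset V}
    {𝒞 : V → V} (hK : G.IsPivotSafe K) (h : PivotRun K rule R 𝒞) :
    ∀ u ∈ R, ∀ v ∈ R, (G.super u = G.super v → 𝒞 u = 𝒞 v) ∧
      (G.HostilePair (G.super u) (G.super v) → 𝒞 u ≠ 𝒞 v) := by
  classical
  induction h with
  | done => simp
  | step R p 𝒞 hp hr hrun ih =>
    intro u hu v hv
    by_cases huC : u ∈ pivotCluster K R p <;> by_cases hvC : v ∈ pivotCluster K R p <;>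
      simp only [assignCluster, huC, hvC, if_true, if_false]
    · refine ⟨fun _ => trivial, fun h => ?_⟩
      obtain ⟨h1, h2⟩ := hK.2 u v h
      rw [SimpleGraph.compl_adj] at h1
      rw [mem_pivotCluster] at huC hvC
      rcases huC.2 with rfl | h3 <;> rcases hvC.2 with rfl | h4
      · exact (h1.1 rfl).elim
      · exact (h1.2 h4).elim
      · exact (h1.2 h3.symm).elim
      · exact (h2 ⟨p, h3.symm, h4.symm⟩).elim
    · refine ⟨fun h => ?_, fun _ => (hrun.ne_pivot hp hv hvC).symm⟩
      exfalso
      have hne : u ≠ v := by rintro rfl; exact hvC huC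
      apply hvC
      rw [mem_pivotCluster] at huC ⊢
      refine ⟨hv, ?_⟩
      obtain ⟨h1, h2⟩ := hK.1 u v hne h
      rcases huC.2 with rfl | h3
      · exact Or.inr h1
      · by_cases hpv : v = p
        · exact Or.inl hpv
        · exact Or.inr ((h2 p h3.ne (Ne.symm hpv)).1 h3.symm).symm
    · refine ⟨fun h => ?_, fun _ => hrun.ne_pivot hp hu huC⟩
      exfalso
      have hne : v ≠ u := by rintro rfl; exact huC hvC
      apply huC
      rw [mem_pivotCluster] at hvC ⊢
      refine ⟨hu, ?_⟩
      obtain ⟨h1, h2⟩ := hK.1 v u hne h.symm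
      rcases hvC.2 with rfl | h3
      · exact Or.inr h1
      · by_cases hpv : u = p
        · exact Or.inl hpv
        · exact Or.inr ((h2 p h3.ne (Ne.symm hpv)).1 h3.symm).symm
    · exact ih u (by simp [hu, huC]) v (by simp [hv, hvC])

theorem PivotRun.isFeasible [Fintype V] {K : SimpleGraph V} {rule : Finset V → V → Prop}
    {𝒞 : V → V} (hK : G.IsPivotSafe K) (h : PivotRun K rule Finset.univ 𝒞) : G.IsFeasible 𝒞 := by
  have := h.respects hK
  refine ⟨fun u v huv => (this u (Finset.mem_univ _) v (Finset.mem_univ _)).1 ?_,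
    fun u v huv => (this u (Finset.mem_univ _) v (Finset.mem_univ _)).2 ⟨u, v, rfl, rfl, huv⟩⟩
  exact SimpleGraph.ConnectedComponent.sound huv.reachable

/-- Every outcome of the random variant is a run with an unrestricted rule, so that statements about
all runs apply to it. -/
theorem pivotRun_of_mem_support {K : SimpleGraph V} (R : Finset V) :
    ∀ 𝒞 ∈ (randomPivot K R).support, PivotRun K (fun _ _ => True) R 𝒞 := by
  classical
  induction R using Finset.strongInduction with
  | H R ih =>
    intro 𝒞 h𝒞
    rw [randomPivot] at h𝒞
    split_ifs at h𝒞 with h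
    · have : Nonempty R := h.to_subtype
      simp only [PMF.support_bind, PMF.support_map, Set.mem_iUnion, Set.mem_image] at h𝒞
      obtain ⟨p, -, 𝒞', h𝒞', rfl⟩ := h𝒞
      refine PivotRun.step R p 𝒞' p.2 trivial ?_
      convert ih _ ?_ 𝒞' h𝒞'
      refine ⟨Finset.sdiff_subset, fun hsub => ?_⟩
      have hp := hsub p.2
      simp [pivotCluster] at hp
    · rw [Finset.not_nonempty_iff_eq_empty] at h
      subst h
      simp only [PMF.support_pure, Set.mem_singleton_iff] at h𝒞
      subst h𝒞
      exact PivotRun.done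

end Basic

end CCInstance


/-! ### Bad triples and the telescoping of Pivot -/

namespace CCInstance

section Triples

variable {V : Type*}

/-- The distinct nodes `p`, `u`, `v` form a bad triple: exactly two of the three pairs are
positive. -/
def BadTriple (K : SimpleGraph V) (p u v : V) : Prop :=
  p ≠ u ∧ p ≠ v ∧ u ≠ v ∧ ((K.Adj u v ∧ K.Adj p u ∧ ¬ K.Adj p v) ∨
    (K.Adj u v ∧ ¬ K.Adj p u ∧ K.Adj p v) ∨ (¬ K.Adj u v ∧ K.Adj p u ∧ K.Adj p v))

theorem BadTriple.swap {K : SimpleGraph V} {p u v : V} : BadTriple K p u v ↔ BadTriple K p v u := by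
  have h1 := K.adj_comm u v
  have h2 : u ≠ v ↔ v ≠ u := ne_comm
  unfold BadTriple
  tauto

/-- With `BadTriple.swap`, this makes bad triples invariant under all permutations; the pivot plays
no distinguished role. -/
theorem BadTriple.rotate {K : SimpleGraph V} {p u v : V} :
    BadTriple K p u v ↔ BadTriple K u p v := by
  have h1 := K.adj_comm p u
  have h2 : p ≠ u ↔ u ≠ p := ne_comm
  unfold BadTriple
  tauto

theorem mem_badPos_union_badNeg {K : SimpleGraph V} {R : Finset V} {p u v : V} :
    s(u, v) ∈ badPos K R p ∪ badNeg K R p ↔ u ∈ R ∧ v ∈ R ∧ BadTriple K p u v := by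
  simp only [badPos, badNeg, Set.mem_union, Set.mem_ofPred_eq, SimpleGraph.compl_adj, BadTriple]
  constructor
  · rintro (⟨a, ha, b, hb, h, h1, h2, h3, h4⟩ | ⟨a, ha, b, hb, h, ⟨h1, h2⟩, h3, h4⟩)
    · rcases Sym2.eq_iff.1 h with ⟨rfl, rfl⟩ | ⟨rfl, rfl⟩
      · exact ⟨ha, hb, h2.ne, h3, h1.ne, Or.inl ⟨h1, h2, h4⟩⟩
      · exact ⟨hb, ha, h3, h2.ne, h1.ne', Or.inr (Or.inl ⟨h1.symm, h4, h2⟩)⟩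
    · rcases Sym2.eq_iff.1 h with ⟨rfl, rfl⟩ | ⟨rfl, rfl⟩
      · exact ⟨ha, hb, h3.ne, h4.ne, h1, Or.inr (Or.inr ⟨h2, h3, h4⟩)⟩
      · exact ⟨hb, ha, h4.ne, h3.ne, Ne.symm h1,
          Or.inr (Or.inr ⟨fun h => h2 h.symm, h4, h3⟩)⟩
  · rintro ⟨hu, hv, hpu, hpv, huv, ⟨h1, h2, h3⟩ | ⟨h1, h2, h3⟩ | ⟨h1, h2, h3⟩⟩
    · exact Or.inl ⟨u, hu, v, hv, rfl, h1, h2, hpv, h3⟩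
    · exact Or.inl ⟨v, hv, u, hu, Sym2.eq_swap, h1.symm, h3, hpu, h2⟩
    · exact Or.inr ⟨u, hu, v, hv, rfl, ⟨huv, h1⟩, h2, h3⟩

theorem badPos_inter_badNeg {K : SimpleGraph V} {R : Finset V} {p : V} {e : Sym2 V}
    (h1 : e ∈ badPos K R p) (h2 : e ∈ badNeg K R p) : False := by
  obtain ⟨a, -, b, -, rfl, h1, -⟩ := h1
  obtain ⟨c, -, d, -, h, h2, -⟩ := h2
  rw [SimpleGraph.compl_adj] at h2
  rcases Sym2.eq_iff.1 h with ⟨rfl, rfl⟩ | ⟨rfl, rfl⟩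
  · exact h2.2 h1
  · exact h2.2 h1.symm

open scoped Classical in
/-- The indicator of the edges on which `K` and `G` agree. -/
noncomputable def agree (G : CCInstance V) (K : SimpleGraph V) (e : Sym2 V) : ℝ :=
  if e ∈ K.edgeSet ↔ e ∈ G.pos.edgeSet then 1 else 0

/-- Pairs of 𝒯⁺ are edges of K and pairs of 𝒯⁻ are not, so the numerator counts the pairs of 𝒯⁺ ∪ 𝒯⁻
on which K and G agree. Numerator and denominator are thus one linear functional applied to two
weights, and only the weight y − agree matters. -/
theorem ratioNum_eq_ratioDen [Fintype V] (G : CCInstance V) (K : SimpleGraph V) (R : Finset V)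
    (p : V) : G.ratioNum K R p = ratioDen K (G.agree K) R p := by
  classical
  have hset : ∀ S : Set (Sym2 V), (S.ncard : ℝ) = ∑ e : Sym2 V, if e ∈ S then 1 else 0 := by
    intro S
    rw [Finset.sum_boole, Set.ncard_eq_toFinset_card']
    congr 2
    ext e
    simp
  rw [ratioNum, ratioDen, hset, hset, Finset.sum_filter, ← Finset.sum_add_distrib]
  refine Finset.sum_congr rfl fun e _ => ?_
  by_cases h1 : e ∈ badPos K R p <;> by_cases h2 : e ∈ badNeg K R p
  · exact (badPos_inter_badNeg h1 h2).elim
  · have h3 : e ∈ K.edgeSet := by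
      obtain ⟨a, -, b, -, rfl, h, -⟩ := h1
      exact h
    simp [h1, h2, h3, agree]
  · have h3 : e ∉ K.edgeSet ∧ (e ∈ G.neg.edgeSet ↔ e ∉ G.pos.edgeSet) := by
      obtain ⟨a, -, b, -, rfl, h, -⟩ := h2
      rw [SimpleGraph.compl_adj] at h
      simp only [SimpleGraph.mem_edgeSet, neg, SimpleGraph.compl_adj]
      exact ⟨h.2, fun h' => h'.2, fun h' => ⟨h.1, h'⟩⟩
    simp [h1, h2, h3.1, h3.2, agree]
  · simp [h1, h2]

open scoped Classical in
-- The new pairs are those that contain w. Besides its use in the next sums, this is how the program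
-- maintains the ratios in quadratic time per node.
theorem ratioDen_insert [Fintype V] {K : SimpleGraph V} (g : Sym2 V → ℝ) {R : Finset V} {w : V}
    (hw : w ∉ R) (p : V) :
    ratioDen K g (insert w R) p =
      ratioDen K g R p + ∑ u ∈ R, if BadTriple K p u w then g s(u, w) else 0 := by
  have hinj : Set.InjOn (fun u => s(u, w)) ((R.filter fun u => BadTriple K p u w : Finset V) : Set V) := by
    intro a _ b _ h
    exact Sym2.congr_left.1 h
  rw [← Finset.sum_filter, ← Finset.sum_image (f := g) hinj, ratioDen, ratioDen, ← Finset.sum_union]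
  · refine Finset.sum_congr ?_ fun _ _ => rfl
    ext e
    induction e with
    | _ u v =>
      simp only [Finset.mem_filter, Finset.mem_univ, true_and, mem_badPos_union_badNeg,
        Finset.mem_union, Finset.mem_image, Finset.mem_insert]
      constructor
      · rintro ⟨rfl | hu, rfl | hv, hb⟩
        · exact (hb.2.2.1 rfl).elim
        · exact Or.inr ⟨v, ⟨hv, BadTriple.swap.1 hb⟩, Sym2.eq_swap⟩
        · exact Or.inr ⟨u, ⟨hu, hb⟩, rfl⟩
        · exact Or.inl ⟨hu, hv, hb⟩
      · rintro (⟨hu, hv, hb⟩ | ⟨a, ⟨ha, hb⟩, h⟩)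
        · exact ⟨Or.inr hu, Or.inr hv, hb⟩
        · rcases Sym2.eq_iff.1 h with ⟨rfl, rfl⟩ | ⟨rfl, rfl⟩
          · exact ⟨Or.inr ha, Or.inl rfl, hb⟩
          · exact ⟨Or.inl rfl, Or.inr ha, BadTriple.swap.1 hb⟩
  · rw [Finset.disjoint_left]
    intro e he he'
    obtain ⟨u, -, rfl⟩ := Finset.mem_image.1 he'
    simp only [Finset.mem_filter, Finset.mem_univ, true_and, mem_badPos_union_badNeg] at he
    exact hw he.2.1

theorem ratioDen_empty [Fintype V] (K : SimpleGraph V) (g : Sym2 V → ℝ) (p : V) :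
    ratioDen K g ∅ p = 0 := by
  classical
  rw [ratioDen]
  refine Finset.sum_eq_zero fun e he => ?_
  induction e with
  | _ u v =>
    simp only [Finset.mem_filter, Finset.mem_univ, true_and, mem_badPos_union_badNeg] at he
    simp at he

open scoped Classical in
theorem two_mul_ratioDen [Fintype V] (K : SimpleGraph V) (g : Sym2 V → ℝ) (R : Finset V) (p : V) :
    2 * ratioDen K g R p = ∑ u ∈ R, ∑ v ∈ R, if BadTriple K p u v then g s(u, v) else 0 := by
  induction R using Finset.induction_on with
  | empty => simp [ratioDen_empty]
  | insert w R hw ih =>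
    have h1 : ∀ v, (if BadTriple K p w v then g s(w, v) else 0) =
        if BadTriple K p v w then g s(v, w) else 0 := by
      intro v
      rw [Sym2.eq_swap]
      simp only [BadTriple.swap (u := w)]
    have h2 : ¬ BadTriple K p w w := fun h => h.2.2.1 rfl
    rw [ratioDen_insert g hw, mul_add, ih, Finset.sum_insert hw, Finset.sum_insert hw]
    simp only [Finset.sum_insert hw, Finset.sum_add_distrib, h1, if_neg h2]
    ring

/-- Each bad triple is seen from each of its three nodes and then contributes the weight of the
opposite pair. Summing over all pivots therefore gives, for each triple, the total weight of its
three pairs. -/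
theorem sum_ratioDen_nonneg [Fintype V] {K : SimpleGraph V} {g : Sym2 V → ℝ}
    (hg : ∀ p u v, BadTriple K p u v → 0 ≤ g s(u, v) + g s(p, u) + g s(p, v)) (R : Finset V) :
    0 ≤ ∑ p ∈ R, ratioDen K g R p := by
  classical
  let B : V → V → V → ℝ := fun p u v => if BadTriple K p u v then g s(u, v) else 0
  have hS : 2 * ∑ p ∈ R, ratioDen K g R p = ∑ p ∈ R, ∑ u ∈ R, ∑ v ∈ R, B p u v := by
    rw [Finset.mul_sum]
    exact Finset.sum_congr rfl fun p _ => two_mul_ratioDen K g R p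
  -- The sum over ordered triples does not change when another node takes the role of the pivot; the
  -- three versions are added in `h3`.
  have h1 : ∑ p ∈ R, ∑ u ∈ R, ∑ v ∈ R, B p u v = ∑ p ∈ R, ∑ u ∈ R, ∑ v ∈ R, B u p v :=
    Finset.sum_comm
  have h2 : ∑ p ∈ R, ∑ u ∈ R, ∑ v ∈ R, B p u v = ∑ p ∈ R, ∑ u ∈ R, ∑ v ∈ R, B v p u := by
    rw [h1]
    refine Finset.sum_congr rfl fun p _ => Finset.sum_comm
  have h3 : 0 ≤ ∑ p ∈ R, ∑ u ∈ R, ∑ v ∈ R, (B p u v + B v p u + B u p v) := by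
    refine Finset.sum_nonneg fun p _ => Finset.sum_nonneg fun u _ => Finset.sum_nonneg fun v _ => ?_
    by_cases h : BadTriple K p u v
    · have h' : BadTriple K u p v := BadTriple.rotate.1 h
      have h'' : BadTriple K v p u := BadTriple.rotate.1 (BadTriple.swap.1 h)
      simp only [B, if_pos h, if_pos h', if_pos h'']
      exact hg p u v h
    · have h' : ¬ BadTriple K u p v := fun h' => h (BadTriple.rotate.1 h')
      have h'' : ¬ BadTriple K v p u := fun h' => h (BadTriple.swap.1 (BadTriple.rotate.1 h'))
      simp [B, h, h', h'']
  simp only [Finset.sum_add_distrib] at h3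
  linarith

/-- The pairs of distinct nodes of `R` on which the clustering `𝒞` disagrees with `K`. -/
def disagreeOn (K : SimpleGraph V) (𝒞 : V → V) (R : Finset V) : Set (Sym2 V) :=
  {e | ∃ u ∈ R, ∃ v ∈ R, e = s(u, v) ∧ u ≠ v ∧ (K.Adj u v ↔ 𝒞 u ≠ 𝒞 v)}

theorem mem_disagreeOn {K : SimpleGraph V} {𝒞 : V → V} {R : Finset V} {u v : V} :
    s(u, v) ∈ disagreeOn K 𝒞 R ↔ u ∈ R ∧ v ∈ R ∧ u ≠ v ∧ (K.Adj u v ↔ 𝒞 u ≠ 𝒞 v) := by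
  constructor
  · rintro ⟨a, ha, b, hb, h, h1, h2⟩
    rcases Sym2.eq_iff.1 h with ⟨rfl, rfl⟩ | ⟨rfl, rfl⟩
    · exact ⟨ha, hb, h1, h2⟩
    · exact ⟨hb, ha, h1.symm, by rw [K.adj_comm, ne_comm]; exact h2⟩
  · rintro ⟨hu, hv, h⟩
    exact ⟨u, hu, v, hv, rfl, h⟩

open scoped Classical in
/-- The total weight of the pairs of `R` on which `𝒞` disagrees with `K`. -/
noncomputable def disagreeSum [Fintype V] (K : SimpleGraph V) (g : Sym2 V → ℝ) (R : Finset V)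
    (𝒞 : V → V) : ℝ :=
  ∑ e : Sym2 V with e ∈ disagreeOn K 𝒞 R, g e

open scoped Classical in
-- Removing the cluster of p decides exactly the pairs that meet it. Among them the clustering
-- disagrees with K on negative pairs inside the cluster and on positive pairs leaving it; these are
-- the pairs that form a bad triple with p. Pairs that contain p always agree.
theorem disagreeSum_assignCluster [Fintype V] {K : SimpleGraph V} {g : Sym2 V → ℝ} {R : Finset V}
    {p : V} {𝒞 : V → V} {rule : Finset V → V → Prop} (hp : p ∈ R)
    (h : PivotRun K rule (R \ pivotCluster K R p) 𝒞) :
    disagreeSum K g R (assignCluster K R p 𝒞) =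
      ratioDen K g R p + disagreeSum K g (R \ pivotCluster K R p) 𝒞 := by
  rw [disagreeSum, disagreeSum, ratioDen, ← Finset.sum_union]
  · refine Finset.sum_congr ?_ fun _ _ => rfl
    ext e
    induction e with
    | _ u v =>
      simp only [Finset.mem_filter, Finset.mem_univ, true_and, mem_badPos_union_badNeg,
        Finset.mem_union, mem_disagreeOn, Finset.mem_sdiff]
      by_cases hu : u ∈ R
      swap
      · simp [hu]
      by_cases hv : v ∈ R
      swap
      · simp [hv]
      have hsymm := K.adj_comm u v
      have huC : u ∈ pivotCluster K R p ↔ (u = p ∨ K.Adj p u) := by simp [mem_pivotCluster, hu]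
      have hvC : v ∈ pivotCluster K R p ↔ (v = p ∨ K.Adj p v) := by simp [mem_pivotCluster, hv]
      have hirr := K.irrefl (v := p)
      by_cases hu' : u ∈ pivotCluster K R p <;> by_cases hv' : v ∈ pivotCluster K R p <;>
        simp only [assignCluster, hu', hv', if_true, if_false, hu, hv, true_and, BadTriple]
      · by_cases h1 : u = p
        · subst h1; by_cases h2 : v = u <;> aesop
        · by_cases h2 : v = p
          · subst h2; aesop
          · aesop
      · have h3 := (h.ne_pivot hp hv hv').symm
        have h1 : v ≠ p := fun h1 => hv' (hvC.2 (Or.inl h1))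
        have h2 : ¬ K.Adj p v := fun h1 => hv' (hvC.2 (Or.inr h1))
        by_cases h4 : u = p
        · subst h4; simp [h2, h3]
        · have : K.Adj p u := (huC.1 hu').resolve_left h4
          simp [h1.symm, h2, h3, this, Ne.symm h4]
      · have h3 := h.ne_pivot hp hu hu'
        have h1 : u ≠ p := fun h1 => hu' (huC.2 (Or.inl h1))
        have h2 : ¬ K.Adj p u := fun h1 => hu' (huC.2 (Or.inr h1))
        by_cases h4 : v = p
        · subst h4; simp [h3, hsymm, h2]
        · have : K.Adj p v := (hvC.1 hv').resolve_left h4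
          simp [h1.symm, h2, h3, this, Ne.symm h4]
      · have h1 : ¬ K.Adj p u := fun h1 => hu' (huC.2 (Or.inr h1))
        have h2 : ¬ K.Adj p v := fun h1 => hv' (hvC.2 (Or.inr h1))
        simp [h1, h2]
  · rw [Finset.disjoint_left]
    intro e he he'
    induction e with
    | _ u v =>
      simp only [Finset.mem_filter, Finset.mem_univ, true_and, mem_badPos_union_badNeg,
        mem_disagreeOn, Finset.mem_sdiff, mem_pivotCluster, not_and, not_or] at he he'
      have h1 := he'.1.2 he.1
      have h2 := he'.2.1.2 he.2.1
      have h3 := he.2.2.2.2.2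
      tauto

theorem disagreeSum_nonneg_of_pivotRun [Fintype V] {K : SimpleGraph V} {g : Sym2 V → ℝ}
    {rule : Finset V → V → Prop} (hg : ∀ R p, p ∈ R → rule R p → 0 ≤ ratioDen K g R p)
    {R : Finset V} {𝒞 : V → V} (h : PivotRun K rule R 𝒞) : 0 ≤ disagreeSum K g R 𝒞 := by
  classical
  induction h with
  | done =>
    refine le_of_eq (Finset.sum_eq_zero fun e he => ?_).symm
    obtain ⟨u, hu, -⟩ := (Finset.mem_filter.1 he).2
    simp at hu
  | step R p 𝒞 hp hr hrun ih =>
    rw [disagreeSum_assignCluster hp (by convert hrun)]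
    have := hg R p hp hr
    have : 0 ≤ disagreeSum K g (R \ pivotCluster K R p) 𝒞 := by convert ih
    linarith

/-- The expectation of a real function of a random clustering. -/
noncomputable def expect {α : Type*} [Fintype α] (μ : PMF α) (f : α → ℝ) : ℝ :=
  ∑ a, (μ a).toReal * f a

theorem expect_bind {α β : Type*} [Fintype α] [Fintype β] (μ : PMF α) (κ : α → PMF β)
    (f : β → ℝ) : expect (μ.bind κ) f = expect μ fun a => expect (κ a) f := by
  simp only [expect, PMF.bind_apply, tsum_fintype, Finset.mul_sum]
  rw [Finset.sum_comm]
  refine Finset.sum_congr rfl fun b _ => ?_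
  rw [ENNReal.toReal_sum, Finset.sum_mul]
  · refine Finset.sum_congr rfl fun a _ => ?_
    rw [ENNReal.toReal_mul, mul_assoc]
  · intro a _
    exact ENNReal.mul_ne_top (PMF.apply_ne_top _ _) (PMF.apply_ne_top _ _)

theorem expect_pure {α : Type*} [Fintype α] (a : α) (f : α → ℝ) : expect (PMF.pure a) f = f a := by
  classical
  rw [expect, Finset.sum_eq_single a] <;> simp +contextual [PMF.pure_apply]

theorem expect_map {α β : Type*} [Fintype α] [Fintype β] (μ : PMF α) (φ : α → β)
    (f : β → ℝ) : expect (μ.map φ) f = expect μ fun a => f (φ a) := by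
  rw [PMF.map, expect_bind]
  simp only [Function.comp_apply, expect_pure]

theorem expect_congr_support {α : Type*} [Fintype α] (μ : PMF α) {f f' : α → ℝ}
    (h : ∀ a ∈ μ.support, f a = f' a) : expect μ f = expect μ f' := by
  refine Finset.sum_congr rfl fun a _ => ?_
  by_cases ha : a ∈ μ.support
  · rw [h a ha]
  · rw [PMF.mem_support_iff, not_not] at ha
    simp [ha]

theorem expect_mono {α : Type*} [Fintype α] (μ : PMF α) {f f' : α → ℝ}
    (h : ∀ a ∈ μ.support, f a ≤ f' a) : expect μ f ≤ expect μ f' := by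
  refine Finset.sum_le_sum fun a _ => ?_
  by_cases ha : a ∈ μ.support
  · exact mul_le_mul_of_nonneg_left (h a ha) ENNReal.toReal_nonneg
  · rw [PMF.mem_support_iff, not_not] at ha
    simp [ha]

theorem expect_const {α : Type*} [Fintype α] (μ : PMF α) (c : ℝ) : expect μ (fun _ => c) = c := by
  have h : ∑ a, (μ a).toReal = 1 := by
    rw [← ENNReal.toReal_sum fun a _ => PMF.apply_ne_top _ _, ← tsum_fintype (L := .unconditional _),
      PMF.tsum_coe, ENNReal.toReal_one]
  rw [expect, ← Finset.sum_mul, h, one_mul]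

theorem expect_add {α : Type*} [Fintype α] (μ : PMF α) (f f' : α → ℝ) :
    expect μ (fun a => f a + f' a) = expect μ f + expect μ f' := by
  simp only [expect, mul_add, Finset.sum_add_distrib]

/-- Condition on the first pivot: the conditional expectation is its own term plus the expectation
for the remaining nodes, which is nonnegative by induction. The average of the first terms is the
hypothesis divided by |R|. -/
theorem expect_disagreeSum_nonneg [Fintype V] [DecidableEq V] {K : SimpleGraph V} {g : Sym2 V → ℝ}
    (hg : ∀ R : Finset V, 0 ≤ ∑ p ∈ R, ratioDen K g R p) (R : Finset V) :
    0 ≤ expect (randomPivot K R) (disagreeSum K g R) := by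
  classical
  induction R using Finset.strongInduction with
  | H R ih =>
    rw [randomPivot]
    split_ifs with h
    · have : Nonempty R := h.to_subtype
      have key : ∀ p : R, ratioDen K g R p ≤
          expect ((randomPivot K (R \ pivotCluster K R p)).map (assignCluster K R p))
            (disagreeSum K g R) := by
        intro p
        rw [expect_map, expect_congr_support (f' := fun 𝒞 => ratioDen K g R p +
          disagreeSum K g (R \ pivotCluster K R p) 𝒞)]
        · rw [expect_add, expect_const]
          have hss : R \ pivotCluster K R p ⊂ R := by
            refine ⟨Finset.sdiff_subset, fun hsub => ?_⟩
            have hp := hsub p.2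
            simp [pivotCluster] at hp
          have := ih _ hss
          linarith
        · intro 𝒞 h𝒞
          have := disagreeSum_assignCluster (g := g) p.2 (rule := fun _ _ => True) (𝒞 := 𝒞) (K := K)
            (by convert pivotRun_of_mem_support _ 𝒞 h𝒞)
          convert this
      rw [expect_bind]
      refine le_trans ?_ (expect_mono (f := fun p : R => ratioDen K g R p) _ fun p _ => by
        convert key p)
      simp only [expect, PMF.uniformOfFintype_apply]
      rw [← Finset.mul_sum]
      refine mul_nonneg ENNReal.toReal_nonneg ?_
      rw [Finset.sum_coe_sort R (fun p => ratioDen K g R p)]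
      exact hg R
    · rw [expect_pure]
      refine le_of_eq (Finset.sum_eq_zero fun e he => ?_).symm
      rw [Finset.not_nonempty_iff_eq_empty] at h
      obtain ⟨u, hu, -⟩ := (Finset.mem_filter.1 he).2
      simp [h] at hu

end Triples

end CCInstance


/-! ### Budgets of bad triples and integral points of the linear program -/

namespace CCInstance

section Budget

variable {V : Type*} {G : CCInstance V}

theorem IsDangerousPair.exists_nodes {e f : Sym2 V} (h : G.IsDangerousPair s(e, f)) :
    ∃ a b c d, e = s(a, b) ∧ f = s(c, d) ∧ G.pos.Adj a b ∧ G.pos.Adj c d ∧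
      G.super b = G.super c ∧ G.HostilePair (G.super a) (G.super d) := by
  obtain ⟨a, b, c, d, h, hab, hcd, hbc, had⟩ := h
  rcases Sym2.eq_iff.1 h with ⟨rfl, rfl⟩ | ⟨rfl, rfl⟩
  · exact ⟨a, b, c, d, rfl, rfl, hab, hcd, hbc, had⟩
  · exact ⟨d, c, b, a, Sym2.eq_swap, Sym2.eq_swap, hcd.symm, hab.symm, hbc.symm, had.symm⟩

/-- This is the triangle constraint for S(a), S(b) = S(c), S(d), in which X⁻ vanishes on the hostile
pair. Consistency makes the three supernodes distinct, since no positive edge joins hostile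
supernodes. -/
theorem IsDangerousPair.one_le {𝒟 : Set (Sym2 (Sym2 V))} {X : LPPoint G} (hG : G.IsConsistent)
    (hX : G.IsLPFeasible 𝒟 X) {e f : Sym2 V} (h : G.IsDangerousPair s(e, f)) :
    1 ≤ X.x e + X.x f := by
  obtain ⟨a, b, c, d, rfl, rfl, hab, hcd, hbc, had⟩ := h.exists_nodes
  have h1 := hX.edge_pos s(a, b) hab
  have h2 := hX.edge_pos s(c, d) hcd
  rw [Sym2.map_mk, hbc] at h1
  rw [Sym2.map_mk] at h2
  have h3 := (hX.hostile _ _ had).1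
  have h4 := hX.triangle (G.super a) (G.super c) (G.super d)
    (fun h => hG.not_pos (h ▸ had) hcd)
    (fun h => hG.not_pos (u := a) (v := b) (by rw [hbc, h]; exact had) hab)
    (hG.super_ne had)
  rw [h1, h2]
  linarith

theorem budget_of_adj {𝒟 : Set (Sym2 (Sym2 V))} {X : LPPoint G} {e : Sym2 V}
    (h : e ∈ (G.auxGraph 𝒟 X).edgeSet) : G.budget 𝒟 X e = 3 * X.x e := by
  rw [budget, if_neg]
  rintro ⟨⟨-, h'⟩, -⟩
  induction e with
  | _ u v => exact ((SimpleGraph.compl_adj _ _ _).1 h').2 h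

theorem budget_of_not_pos {𝒟 : Set (Sym2 (Sym2 V))} {X : LPPoint G} {e : Sym2 V}
    (h : e ∉ G.pos.edgeSet) : G.budget 𝒟 X e = 3 * X.x e := by
  rw [budget, if_neg]
  rintro ⟨⟨h', -⟩, -⟩
  exact h h'

theorem IsLPFeasible.x_nonneg {𝒟 : Set (Sym2 (Sym2 V))} {X : LPPoint G}
    (hX : G.IsLPFeasible 𝒟 X) {u v : V} (huv : u ≠ v) : 0 ≤ X.x s(u, v) := by
  by_cases h : G.pos.Adj u v
  · rw [hX.edge_pos s(u, v) h]; exact (hX.nonneg _ _).1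
  · rw [hX.edge_neg s(u, v) ((SimpleGraph.compl_adj _ _ _).2 ⟨huv, h⟩)]; exact (hX.nonneg _ _).2

theorem budget_nonneg {𝒟 : Set (Sym2 (Sym2 V))} {X : LPPoint G}
    (hX : G.IsLPFeasible 𝒟 X) {u v : V} (huv : u ≠ v) : 0 ≤ G.budget 𝒟 X s(u, v) := by
  have := hX.x_nonneg huv
  rw [budget]
  split_ifs <;> linarith

/-- A positive edge of `G` that is a non-balanced non-edge of the auxiliary graph has a large LP
value, or its partner is a positive edge of the auxiliary graph. -/
theorem cases_of_pos_not_adj {𝒟 : Set (Sym2 (Sym2 V))} {X : LPPoint G}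
    (hD : G.IsMaximalDangerous 𝒟) {u v : V} (huv : G.pos.Adj u v)
    (hK : ¬ (G.auxGraph 𝒟 X).Adj u v) (hb : s(u, v) ∉ G.balancedEdges 𝒟 (G.auxGraph 𝒟 X)) :
    min (X.Xneg s(G.super u, G.super v)) (2 / 3) ≤ X.Xpos s(G.super u, G.super v) ∨
      ∃ f, s(s(u, v), f) ∈ 𝒟 ∧ f ∈ (G.auxGraph 𝒟 X).edgeSet ∧ f ∈ G.pos.edgeSet := by
  by_cases h : s(u, v) ∈ dangerousEdges 𝒟
  · right
    obtain ⟨f, hf⟩ := h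
    have hfpos : f ∈ G.pos.edgeSet := by
      obtain ⟨a, b, c, d, -, rfl, -, hcd, -, -⟩ := (hD.prop.1 _ hf).exists_nodes
      exact hcd
    refine ⟨f, hf, ?_, hfpos⟩
    by_contra hfK
    refine hb ⟨⟨huv, (SimpleGraph.compl_adj _ _ _).2 ⟨huv.ne, hK⟩⟩, f, hf, hfpos, ?_⟩
    induction f with
    | _ c d => exact (SimpleGraph.compl_adj _ _ _).2 ⟨SimpleGraph.Adj.ne hfpos, hfK⟩
  · left
    by_contra hlt
    exact hK ⟨huv.ne, Or.inr ⟨⟨u, v, rfl, rfl, huv, h⟩, not_le.1 hlt⟩⟩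

theorem IsLPFeasible.x_pos {𝒟 : Set (Sym2 (Sym2 V))} {X : LPPoint G}
    (hX : G.IsLPFeasible 𝒟 X) {u v : V} (h : G.pos.Adj u v) :
    X.x s(u, v) = X.Xpos s(G.super u, G.super v) := hX.edge_pos s(u, v) h

theorem IsLPFeasible.x_neg {𝒟 : Set (Sym2 (Sym2 V))} {X : LPPoint G}
    (hX : G.IsLPFeasible 𝒟 X) {u v : V} (huv : u ≠ v) (h : ¬ G.pos.Adj u v) :
    X.x s(u, v) = X.Xneg s(G.super u, G.super v) :=
  hX.edge_neg s(u, v) ((SimpleGraph.compl_adj _ _ _).2 ⟨huv, h⟩)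

theorem x_lt_of_adj_pos {𝒟 : Set (Sym2 (Sym2 V))} {X : LPPoint G}
    (hX : G.IsLPFeasible 𝒟 X) {f : Sym2 V} (hK : f ∈ (G.auxGraph 𝒟 X).edgeSet)
    (hf : f ∈ G.pos.edgeSet) : X.x f < 2 / 3 := by
  induction f with
  | _ c d =>
    rw [hX.x_pos hf]
    rcases hK.2 with h | ⟨-, h⟩
    · rw [h, (hX.diag _).1]; norm_num
    · exact h.trans_le (min_le_right _ _)

theorem agree_of_adj_pos {K : SimpleGraph V} {u v : V} (hK : K.Adj u v) (h : G.pos.Adj u v) :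
    G.agree K s(u, v) = 1 := by simp [agree, hK, h]

theorem agree_of_adj_not_pos {K : SimpleGraph V} {u v : V} (hK : K.Adj u v)
    (h : ¬ G.pos.Adj u v) : G.agree K s(u, v) = 0 := by simp [agree, hK, h]

theorem agree_of_not_adj_pos {K : SimpleGraph V} {u v : V} (hK : ¬ K.Adj u v) (h : G.pos.Adj u v) :
    G.agree K s(u, v) = 0 := by simp [agree, hK, h]

theorem agree_of_not_adj_not_pos {K : SimpleGraph V} {u v : V} (hK : ¬ K.Adj u v)
    (h : ¬ G.pos.Adj u v) : G.agree K s(u, v) = 1 := by simp [agree, hK, h]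

/-- An edge of K between distinct supernodes has X⁺ < X⁻, hence X⁻ ≥ 1/2. If ik is negative, the
triangle constraint gives total LP value at least 1, thus budget 3, because replacing X⁺ by X⁻ on ij
or jk only helps. If ik is positive, it counts no agreement, and only the case of positive ij and jk
needs more than one of the bounds X⁻ ≥ 1/2 on an edge of K. -/
theorem budget_triple {𝒟 : Set (Sym2 (Sym2 V))} {X : LPPoint G} (hG : G.IsConsistent)
    (hD : G.IsMaximalDangerous 𝒟) (hX : G.IsLPFeasible 𝒟 X) {i j k : V} (hne : i ≠ k)
    (hij : (G.auxGraph 𝒟 X).Adj i j) (hjk : (G.auxGraph 𝒟 X).Adj j k)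
    (hik : ¬ (G.auxGraph 𝒟 X).Adj i k) :
    G.agree (G.auxGraph 𝒟 X) s(i, j) + G.agree (G.auxGraph 𝒟 X) s(j, k) +
        G.agree (G.auxGraph 𝒟 X) s(i, k) ≤
      G.budget 𝒟 X s(i, j) + G.budget 𝒟 X s(j, k) + G.budget 𝒟 X s(i, k) := by
  -- Nodes of one supernode have the same neighbours in K, so a bad triple meets three supernodes.
  have hAB : G.super i ≠ G.super j := fun h =>
    hik ((auxGraph_adj_congr h hne.symm hjk.ne').2 hjk)
  have hBC : G.super j ≠ G.super k := fun h =>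
    hik (((auxGraph_adj_congr h hij.ne hne).1 hij.symm).symm)
  have hAC : G.super i ≠ G.super k := fun h => hik (auxGraph_adj_of_super_eq hne h)
  rw [budget_of_adj (e := s(i, j)) hij, budget_of_adj (e := s(j, k)) hjk]
  have h1 := (hij.2.resolve_left hAB).2
  have h2 := (hjk.2.resolve_left hBC).2
  rw [lt_min_iff] at h1 h2
  have h3 := hX.pair (G.super i) (G.super j)
  have h4 := hX.pair (G.super j) (G.super k)
  have htri := hX.triangle _ _ _ hAB hBC hAC
  have hn1 := hX.nonneg (G.super i) (G.super j)
  have hn2 := hX.nonneg (G.super j) (G.super k)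
  have hn3 := hX.nonneg (G.super i) (G.super k)
  by_cases p3 : G.pos.Adj i k
  · rw [agree_of_not_adj_pos hik p3]
    by_cases hb : s(i, k) ∈ G.balancedEdges 𝒟 (G.auxGraph 𝒟 X)
    -- A balanced ik pays alone for the at most two agreements on ij and jk.
    · have hy : G.budget 𝒟 X s(i, k) = 2 := by rw [budget, if_pos hb]
      rw [hy]
      have : ∀ e, G.agree (G.auxGraph 𝒟 X) e ≤ 1 := by
        intro e; rw [agree]; split_ifs <;> norm_num
      have := hX.x_nonneg hij.ne
      have := hX.x_nonneg hjk.ne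
      linarith [‹∀ e, G.agree (G.auxGraph 𝒟 X) e ≤ 1› s(i, j),
        ‹∀ e, G.agree (G.auxGraph 𝒟 X) e ≤ 1› s(j, k)]
    · have hy : G.budget 𝒟 X s(i, k) = 3 * X.x s(i, k) := by rw [budget, if_neg hb]
      rw [hy]
      by_cases p1 : G.pos.Adj i j
      · by_cases p2 : G.pos.Adj j k
        · rw [agree_of_adj_pos hij p1, agree_of_adj_pos hjk p2]
          rcases cases_of_pos_not_adj hD p3 hik hb with h | ⟨f, hf, hfK, hfp⟩
          -- If X⁻ ≤ X⁺ on ik, the triangle constraint gives total at least 1; otherwise X⁺ ≥ 2/3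
          -- already gives budget 2.
          · rw [hX.x_pos p1, hX.x_pos p2, hX.x_pos p3]
            rcases min_le_iff.1 h with h | h <;> linarith
          -- HEAP gives x_ij + x_jk ≥ 1 − x_f, and x_ik ≥ 1 − x_f. The total is at least 2 − 2x_f,
          -- which exceeds 2/3 because f is an edge of K.
          · have h5 := hX.heap i j k f hf hAB.symm hBC p1 p2
            have h6 := (hD.prop.1 _ hf).one_le hG hX
            have h7 := x_lt_of_adj_pos hX hfK hfp
            linarith
        · rw [agree_of_adj_pos hij p1, agree_of_adj_not_pos hjk p2]
          have := hX.x_nonneg hne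
          rw [hX.x_pos p1, hX.x_neg hjk.ne p2]
          linarith
      · have := hX.x_nonneg hne
        have := hX.x_nonneg hjk.ne
        have hle : G.agree (G.auxGraph 𝒟 X) s(j, k) ≤ 1 := by
          rw [agree]; split_ifs <;> norm_num
        rw [agree_of_adj_not_pos hij p1, hX.x_neg hij.ne p1]
        linarith
  · rw [agree_of_not_adj_not_pos hik p3, budget_of_not_pos (e := s(i, k)) p3, hX.x_neg hne p3]
    by_cases p1 : G.pos.Adj i j <;> by_cases p2 : G.pos.Adj j k
    · rw [agree_of_adj_pos hij p1, agree_of_adj_pos hjk p2, hX.x_pos p1, hX.x_pos p2]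
      linarith
    · rw [agree_of_adj_pos hij p1, agree_of_adj_not_pos hjk p2, hX.x_pos p1, hX.x_neg hjk.ne p2]
      linarith
    · rw [agree_of_adj_not_pos hij p1, agree_of_adj_pos hjk p2, hX.x_neg hij.ne p1, hX.x_pos p2]
      linarith
    · rw [agree_of_adj_not_pos hij p1, agree_of_adj_not_pos hjk p2, hX.x_neg hij.ne p1,
        hX.x_neg hjk.ne p2]
      linarith

theorem budget_badTriple {𝒟 : Set (Sym2 (Sym2 V))} {X : LPPoint G} (hG : G.IsConsistent)
    (hD : G.IsMaximalDangerous 𝒟) (hX : G.IsLPFeasible 𝒟 X) {p u v : V}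
    (h : BadTriple (G.auxGraph 𝒟 X) p u v) :
    G.agree (G.auxGraph 𝒟 X) s(u, v) + G.agree (G.auxGraph 𝒟 X) s(p, u) +
        G.agree (G.auxGraph 𝒟 X) s(p, v) ≤
      G.budget 𝒟 X s(u, v) + G.budget 𝒟 X s(p, u) + G.budget 𝒟 X s(p, v) := by
  obtain ⟨hpu, hpv, huv, ⟨h1, h2, h3⟩ | ⟨h1, h2, h3⟩ | ⟨h1, h2, h3⟩⟩ := h
  · linarith [budget_triple hG hD hX hpv h2 h1 h3]
  · have := budget_triple hG hD hX hpu h3 h1.symm h2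
    rw [Sym2.eq_swap (a := v) (b := u)] at this
    linarith
  · have := budget_triple hG hD hX huv h2.symm h3 h1
    rw [Sym2.eq_swap (a := u) (b := p)] at this
    linarith

/-- This pays for pairs on which the clustering follows K against G. Such a pair has LP value at
least 1/2 or at least 2/3, or its partner has value below 2/3, so that its own value exceeds 1/3;
the last case is the tight one. -/
theorem one_sub_agree_le_budget {𝒟 : Set (Sym2 (Sym2 V))} {X : LPPoint G} (hG : G.IsConsistent)
    (hD : G.IsMaximalDangerous 𝒟) (hX : G.IsLPFeasible 𝒟 X) {u v : V} (huv : u ≠ v)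
    (hb : s(u, v) ∉ G.balancedEdges 𝒟 (G.auxGraph 𝒟 X)) :
    1 - G.agree (G.auxGraph 𝒟 X) s(u, v) ≤ 3 * X.x s(u, v) := by
  have h0 := hX.x_nonneg huv
  have hpair := hX.pair (G.super u) (G.super v)
  by_cases hK : (G.auxGraph 𝒟 X).Adj u v <;> by_cases hp : G.pos.Adj u v
  · rw [agree_of_adj_pos hK hp]; linarith
  · rw [agree_of_adj_not_pos hK hp, hX.x_neg huv hp]
    rcases hK.2 with h | ⟨-, h⟩
    · exact (hp (hG.1 u v huv h)).elim
    · rw [lt_min_iff] at h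
      linarith
  · rw [agree_of_not_adj_pos hK hp]
    rcases cases_of_pos_not_adj hD hp hK hb with h | ⟨f, hf, hfK, hfp⟩
    · rw [hX.x_pos hp]
      rcases min_le_iff.1 h with h | h <;> linarith
    · have h6 := (hD.prop.1 _ hf).one_le hG hX
      have h7 := x_lt_of_adj_pos hX hfK hfp
      linarith
  · rw [agree_of_not_adj_not_pos hK hp]; linarith

/-- The solution of the linear program that corresponds to a clustering. -/
noncomputable def clusterPoint (G : CCInstance V) (φ : G.Supernode → V) : LPPoint G :=
  open scoped Classical in
  { Xpos := fun e => if (e.map φ).IsDiag then 0 else 1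
    Xneg := fun e => if (e.map φ).IsDiag then 1 else 0
    x := fun e => if e ∈ G.pos.edgeSet then (if ((e.map G.super).map φ).IsDiag then 0 else 1)
      else if ((e.map G.super).map φ).IsDiag then 1 else 0 }

theorem exists_superMap {𝒞 : V → V} (h : G.IsFeasible 𝒞) :
    ∃ φ : G.Supernode → V, ∀ u, φ (G.super u) = 𝒞 u := by
  refine ⟨fun A => 𝒞 A.out, fun u => h.eq_of_super_eq ?_⟩
  exact Quot.out_eq _

/-- For HEAP: if neither ab nor bc is cut, then a and c share a cluster. The partner of ac starts in
the supernode of one of them and ends in a supernode hostile to that of the other, so it is cut. -/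
theorem clusterPoint_isLPFeasible {𝒟 : Set (Sym2 (Sym2 V))} (hD : G.IsEdgeDisjointDangerous 𝒟)
    {𝒞 : V → V} (h : G.IsFeasible 𝒞) {φ : G.Supernode → V}
    (hφ : ∀ u, φ (G.super u) = 𝒞 u) : G.IsLPFeasible 𝒟 (G.clusterPoint φ) := by
  classical
  have hh : ∀ A B, G.HostilePair A B → φ A ≠ φ B := by
    rintro A B ⟨a, b, rfl, rfl, hab⟩
    rw [hφ, hφ]
    exact h.2 _ _ hab
  constructor
  · intro e he
    simp [clusterPoint, he]
  · intro e he
    have : e ∉ G.pos.edgeSet := by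
      induction e with
      | _ u v => exact ((SimpleGraph.compl_adj _ _ _).1 he).2
    simp [clusterPoint, this]
  · intro A; simp [clusterPoint]
  · intro A B hAB
    simp [clusterPoint, hh A B hAB]
  · intro A B C _ _ _
    simp only [clusterPoint, Sym2.map_mk, Sym2.mk_isDiag_iff]
    by_cases h1 : φ A = φ B <;> by_cases h2 : φ B = φ C <;> by_cases h3 : φ A = φ C <;>
      simp_all
  · intro A B
    simp only [clusterPoint]
    split_ifs <;> norm_num
  · intro A B
    simp only [clusterPoint]
    split_ifs <;> norm_num
  · intro a b c f hf _ _ hab hbc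
    obtain ⟨a', c', c'', d, hac, rfl, -, hcd, h3, h4⟩ := (hD.1 _ hf).exists_nodes
    have hne := hh _ _ h4
    have heq : φ (G.super c') = φ (G.super c'') := by rw [h3]
    simp only [clusterPoint, SimpleGraph.mem_edgeSet, hab, hbc, hcd, if_true, Sym2.map_mk,
      Sym2.mk_isDiag_iff]
    rcases Sym2.eq_iff.1 hac with ⟨rfl, rfl⟩ | ⟨rfl, rfl⟩
    · by_cases h1 : φ (G.super a) = φ (G.super b)
      · by_cases h2 : φ (G.super b) = φ (G.super c)
        · have : φ (G.super c'') ≠ φ (G.super d) := by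
            rw [← heq, ← h2, ← h1]; exact hne
          simp [h1, h2, this]
        · rw [if_neg h2]; split_ifs <;> norm_num
      · rw [if_neg h1]; split_ifs <;> norm_num
    · by_cases h1 : φ (G.super a) = φ (G.super b)
      · by_cases h2 : φ (G.super b) = φ (G.super c)
        · have : φ (G.super c'') ≠ φ (G.super d) := by
            rw [← heq, h1, h2]; exact hne
          simp [h1, h2, this]
        · rw [if_neg h2]; split_ifs <;> norm_num
      · rw [if_neg h1]; split_ifs <;> norm_num

theorem agree_nonneg (K : SimpleGraph V) (e : Sym2 V) : 0 ≤ G.agree K e := by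
  rw [agree]; split_ifs <;> norm_num

end Budget

/-! ### Charging the cost of the clustering to the linear program -/

section Cost

variable {V : Type*} [Fintype V] {G : CCInstance V}

open scoped Classical in
theorem cost_eq_sum (G : CCInstance V) (𝒞 : V → V) :
    (G.cost 𝒞 : ℝ) =
      ∑ e : Sym2 V with ¬ e.IsDiag, if e ∈ disagreeOn G.pos 𝒞 Finset.univ then 1 else 0 := by
  have hset : ∀ S : Set (Sym2 V), (S.ncard : ℝ) = ∑ e : Sym2 V, if e ∈ S then 1 else 0 := by
    intro S
    rw [Finset.sum_boole, Set.ncard_eq_toFinset_card']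
    congr 2
    ext e
    simp
  rw [cost, Nat.cast_add, hset, hset, ← Finset.sum_add_distrib, Finset.sum_filter]
  refine Finset.sum_congr rfl fun e _ => ?_
  induction e with
  | _ u v =>
    have hin : s(u, v) ∈ inside 𝒞 ↔ 𝒞 u = 𝒞 v := by
      constructor
      · rintro ⟨a, b, h, hab⟩
        rcases Sym2.eq_iff.1 h with ⟨rfl, rfl⟩ | ⟨rfl, rfl⟩
        · exact hab
        · exact hab.symm
      · exact fun h => ⟨u, v, rfl, h⟩
    simp only [Set.mem_sdiff, Set.mem_inter_iff, hin, SimpleGraph.mem_edgeSet, neg,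
      SimpleGraph.compl_adj, mem_disagreeOn, Finset.mem_univ, true_and, Sym2.mk_isDiag_iff]
    by_cases huv : u = v
    · subst huv; simp
    · by_cases hp : G.pos.Adj u v <;> by_cases hc : 𝒞 u = 𝒞 v <;> simp [huv, hp, hc]

theorem clusterPoint_objective {𝒞 : V → V} {φ : G.Supernode → V}
    (hφ : ∀ u, φ (G.super u) = 𝒞 u) : (G.clusterPoint φ).objective = G.cost 𝒞 := by
  classical
  rw [cost_eq_sum, LPPoint.objective]
  refine Finset.sum_congr rfl fun e he => ?_
  induction e with
  | _ u v =>
    have huv : u ≠ v := by simpa using he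
    simp only [clusterPoint, SimpleGraph.mem_edgeSet, Sym2.map_mk, Sym2.mk_isDiag_iff, hφ,
      mem_disagreeOn, Finset.mem_univ, true_and]
    by_cases hp : G.pos.Adj u v <;> by_cases hc : 𝒞 u = 𝒞 v <;> simp [huv, hp, hc]

theorem IsLPApprox.objective_le {𝒟 : Set (Sym2 (Sym2 V))} (hD : G.IsEdgeDisjointDangerous 𝒟)
    {α : ℝ} {X : LPPoint G} (hX : G.IsLPApprox 𝒟 α X) {𝒞 : V → V} (h : G.IsFeasible 𝒞) :
    X.objective ≤ α * G.cost 𝒞 := by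
  obtain ⟨φ, hφ⟩ := exists_superMap h
  rw [← clusterPoint_objective hφ]
  exact hX.2 _ (clusterPoint_isLPFeasible hD h hφ)

open scoped Classical in
/-- Summed over the balanced edges, the charges are bounded by the LP values. -/
theorem sum_balanced_le {𝒟 : Set (Sym2 (Sym2 V))} {X : LPPoint G} (hG : G.IsConsistent)
    (hD : G.IsMaximalDangerous 𝒟) (hX : G.IsLPFeasible 𝒟 X) {𝒞 : V → V} (h𝒞 : G.IsFeasible 𝒞) :
    ∑ e : Sym2 V with e ∈ G.balancedEdges 𝒟 (G.auxGraph 𝒟 X),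
        (1 + if e ∈ disagreeOn (G.auxGraph 𝒟 X) 𝒞 Finset.univ then (1 : ℝ) else 0) ≤
      ∑ e : Sym2 V with e ∈ G.balancedEdges 𝒟 (G.auxGraph 𝒟 X), 3 * X.x e := by
  set K := G.auxGraph 𝒟 X with hK
  set B : Finset (Sym2 V) := Finset.univ.filter fun e => e ∈ G.balancedEdges 𝒟 K with hB
  have hρ : ∀ e ∈ B, ∃ f, s(e, f) ∈ 𝒟 ∧ f ∈ G.pos.edgeSet ∩ Kᶜ.edgeSet := by
    intro e he
    exact (Finset.mem_filter.1 he).2.2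
  choose! ρ hρ1 hρ2 using hρ
  have hρB : ∀ e ∈ B, ρ e ∈ B := by
    intro e he
    refine Finset.mem_filter.2 ⟨Finset.mem_univ _, hρ2 e he, e, ?_, (Finset.mem_filter.1 he).2.1⟩
    rw [Sym2.eq_swap]; exact hρ1 e he
  have hinv : ∀ e ∈ B, ρ (ρ e) = e := by
    intro e he
    have h1 := hρ1 e he
    have h2 := hρ1 (ρ e) (hρB e he)
    have := hD.prop.2 _ h1 _ h2 (ρ e) (by simp) (by simp)
    rcases Sym2.eq_iff.1 this with ⟨h3, h4⟩ | ⟨h3, -⟩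
    · rw [← h4, ← h3]
    · exact h3.symm
  have hswap : ∀ g : Sym2 V → ℝ, ∑ e ∈ B, g (ρ e) = ∑ e ∈ B, g e := fun g =>
    Finset.sum_nbij' ρ ρ hρB hρB hinv hinv fun e _ => rfl
  set d : Sym2 V → ℝ := fun e => if e ∈ disagreeOn K 𝒞 Finset.univ then 1 else 0 with hd
  have hle : ∑ e ∈ B, ((1 + d e) + (1 + d (ρ e))) ≤ ∑ e ∈ B, (3 * X.x e + 3 * X.x (ρ e)) := by
    refine Finset.sum_le_sum fun e he => ?_
    have h1 := (hD.prop.1 _ (hρ1 e he)).one_le hG hX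
    -- Balanced edges are negative in K, so a disagreement means that the edge lies inside a
    -- cluster. Two partners inside clusters would be in one cluster through their common supernode,
    -- and so would their hostile ends.
    have h2 : d e + d (ρ e) ≤ 1 := by
      have hd1 : ∀ e, d e = 0 ∨ (d e = 1 ∧ e ∈ disagreeOn K 𝒞 Finset.univ) := by
        intro e
        simp only [hd]
        split_ifs with h <;> simp [h]
      rcases hd1 e with h | ⟨h, he1⟩ <;> rcases hd1 (ρ e) with h' | ⟨h', he2⟩ <;>
        rw [h, h'] <;> norm_num
      have he3 := (Finset.mem_filter.1 he).2.1.2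
      have he4 := (hρ2 e he).2
      obtain ⟨a, b, c, d, hab, hcd, -, -, hbc, had⟩ := (hD.prop.1 _ (hρ1 e he)).exists_nodes
      rw [hab] at he1 he3
      rw [hcd] at he2 he4
      have h1 := ((SimpleGraph.compl_adj _ _ _).1 he3).2
      have h2 := ((SimpleGraph.compl_adj _ _ _).1 he4).2
      have h3 := (mem_disagreeOn.1 he1).2.2.2
      have h4 := (mem_disagreeOn.1 he2).2.2.2
      have h5 : 𝒞 a = 𝒞 b := by by_contra h5; exact h1 (h3.2 h5)
      have h6 : 𝒞 c = 𝒞 d := by by_contra h6; exact h2 (h4.2 h6)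
      exact h𝒞.ne_of_hostilePair had (h5.trans ((h𝒞.eq_of_super_eq hbc).trans h6))
    linarith
  -- The involution ρ permutes the balanced edges, so both sides are twice the desired sums.
  rw [Finset.sum_add_distrib (f := fun e => 1 + d e), Finset.sum_add_distrib (f := fun e => 3 * X.x e),
    hswap (fun e => 1 + d e), hswap (fun e => 3 * X.x e)] at hle
  linarith

/-- The left side splits over pairs. On a non-balanced pair it equals y = 3x if the clustering
disagrees with K, and 1 − agree ≤ 3x otherwise. On a balanced edge it equals 1 + d, which is handled
in partner pairs by `sum_balanced_le`. -/
theorem cost_add_disagreeSum_le {𝒟 : Set (Sym2 (Sym2 V))} {X : LPPoint G} (hG : G.IsConsistent)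
    (hD : G.IsMaximalDangerous 𝒟) (hX : G.IsLPFeasible 𝒟 X) {𝒞 : V → V} (h𝒞 : G.IsFeasible 𝒞) :
    (G.cost 𝒞 : ℝ) + disagreeSum (G.auxGraph 𝒟 X)
      (fun e => G.budget 𝒟 X e - G.agree (G.auxGraph 𝒟 X) e) Finset.univ 𝒞 ≤
        3 * X.objective := by
  classical
  set K := G.auxGraph 𝒟 X with hK
  set d : Sym2 V → ℝ := fun e => if e ∈ disagreeOn K 𝒞 Finset.univ then 1 else 0 with hd
  have h1 : disagreeSum K (fun e => G.budget 𝒟 X e - G.agree K e) Finset.univ 𝒞 =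
      ∑ e : Sym2 V with ¬ e.IsDiag, d e * (G.budget 𝒟 X e - G.agree K e) := by
    rw [disagreeSum, Finset.sum_filter, Finset.sum_filter]
    refine Finset.sum_congr rfl fun e _ => ?_
    by_cases he : e ∈ disagreeOn K 𝒞 Finset.univ
    · have : ¬ e.IsDiag := by
        obtain ⟨u, -, v, -, rfl, h, -⟩ := he
        simpa using h
      simp [he, this, d]
    · simp [he, d]
  rw [cost_eq_sum, h1, ← Finset.sum_add_distrib, LPPoint.objective, Finset.mul_sum]
  have hbal : ∀ f : Sym2 V → ℝ, ∑ e : Sym2 V with ¬ e.IsDiag, f e =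
      (∑ e : Sym2 V with e ∈ G.balancedEdges 𝒟 K, f e) +
        ∑ e : Sym2 V with ¬ e.IsDiag ∧ e ∉ G.balancedEdges 𝒟 K, f e := by
    intro f
    rw [← Finset.sum_filter_add_sum_filter_not _ (fun e => e ∈ G.balancedEdges 𝒟 K),
      Finset.filter_filter, Finset.filter_filter]
    congr 1
    refine Finset.sum_congr ?_ fun _ _ => rfl
    ext e
    simp only [Finset.mem_filter, Finset.mem_univ, true_and, and_iff_right_iff_imp]
    rintro ⟨⟨h, -⟩, -⟩
    exact G.pos.not_isDiag_of_mem_edgeSet h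
  have hcost : ∀ u v, u ≠ v → (if s(u, v) ∈ disagreeOn G.pos 𝒞 Finset.univ then (1 : ℝ) else 0) =
      d s(u, v) * G.agree K s(u, v) + (1 - d s(u, v)) * (1 - G.agree K s(u, v)) := by
    intro u v huv
    simp only [d, agree, mem_disagreeOn, Finset.mem_univ, true_and, SimpleGraph.mem_edgeSet]
    by_cases h1 : G.pos.Adj u v <;> by_cases h2 : K.Adj u v <;> by_cases h3 : 𝒞 u = 𝒞 v <;>
      simp [h1, h2, h3, huv]
  rw [hbal, hbal]
  refine add_le_add (le_trans (Finset.sum_le_sum fun e he => ?_)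
    (sum_balanced_le hG hD hX h𝒞)) (Finset.sum_le_sum fun e he => ?_)
  · have hb := (Finset.mem_filter.1 he).2
    have hy : G.budget 𝒟 X e = 2 := by rw [budget, if_pos hb]
    induction e with
    | _ u v =>
      have hp : G.pos.Adj u v := hb.1.1
      have hk := ((SimpleGraph.compl_adj _ _ _).1 hb.1.2).2
      rw [hcost u v hp.ne, hy, agree_of_not_adj_pos hk hp]
      simp only [d]
      linarith
  · have hb := (Finset.mem_filter.1 he).2
    have hy : G.budget 𝒟 X e = 3 * X.x e := by rw [budget, if_neg hb.2]
    induction e with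
    | _ u v =>
      have huv : u ≠ v := by simpa using hb.1
      rw [hcost u v huv, hy]
      have h2 := one_sub_agree_le_budget hG hD hX huv hb.2
      have h3 := hX.x_nonneg huv
      have h4 : d s(u, v) = 0 ∨ d s(u, v) = 1 := by
        simp only [d]; split_ifs <;> simp
      rcases h4 with h4 | h4 <;> rw [h4] <;> linarith

theorem ratioDen_sub (K : SimpleGraph V) (y a : Sym2 V → ℝ) (R : Finset V) (p : V) :
    ratioDen K (fun e => y e - a e) R p = ratioDen K y R p - ratioDen K a R p := by
  simp only [ratioDen, Finset.sum_sub_distrib]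

theorem ratioDen_nonneg {K : SimpleGraph V} {y : Sym2 V → ℝ} (hy : ∀ u v, u ≠ v → 0 ≤ y s(u, v))
    (R : Finset V) (p : V) : 0 ≤ ratioDen K y R p := by
  classical
  refine Finset.sum_nonneg fun e he => ?_
  induction e with
  | _ u v => exact hy u v (mem_badPos_union_badNeg.1 (Finset.mem_filter.1 he).2).2.2.2.2.1

theorem sum_ratioDen_budget_sub_agree_nonneg {𝒟 : Set (Sym2 (Sym2 V))} {X : LPPoint G}
    (hG : G.IsConsistent) (hD : G.IsMaximalDangerous 𝒟) (hX : G.IsLPFeasible 𝒟 X)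
    (R : Finset V) : 0 ≤ ∑ p ∈ R, ratioDen (G.auxGraph 𝒟 X)
      (fun e => G.budget 𝒟 X e - G.agree (G.auxGraph 𝒟 X) e) R p := by
  refine sum_ratioDen_nonneg (fun p u v h => ?_) R
  have := budget_badTriple hG hD hX h
  linarith

/-- The smallest ratio is at most the quotient of the sums of numerators and denominators, which is
at most 1 by the bound on bad triples. The conclusion says num ≤ den for p. -/
theorem MinimizesRatio.ratioNum_le {𝒟 : Set (Sym2 (Sym2 V))} {X : LPPoint G}
    (hG : G.IsConsistent) (hD : G.IsMaximalDangerous 𝒟) (hX : G.IsLPFeasible 𝒟 X)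
    {R : Finset V} {p : V} (hp : p ∈ R) (h : G.MinimizesRatio 𝒟 X R p) :
    0 ≤ ratioDen (G.auxGraph 𝒟 X)
      (fun e => G.budget 𝒟 X e - G.agree (G.auxGraph 𝒟 X) e) R p := by
  set K := G.auxGraph 𝒟 X with hK
  have hden : ∀ q, 0 ≤ ratioDen K (G.budget 𝒟 X) R q :=
    ratioDen_nonneg (fun u v huv => budget_nonneg hX huv) R
  have hnum : ∀ q, 0 ≤ ratioDen K (G.agree K) R q :=
    ratioDen_nonneg (fun u v _ => agree_nonneg _ _) R
  have hsum := sum_ratioDen_budget_sub_agree_nonneg hG hD hX R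
  simp only [ratioDen_sub, ← hK, Finset.sum_sub_distrib] at hsum ⊢
  have h1 : ratioDen K (G.agree K) R p * ∑ q ∈ R, ratioDen K (G.budget 𝒟 X) R q ≤
      (∑ q ∈ R, ratioDen K (G.agree K) R q) * ratioDen K (G.budget 𝒟 X) R p := by
    rw [Finset.mul_sum, Finset.sum_mul]
    refine Finset.sum_le_sum fun q hq => ?_
    have := h q hq
    rwa [ratioNum_eq_ratioDen, ratioNum_eq_ratioDen] at this
  have h0 : 0 ≤ ∑ q ∈ R, ratioDen K (G.budget 𝒟 X) R q := Finset.sum_nonneg fun q _ => hden q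
  have hp1 : ratioDen K (G.agree K) R p ≤ ∑ q ∈ R, ratioDen K (G.agree K) R q :=
    Finset.single_le_sum (f := fun q => ratioDen K (G.agree K) R q) (fun q _ => hnum q) hp
  have := hden p
  rcases h0.eq_or_lt with h0 | h0
  -- If all denominators vanish, then the numerators sum to at most 0, so that of p is 0.
  · have := hnum p
    linarith
  · have h2 : ratioDen K (G.agree K) R p * ∑ q ∈ R, ratioDen K (G.budget 𝒟 X) R q ≤
        ratioDen K (G.budget 𝒟 X) R p * ∑ q ∈ R, ratioDen K (G.budget 𝒟 X) R q := by
      refine h1.trans ?_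
      rw [mul_comm]
      exact mul_le_mul_of_nonneg_left (by linarith) this
    have := le_of_mul_le_mul_right h2 h0
    linarith

theorem isApproxClustering_of_pivotRun {𝒟 : Set (Sym2 (Sym2 V))} {X : LPPoint G} {ε : ℝ}
    (hG : G.IsConsistent) (hD : G.IsMaximalDangerous 𝒟) (hX : G.IsLPApprox 𝒟 (1 + ε / 3) X)
    {𝒞 : V → V}
    (h : PivotRun (G.auxGraph 𝒟 X) (G.MinimizesRatio 𝒟 X) Finset.univ 𝒞) :
    G.IsApproxClustering (3 + ε) 𝒞 := by
  have hf := h.isFeasible (auxGraph_isPivotSafe hG hD hX.1)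
  refine ⟨hf, fun 𝒞' h' => ?_⟩
  have h1 := cost_add_disagreeSum_le hG hD hX.1 hf
  have h2 := hX.objective_le hD.prop h'
  have h3 := disagreeSum_nonneg_of_pivotRun
    (fun R p hp hr => MinimizesRatio.ratioNum_le hG hD hX.1 hp hr) h
  linarith

theorem expectedCost_le {𝒟 : Set (Sym2 (Sym2 V))} {X : LPPoint G} {ε : ℝ}
    (hG : G.IsConsistent) (hD : G.IsMaximalDangerous 𝒟) (hX : G.IsLPApprox 𝒟 (1 + ε / 3) X)
    {𝒞' : V → V} (h' : G.IsFeasible 𝒞') :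
    G.expectedCost (randomPivot (G.auxGraph 𝒟 X) Finset.univ) ≤ (3 + ε) * G.cost 𝒞' := by
  classical
  set K := G.auxGraph 𝒟 X with hK
  set μ := randomPivot K Finset.univ
  have h1 : G.expectedCost μ = expect μ fun 𝒞 => (G.cost 𝒞 : ℝ) := by
    rw [expectedCost, expect]
  have h2 : expect μ (fun 𝒞 => (G.cost 𝒞 : ℝ) + disagreeSum K
      (fun e => G.budget 𝒟 X e - G.agree K e) Finset.univ 𝒞) ≤ expect μ fun _ => 3 * X.objective := by
    refine expect_mono _ fun 𝒞 h𝒞 => ?_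
    refine cost_add_disagreeSum_le hG hD hX.1 ?_
    exact (pivotRun_of_mem_support _ 𝒞 h𝒞).isFeasible (auxGraph_isPivotSafe hG hD hX.1)
  rw [expect_add, expect_const] at h2
  have h3 := expect_disagreeSum_nonneg
    (sum_ratioDen_budget_sub_agree_nonneg hG hD hX.1) Finset.univ
  have h4 := hX.objective_le hD.prop h'
  rw [h1]
  have h5 : expect μ (disagreeSum K (fun e => G.budget 𝒟 X e - G.agree K e) Finset.univ) =
    expect μ (fun 𝒞 => disagreeSum K (fun e => G.budget 𝒟 X e - G.agree K e) Finset.univ 𝒞) := rfl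
  linarith

end Cost

end CCInstance


namespace RealRAM

/-! ## A program logic with time -/

attribute [simp] IExp.eval NExp.eval Test.holds IExp.steps NExp.steps Test.steps

@[simp] theorem Mem.writeIdx_num (m : Mem) (a i j k : ℕ) : (m.writeIdx a i j k).num = m.num := rfl

@[simp] theorem Mem.writeNum_idx (m : Mem) (a i j : ℕ) (r : ℝ) :
    (m.writeNum a i j r).idx = m.idx := rfl

@[simp] theorem Mem.writeIdx_idx (m : Mem) (a i j k a' i' j' : ℕ) :
    (m.writeIdx a i j k).idx a' i' j' =
      if a' = a ∧ i' = i ∧ j' = j then k else m.idx a' i' j' := rfl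

@[simp] theorem Mem.writeNum_num (m : Mem) (a i j a' i' j' : ℕ) (r : ℝ) :
    (m.writeNum a i j r).num a' i' j' =
      if a' = a ∧ i' = i ∧ j' = j then r else m.num a' i' j' := rfl

/-- `P`, started with memory `m`, halts with a memory and a number of steps that satisfy `Q`. -/
def Yields (P : Prog) (m : Mem) (Q : Mem → ℕ → Prop) : Prop := ∃ m' T, Run P m m' T ∧ Q m' T

theorem Yields.mono {P : Prog} {m : Mem} {Q Q' : Mem → ℕ → Prop} (h : Yields P m Q)
    (hQ : ∀ m' T, Q m' T → Q' m' T) : Yields P m Q' := by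
  obtain ⟨m', T, hr, hq⟩ := h
  exact ⟨m', T, hr, hQ _ _ hq⟩

/-- The arrays of natural numbers that a program may write to. -/
def Prog.idxWrites : Prog → List ℕ
  | .skip => []
  | .setIdx a _ _ _ => [a]
  | .setNum _ _ _ _ => []
  | .seq P Q => P.idxWrites ++ Q.idxWrites
  | .branch _ P Q => P.idxWrites ++ Q.idxWrites
  | .loop _ P => P.idxWrites

/-- The arrays of real numbers that a program may write to. -/
def Prog.numWrites : Prog → List ℕ
  | .skip => []
  | .setIdx _ _ _ _ => []
  | .setNum a _ _ _ => [a]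
  | .seq P Q => P.numWrites ++ Q.numWrites
  | .branch _ P Q => P.numWrites ++ Q.numWrites
  | .loop _ P => P.numWrites

/-- `m` and `m'` differ at most in the listed arrays. -/
def SameExcept (I N : List ℕ) (m m' : Mem) : Prop :=
  (∀ a, a ∉ I → m'.idx a = m.idx a) ∧ ∀ a, a ∉ N → m'.num a = m.num a

theorem SameExcept.refl (I N : List ℕ) (m : Mem) : SameExcept I N m m :=
  ⟨fun _ _ => rfl, fun _ _ => rfl⟩

theorem SameExcept.trans {I N : List ℕ} {m m' m'' : Mem} (h : SameExcept I N m m')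
    (h' : SameExcept I N m' m'') : SameExcept I N m m'' :=
  ⟨fun a ha => (h'.1 a ha).trans (h.1 a ha), fun a ha => (h'.2 a ha).trans (h.2 a ha)⟩

theorem SameExcept.mono {I N I' N' : List ℕ} {m m' : Mem} (h : SameExcept I N m m')
    (hI : ∀ a ∈ I, a ∈ I') (hN : ∀ a ∈ N, a ∈ N') : SameExcept I' N' m m' :=
  ⟨fun a ha => h.1 a fun h => ha (hI a h), fun a ha => h.2 a fun h => ha (hN a h)⟩

theorem Run.sameExcept {P : Prog} {m m' : Mem} {T : ℕ} (h : Run P m m' T) :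
    SameExcept P.idxWrites P.numWrites m m' := by
  induction h with
  | skip => exact SameExcept.refl _ _ _
  | setIdx a i j e m =>
    refine ⟨fun b hb => ?_, fun b _ => rfl⟩
    have : b ≠ a := by simpa [Prog.idxWrites] using hb
    funext i' j'
    simp [this]
  | setNum a i j e m =>
    refine ⟨fun b _ => rfl, fun b hb => ?_⟩
    have : b ≠ a := by simpa [Prog.numWrites] using hb
    funext i' j'
    simp [this]
  | seq P Q m m' m'' T T' _ _ ih ih' =>
    exact (ih.mono (by simp +contextual [Prog.idxWrites]) (by simp +contextual [Prog.numWrites])).trans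
      (ih'.mono (by simp +contextual [Prog.idxWrites]) (by simp +contextual [Prog.numWrites]))
  | branch_true b P Q m m' T _ _ ih =>
    exact ih.mono (by simp +contextual [Prog.idxWrites]) (by simp +contextual [Prog.numWrites])
  | branch_false b P Q m m' T _ _ ih =>
    exact ih.mono (by simp +contextual [Prog.idxWrites]) (by simp +contextual [Prog.numWrites])
  | loop_true b P m m' m'' T T' _ _ _ ih ih' => exact ih.trans ih'
  | loop_false b P m _ => exact SameExcept.refl _ _ _

/-- Arrays that do not occur as targets of assignments keep their contents. The lists of targets are
syntactic, so later framing conditions are decidable. -/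
theorem Yields.frame {P : Prog} {m : Mem} {Q : Mem → ℕ → Prop} (h : Yields P m Q) :
    Yields P m fun m' T => Q m' T ∧ SameExcept P.idxWrites P.numWrites m m' := by
  obtain ⟨m', T, hr, hq⟩ := h
  exact ⟨m', T, hr, hq, hr.sameExcept⟩

theorem yields_seq {P P' : Prog} {m : Mem} {Q : Mem → ℕ → Prop}
    (h : Yields P m fun m' T => Yields P' m' fun m'' T' => Q m'' (T + T')) :
    Yields (.seq P P') m Q := by
  obtain ⟨m', T, hr, m'', T', hr', hq⟩ := h
  exact ⟨m'', T + T', Run.seq _ _ _ _ _ _ _ hr hr', hq⟩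

theorem yields_branch {b : Test} {P P' : Prog} {m : Mem} {Q : Mem → ℕ → Prop}
    (h : b.holds m → Yields P m fun m' T => Q m' (b.steps + T + 1))
    (h' : ¬ b.holds m → Yields P' m fun m' T => Q m' (b.steps + T + 1)) :
    Yields (.branch b P P') m Q := by
  by_cases hb : b.holds m
  · obtain ⟨m', T, hr, hq⟩ := h hb
    exact ⟨m', _, Run.branch_true _ _ _ _ _ _ hb hr, hq⟩
  · obtain ⟨m', T, hr, hq⟩ := h' hb
    exact ⟨m', _, Run.branch_false _ _ _ _ _ _ hb hr, hq⟩

/-- A program without loops. -/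
def Prog.loopFree : Prog → Bool
  | .seq P Q => P.loopFree && Q.loopFree
  | .branch _ P Q => P.loopFree && Q.loopFree
  | .loop _ _ => false
  | _ => true

/-- A bound for the number of steps of a program without loops. -/
def Prog.maxSteps : Prog → ℕ
  | .skip => 1
  | .setIdx _ i j e => i.steps + j.steps + e.steps + 1
  | .setNum _ i j e => i.steps + j.steps + e.steps + 1
  | .seq P Q => P.maxSteps + Q.maxSteps
  | .branch b P Q => b.steps + max P.maxSteps Q.maxSteps + 1
  | .loop _ _ => 0

open scoped Classical in
/-- The effect of a program without loops. -/
noncomputable def Prog.exec : Prog → Mem → Mem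
  | .skip, m => m
  | .setIdx a i j e, m => m.writeIdx a (i.eval m) (j.eval m) (e.eval m)
  | .setNum a i j e, m => m.writeNum a (i.eval m) (j.eval m) (e.eval m)
  | .seq P Q, m => Q.exec (P.exec m)
  | .branch b P Q, m => if b.holds m then P.exec m else Q.exec m
  | .loop _ _, m => m

attribute [simp] Prog.exec

/-- Code without loops has a functional meaning and a time bound that can be computed from its
syntax; its verification then needs no program logic. -/
theorem run_exec {P : Prog} (h : P.loopFree = true) (m : Mem) :
    ∃ T ≤ P.maxSteps, Run P m (P.exec m) T := by
  induction P generalizing m with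
  | skip => exact ⟨1, le_rfl, Run.skip m⟩
  | setIdx a i j e => exact ⟨_, le_rfl, Run.setIdx a i j e m⟩
  | setNum a i j e => exact ⟨_, le_rfl, Run.setNum a i j e m⟩
  | seq P Q ihP ihQ =>
    simp only [Prog.loopFree, Bool.and_eq_true] at h
    obtain ⟨T, hT, hr⟩ := ihP h.1 m
    obtain ⟨T', hT', hr'⟩ := ihQ h.2 (P.exec m)
    exact ⟨T + T', add_le_add hT hT', Run.seq _ _ _ _ _ _ _ hr hr'⟩
  | branch b P Q ihP ihQ =>
    simp only [Prog.loopFree, Bool.and_eq_true] at h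
    by_cases hb : b.holds m
    · obtain ⟨T, hT, hr⟩ := ihP h.1 m
      refine ⟨b.steps + T + 1, ?_, ?_⟩
      · have := le_max_left P.maxSteps Q.maxSteps
        rw [Prog.maxSteps]; omega
      · rw [Prog.exec, if_pos hb]
        exact Run.branch_true _ _ _ _ _ _ hb hr
    · obtain ⟨T, hT, hr⟩ := ihQ h.2 m
      refine ⟨b.steps + T + 1, ?_, ?_⟩
      · have := le_max_right P.maxSteps Q.maxSteps
        rw [Prog.maxSteps]; omega
      · rw [Prog.exec, if_neg hb]
        exact Run.branch_false _ _ _ _ _ _ hb hr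
  | loop => simp [Prog.loopFree] at h

theorem yields_exec {P : Prog} {m : Mem} {Q : Mem → ℕ → Prop} (h : P.loopFree = true)
    (hQ : ∀ T ≤ P.maxSteps, Q (P.exec m) T) : Yields P m Q := by
  obtain ⟨T, hT, hr⟩ := run_exec h m
  exact ⟨_, T, hr, hQ T hT⟩

/-- The rule for loops. The invariant bounds the elapsed time, so that the loop terminates. -/
theorem yields_loop {b : Test} {P : Prog} {m : Mem} {Q : Mem → ℕ → Prop} (B : ℕ)
    (Inv : Mem → ℕ → Prop) (hB : ∀ m' T, Inv m' T → T ≤ B) (init : Inv m 0)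
    (step : ∀ m' T, SameExcept P.idxWrites P.numWrites m m' → Inv m' T → b.holds m' →
      Yields P m' fun m'' T' => Inv m'' (T + T' + b.steps + 1))
    (final : ∀ m' T, SameExcept P.idxWrites P.numWrites m m' → Inv m' T → ¬ b.holds m' →
      Q m' (T + b.steps + 1)) :
    Yields (.loop b P) m Q := by
  -- F is fuel. Every iteration takes at least one step and the invariant caps the clock at B, so B
  -- + 1 units suffice.
  suffices H : ∀ F : ℕ, ∀ m' T, SameExcept P.idxWrites P.numWrites m m' → Inv m' T → B + 1 ≤ T + F →
      Yields (.loop b P) m' fun m'' T' => Q m'' (T + T') by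
    have := H (B + 1) m 0 (SameExcept.refl _ _ _) init (by omega)
    simpa using this
  intro F
  induction F with
  | zero => intro m' T _ h1 h2; have := hB m' T h1; omega
  | succ F ih =>
    intro m' T hs h1 h2
    by_cases hb : b.holds m'
    · obtain ⟨m2, T2, hr, hI⟩ := step m' T hs h1 hb
      obtain ⟨m3, T3, hr3, hq⟩ := ih m2 _ (hs.trans hr.sameExcept) hI (by omega)
      refine ⟨m3, _, Run.loop_true _ _ _ _ _ _ _ hb hr hr3, ?_⟩
      convert hq using 1
      ring
    · exact ⟨m', _, Run.loop_false _ _ _ hb, final m' T hs h1 hb⟩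

/-- The scalar variable that is stored in the first cell of the array `k`. -/
abbrev sc (k : ℕ) : IExp := .cell k (.lit 0) (.lit 0)

/-- The real scalar variable that is stored in the first cell of the array `k`. -/
abbrev rsc (k : ℕ) : NExp := .cell k (.lit 0) (.lit 0)

/-- Assignment to a scalar variable. -/
abbrev setSc (k : ℕ) (e : IExp) : Prog := .setIdx k (.lit 0) (.lit 0) e

/-- Assignment to a real scalar variable. -/
abbrev setRsc (k : ℕ) (e : NExp) : Prog := .setNum k (.lit 0) (.lit 0) e

/-- The test for equality of natural numbers. -/
abbrev eqI (e f : IExp) : Test := .conj (.neg (.ltIdx e f)) (.neg (.ltIdx f e))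

theorem eqI_holds {e f : IExp} {m : Mem} : (eqI e f).holds m ↔ e.eval m = f.eval m := by
  simp only [Test.holds]; omega

/-- The loop `for i = 0, …, n - 1 do P`, where `n` is the number of nodes. -/
def forP (i : ℕ) (P : Prog) : Prog :=
  .seq (setSc i (.lit 0)) (.loop (.ltIdx (sc i) (sc 0)) (.seq P (setSc i (.add (sc i) (.lit 1)))))

/-- The exact clock: 4 steps to clear the counter, 16 per iteration for the test and the increment,
8 for the failing test. The hypothesis `hcongr` says that the invariant ignores the counter. -/
theorem yields_for_clock {i : ℕ} {P : Prog} {m : Mem} {n : ℕ} (Inv : ℕ → Mem → ℕ → Prop)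
    (hn : m.idx 0 0 0 = n) (h0 : 0 ∉ i :: P.idxWrites) (hi : i ∉ P.idxWrites)
    (hcongr : ∀ k m m' T, (∀ a, a ≠ i → m'.idx a = m.idx a) → m'.num = m.num →
      Inv k m T → Inv k m' T)
    (init : Inv 0 m 4)
    (step : ∀ k < n, ∀ m' T, SameExcept (i :: P.idxWrites) P.numWrites m m' → m'.idx i 0 0 = k →
      m'.idx 0 0 0 = n → Inv k m' T → Yields P m' fun m'' T' => Inv (k + 1) m'' (T + T' + 16)) :
    Yields (forP i P) m fun m' T => ∃ T', T = T' + 8 ∧ Inv n m' T' := by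
  have hi0 : 0 ≠ i := fun h => h0 (by simp [h])
  have h0' : 0 ∉ P.idxWrites := fun h => h0 (by simp [h])
  suffices H : ∀ F k, k + F = n → ∀ m' T, SameExcept (i :: P.idxWrites) P.numWrites m m' →
      m'.idx i 0 0 = k → Inv k m' T →
      Yields (.loop (.ltIdx (sc i) (sc 0)) (.seq P (setSc i (.add (sc i) (.lit 1))))) m'
        fun m'' T' => ∃ T'', T + T' = T'' + 8 ∧ Inv n m'' T'' by
    obtain ⟨m', T', hr', hI⟩ := H n 0 (by omega) (m.writeIdx i 0 0 0) 4 ⟨fun a ha => by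
      have : a ≠ i := fun h => ha (by simp [h])
      funext i' j'; simp [this], fun a _ => rfl⟩ (by simp)
      (hcongr 0 m _ 4 (fun a ha => by funext i' j'; simp [ha]) rfl init)
    exact ⟨m', 4 + T', Run.seq _ _ _ _ _ _ _ (Run.setIdx i (.lit 0) (.lit 0) (.lit 0) m) hr', hI⟩
  intro F
  induction F with
  | zero =>
    intro k hk m' T hs hik hI
    have hkn : k = n := by omega
    subst hkn
    have h0m : m'.idx 0 0 0 = k := by rw [hs.1 0 h0, hn]
    exact ⟨m', 8, Run.loop_false _ _ _ (by simp [hik, h0m]), T, rfl, hI⟩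
  | succ F ih =>
    intro k hk m' T hs hik hI
    have h0m : m'.idx 0 0 0 = n := by rw [hs.1 0 h0, hn]
    obtain ⟨m2, T2, hr2, hI2⟩ := step k (by omega) m' T hs hik h0m hI
    have hik2 : m2.idx i 0 0 = k := by rw [hr2.sameExcept.1 i hi, hik]
    have hw : ∀ a, a ≠ i → (m2.writeIdx i 0 0 (k + 1)).idx a = m2.idx a := fun a ha => by
      funext i' j'; simp [ha]
    obtain ⟨m3, T3, hr3, T4, hT4, hI3⟩ := ih (k + 1) (by omega) (m2.writeIdx i 0 0 (k + 1))
      (T + T2 + 16) ((hs.trans (hr2.sameExcept.mono (by simp +contextual) (by simp))).trans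
        ⟨fun a ha => hw a fun h => ha (by simp [h]), fun a _ => rfl⟩) (by simp)
      (hcongr _ m2 _ _ hw rfl hI2)
    have hset := Run.setIdx i (.lit 0) (.lit 0) (.add (sc i) (.lit 1)) m2
    simp only [IExp.eval, hik2] at hset
    refine ⟨m3, _, Run.loop_true _ _ _ _ _ _ _ (by simp [hik, h0m]; omega)
      (Run.seq _ _ _ _ _ _ _ hr2 hset) hr3, T4, ?_, hI3⟩
    rw [← hT4]
    simp
    ring

theorem yields_for {i : ℕ} {P : Prog} {m : Mem} {n c d : ℕ} {Q : Mem → ℕ → Prop}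
    (Inv : ℕ → Mem → Prop)
    (hn : m.idx 0 0 0 = n) (h1 : 1 ≤ n) (h0 : 0 ∉ i :: P.idxWrites) (hi : i ∉ P.idxWrites)
    (hcongr : ∀ k m m', (∀ a, a ≠ i → m'.idx a = m.idx a) → m'.num = m.num →
      Inv k m → Inv k m')
    (init : Inv 0 m)
    (step : ∀ k < n, ∀ m', SameExcept (i :: P.idxWrites) P.numWrites m m' → m'.idx i 0 0 = k →
      m'.idx 0 0 0 = n → Inv k m' → Yields P m' fun m'' T => T ≤ c * n ^ d ∧ Inv (k + 1) m'')
    (final : ∀ m' T, SameExcept (forP i P).idxWrites (forP i P).numWrites m m' →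
      T ≤ (c + 28) * n ^ (d + 1) → Inv n m' → Q m' T) :
    Yields (forP i P) m Q := by
  refine (yields_for_clock (n := n) (fun k m T => T ≤ k * (c * n ^ d + 16) + 4 ∧ Inv k m) hn h0 hi
    ?_ ?_ ?_).frame.mono ?_
  · rintro k m m' T ha hn ⟨hT, hI⟩
    exact ⟨hT, hcongr k m m' ha hn hI⟩
  · exact ⟨by simp, init⟩
  · rintro k hk m' T hs hik h0 ⟨hT, hI⟩
    refine (step k hk m' hs hik h0 hI).mono ?_
    rintro m'' T' ⟨hT', hI'⟩
    refine ⟨?_, hI'⟩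
    rw [Nat.add_mul]
    omega
  · rintro m' T ⟨⟨T', rfl, hT, hI⟩, hs⟩
    refine final m' _ hs ?_ hI
    -- The total is at most n(c·nᵈ + 16) + 4 + 8, and 16n + 12 ≤ 28n as n ≥ 1.
    have hp : n ≤ n ^ (d + 1) := Nat.le_self_pow (by omega) n
    have : n * (c * n ^ d + 16) = c * n ^ (d + 1) + 16 * n := by ring
    rw [Nat.add_mul]
    omega

/-- The invariant depends on the set of processed nodes instead of the counter, and its clock counts
only the body. This allows amortized bounds and makes nested loops look like one loop over pairs or
triples. -/
theorem yields_forFin {i : ℕ} {P : Prog} {m : Mem} {n : ℕ} {Q : Mem → ℕ → Prop}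
    (Inv : Set (Fin n) → Mem → ℕ → Prop)
    (hn : m.idx 0 0 0 = n) (h1 : 1 ≤ n) (h0 : 0 ∉ i :: P.idxWrites) (hi : i ∉ P.idxWrites)
    (hcongr : ∀ S m m' T, (∀ a, a ≠ i → m'.idx a = m.idx a) → m'.num = m.num →
      Inv S m T → Inv S m' T)
    (init : Inv ∅ m 0)
    (step : ∀ (k : Fin n) (S : Set (Fin n)), k ∉ S → ∀ m' T,
      SameExcept (i :: P.idxWrites) P.numWrites m m' → m'.idx i 0 0 = k →
      m'.idx 0 0 0 = n → Inv S m' T → Yields P m' fun m'' T' => Inv (insert k S) m'' (T + T'))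
    (final : ∀ m' T T', SameExcept (forP i P).idxWrites (forP i P).numWrites m m' →
      T ≤ T' + 28 * n → Inv Set.univ m' T' → Q m' T) :
    Yields (forP i P) m Q := by
  refine (yields_for_clock (n := n) (fun k m T => ∃ T', T = T' + 16 * k + 4 ∧
    Inv {u : Fin n | u.1 < k} m T') hn h0 hi ?_ ?_ ?_).frame.mono ?_
  · rintro k m m' T ha hn ⟨T', hT, hI⟩
    exact ⟨T', hT, hcongr _ m m' _ ha hn hI⟩
  · exact ⟨0, by simp, by simpa using init⟩
  · rintro k hk m' T hs hik h0 ⟨T0, hT, hI⟩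
    refine (step ⟨k, hk⟩ _ (by simp) m' T0 hs hik h0 hI).mono ?_
    intro m'' T' hI'
    refine ⟨T0 + T', by omega, ?_⟩
    convert hI' using 1
    ext u
    simp only [Set.mem_ofPred_eq, Set.mem_insert_iff, Fin.ext_iff]
    omega
  · rintro m' T ⟨⟨T', rfl, T0, hT, hI⟩, hs⟩
    refine final m' _ T0 hs (by omega) ?_
    convert hI
    ext u
    simp

theorem yields_forFin₂ {i j : ℕ} {P : Prog} {m : Mem} {n : ℕ} {Q : Mem → ℕ → Prop}
    (Inv : Set (Fin n × Fin n) → Mem → ℕ → Prop)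
    (hn : m.idx 0 0 0 = n) (h1 : 1 ≤ n) (h0 : 0 ∉ i :: j :: P.idxWrites)
    (hi : i ∉ j :: P.idxWrites) (hj : j ∉ P.idxWrites)
    (hcongr : ∀ S m m' T, (∀ a, a ≠ i → a ≠ j → m'.idx a = m.idx a) → m'.num = m.num →
      Inv S m T → Inv S m' T)
    (init : Inv ∅ m 0)
    (step : ∀ (u v : Fin n) (S : Set (Fin n × Fin n)), (u, v) ∉ S → ∀ m' T,
      SameExcept (i :: j :: P.idxWrites) P.numWrites m m' → m'.idx i 0 0 = u → m'.idx j 0 0 = v →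
      m'.idx 0 0 0 = n → Inv S m' T → Yields P m' fun m'' T' => Inv (insert (u, v) S) m'' (T + T'))
    (final : ∀ m' T T', SameExcept (forP i (forP j P)).idxWrites (forP i (forP j P)).numWrites m m' →
      T ≤ T' + 56 * n ^ 2 → Inv Set.univ m' T' → Q m' T) :
    Yields (forP i (forP j P)) m Q := by
  have hsub : ∀ a ∈ i :: (forP j P).idxWrites, a ∈ i :: j :: P.idxWrites := by
    simp [forP, Prog.idxWrites]; tauto
  have hsubN : ∀ a ∈ (forP j P).numWrites, a ∈ P.numWrites := by
    simp [forP, Prog.numWrites]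
  refine yields_forFin (n := n) (fun S m T => ∃ T', T ≤ T' + (28 * n) * S.ncard ∧
    Inv (Prod.fst ⁻¹' S) m T') hn h1 (fun h => h0 (hsub 0 h)) (fun h => hi ?_) ?_ ?_ ?_ ?_
  · simp [forP, Prog.idxWrites] at h ⊢; tauto
  · rintro S m m' T ha hn ⟨T', hT, hI⟩
    exact ⟨T', hT, hcongr _ m m' _ (fun a h _ => ha a h) hn hI⟩
  · exact ⟨0, by simp, by simpa using init⟩
  · rintro u S huS m1 T hs1 hu1 h01 ⟨T1, hT1, hI1⟩
    have hs1' := hs1.mono hsub hsubN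
    refine yields_forFin (n := n) (fun S' m T' => Inv (Prod.fst ⁻¹' S ∪ {q | q.1 = u ∧ q.2 ∈ S'}) m
      (T1 + T')) h01 h1 (fun h => h0 (List.mem_cons_of_mem _ h)) hj ?_ ?_ ?_ ?_
    · rintro S m m' T ha hn hI
      exact hcongr _ m m' _ (fun a _ h => ha a h) hn hI
    · simpa using hI1
    · intro v S' hvS' m2 T2 hs2 hv2 h02 hI2
      have hu2 : m2.idx i 0 0 = u := by rw [hs2.1 i hi, hu1]
      refine (step u v _ ?_ m2 _ (hs1'.trans (hs2.mono (fun a h => List.mem_cons_of_mem _ h)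
        fun a h => h)) hu2 hv2 h02 hI2).mono ?_
      · simp [huS, hvS']
      · intro m3 T3 hI3
        rw [← add_assoc]
        convert hI3 using 1
        ext q
        obtain ⟨a, b⟩ := q
        simp only [Set.mem_union, Set.mem_preimage, Set.mem_ofPred_eq, Set.mem_insert_iff,
          Prod.mk.injEq]
        tauto
    · intro m3 T3 T3' _ hT3 hI3
      refine ⟨T1 + T3', ?_, ?_⟩
      · rw [Set.ncard_insert_of_notMem huS, mul_add]
        omega
      · convert hI3 using 1
        ext q
        simp [or_comm]
  · rintro m' T T' hs hT ⟨T0, hT0, hI⟩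
    refine final m' T T0 hs ?_ hI
    rw [Set.ncard_univ, Nat.card_eq_fintype_card, Fintype.card_fin] at hT0
    nlinarith

/-- The overhead is 56n² for each of the n double loops, plus 28n for the outer one. -/
theorem yields_forFin₃ {i j l : ℕ} {P : Prog} {m : Mem} {n : ℕ} {Q : Mem → ℕ → Prop}
    (Inv : Set (Fin n × Fin n × Fin n) → Mem → ℕ → Prop)
    (hn : m.idx 0 0 0 = n) (h1 : 1 ≤ n) (h0 : 0 ∉ i :: j :: l :: P.idxWrites)
    (hi : i ∉ j :: l :: P.idxWrites) (hj : j ∉ l :: P.idxWrites) (hl : l ∉ P.idxWrites)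
    (hcongr : ∀ S m m' T, (∀ a, a ≠ i → a ≠ j → a ≠ l → m'.idx a = m.idx a) → m'.num = m.num →
      Inv S m T → Inv S m' T)
    (init : Inv ∅ m 0)
    (step : ∀ (u v w : Fin n) (S : Set (Fin n × Fin n × Fin n)), (u, v, w) ∉ S → ∀ m' T,
      SameExcept (i :: j :: l :: P.idxWrites) P.numWrites m m' → m'.idx i 0 0 = u →
      m'.idx j 0 0 = v → m'.idx l 0 0 = w → m'.idx 0 0 0 = n → Inv S m' T →
      Yields P m' fun m'' T' => Inv (insert (u, v, w) S) m'' (T + T'))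
    (final : ∀ m' T T', SameExcept (forP i (forP j (forP l P))).idxWrites
      (forP i (forP j (forP l P))).numWrites m m' →
      T ≤ T' + 84 * n ^ 3 → Inv Set.univ m' T' → Q m' T) :
    Yields (forP i (forP j (forP l P))) m Q := by
  have hsub : ∀ a ∈ i :: (forP j (forP l P)).idxWrites, a ∈ i :: j :: l :: P.idxWrites := by
    simp [forP, Prog.idxWrites]; tauto
  have hsubN : ∀ a ∈ (forP j (forP l P)).numWrites, a ∈ P.numWrites := by
    simp [forP, Prog.numWrites]
  refine yields_forFin (n := n) (fun S m T => ∃ T', T ≤ T' + (56 * n ^ 2) * S.ncard ∧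
    Inv (Prod.fst ⁻¹' S) m T') hn h1 (fun h => h0 (hsub 0 h)) (fun h => hi ?_) ?_ ?_ ?_ ?_
  · simp [forP, Prog.idxWrites] at h ⊢; tauto
  · rintro S m m' T ha hn ⟨T', hT, hI⟩
    exact ⟨T', hT, hcongr _ m m' _ (fun a h _ _ => ha a h) hn hI⟩
  · exact ⟨0, by simp, by simpa using init⟩
  · rintro u S huS m1 T hs1 hu1 h01 ⟨T1, hT1, hI1⟩
    have hs1' := hs1.mono hsub hsubN
    refine yields_forFin₂ (n := n) (fun S' m T' => Inv (Prod.fst ⁻¹' S ∪ {q | q.1 = u ∧ q.2 ∈ S'}) m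
      (T1 + T')) h01 h1 (fun h => h0 (List.mem_cons_of_mem _ h)) hj hl ?_ ?_ ?_ ?_
    · rintro S m m' T ha hn hI
      exact hcongr _ m m' _ (fun a _ h h' => ha a h h') hn hI
    · simpa using hI1
    · intro v w S' hvS' m2 T2 hs2 hv2 hw2 h02 hI2
      have hu2 : m2.idx i 0 0 = u := by rw [hs2.1 i hi, hu1]
      refine (step u v w _ ?_ m2 _ (hs1'.trans (hs2.mono (fun a h => List.mem_cons_of_mem _ h)
        fun a h => h)) hu2 hv2 hw2 h02 hI2).mono ?_
      · simp [huS, hvS']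
      · intro m3 T3 hI3
        rw [← add_assoc]
        convert hI3 using 1
        ext q
        obtain ⟨a, b⟩ := q
        simp only [Set.mem_union, Set.mem_preimage, Set.mem_ofPred_eq, Set.mem_insert_iff,
          Prod.mk.injEq]
        tauto
    · intro m3 T3 T3' _ hT3 hI3
      refine ⟨T1 + T3', ?_, ?_⟩
      · rw [Set.ncard_insert_of_notMem huS, mul_add]
        omega
      · convert hI3 using 1
        ext q
        simp [or_comm]
  · rintro m' T T' hs hT ⟨T0, hT0, hI⟩
    refine final m' T T0 hs ?_ hI
    rw [Set.ncard_univ, Nat.card_eq_fintype_card, Fintype.card_fin] at hT0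
    have h2 : n ≤ n ^ 3 := Nat.le_self_pow (by norm_num) n
    have h3 : 56 * n ^ 2 * n = 56 * n ^ 3 := by ring
    omega

/-- The rule for two nested loops around a body without loops. -/
theorem yields_table {i j : ℕ} {P : Prog} {m : Mem} {n c : ℕ} {Q : Mem → ℕ → Prop}
    (Inv : Set (Fin n × Fin n) → Mem → Prop)
    (hn : m.idx 0 0 0 = n) (h1 : 1 ≤ n) (h0 : 0 ∉ i :: j :: P.idxWrites)
    (hi : i ∉ j :: P.idxWrites) (hj : j ∉ P.idxWrites) (hP : P.loopFree = true)
    (hc : P.maxSteps ≤ c)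
    (hcongr : ∀ S m m', (∀ a, a ≠ i → a ≠ j → m'.idx a = m.idx a) → m'.num = m.num →
      Inv S m → Inv S m')
    (init : Inv ∅ m)
    (step : ∀ (u v : Fin n) (S : Set (Fin n × Fin n)), (u, v) ∉ S → ∀ m',
      SameExcept (i :: j :: P.idxWrites) P.numWrites m m' → m'.idx i 0 0 = u → m'.idx j 0 0 = v →
      m'.idx 0 0 0 = n → Inv S m' → Inv (insert (u, v) S) (P.exec m'))
    (final : ∀ m' T, SameExcept (forP i (forP j P)).idxWrites (forP i (forP j P)).numWrites m m' →
      T ≤ (c + 56) * n ^ 2 → Inv Set.univ m' → Q m' T) :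
    Yields (forP i (forP j P)) m Q := by
  refine yields_forFin₂ (n := n) (fun S m T => T ≤ c * S.ncard ∧ Inv S m) hn h1 h0 hi hj ?_ ?_ ?_ ?_
  · rintro S m m' T ha hn ⟨hT, hI⟩
    exact ⟨hT, hcongr S m m' ha hn hI⟩
  · exact ⟨by simp, init⟩
  · rintro u v S huv m' T hs hu hv h0 ⟨hT, hI⟩
    refine yields_exec hP fun T' hT' => ⟨?_, step u v S huv m' hs hu hv h0 hI⟩
    rw [Set.ncard_insert_of_notMem huv, mul_add]
    omega
  · rintro m' T T' hs hT ⟨hT', hI⟩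
    refine final m' T hs ?_ hI
    rw [Set.ncard_univ, Nat.card_eq_fintype_card, Fintype.card_prod, Fintype.card_fin] at hT'
    rw [add_mul, sq] at *
    omega

theorem yields_branch_skip {b : Test} {P : Prog} {m : Mem} {Q : Mem → ℕ → Prop}
    (h : b.holds m → Yields P m fun m' T => Q m' (b.steps + T + 1))
    (h' : ¬ b.holds m → Q m (b.steps + 2)) : Yields (.branch b P .skip) m Q :=
  yields_branch h fun hb => ⟨m, 1, Run.skip m, h' hb⟩

end RealRAM


/-! ## Multiplicative weights for covering programs with three variables per constraint -/

/-- A covering program: minimize `∑ w p * x p` over `x ≥ 0` that vanish on `zero` and satisfy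
`x p + x q + x r ≥ 1` for `(p, q, r) ∈ con`. -/
structure CoverProgram (ι : Type*) where
  w : ι → ℝ
  zero : Set ι
  con : Set (ι × ι × ι)

namespace CoverProgram

variable {ι : Type*} [Fintype ι]

/-- The feasible points. -/
structure Feasible (S : CoverProgram ι) (x : ι → ℝ) : Prop where
  nonneg : ∀ p, 0 ≤ x p
  zero : ∀ p ∈ S.zero, x p = 0
  cover : ∀ p q r, (p, q, r) ∈ S.con → 1 ≤ x p + x q + x r

/-- The objective. -/
def cost (S : CoverProgram ι) (x : ι → ℝ) : ℝ := ∑ p, S.w p * x p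

/-- The variables that may be set to `1` at no cost. -/
def Loose (S : CoverProgram ι) (p : ι) : Prop := p ∉ S.zero ∧ S.w p = 0

/-- The variables that are neither fixed nor without cost. -/
def Free (S : CoverProgram ι) (p : ι) : Prop := p ∉ S.zero ∧ 1 ≤ S.w p

open scoped Classical in
/-- The step sizes. -/
noncomputable def rate (S : CoverProgram ι) (p : ι) : ℝ := if p ∈ S.zero then 0 else 1 / S.w p

open scoped Classical in
/-- The initial lengths. -/
noncomputable def init (S : CoverProgram ι) (big : ℝ) (p : ι) : ℝ :=
  if p ∈ S.zero then 0 else if S.w p = 0 then big else 1 / S.w p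

/-- Standing assumptions: integral weights with total at most `M`, and constraints with distinct
variables unless they are satisfied at no cost. -/
structure Regular (S : CoverProgram ι) (M : ℝ) : Prop where
  weight : ∀ p, S.w p = 0 ∨ 1 ≤ S.w p
  total : ∑ p, S.w p ≤ M
  distinct : ∀ p q r, (p, q, r) ∈ S.con →
    (p ≠ q ∧ q ≠ r ∧ p ≠ r) ∨ S.Loose p ∨ S.Loose q ∨ S.Loose r

/-- The invariant for the lengths. -/
structure Lengths (S : CoverProgram ι) (big : ℝ) (L : ι → ℝ) : Prop where
  zero : ∀ p ∈ S.zero, L p = 0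
  loose : ∀ p, S.Loose p → L p = big
  free : ∀ p, S.Free p → 1 ≤ S.w p * L p ∧ L p ≤ 2 * big

variable {S : CoverProgram ι} {M η big α b : ℝ} {L : ι → ℝ}

theorem Regular.cases (hS : S.Regular M) (p : ι) : p ∈ S.zero ∨ S.Loose p ∨ S.Free p := by
  by_cases h : p ∈ S.zero
  · exact Or.inl h
  · rcases hS.weight p with h' | h'
    · exact Or.inr (Or.inl ⟨h, h'⟩)
    · exact Or.inr (Or.inr ⟨h, h'⟩)

theorem Regular.w_nonneg (hS : S.Regular M) (p : ι) : 0 ≤ S.w p := by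
  rcases hS.weight p with h | h <;> linarith

theorem Regular.w_le (hS : S.Regular M) (p : ι) : S.w p ≤ M :=
  (Finset.single_le_sum (f := S.w) (fun q _ => hS.w_nonneg q) (Finset.mem_univ p)).trans hS.total

theorem Lengths.nonneg (hS : S.Regular M) (hbig : 0 ≤ big) (hL : S.Lengths big L) (p : ι) :
    0 ≤ L p := by
  rcases hS.cases p with h | h | h
  · rw [hL.zero p h]
  · rw [hL.loose p h]; exact hbig
  · have h1 := (hL.free p h).1
    have h2 := h.2
    by_contra hneg
    have : S.w p * L p ≤ 0 := mul_nonpos_of_nonneg_of_nonpos (by linarith) (by linarith)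
    linarith

theorem Lengths.weight_mul_nonneg (hS : S.Regular M) (hbig : 0 ≤ big) (hL : S.Lengths big L)
    (p : ι) : 0 ≤ S.w p * L p := mul_nonneg (hS.w_nonneg p) (hL.nonneg hS hbig p)

theorem rate_nonneg (hS : S.Regular M) (p : ι) : 0 ≤ S.rate p := by
  rw [rate]
  split_ifs
  · exact le_rfl
  · exact one_div_nonneg.2 (hS.w_nonneg p)

theorem init_lengths {κ : Type*} {S : CoverProgram κ} (hbig : 1 ≤ big) : S.Lengths big (S.init big) := by
  refine ⟨fun p hp => by simp [init, hp], fun p hp => by simp [init, hp.1, hp.2], fun p hp => ?_⟩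
  have h2 := hp.2
  have hw : S.w p ≠ 0 := by linarith
  rw [init, if_neg hp.1, if_neg hw]
  refine ⟨by rw [mul_one_div_cancel hw], ?_⟩
  rw [div_le_iff₀ (by linarith)]
  nlinarith

/-- The potential that bounds the number of updates, in units of `log (1 + η)`. -/
noncomputable def potential (S : CoverProgram ι) (L : ι → ℝ) : ℝ := ∑ p, Real.log (S.w p * L p)

/-- The invariant of the method: `b` is the cost of the best solution so far. -/
def Progress (S : CoverProgram ι) (η big b : ℝ) (L : ι → ℝ) : Prop :=
  0 ≤ b ∧ ∀ x, S.Feasible x →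
    b * (Real.log (S.cost L) - Real.log (S.cost (S.init big))) * Real.log (1 + η) ≤
      η * (1 + η) * ∑ p, S.w p * x p * Real.log (S.w p * L p)

/-- When a cheaper solution is found, b decreases; the invariant survives because its factor, the
growth of the logarithm of the total length, is nonnegative. -/
theorem Progress.mono {b' : ℝ} (h : S.Progress η big b L) (hη : 0 < η) (hb : 0 ≤ b') (hbb : b' ≤ b)
    (hle : Real.log (S.cost (S.init big)) ≤ Real.log (S.cost L)) : S.Progress η big b' L := by
  refine ⟨hb, fun x hx => le_trans ?_ (h.2 x hx)⟩
  have h1 : 0 ≤ Real.log (1 + η) := Real.log_nonneg (by linarith)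
  gcongr

/-- The update of the lengths on a violated constraint. -/
noncomputable def update [DecidableEq ι] (S : CoverProgram ι) (η : ℝ) (L : ι → ℝ) (p q r : ι) :
    ι → ℝ := fun t =>
  if t = p ∨ t = q ∨ t = r then
    L t * (1 + η * S.rate t / max (S.rate p) (max (S.rate q) (S.rate r)))
  else L t

/-- Bernoulli's inequality for the exponent σ ≤ 1: (1 + η)^σ ≤ 1 + ησ. -/
theorem log_one_add_mul_ge {η σ : ℝ} (hη : 0 < η) (h0 : 0 ≤ σ) (h1 : σ ≤ 1) :
    σ * Real.log (1 + η) ≤ Real.log (1 + η * σ) := by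
  rw [← Real.log_rpow (by linarith)]
  refine Real.log_le_log (Real.rpow_pos_of_pos (by linarith) _) ?_
  have := rpow_one_add_le_one_add_mul_self (s := η) (p := σ) (by linarith) h0 h1
  linarith

/-- Let s be the largest rate of the constraint, so 1/s is its smallest positive weight. The update
raises the total D by (η/s)(L_p + L_q + L_r) < (η/s)(1 + η)α. As bα ≤ D, the product b·log D rises
by at most η(1 + η)/s. On the other side, ∑ w x log(wL) rises by at least log(1 + η)/s, because x
covers the constraint. The two increments balance in the invariant. -/
theorem update_spec [DecidableEq ι] (hS : S.Regular M) (hfeas : ∃ x, S.Feasible x) (hη : 0 < η)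
    (hη1 : η ≤ 1) (hα : 0 < α) (hαbig : (1 + η) * α ≤ big) (hL : S.Lengths big L)
    (hP : S.Progress η big b L) (hb : b * α ≤ S.cost L) {p q r : ι} (hcon : (p, q, r) ∈ S.con)
    (hviol : L p + L q + L r < (1 + η) * α) :
    S.Lengths big (S.update η L p q r) ∧ S.Progress η big b (S.update η L p q r) ∧
      S.cost L ≤ S.cost (S.update η L p q r) ∧
      S.potential L + Real.log (1 + η) ≤ S.potential (S.update η L p q r) ∧
      p ≠ q ∧ q ≠ r ∧ p ≠ r ∧ 0 < S.cost L := by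
  have hbig : 0 < big := lt_of_lt_of_le (by positivity) hαbig
  have hn := hL.nonneg hS hbig.le
  -- A loose variable has length big, which alone would satisfy the constraint. Hence the three
  -- variables are distinct.
  have hlp : ¬ S.Loose p := fun h => by
    have := hL.loose p h; have := hn q; have := hn r; linarith
  have hlq : ¬ S.Loose q := fun h => by
    have := hL.loose q h; have := hn p; have := hn r; linarith
  have hlr : ¬ S.Loose r := fun h => by
    have := hL.loose r h; have := hn p; have := hn q; linarith
  obtain ⟨hpq, hqr, hpr⟩ : p ≠ q ∧ q ≠ r ∧ p ≠ r := by
    rcases hS.distinct p q r hcon with h | h | h | h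
    · exact h
    · exact (hlp h).elim
    · exact (hlq h).elim
    · exact (hlr h).elim
  set s := max (S.rate p) (max (S.rate q) (S.rate r)) with hs
  set T : Finset ι := {p, q, r} with hT
  have hmemT : ∀ t, t ∈ T ↔ t = p ∨ t = q ∨ t = r := by intro t; simp [hT]
  have hnl : ∀ t ∈ T, ¬ S.Loose t := by
    intro t ht
    rcases (hmemT t).1 ht with rfl | rfl | rfl <;> assumption
  have hrs : ∀ t ∈ T, S.rate t ≤ s := by
    intro t ht
    rcases (hmemT t).1 ht with rfl | rfl | rfl <;> simp [hs]
  have hsum : ∀ f : ι → ℝ, ∑ t ∈ T, f t = f p + f q + f r := by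
    intro f
    rw [hT, Finset.sum_insert (by simp [hpq, hpr]), Finset.sum_insert (by simp [hqr]),
      Finset.sum_singleton]
    ring
  -- some variable of the constraint is free
  obtain ⟨f, hfT, hf⟩ : ∃ f ∈ T, S.Free f := by
    by_contra hno
    push Not at hno
    obtain ⟨x, hx⟩ := hfeas
    have hz : ∀ t ∈ T, x t = 0 := fun t ht => hx.zero t
      (((hS.cases t).resolve_right fun h => h.elim (hnl t ht) (hno t ht)))
    have := hx.cover p q r hcon
    rw [← hsum x, Finset.sum_eq_zero hz] at this
    linarith
  have hs0 : 0 < s := by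
    refine lt_of_lt_of_le ?_ (hrs f hfT)
    rw [rate, if_neg hf.1]
    have := hf.2
    positivity
  have hcost0 : 0 < S.cost L := by
    have h1 := Finset.single_le_sum (f := fun t => S.w t * L t)
      (fun t _ => hL.weight_mul_nonneg hS hbig.le t) (Finset.mem_univ f)
    have := (hL.free f hf).1
    exact lt_of_lt_of_le (by linarith) h1
  have hσ0 : ∀ t, 0 ≤ S.rate t / s := fun t => div_nonneg (rate_nonneg hS t) hs0.le
  have hσ1 : ∀ t ∈ T, S.rate t / s ≤ 1 := fun t ht => (div_le_one hs0).2 (hrs t ht)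
  have hupd : ∀ t ∈ T, S.update η L p q r t = L t * (1 + η * (S.rate t / s)) := by
    intro t ht
    rw [update, if_pos ((hmemT t).1 ht), mul_div_assoc]
  have hupd' : ∀ t, t ∉ T → S.update η L p q r t = L t := by
    intro t ht
    rw [update, if_neg (fun h => ht ((hmemT t).2 h))]
  have hdiff : ∀ F : ι → ℝ → ℝ, ∑ t, F t (S.update η L p q r t) =
      ∑ t, F t (L t) + ∑ t ∈ T, (F t (S.update η L p q r t) - F t (L t)) := by
    intro F
    rw [← sub_eq_iff_eq_add', ← Finset.sum_sub_distrib]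
    symm
    refine Finset.sum_subset (Finset.subset_univ _) fun t _ ht => ?_
    rw [hupd' t ht, sub_self]
  -- Rate and weight are inverse on T except at fixed variables; their rate 0 is harmless since
  -- lengths and feasible points vanish there.
  have hwr : ∀ t ∈ T, ∀ y : ℝ, (t ∈ S.zero → y = 0) → S.w t * S.rate t * y = y := by
    intro t ht y hy
    rcases hS.cases t with h | h | h
    · rw [hy h, mul_zero]
    · exact (hnl t ht h).elim
    · rw [rate, if_neg h.1, mul_one_div_cancel (by have := h.2; linarith), one_mul]
  -- At fixed variables both sides are 0, by log 0 = 0 and rate 0.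
  have hlog : ∀ t ∈ T, Real.log (S.w t * S.update η L p q r t) =
      Real.log (S.w t * L t) + Real.log (1 + η * (S.rate t / s)) := by
    intro t ht
    rw [hupd t ht, ← mul_assoc]
    rcases hS.cases t with h | h | h
    · simp [hL.zero t h, rate, h]
    · exact (hnl t ht h).elim
    · have h1 := (hL.free t h).1
      have h2 := hσ0 t
      rw [Real.log_mul (by linarith) (by positivity)]
  have hlogη : 0 < Real.log (1 + η) := Real.log_pos (by linarith)
  have hcost : S.cost (S.update η L p q r) = S.cost L + η / s * (L p + L q + L r) := by
    rw [cost, hdiff (fun t y => S.w t * y), cost, ← hsum, Finset.mul_sum]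
    congr 1
    refine Finset.sum_congr rfl fun t ht => ?_
    rw [hupd t ht]
    have := hwr t ht (L t) (hL.zero t)
    field_simp
    linear_combination η * this
  have hcostle : S.cost L ≤ S.cost (S.update η L p q r) := by
    rw [hcost]
    have := hn p; have := hn q; have := hn r
    have : 0 ≤ η / s * (L p + L q + L r) := by positivity
    linarith
  refine ⟨⟨?_, ?_, ?_⟩, ⟨hP.1, ?_⟩, hcostle, ?_, hpq, hqr, hpr, hcost0⟩
  · intro t ht
    by_cases h : t ∈ T
    · rw [hupd t h, hL.zero t ht, zero_mul]
    · rw [hupd' t h, hL.zero t ht]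
  · intro t ht
    rw [hupd' t (fun h => hnl t h ht), hL.loose t ht]
  · intro t ht
    by_cases h : t ∈ T
    · rw [hupd t h]
      have h1 := (hL.free t ht).1
      have h2 := hσ0 t
      have h3 := hσ1 t h
      -- A variable is raised only while its length is at most big, and by a factor of at most 2;
      -- hence the bound 2·big.
      have h4 : L t ≤ (1 + η) * α := by
        have := Finset.single_le_sum (f := L) (fun t _ => hn t) h
        rw [hsum] at this
        linarith
      have h5 := hn t
      refine ⟨?_, ?_⟩
      · rw [← mul_assoc]
        have : 0 ≤ η * (S.rate t / s) := by positivity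
        nlinarith
      · have : L t * (1 + η * (S.rate t / s)) ≤ L t * (1 + 1 * 1) := by gcongr
        linarith
    · rw [hupd' t h]; exact hL.free t ht
  · intro x hx
    have h1 := hP.2 x hx
    rw [hdiff (fun t y => S.w t * x t * Real.log (S.w t * y))]
    have h2 : Real.log (1 + η) / s ≤ ∑ t ∈ T, (S.w t * x t *
        Real.log (S.w t * S.update η L p q r t) - S.w t * x t * Real.log (S.w t * L t)) := by
      have h3 : Real.log (1 + η) / s ≤ ∑ t ∈ T, Real.log (1 + η) / s * x t := by
        rw [← Finset.mul_sum, hsum]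
        have := hx.cover p q r hcon
        have h4 : 0 ≤ Real.log (1 + η) / s := by positivity
        nlinarith
      refine h3.trans (Finset.sum_le_sum fun t ht => ?_)
      rw [hlog t ht, mul_add, add_sub_cancel_left]
      have h4 := log_one_add_mul_ge hη (hσ0 t) (hσ1 t ht)
      have h5 : 0 ≤ S.w t * x t := mul_nonneg (hS.w_nonneg t) (hx.nonneg t)
      have h6 := mul_le_mul_of_nonneg_left h4 h5
      refine le_trans (le_of_eq ?_) h6
      have := hwr t ht (x t) (hx.zero t)
      field_simp
      linear_combination -this
    have h3 : b * (Real.log (S.cost (S.update η L p q r)) - Real.log (S.cost L)) ≤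
        η * (1 + η) / s := by
      have h4 : Real.log (S.cost (S.update η L p q r)) - Real.log (S.cost L) ≤
          η / s * (L p + L q + L r) / S.cost L := by
        rw [← Real.log_div (by linarith) (by linarith)]
        refine (Real.log_le_sub_one_of_pos (div_pos (by linarith) hcost0)).trans (le_of_eq ?_)
        rw [hcost]
        field_simp
        ring
      calc _ ≤ b * (η / s * (L p + L q + L r) / S.cost L) := mul_le_mul_of_nonneg_left h4 hP.1
        _ ≤ b * (η / s * ((1 + η) * α) / S.cost L) := by
            have := hP.1
            gcongr
        _ = η * (1 + η) / s * (b * α / S.cost L) := by ring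
        _ ≤ η * (1 + η) / s * 1 := by
            gcongr
            exact (div_le_one hcost0).2 hb
        _ = _ := mul_one _
    have h4 := mul_le_mul_of_nonneg_right h3 hlogη.le
    have h5 := mul_le_mul_of_nonneg_left h2 (show 0 ≤ η * (1 + η) by positivity)
    have h6 : η * (1 + η) / s * Real.log (1 + η) = η * (1 + η) * (Real.log (1 + η) / s) := by ring
    linarith
  · rw [potential, potential, hdiff (fun t y => Real.log (S.w t * y))]
    have h1 : ∀ t ∈ T, Real.log (S.w t * S.update η L p q r t) - Real.log (S.w t * L t) =
        Real.log (1 + η * (S.rate t / s)) := by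
      intro t ht
      rw [hlog t ht, add_sub_cancel_left]
    rw [Finset.sum_congr rfl h1]
    -- The variable of largest rate is multiplied by exactly 1 + η; it alone raises the potential by
    -- log(1 + η).
    obtain ⟨t, ht, hts⟩ : ∃ t ∈ T, S.rate t = s := by
      rcases max_choice (S.rate p) (max (S.rate q) (S.rate r)) with h | h
      · exact ⟨p, by simp [hT], by rw [hs, h]⟩
      · rcases max_choice (S.rate q) (S.rate r) with h' | h'
        · exact ⟨q, by simp [hT], by rw [hs, h, h']⟩
        · exact ⟨r, by simp [hT], by rw [hs, h, h']⟩
    have h2 := Finset.single_le_sum (f := fun t => Real.log (1 + η * (S.rate t / s)))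
      (fun t _ => Real.log_nonneg (by have := hσ0 t; have := mul_nonneg hη.le this; linarith)) ht
    simp only [hts, div_self hs0.ne', mul_one] at h2
    linarith

/-- The lengths, scaled by a lower bound for the lengths of the constraints and truncated at `1`,
form a solution. -/
theorem candidate_spec (hS : S.Regular M) (hα : 0 < α) (hαbig : α ≤ big) (hL : S.Lengths big L)
    (hcon : ∀ p q r, (p, q, r) ∈ S.con → α ≤ L p + L q + L r) :
    S.Feasible (fun p => min 1 (L p / α)) ∧ (∀ p, S.Loose p → min 1 (L p / α) = 1) ∧
      S.cost (fun p => min 1 (L p / α)) ≤ S.cost L / α := by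
  have hn := hL.nonneg hS (hα.le.trans hαbig)
  have hn' : ∀ p, 0 ≤ L p / α := fun p => div_nonneg (hn p) hα.le
  have hm : ∀ p, 0 ≤ min 1 (L p / α) := fun p => le_min zero_le_one (hn' p)
  refine ⟨⟨hm, fun p hp => by simp [hL.zero p hp], fun p q r h => ?_⟩, fun p hp => ?_, ?_⟩
  · have h1 : 1 ≤ L p / α + L q / α + L r / α := by
      rw [← add_div, ← add_div, le_div_iff₀ hα, one_mul]
      exact hcon p q r h
    have := hm p; have := hm q; have := hm r
    rcases le_total 1 (L p / α) with h2 | h2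
    · rw [min_eq_left h2]; linarith
    rcases le_total 1 (L q / α) with h3 | h3
    · rw [min_eq_left h3]; linarith
    rcases le_total 1 (L r / α) with h4 | h4
    · rw [min_eq_left h4]; linarith
    rw [min_eq_right h2, min_eq_right h3, min_eq_right h4]
    exact h1
  · rw [hL.loose p hp, min_eq_left]
    rwa [le_div_iff₀ hα, one_mul]
  · rw [cost, cost, Finset.sum_div]
    refine Finset.sum_le_sum fun p _ => ?_
    rw [mul_div_assoc]
    exact mul_le_mul_of_nonneg_left (min_le_right _ _) (hS.w_nonneg p)

/-- By feasibility a constraint contains a variable that is not fixed to zero. Its initial length is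
big or 1/w ≥ 1/M. So 1/M is a valid first value of α. -/
theorem init_cover (hS : S.Regular M) (hM : 1 ≤ M) (hfeas : ∃ x, S.Feasible x) (hbig : 1 ≤ big)
    {p q r : ι} (hcon : (p, q, r) ∈ S.con) :
    1 / M ≤ S.init big p + S.init big q + S.init big r := by
  have hL := init_lengths (S := S) hbig
  have hn := hL.nonneg hS (by linarith)
  have hM0 : 0 < M := by linarith
  have key : ∀ t, t ∉ S.zero → 1 / M ≤ S.init big t := by
    intro t ht
    rw [init, if_neg ht]
    split_ifs with h
    · exact ((div_le_one hM0).2 hM).trans hbig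
    · have := (hS.weight t).resolve_left h
      exact one_div_le_one_div_of_le (by linarith) (hS.w_le t)
  have := hn p; have := hn q; have := hn r
  by_cases hp : p ∈ S.zero
  · by_cases hq : q ∈ S.zero
    · by_cases hr : r ∈ S.zero
      · obtain ⟨x, hx⟩ := hfeas
        have := hx.cover p q r hcon
        rw [hx.zero p hp, hx.zero q hq, hx.zero r hr] at this
        linarith
      · linarith [key r hr]
    · linarith [key q hq]
  · linarith [key p hp]

theorem cost_init_le (hS : S.Regular M) : S.cost (S.init big) ≤ M := by
  refine le_trans (Finset.sum_le_sum fun p _ => ?_) hS.total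
  rcases hS.cases p with h | h | h
  · simp [init, h, hS.w_nonneg p]
  · simp [h.2]
  · have := h.2
    rw [init, if_neg h.1, if_neg (by linarith), mul_one_div_cancel (by linarith)]
    exact this

theorem potential_init (hS : S.Regular M) : S.potential (S.init big) = 0 := by
  refine Finset.sum_eq_zero fun p _ => ?_
  rcases hS.cases p with h | h | h
  · simp [init, h]
  · simp [h.2]
  · have := h.2
    rw [init, if_neg h.1, if_neg (by linarith), mul_one_div_cancel (by linarith), Real.log_one]

/-- Only free variables contribute, each at most log(M·2big). Their weights are at least 1, so there
are at most M of them. -/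
theorem potential_le (hS : S.Regular M) (hM : 1 ≤ M) (hbig : 1 ≤ big) (hL : S.Lengths big L) :
    S.potential L ≤ M * Real.log (M * (2 * big)) := by
  have hl : 0 ≤ Real.log (M * (2 * big)) := Real.log_nonneg (by nlinarith)
  refine le_trans (Finset.sum_le_sum (g := fun p => S.w p * Real.log (M * (2 * big)))
    fun p _ => ?_) ?_
  · rcases hS.cases p with h | h | h
    · rw [hL.zero p h, mul_zero, Real.log_zero]
      exact mul_nonneg (hS.w_nonneg p) hl
    · simp [h.2]
    · have h1 := hL.free p h
      have h2 := h.2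
      calc Real.log (S.w p * L p) ≤ Real.log (M * (2 * big)) := by
            refine Real.log_le_log (by linarith) ?_
            have := hS.w_le p
            have := hL.nonneg hS (by linarith) p
            gcongr
            exact h1.2
        _ ≤ S.w p * Real.log (M * (2 * big)) := le_mul_of_one_le_left hl h2
  · rw [← Finset.sum_mul]
    exact mul_le_mul_of_nonneg_right hS.total hl

theorem progress_init {b : ℝ} (hb : 0 ≤ b) (hS : S.Regular M) :
    S.Progress η big b (S.init big) := by
  refine ⟨hb, fun x hx => le_of_eq ?_⟩
  rw [sub_self, mul_zero, zero_mul, Finset.sum_eq_zero, mul_zero]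
  intro p _
  have := potential_init (big := big) hS
  rcases hS.cases p with h | h | h
  · simp [init, h]
  · simp [h.2]
  · have := h.2
    rw [init, if_neg h.1, if_neg (by linarith), mul_one_div_cancel (by linarith), Real.log_one,
      mul_zero]

/-- Near optimality of the best solution once the total weight is large. -/
theorem Progress.le_cost (hS : S.Regular M) (hη : 0 < η) (hM : 1 < M) (hbig : 0 ≤ big)
    (hL : S.Lengths big L) (hP : S.Progress η big b L)
    (hlarge : (1 + η) * Real.log M ≤ η * Real.log (S.cost L)) {x : ι → ℝ} (hx : S.Feasible x) :
    b ≤ (1 + η) ^ 3 * S.cost x := by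
  have h1 := hP.2 x hx
  set D := S.cost L with hD
  have hlM : 0 < Real.log M := Real.log_pos hM
  have hlη : 0 < Real.log (1 + η) := Real.log_pos (by linarith)
  have hD0 : Real.log (S.cost (S.init big)) ≤ Real.log M := by
    have hle := cost_init_le (big := big) hS
    have h0 : 0 ≤ S.cost (S.init big) := by
      refine Finset.sum_nonneg fun p _ => ?_
      rcases hS.cases p with h | h | h
      · simp [init, h]
      · simp [h.2]
      · have := h.2
        rw [init, if_neg h.1, if_neg (by linarith), mul_one_div_cancel (by linarith)]
        exact zero_le_one
    rcases h0.eq_or_lt with h | h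
    · rw [← h, Real.log_zero]; exact hlM.le
    · exact Real.log_le_log h hle
  have hx0 : 0 ≤ S.cost x := Finset.sum_nonneg fun p _ => mul_nonneg (hS.w_nonneg p) (hx.nonneg p)
  -- Every single w_p L_p is at most the total D, so x turns into its cost.
  have hsum : ∑ p, S.w p * x p * Real.log (S.w p * L p) ≤ S.cost x * Real.log D := by
    rw [cost, Finset.sum_mul]
    refine Finset.sum_le_sum fun p _ => ?_
    have h2 := mul_nonneg (hS.w_nonneg p) (hx.nonneg p)
    rcases hS.cases p with h | h | h
    · rw [hx.zero p h]; simp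
    · simp [h.2]
    · refine mul_le_mul_of_nonneg_left (Real.log_le_log ?_ ?_) h2
      · linarith [(hL.free p h).1]
      · exact Finset.single_le_sum (f := fun p => S.w p * L p)
          (fun t _ => hL.weight_mul_nonneg hS hbig t) (Finset.mem_univ p)
  -- The assumption on D says log M ≤ ηd, hence log D ≤ (1 + η)d: the loss from the initial total is
  -- one factor 1 + η.
  set d := Real.log D - Real.log M with hd
  have hd0 : 0 < d := by
    have : 0 < η * d := by rw [hd]; nlinarith
    exact pos_of_mul_pos_right this hη.le
  have hlD : Real.log D ≤ (1 + η) * d := by rw [hd]; linarith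
  -- Replacing η by (1 + η) log(1 + η) costs another factor 1 + η. With the one in the invariant
  -- this makes three.
  have hη2 : η ≤ (1 + η) * Real.log (1 + η) := by
    have := Real.one_sub_inv_le_log_of_pos (show 0 < 1 + η by linarith)
    have h3 := mul_le_mul_of_nonneg_left this (show 0 ≤ 1 + η by linarith)
    rw [mul_sub, mul_inv_cancel₀ (by linarith)] at h3
    linarith
  have h2 : b * d * Real.log (1 + η) ≤ (1 + η) ^ 3 * S.cost x * d * Real.log (1 + η) := by
    calc b * d * Real.log (1 + η)
        ≤ b * (Real.log D - Real.log (S.cost (S.init big))) * Real.log (1 + η) := by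
          have := hP.1
          have : d ≤ Real.log D - Real.log (S.cost (S.init big)) := by rw [hd]; linarith
          gcongr
      _ ≤ η * (1 + η) * ∑ p, S.w p * x p * Real.log (S.w p * L p) := h1
      _ ≤ η * (1 + η) * (S.cost x * Real.log D) := by gcongr
      _ ≤ η * (1 + η) * (S.cost x * ((1 + η) * d)) := by gcongr
      _ ≤ (1 + η) * Real.log (1 + η) * (1 + η) * (S.cost x * ((1 + η) * d)) := by gcongr
      _ = _ := by ring
  have h3 := le_of_mul_le_mul_right h2 hlη
  exact le_of_mul_le_mul_right h3 hd0

/-- If the total weight stays small, then the variables with large lengths cover all constraints at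
no cost. -/
theorem trivial_spec (hS : S.Regular M) {Θ : ℝ} (hΘ : 0 < Θ) (hbig : Θ ≤ big)
    (hL : S.Lengths big L) (hsmall : S.cost L < Θ / 3)
    (hcon : ∀ p q r, (p, q, r) ∈ S.con → Θ ≤ L p + L q + L r) :
    S.Feasible (fun p => if L p < big then 0 else 1) ∧
      (∀ p, S.Loose p → (if L p < big then (0 : ℝ) else 1) = 1) ∧
      S.cost (fun p => if L p < big then 0 else 1) = 0 := by
  -- Free variables have weight at least 1, so L_p ≤ D < Θ/3. Three such lengths do not reach Θ;
  -- therefore every constraint contains a loose variable.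
  have hfree : ∀ p, S.Free p → L p < Θ / 3 := by
    intro p hp
    have h1 := Finset.single_le_sum (f := fun p => S.w p * L p)
      (fun t _ => hL.weight_mul_nonneg hS (hΘ.le.trans hbig) t) (Finset.mem_univ p)
    have h2 := le_mul_of_one_le_left (hL.nonneg hS (hΘ.le.trans hbig) p) hp.2
    exact h2.trans_lt (h1.trans_lt hsmall)
  have hne : ∀ p, L p < Θ / 3 ∨ L p = big := by
    intro p
    rcases hS.cases p with h | h | h
    · left; rw [hL.zero p h]; linarith
    · right; exact hL.loose p h
    · left; exact hfree p h
  have h01 : ∀ p, 0 ≤ if L p < big then (0 : ℝ) else 1 := by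
    intro p; split_ifs <;> norm_num
  refine ⟨⟨h01, fun p hp => ?_, fun p q r h => ?_⟩, fun p hp => ?_, ?_⟩
  · rw [if_pos]; rw [hL.zero p hp]; linarith
  · have h1 := hcon p q r h
    have := h01 p; have := h01 q; have := h01 r
    rcases hne p with hp | hp
    · rcases hne q with hq | hq
      · rcases hne r with hr | hr
        · linarith
        · have : (if L r < big then (0 : ℝ) else 1) = 1 := by rw [hr, if_neg (lt_irrefl _)]
          linarith
      · have : (if L q < big then (0 : ℝ) else 1) = 1 := by rw [hq, if_neg (lt_irrefl _)]
        linarith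
    · have : (if L p < big then (0 : ℝ) else 1) = 1 := by rw [hp, if_neg (lt_irrefl _)]
      linarith
  · rw [hL.loose p hp, if_neg (lt_irrefl _)]
  · refine Finset.sum_eq_zero fun p _ => ?_
    rcases hS.cases p with h | h | h
    · have : L p < big := by rw [hL.zero p h]; linarith
      simp [this]
    · rw [h.2, zero_mul]
    · have : L p < big := by linarith [hfree p h]
      simp [this]

end CoverProgram


namespace RealRAM

open CCInstance

/-- The test whether a natural number is positive. -/
abbrev posI (e : IExp) : Test := .ltIdx (.lit 0) e

/-- An entry of a column. -/
abbrev col (a : ℕ) (i : IExp) : IExp := .cell a i (.lit 0)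

theorem le_const {T k c n : ℕ} (h : T ≤ k) (hk : k ≤ c) : T ≤ c * n ^ 0 := by
  simpa using h.trans hk

/-- The memory contains the instance `G`. -/
structure HasInput {n : ℕ} (G : CCInstance (Fin n)) (m : Mem) : Prop where
  size : m.idx 0 0 0 = n
  pos : ∀ u v : Fin n, 0 < m.idx 1 u v ↔ G.pos.Adj u v
  friendly : ∀ u v : Fin n, 0 < m.idx 2 u v ↔ G.friendly.Adj u v
  hostile : ∀ u v : Fin n, 0 < m.idx 3 u v ↔ G.hostile.Adj u v

theorem HasInput.congr {n : ℕ} {G : CCInstance (Fin n)} {m m' : Mem} (h : HasInput G m)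
    (h' : ∀ a, a < 4 → m'.idx a = m.idx a) : HasInput G m' := by
  obtain ⟨h0, h1, h2, h3⟩ := h
  exact ⟨by rw [h' 0 (by norm_num), h0], by rw [h' 1 (by norm_num)]; exact h1,
    by rw [h' 2 (by norm_num)]; exact h2, by rw [h' 3 (by norm_num)]; exact h3⟩

theorem HasInput.of_same {n : ℕ} {G : CCInstance (Fin n)} {m m' : Mem} {I N : List ℕ}
    (h : HasInput G m) (hs : SameExcept I N m m') (hI : ∀ a ∈ I, 4 ≤ a) : HasInput G m' :=
  h.congr fun a ha => hs.1 a fun h' => by have := hI a h'; omega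

/-! ## Supernode labels -/

/-- Replace the label `x` (in scalar 23) by the label `y` (in scalar 24). -/
def relabelP : Prog :=
  forP 22 (.branch (eqI (col 5 (sc 22)) (sc 23)) (.setIdx 5 (sc 22) (.lit 0) (sc 24)) .skip)

theorem relabelP_spec {m : Mem} {n : ℕ} (hn : m.idx 0 0 0 = n) (h1 : 1 ≤ n) :
    Yields relabelP m fun m' T => T ≤ 60 * n ^ 1 ∧ ∀ w < n,
      m'.idx 5 w 0 = if m.idx 5 w 0 = m.idx 23 0 0 then m.idx 24 0 0 else m.idx 5 w 0 := by
  refine yields_for (n := n) (c := 32) (d := 0) (fun k m' => ∀ w < n, m'.idx 5 w 0 =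
    if w < k ∧ m.idx 5 w 0 = m.idx 23 0 0 then m.idx 24 0 0 else m.idx 5 w 0)
    hn h1 (by decide) (by decide) ?_ ?_ ?_ ?_
  · intro k m1 m2 h _ hI
    rw [h 5 (by decide)]; exact hI
  · simp
  · intro k hk m' hs hik _ hI
    refine yields_exec rfl fun T hT => ⟨le_const hT (by decide), fun w hw => ?_⟩
    have e1 : m'.idx 23 = m.idx 23 := hs.1 23 (by decide)
    have e2 : m'.idx 24 = m.idx 24 := hs.1 24 (by decide)
    have e3 := hI k hk
    simp only [lt_irrefl, false_and, if_false] at e3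
    simp only [Prog.exec, eqI_holds, IExp.eval, hik, e1, e2, e3]
    have := hI w hw
    by_cases hwk : w = k
    · subst hwk
      by_cases hc : m.idx 5 w 0 = m.idx 23 0 0
      · simp [hc]
      · simp [hc, e3]
    · have h2 : w < k + 1 ↔ w < k := by omega
      by_cases hc : m.idx 5 k 0 = m.idx 23 0 0 <;> simp only [hc, if_true, if_false, h2,
        Mem.writeIdx_idx, hwk, false_and, and_false] <;> exact this
  · intro m' T _ hT hI
    refine ⟨hT, fun w hw => ?_⟩
    rw [hI w hw]; simp [hw]

/-- Compute labels of the nodes such that two nodes have the same label iff they lie in the same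
supernode. -/
def labelsP : Prog :=
  .seq (forP 20 (.setIdx 5 (sc 20) (.lit 0) (sc 20)))
    (forP 20 (forP 21 (.branch (posI (.cell 2 (sc 20) (sc 21)))
      (.seq (setSc 23 (col 5 (sc 20))) (.seq (setSc 24 (col 5 (sc 21))) relabelP)) .skip)))

/-- The array `5` contains the labels `lab`. -/
structure HasLabels {n : ℕ} (G : CCInstance (Fin n)) (lab : Fin n → Fin n) (m : Mem) : Prop where
  cell : ∀ u : Fin n, m.idx 5 u 0 = lab u
  iff : ∀ u v, lab u = lab v ↔ G.super u = G.super v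

/-- The invariant of the computation of the labels. -/
def LabelsInv {n : ℕ} (G : CCInstance (Fin n)) (f : ℕ → ℕ) : Prop :=
  (∀ u < n, f u < n) ∧ ∀ u v : Fin n, f u = f v → G.super u = G.super v

/-- Merging two label classes is sound if they contain nodes of a common supernode. -/
theorem LabelsInv.relabel {n : ℕ} {G : CCInstance (Fin n)} {f f' : ℕ → ℕ} (h : LabelsInv G f)
    {u v : Fin n} (huv : G.super u = G.super v)
    (hf : ∀ w < n, f' w = if f w = f u then f v else f w) : LabelsInv G f' := by
  refine ⟨fun w hw => ?_, fun a b hab => ?_⟩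
  · rw [hf w hw]
    split_ifs
    · exact h.1 v v.2
    · exact h.1 w hw
  · rw [hf a a.2, hf b b.2] at hab
    split_ifs at hab with h1 h2 h2
    · exact h.2 _ _ (h1.trans h2.symm)
    · exact (h.2 _ _ h1).trans (huv.trans (h.2 _ _ hab))
    · exact (h.2 _ _ hab).trans (huv.symm.trans (h.2 _ _ h2).symm)
    · exact h.2 _ _ hab

/-- All labels start distinct and are merged along friendly edges, with linear time per edge. Equal
labels always imply equal supernodes; the converse follows at the end along friendly walks. -/
theorem labelsP_spec {n : ℕ} {G : CCInstance (Fin n)} {m : Mem} (hm : HasInput G m) (h1 : 1 ≤ n) :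
    Yields labelsP m fun m' T => T ≤ 300 * n ^ 3 ∧ ∃ lab, HasLabels G lab m' := by
  refine yields_seq ?_
  refine yields_for (n := n) (c := 8) (d := 0) (fun k m' => ∀ w < k, m'.idx 5 w 0 = w)
    hm.size h1 (by decide) (by decide) ?_ (by simp) ?_ ?_
  · intro k m1 m2 h _ hI
    rw [h 5 (by decide)]; exact hI
  · intro k hk m' hs hik _ hI
    refine yields_exec rfl fun T hT => ⟨le_const hT (by decide), fun w hw => ?_⟩
    simp only [Prog.exec, IExp.eval, hik, Mem.writeIdx_idx, true_and, and_true]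
    split_ifs with h
    · exact h.symm
    · exact hI w (by omega)
  intro m1 T1 hs1 hT1 hI1
  have hm1 : HasInput G m1 := hm.of_same hs1 (by decide)
  refine yields_for (n := n) (c := 116 + 28) (d := 2) (fun k m' => LabelsInv G (fun w => m'.idx 5 w 0) ∧
    ∀ u v : Fin n, u.1 < k → G.friendly.Adj u v → m'.idx 5 u 0 = m'.idx 5 v 0)
    hm1.size h1 (by decide) (by decide) ?_ ?_ ?_ ?_
  · intro k m1 m2 h _ hI
    rw [h 5 (by decide)]; exact hI
  · refine ⟨⟨fun w hw => ?_, fun u v h => ?_⟩, by simp⟩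
    · simpa only [hI1 w hw] using hw
    · simp only [hI1 u u.2, hI1 v v.2] at h
      rw [Fin.ext h]
  · intro k hk m2 hs2 hik2 h02 hI2
    have hm2 : HasInput G m2 := hm1.of_same hs2 (by decide)
    refine yields_for (n := n) (c := 116) (d := 1) (fun j m' =>
      LabelsInv G (fun w => m'.idx 5 w 0) ∧ ∀ u v : Fin n, (u.1 < k ∨ u.1 = k ∧ v.1 < j) →
        G.friendly.Adj u v → m'.idx 5 u 0 = m'.idx 5 v 0)
      hm2.size h1 (by decide) (by decide) ?_ ?_ ?_ ?_
    · intro k m1 m2 h _ hI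
      rw [h 5 (by decide)]; exact hI
    · refine ⟨hI2.1, fun u v h => hI2.2 u v (h.resolve_right (by simp))⟩
    · intro j hj m3 hs3 hjk3 h03 hI3
      have hm3 : HasInput G m3 := hm2.of_same hs3 (by decide)
      have hik3 : m3.idx 20 0 0 = k := by rw [hs3.1 20 (by decide), hik2]
      refine yields_branch_skip (fun hb => ?_) (fun hb => ?_)
      · have hadj : G.friendly.Adj ⟨k, hk⟩ ⟨j, hj⟩ := by
          rw [← hm3.friendly]
          simpa [hik3, hjk3] using hb
        refine yields_seq (yields_exec rfl fun T3 hT3 => ?_)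
        refine yields_seq (yields_exec rfl fun T4 hT4 => ?_)
        refine (relabelP_spec (n := n) (by simp [h03]) h1).mono ?_
        rintro m4 T5 ⟨hT5, hI4⟩
        simp only [Prog.exec, IExp.eval, Mem.writeIdx_idx, hik3, hjk3] at hI4
        have hI4' : ∀ w < n, m4.idx 5 w 0 =
            if m3.idx 5 w 0 = m3.idx 5 k 0 then m3.idx 5 j 0 else m3.idx 5 w 0 := by
          intro w hw
          simpa using hI4 w hw
        refine ⟨?_, ?_, ?_⟩
        · have h3 : T3 ≤ 20 := hT3.trans (by decide)
          have h4 : T4 ≤ 20 := hT4.trans (by decide)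
          simp only [Test.steps, IExp.steps, pow_one] at hT5 ⊢
          omega
        · exact hI3.1.relabel (u := ⟨k, hk⟩) (v := ⟨j, hj⟩)
            (SimpleGraph.ConnectedComponent.sound hadj.reachable) hI4'
        · intro u v huv huvadj
          rw [hI4' u u.2, hI4' v v.2]
          -- Relabelling acts on labels, so equalities already reached are preserved.
          by_cases h5 : u.1 < k ∨ u.1 = k ∧ v.1 < j
          · rw [hI3.2 u v h5 huvadj]
          · have h6 : u.1 = k ∧ v.1 = j := by omega
            rw [h6.1, h6.2]
            simp
      · refine ⟨?_, hI3.1, ?_⟩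
        · simp only [Test.steps, IExp.steps, pow_one]
          omega
        · intro u v huv huvadj
          by_cases h5 : u.1 < k ∨ u.1 = k ∧ v.1 < j
          · exact hI3.2 u v h5 huvadj
          · have h6 : u.1 = k ∧ v.1 = j := by omega
            exfalso
            apply hb
            rw [← hm3.friendly] at huvadj
            simpa [hik3, hjk3, ← h6.1, ← h6.2] using huvadj
    · intro m4 T4 _ hT4 hI4
      exact ⟨hT4, hI4.1, fun u v h => hI4.2 u v (by omega)⟩
  · intro m5 T5 _ hT5 hI5
    refine ⟨?_, ?_⟩
    · have : n ^ 1 ≤ n ^ 3 := Nat.pow_le_pow_right h1 (by norm_num)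
      simp only [zero_add, Nat.reduceAdd] at hT1 hT5
      omega
    · refine ⟨fun u => ⟨m5.idx 5 u 0, hI5.1.1 u u.2⟩, fun u => rfl, fun u v => ?_⟩
      rw [Fin.mk.injEq]
      refine ⟨hI5.1.2 u v, fun h => ?_⟩
      obtain ⟨p⟩ := SimpleGraph.ConnectedComponent.exact h
      clear h
      induction p with
      | nil => rfl
      | cons hadj _ ih => exact (hI5.2 _ _ (Fin.is_lt _) hadj).trans ih

end RealRAM


namespace RealRAM

open CCInstance

variable {n : ℕ} {G : CCInstance (Fin n)} {lab : Fin n → Fin n}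

/-! ## Hostile supernodes -/

/-- Mark the pairs of labels of the node pairs that satisfy `t` in the array `a`. -/
def markP (a : ℕ) (t : Test) : Prog :=
  forP 20 (forP 21 (.branch t (.setIdx a (col 5 (sc 20)) (col 5 (sc 21)) (.lit 1)) .skip))

/-- Mark the pairs of labels of hostile supernodes. -/
def hostP : Prog := markP 6 (posI (.cell 3 (sc 20) (sc 21)))

/-- The array `6` marks the pairs of hostile supernodes. -/
def HasHostile (G : CCInstance (Fin n)) (lab : Fin n → Fin n) (m : Mem) : Prop :=
  ∀ u v, 0 < m.idx 6 (lab u) (lab v) ↔ G.HostilePair (G.super u) (G.super v)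

theorem HasLabels.of_eq {m m' : Mem} (h : HasLabels G lab m) (h' : m'.idx 5 = m.idx 5) :
    HasLabels G lab m' := ⟨by rw [h']; exact h.cell, h.iff⟩

theorem markP_spec {m : Mem} {a : ℕ} {t : Test} {r : Fin n → Fin n → Prop} (hn : m.idx 0 0 0 = n)
    (h1 : 1 ≤ n) (hl : HasLabels G lab m) (ha : 5 < a) (ha' : a < 20) (ht : t.steps ≤ 60)
    (ha0 : ∀ i j, m.idx a i j = 0)
    (hr : ∀ (u v : Fin n) m', SameExcept [20, 21, a] [] m m' → m'.idx 20 0 0 = u →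
      m'.idx 21 0 0 = v → (t.holds m' ↔ r u v)) :
    Yields (markP a t) m fun m' T => T ≤ 200 * n ^ 2 ∧
      ∀ u v, 0 < m'.idx a (lab u) (lab v) ↔
        ∃ u' v', G.super u' = G.super u ∧ G.super v' = G.super v ∧ r u' v' := by
  classical
  have e0 : 0 ≠ a := by omega
  have e5 : 5 ≠ a := by omega
  have e20 : 20 ≠ a := by omega
  have e21 : 21 ≠ a := by omega
  refine yields_table (n := n) (c := 100) (fun S m => ∀ A B, 0 < m.idx a A B ↔
    ∃ u v : Fin n, (u, v) ∈ S ∧ r u v ∧ (lab u : ℕ) = A ∧ (lab v : ℕ) = B)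
    hn h1 (by simp [Prog.idxWrites, e0]) (by simp [Prog.idxWrites, e20])
    (by simp [Prog.idxWrites, e21]) rfl ?_ ?_ ?_ ?_ ?_
  · simp only [Prog.maxSteps, IExp.steps]
    omega
  · intro S m m' h _ hI
    rw [h a e20.symm e21.symm]; exact hI
  · simp [ha0]
  · intro u v S _ m' hs hu hv _ hI A B
    have hs' : SameExcept [20, 21, a] [] m m' := hs.mono (by simp [Prog.idxWrites])
      (by simp [Prog.numWrites])
    have el := hl.of_eq (hs'.1 5 (by simp [e5]))
    simp only [Prog.exec, hr u v m' hs' hu hv, IExp.eval, hu, hv, el.cell]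
    by_cases hh : r u v
    · simp only [hh, if_true, Mem.writeIdx_idx, true_and]
      by_cases hAB : A = lab u ∧ B = lab v
      · simp only [hAB, and_self, if_true, Nat.one_pos, true_iff]
        exact ⟨u, v, by simp, hh, rfl, rfl⟩
      · simp only [if_neg hAB, hI A B]
        refine exists_congr fun a => exists_congr fun b => ?_
        simp only [Set.mem_insert_iff, Prod.mk.injEq]
        constructor
        · rintro ⟨h1, h2⟩; exact ⟨Or.inr h1, h2⟩
        · rintro ⟨⟨rfl, rfl⟩ | h1, h2, h3, h4⟩
          · exact (hAB ⟨h3.symm, h4.symm⟩).elim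
          · exact ⟨h1, h2, h3, h4⟩
    · simp only [hh, if_false, hI A B]
      refine exists_congr fun a => exists_congr fun b => ?_
      simp only [Set.mem_insert_iff, Prod.mk.injEq]
      constructor
      · rintro ⟨h1, h2⟩; exact ⟨Or.inr h1, h2⟩
      · rintro ⟨⟨rfl, rfl⟩ | h1, h2⟩
        · exact (hh h2.1).elim
        · exact ⟨h1, h2⟩
  · intro m' T _ hT hI
    refine ⟨hT.trans (Nat.mul_le_mul_right _ (by norm_num)), fun u v => ?_⟩
    rw [hI]
    simp only [Set.mem_univ, true_and, Fin.val_inj, hl.iff]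
    constructor
    · rintro ⟨a, b, h, ha, hb⟩; exact ⟨a, b, ha, hb, h⟩
    · rintro ⟨a, b, ha, hb, h⟩; exact ⟨a, b, h, ha, hb⟩

theorem hostP_spec {m : Mem} (hm : HasInput G m) (h1 : 1 ≤ n) (hl : HasLabels G lab m)
    (h6 : ∀ i j, m.idx 6 i j = 0) :
    Yields hostP m fun m' T => T ≤ 200 * n ^ 2 ∧ HasHostile G lab m' := by
  refine markP_spec hm.size h1 hl (by norm_num) (by norm_num) (by decide) h6 fun u v m' hs hu hv => ?_
  simp only [Test.holds, IExp.eval, hu, hv, (hm.of_same hs (by decide)).hostile u v]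

/-! ## The matching of dangerous pairs -/

/-- The next candidate `c` for an edge from the supernode of `b` to `d`. -/
abbrev ptrE : IExp := .cell 10 (sc 22) (col 5 (sc 21))

/-- The candidate is an unmatched positive edge. -/
abbrev goodT : Test := .conj (eqI (col 5 ptrE) (col 5 (sc 21)))
  (.conj (posI (.cell 1 ptrE (sc 22))) (.neg (posI (.cell 7 ptrE (sc 22)))))

/-- Advance the candidate. -/
def advanceP : Prog :=
  .loop (.conj (.ltIdx ptrE (sc 0)) (.neg goodT))
    (.setIdx 10 (sc 22) (col 5 (sc 21)) (.add ptrE (.lit 1)))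

/-- Write an entry for an unordered pair. -/
def setSym (a : ℕ) (i j e : IExp) : Prog := .seq (.setIdx a i j e) (.setIdx a j i e)

theorem exec_setSym {a x y z : ℕ} (hx : x ≠ a) (hy : y ≠ a) (hz : z ≠ a) (m : Mem) (a' u v : ℕ) :
    ((setSym a (sc x) (sc y) (sc z)).exec m).idx a' u v =
      if a' = a ∧ ((u = m.idx x 0 0 ∧ v = m.idx y 0 0) ∨ (u = m.idx y 0 0 ∧ v = m.idx x 0 0)) then
        m.idx z 0 0 else m.idx a' u v := by
  simp only [setSym, Prog.exec, IExp.eval, Mem.writeIdx_idx, hx, hy, hz, false_and, if_false]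
  split_ifs <;> first | rfl | tauto

theorem exec_setSym_lit {a x y z : ℕ} (hx : x ≠ a) (hy : y ≠ a) (m : Mem) (a' u v : ℕ) :
    ((setSym a (sc x) (sc y) (.lit z)).exec m).idx a' u v =
      if a' = a ∧ ((u = m.idx x 0 0 ∧ v = m.idx y 0 0) ∨ (u = m.idx y 0 0 ∧ v = m.idx x 0 0)) then
        z else m.idx a' u v := by
  simp only [setSym, Prog.exec, IExp.eval, Mem.writeIdx_idx, hx, hy, false_and, if_false]
  split_ifs <;> first | rfl | tauto

/-- Match the edge `ab` with the edge `cd`. -/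
def pairP : Prog :=
  .seq (setSc 23 ptrE)
  (.seq (setSym 7 (sc 20) (sc 21) (.lit 1)) (.seq (setSym 7 (sc 23) (sc 22) (.lit 1))
  (.seq (setSym 8 (sc 20) (sc 21) (sc 23)) (.seq (setSym 9 (sc 20) (sc 21) (sc 22))
  (.seq (setSym 8 (sc 23) (sc 22) (sc 20)) (setSym 9 (sc 23) (sc 22) (sc 21)))))))

/-- Compute a maximal set of disjoint dangerous pairs. -/
def matchP : Prog :=
  forP 20 (forP 21 (forP 22 (.branch
    (.conj (posI (.cell 1 (sc 20) (sc 21))) (.conj (.neg (posI (.cell 7 (sc 20) (sc 21))))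
      (posI (.cell 6 (col 5 (sc 20)) (col 5 (sc 22))))))
    (.seq advanceP (.branch (.ltIdx ptrE (sc 0)) pairP .skip)) .skip)))

/-- The arrays `7`, `8`, `9` contain the matching `𝒟`. -/
structure HasMatching (𝒟 : Set (Sym2 (Sym2 (Fin n)))) (m : Mem) : Prop where
  matched : ∀ u v : Fin n, 0 < m.idx 7 u v ↔ s(u, v) ∈ dangerousEdges 𝒟
  partner : ∀ u v : Fin n, s(u, v) ∈ dangerousEdges 𝒟 →
    ∃ c d : Fin n, m.idx 8 u v = c ∧ m.idx 9 u v = d ∧ s(s(u, v), s(c, d)) ∈ 𝒟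

theorem HasMatching.of_eq {𝒟 : Set (Sym2 (Sym2 (Fin n)))} {m m' : Mem} (h : HasMatching 𝒟 m)
    (h7 : m'.idx 7 = m.idx 7) (h8 : m'.idx 8 = m.idx 8) (h9 : m'.idx 9 = m.idx 9) :
    HasMatching 𝒟 m' := by
  obtain ⟨h1, h2⟩ := h
  exact ⟨by rw [h7]; exact h1, by rw [h8, h9]; exact h2⟩

/-- The candidates that have been passed are matched. -/
def PtrInv (G : CCInstance (Fin n)) (lab : Fin n → Fin n) (𝒟 : Set (Sym2 (Sym2 (Fin n))))
    (m : Mem) : Prop :=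
  ∀ d B : Fin n, m.idx 10 d B ≤ n ∧ ∀ c : Fin n, c.1 < m.idx 10 d B → lab c = B →
    G.pos.Adj c d → s(c, d) ∈ dangerousEdges 𝒟

theorem sum_change {α : Type*} [Fintype α] {f f' : α → ℕ} {a : α}
    (h : ∀ b, b ≠ a → f' b = f b) : ∑ b, f' b + f a = ∑ b, f b + f' a := by
  classical
  rw [← Finset.add_sum_erase _ f (Finset.mem_univ a), ← Finset.add_sum_erase _ f' (Finset.mem_univ a),
    Finset.sum_congr rfl fun b hb => h b (Finset.ne_of_mem_erase hb)]
  ring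

/-- There is one pointer for each node d and supernode label B. It never moves back: a passed
candidate was unsuitable or already matched, and matched edges stay matched. Up to a constant, the
running time is paid by the increase of the sum of all pointers. -/
theorem advanceP_spec {m : Mem} {𝒟 : Set (Sym2 (Sym2 (Fin n)))} (hm : HasInput G m)
    (hl : HasLabels G lab m) (hM : HasMatching 𝒟 m) (hP : PtrInv G lab 𝒟 m) {b d : Fin n}
    (hb : m.idx 21 0 0 = b) (hd : m.idx 22 0 0 = d) :
    Yields advanceP m fun m' T => PtrInv G lab 𝒟 m' ∧
      T + 200 * ∑ q : Fin n × Fin n, m.idx 10 q.1 q.2 ≤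
        200 * ∑ q : Fin n × Fin n, m'.idx 10 q.1 q.2 + 170 ∧
      (m'.idx 10 d (lab b) = n ∨ ∃ c : Fin n, m'.idx 10 d (lab b) = c ∧ lab c = lab b ∧
        G.pos.Adj c d ∧ s(c, d) ∉ dangerousEdges 𝒟) := by
  set k0 := m.idx 10 d (lab b) with hk0
  refine yields_loop (200 * n) (fun m' T => T + 200 * k0 ≤ 200 * m'.idx 10 d (lab b) ∧
    PtrInv G lab 𝒟 m' ∧ ∀ q : Fin n × Fin n, q ≠ (d, lab b) → m'.idx 10 q.1 q.2 = m.idx 10 q.1 q.2)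
    ?_ ?_ ?_ ?_
  · rintro m' T ⟨hT, hP, -⟩
    have := (hP d (lab b)).1
    omega
  · exact ⟨by omega, hP, fun q _ => rfl⟩
  · rintro m' T hs ⟨hT, hP', hq⟩ htest
    have hm' := hm.of_same hs (by decide)
    have el := hl.of_eq (hs.1 5 (by decide))
    have eM := hM.of_eq (hs.1 7 (by decide)) (hs.1 8 (by decide)) (hs.1 9 (by decide))
    have hb' : m'.idx 21 0 0 = b := by rw [hs.1 21 (by decide), hb]
    have hd' : m'.idx 22 0 0 = d := by rw [hs.1 22 (by decide), hd]
    simp only [Test.holds, IExp.eval, hb', hd', el.cell, hm'.size] at htest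
    obtain ⟨hlt, htest⟩ := htest
    refine yields_exec rfl fun T' hT' => ?_
    have hT'' : T' ≤ 30 := hT'.trans (by decide)
    have hw : ∀ x y, ((Prog.setIdx 10 (sc 22) (col 5 (sc 21)) (.add ptrE (.lit 1))).exec m').idx
        10 x y = if x = d ∧ y = lab b then m'.idx 10 d (lab b) + 1 else m'.idx 10 x y := by
      intro x y
      simp [hb', hd', el.cell]
    refine ⟨?_, ?_, ?_⟩
    · rw [hw, if_pos ⟨rfl, rfl⟩]
      simp only [Test.steps, IExp.steps]
      omega
    · intro d' B
      rw [hw]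
      by_cases hc : d' = d ∧ B = lab b
      · obtain ⟨rfl, rfl⟩ := hc
        simp only [and_self, if_true]
        refine ⟨by omega, fun c hc hcB hcd => ?_⟩
        by_cases hc2 : c.1 < m'.idx 10 d' (lab b)
        · exact (hP' _ _).2 c hc2 hcB hcd
        · have hce : m'.idx 10 d' (lab b) = c := by omega
          rw [hce] at htest
          by_contra hno
          apply htest
          rw [el.cell, hcB, hm'.pos, eM.matched]
          exact ⟨by simp, hcd, hno⟩
      · rw [if_neg (by simpa [Fin.val_inj] using hc)]
        exact hP' d' B
    · intro q hqne
      rw [hw, if_neg, hq q hqne]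
      rintro ⟨h1, h2⟩
      exact hqne (Prod.ext (Fin.ext h1) (Fin.ext h2))
  · rintro m' T hs ⟨hT, hP', hq⟩ htest
    have hm' := hm.of_same hs (by decide)
    have el := hl.of_eq (hs.1 5 (by decide))
    have eM := hM.of_eq (hs.1 7 (by decide)) (hs.1 8 (by decide)) (hs.1 9 (by decide))
    have hb' : m'.idx 21 0 0 = b := by rw [hs.1 21 (by decide), hb]
    have hd' : m'.idx 22 0 0 = d := by rw [hs.1 22 (by decide), hd]
    refine ⟨hP', ?_, ?_⟩
    · have := sum_change (f := fun q : Fin n × Fin n => m.idx 10 q.1 q.2)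
        (f' := fun q : Fin n × Fin n => m'.idx 10 q.1 q.2) (a := (d, lab b)) hq
      simp only [← hk0] at this
      simp only [Test.steps, IExp.steps]
      omega
    · rcases (hP' d (lab b)).1.eq_or_lt with h | h
      · exact Or.inl h
      · right
        refine ⟨⟨_, h⟩, rfl, ?_⟩
        simp only [Test.holds, IExp.eval, hb', hd', el.cell, hm'.size, h, true_and, not_not] at htest
        have h1 := el.cell ⟨_, h⟩
        have h2 := hm'.pos ⟨_, h⟩ d
        have h3 := eM.matched ⟨_, h⟩ d
        simp only at h1 h2 h3
        rw [h1, h2, h3] at htest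
        exact ⟨Fin.ext (by omega), htest.2⟩

/-- Adding a pair to the matching. -/
theorem pairP_spec {m : Mem} {𝒟 : Set (Sym2 (Sym2 (Fin n)))} (hM : HasMatching 𝒟 m)
    {a b c d B : Fin n} (ha : m.idx 20 0 0 = a) (hb : m.idx 21 0 0 = b)
    (hd : m.idx 22 0 0 = d) (hB : m.idx 5 b 0 = B) (hc : m.idx 10 d B = c) :
    HasMatching (insert s(s(a, b), s(c, d)) 𝒟) (pairP.exec m) := by
  have hval : ∀ x y : Fin n, x.1 = y.1 ↔ x = y := fun x y => Fin.val_inj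
  have h7 : ∀ u v : Fin n, (pairP.exec m).idx 7 u v =
      if s(u, v) = s(a, b) ∨ s(u, v) = s(c, d) then 1 else m.idx 7 u v := by
    intro u v
    simp (disch := decide) [pairP, exec_setSym, exec_setSym_lit, hval, ha, hb, hd, hB, hc]
    split_ifs <;> first | rfl | tauto
  have h8 : ∀ u v : Fin n, (pairP.exec m).idx 8 u v =
      if s(u, v) = s(c, d) then a.1 else if s(u, v) = s(a, b) then c.1 else m.idx 8 u v := by
    intro u v
    simp (disch := decide) [pairP, exec_setSym, exec_setSym_lit, hval, ha, hb, hd, hB, hc]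
  have h9 : ∀ u v : Fin n, (pairP.exec m).idx 9 u v =
      if s(u, v) = s(c, d) then b.1 else if s(u, v) = s(a, b) then d.1 else m.idx 9 u v := by
    intro u v
    simp (disch := decide) [pairP, exec_setSym, exec_setSym_lit, hval, ha, hb, hd, hB, hc]
  constructor
  · intro u v
    rw [h7, mem_dangerousEdges_insert, ← hM.matched]
    split_ifs with h
    · simp only [Nat.one_pos, true_iff]; tauto
    · tauto
  · intro u v huv
    rw [mem_dangerousEdges_insert] at huv
    simp only [h8, h9]
    by_cases h1 : s(u, v) = s(c, d)
    · refine ⟨a, b, by rw [if_pos h1], by rw [if_pos h1], ?_⟩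
      rw [h1]; exact Or.inl Sym2.eq_swap
    · by_cases h2 : s(u, v) = s(a, b)
      · refine ⟨c, d, by rw [if_neg h1, if_pos h2], by rw [if_neg h1, if_pos h2], ?_⟩
        rw [h2]; exact Or.inl rfl
      · obtain ⟨x, y, hx, hy, hxy⟩ := hM.partner u v (by tauto)
        refine ⟨x, y, by rw [if_neg h1, if_neg h2, hx], by rw [if_neg h1, if_neg h2, hy],
          Or.inr hxy⟩

/-- The invariant of the computation of the matching. -/
structure MatchInv (G : CCInstance (Fin n)) (lab : Fin n → Fin n) (𝒟 : Set (Sym2 (Sym2 (Fin n))))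
    (S : Set (Fin n × Fin n × Fin n)) (m : Mem) : Prop where
  disjoint : G.IsEdgeDisjointDangerous 𝒟
  matching : HasMatching 𝒟 m
  ptr : PtrInv G lab 𝒟 m
  done : ∀ a b d, (a, b, d) ∈ S → G.pos.Adj a b → G.HostilePair (G.super a) (G.super d) →
    s(a, b) ∈ dangerousEdges 𝒟 ∨
      ∀ c, G.super b = G.super c → G.pos.Adj c d → s(c, d) ∈ dangerousEdges 𝒟

/-- For a, b, d with ab positive and unmatched and S(a), S(d) hostile, any unmatched positive edge
cd with c in S(b) completes a dangerous pair. The triples (a, b, d) number n³, whereas quadruples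
would be too many; the search for c is amortized by the pointers. -/
theorem matchP_spec {m : Mem} (hm : HasInput G m) (h1 : 1 ≤ n)
    (hl : HasLabels G lab m) (hH : HasHostile G lab m) (h7 : ∀ i j, m.idx 7 i j = 0)
    (h10 : ∀ i j, m.idx 10 i j = 0) :
    Yields matchP m fun m' T => T ≤ 1000 * n ^ 3 ∧
      ∃ 𝒟, G.IsMaximalDangerous 𝒟 ∧ HasMatching 𝒟 m' := by
  refine yields_forFin₃ (n := n) (fun S m T => ∃ 𝒟, MatchInv G lab 𝒟 S m ∧
    T ≤ 600 * S.ncard + 200 * ∑ q : Fin n × Fin n, m.idx 10 q.1 q.2)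
    hm.size h1 (by decide) (by decide) (by decide) (by decide) ?_ ?_ ?_ ?_
  · rintro S m m' T ha hn ⟨𝒟, ⟨i1, i2, i3, i4⟩, hT⟩
    have e10 := ha 10 (by decide) (by decide) (by decide)
    refine ⟨𝒟, ⟨i1, i2.of_eq (ha 7 (by decide) (by decide) (by decide))
      (ha 8 (by decide) (by decide) (by decide)) (ha 9 (by decide) (by decide) (by decide)),
      by unfold PtrInv; rw [e10]; exact i3, i4⟩, by rw [e10]; exact hT⟩
  · refine ⟨∅, ⟨⟨by simp, by simp⟩, ⟨?_, ?_⟩, ?_, by simp⟩, by simp⟩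
    · simp [h7, dangerousEdges]
    · simp [dangerousEdges]
    · intro d B; simp [h10]
  · rintro a b d S hS m1 T hs ha hb hd h0 ⟨𝒟, hI, hT⟩
    have hm1 := hm.of_same hs (by decide)
    have el := hl.of_eq (hs.1 5 (by decide))
    have eH : HasHostile G lab m1 := by
      unfold HasHostile; rw [hs.1 6 (by decide)]; exact hH
    have hcard := Set.ncard_insert_of_notMem hS
    -- The set of matched edges only grows, so earlier triples remain settled.
    have hmono : ∀ {𝒟' m'}, G.IsEdgeDisjointDangerous 𝒟' → HasMatching 𝒟' m' → PtrInv G lab 𝒟' m' →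
        (∀ e ∈ dangerousEdges 𝒟, e ∈ dangerousEdges 𝒟') →
        (G.pos.Adj a b → G.HostilePair (G.super a) (G.super d) →
          s(a, b) ∈ dangerousEdges 𝒟' ∨
            ∀ c, G.super b = G.super c → G.pos.Adj c d → s(c, d) ∈ dangerousEdges 𝒟') →
        MatchInv G lab 𝒟' (insert (a, b, d) S) m' := by
      intro 𝒟' m' j1 j2 j3 j4 j5
      refine ⟨j1, j2, j3, ?_⟩
      rintro a' b' d' h hab had
      rcases h with h | h
      · obtain ⟨rfl, rfl, rfl⟩ : a' = a ∧ b' = b ∧ d' = d := by simpa using h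
        exact j5 hab had
      · rcases hI.done a' b' d' h hab had with h' | h'
        · exact Or.inl (j4 _ h')
        · exact Or.inr fun c hc hcd => j4 _ (h' c hc hcd)
    refine yields_branch_skip (fun htest => ?_) (fun htest => ?_)
    · simp only [Test.holds, IExp.eval, ha, hb, hd, el.cell] at htest
      rw [hm1.pos, hI.matching.matched, eH] at htest
      obtain ⟨hab, habD, had⟩ := htest
      refine yields_seq ((advanceP_spec hm1 el hI.matching hI.ptr hb hd).frame.mono ?_)
      rintro m2 T2 ⟨⟨hP2, hT2, hc⟩, hs2⟩
      have el2 := el.of_eq (hs2.1 5 (by decide))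
      have eM2 := hI.matching.of_eq (hs2.1 7 (by decide)) (hs2.1 8 (by decide)) (hs2.1 9 (by decide))
      have hm2 := hm1.of_same hs2 (by decide)
      have ha2 : m2.idx 20 0 0 = a := by rw [hs2.1 20 (by decide), ha]
      have hb2 : m2.idx 21 0 0 = b := by rw [hs2.1 21 (by decide), hb]
      have hd2 : m2.idx 22 0 0 = d := by rw [hs2.1 22 (by decide), hd]
      refine yields_branch_skip (fun htest => ?_) (fun htest => ?_)
      · simp only [Test.holds, IExp.eval, hb2, hd2, el2.cell, hm2.size] at htest
        obtain ⟨c, hc, hcb, hcd, hcdD⟩ := hc.resolve_left (by omega)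
        have hdan : G.IsDangerousPair s(s(a, b), s(c, d)) :=
          ⟨a, b, c, d, rfl, hab, hcd, ((hl.iff _ _).1 hcb).symm, had⟩
        refine yields_exec (by decide) fun T3 hT3 => ⟨insert s(s(a, b), s(c, d)) 𝒟,
          hmono (hI.disjoint.insert hdan habD hcdD) (pairP_spec eM2 ha2 hb2 hd2 (el2.cell b) hc) ?_ ?_ ?_, ?_⟩
        · intro x B
          have := hP2 x B
          have e10 : (pairP.exec m2).idx 10 = m2.idx 10 := by
            obtain ⟨T', -, hr⟩ := run_exec (P := pairP) (by decide) m2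
            exact hr.sameExcept.1 10 (by decide)
          rw [e10]
          refine ⟨this.1, fun y hy hyB hyx => ?_⟩
          rw [mem_dangerousEdges_insert]
          exact Or.inr (Or.inr (this.2 y hy hyB hyx))
        · intro e he
          rw [mem_dangerousEdges_insert]
          exact Or.inr (Or.inr he)
        · intro _ _
          left
          rw [mem_dangerousEdges_insert]
          exact Or.inl rfl
        · have hT3' : T3 ≤ 150 := hT3.trans (by decide)
          have e10 : (pairP.exec m2).idx 10 = m2.idx 10 := by
            obtain ⟨T', -, hr⟩ := run_exec (P := pairP) (by decide) m2
            exact hr.sameExcept.1 10 (by decide)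
          rw [e10]
          simp only [Test.steps, IExp.steps]
          omega
      · simp only [Test.holds, IExp.eval, hb2, hd2, el2.cell, hm2.size] at htest
        refine ⟨𝒟, hmono hI.disjoint eM2 hP2 (fun e he => he) ?_, ?_⟩
        · intro _ _
          right
          intro c hbc hcd
          refine (hP2 d (lab b)).2 c (lt_of_lt_of_le c.2 (not_lt.1 htest)) ?_ hcd
          rw [hl.iff, hbc]
        · simp only [Test.steps, IExp.steps]
          omega
    · simp only [Test.holds, IExp.eval, ha, hb, hd, el.cell] at htest
      rw [hm1.pos, hI.matching.matched, eH] at htest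
      refine ⟨𝒟, hmono hI.disjoint hI.matching hI.ptr (fun e he => he) (fun hab had => ?_), ?_⟩
      · left
        by_contra h
        exact htest ⟨hab, h, had⟩
      · simp only [Test.steps, IExp.steps]
        omega
  · rintro m' T T' hs hT ⟨𝒟, hI, hT'⟩
    refine ⟨?_, 𝒟, isMaximalDangerous_of_forall hI.disjoint ?_, hI.matching⟩
    -- There are n² pointers, each at most n, so all searches together take O(n³) steps.
    · have hsum : ∑ q : Fin n × Fin n, m'.idx 10 q.1 q.2 ≤ ∑ _q : Fin n × Fin n, n :=
        Finset.sum_le_sum fun q _ => (hI.ptr q.1 q.2).1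
      simp only [Finset.sum_const, Finset.card_univ, Fintype.card_prod, Fintype.card_fin,
        smul_eq_mul] at hsum
      simp only [Set.ncard_univ, Nat.card_eq_fintype_card, Fintype.card_prod, Fintype.card_fin] at hT'
      have e1 : n * (n * n) = n ^ 3 := by ring
      have e2 : n * n * n = n ^ 3 := by ring
      rw [e1] at hT'
      rw [e2] at hsum
      omega
    · intro e f hef
      obtain ⟨a, b, c, d, rfl, rfl, hab, hcd, hbc, had⟩ := hef.exists_nodes
      rcases hI.done a b d (Set.mem_univ _) hab had with h | h
      · exact Or.inl h
      · exact Or.inr (h c hbc hcd)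

end RealRAM


namespace CCInstance

/-! ## The linear program as a covering program -/

section

variable {V : Type*} (G : CCInstance V)

/-- The variables: `(true, s(A, B))` for `X⁺_AB` and `(false, s(A, B))` for `X⁻_AB`. -/
abbrev LPVar : Type _ := Bool × Sym2 G.Supernode

noncomputable instance [Fintype V] : Fintype G.LPVar :=
  haveI : Finite G.Supernode := Quot.finite _
  haveI : Finite (Sym2 G.Supernode) := Quot.finite _
  Fintype.ofFinite _

open scoped Classical in
/-- The variable that gives the value of an edge. -/
noncomputable def edgeVar (e : Sym2 V) : G.LPVar := (decide (e ∈ G.pos.edgeSet), e.map G.super)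

/-- The variables of the constraint of a triple of nodes. -/
def triVars (u v w : V) : G.LPVar × G.LPVar × G.LPVar :=
  ((true, s(G.super u, G.super v)), (true, s(G.super v, G.super w)),
    (false, s(G.super u, G.super w)))

/-- The variables of a HEAP constraint. -/
def heapVars (a b c : V) (f : Sym2 V) : G.LPVar × G.LPVar × G.LPVar :=
  ((true, s(G.super a, G.super b)), (true, s(G.super b, G.super c)), (true, f.map G.super))

open scoped Classical in
/-- The covering program of an instance and a set of dangerous pairs. -/
noncomputable def coverProgram [Fintype V] (𝒟 : Set (Sym2 (Sym2 V))) : CoverProgram G.LPVar where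
  w p := ((Finset.univ.filter fun e : Sym2 V => ¬ e.IsDiag ∧ G.edgeVar e = p).card : ℝ)
  zero := {p | (p.1 = true ∧ p.2.IsDiag) ∨
    (p.1 = false ∧ ∃ A B, p.2 = s(A, B) ∧ G.HostilePair A B)}
  con := {t | ∃ u v w, t = G.triVars u v w} ∪ {t | ∃ a b c f, s(s(a, c), f) ∈ 𝒟 ∧
    G.super b ≠ G.super a ∧ G.super b ≠ G.super c ∧ G.pos.Adj a b ∧ G.pos.Adj b c ∧
      t = G.heapVars a b c f}

/-- The point of the linear program given by the values of the variables. -/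
noncomputable def lpPoint (x : G.LPVar → ℝ) : LPPoint G where
  Xpos e := x (true, e)
  Xneg e := x (false, e)
  x e := x (G.edgeVar e)

/-- The values of the variables at a point of the linear program. -/
noncomputable def lpValues (X : LPPoint G) (p : G.LPVar) : ℝ := if p.1 then X.Xpos p.2 else X.Xneg p.2

variable {G} {𝒟 : Set (Sym2 (Sym2 V))}

theorem edgeVar_of_pos {e : Sym2 V} (h : e ∈ G.pos.edgeSet) :
    G.edgeVar e = (true, e.map G.super) := by simp [edgeVar, h]

theorem edgeVar_of_not_pos {e : Sym2 V} (h : e ∉ G.pos.edgeSet) :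
    G.edgeVar e = (false, e.map G.super) := by simp [edgeVar, h]

theorem not_pos_of_neg {e : Sym2 V} (h : e ∈ G.neg.edgeSet) : e ∉ G.pos.edgeSet := by
  induction e with
  | _ u v => exact ((SimpleGraph.compl_adj _ _ _).1 h).2

theorem super_surjective (A : G.Supernode) : ∃ u, G.super u = A := Quot.exists_rep A

variable [Fintype V]

open scoped Classical in
theorem cost_coverProgram (x : G.LPVar → ℝ) :
    (G.coverProgram 𝒟).cost x = ∑ e : Sym2 V with ¬ e.IsDiag, x (G.edgeVar e) := by
  rw [CoverProgram.cost, ← Finset.sum_fiberwise_of_maps_to (g := G.edgeVar)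
    (t := Finset.univ) (fun _ _ => Finset.mem_univ _)]
  refine Finset.sum_congr rfl fun p _ => ?_
  rw [Finset.sum_congr (g := fun _ => x p) rfl fun e he => by rw [(Finset.mem_filter.1 he).2],
    Finset.sum_const, nsmul_eq_mul, Finset.filter_filter]
  rfl

theorem cost_lpPoint (x : G.LPVar → ℝ) : (G.coverProgram 𝒟).cost x = (G.lpPoint x).objective :=
  cost_coverProgram x

theorem cost_lpValues {X : LPPoint G} (hX : G.IsLPFeasible 𝒟 X) :
    (G.coverProgram 𝒟).cost (G.lpValues X) = X.objective := by
  classical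
  rw [cost_coverProgram, LPPoint.objective]
  refine Finset.sum_congr rfl fun e he => ?_
  have he := (Finset.mem_filter.1 he).2
  by_cases h : e ∈ G.pos.edgeSet
  · rw [edgeVar_of_pos h, hX.edge_pos e h]; rfl
  · rw [edgeVar_of_not_pos h, hX.edge_neg e]
    · rfl
    · induction e with
      | _ u v => exact (SimpleGraph.compl_adj _ _ _).2 ⟨by simpa using he, h⟩

/-- The covering program has a triangle constraint for every triple of nodes. When supernodes
coincide, it follows from the values on the diagonal and from X⁺ + X⁻ ≥ 1. -/
theorem lpValues_feasible (hD : G.IsEdgeDisjointDangerous 𝒟) {X : LPPoint G}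
    (hX : G.IsLPFeasible 𝒟 X) : (G.coverProgram 𝒟).Feasible (G.lpValues X) := by
  constructor
  · rintro ⟨b, e⟩
    induction e with
    | _ A B => cases b <;> simp [lpValues, hX.nonneg A B]
  · rintro ⟨b, e⟩ (⟨rfl, h⟩ | ⟨rfl, A, B, rfl, h⟩)
    · induction e with
      | _ A B =>
        simp only [Sym2.mk_isDiag_iff] at h
        subst h
        simp [lpValues, hX.diag]
    · simp [lpValues, hX.hostile A B h]
  · rintro p q r (⟨u, v, w, h⟩ | ⟨a, b, c, f, hf, hba, hbc, hab, hbc', h⟩)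
    · obtain ⟨rfl, rfl, rfl⟩ : p = _ ∧ q = _ ∧ r = _ := by simpa [triVars] using h
      simp only [lpValues, if_true, Bool.false_eq_true, if_false]
      have h1 := hX.nonneg (G.super u) (G.super v)
      have h2 := hX.pair (G.super u) (G.super w)
      by_cases huv : G.super u = G.super v
      · rw [huv] at h2 ⊢
        rw [(hX.diag _).1]
        linarith
      by_cases hvw : G.super v = G.super w
      · rw [hvw, (hX.diag _).1]
        linarith
      by_cases huw : G.super u = G.super w
      · rw [huw, (hX.diag _).2]
        have := (hX.nonneg (G.super w) (G.super v)).1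
        have := (hX.nonneg (G.super v) (G.super w)).1
        linarith
      · exact hX.triangle _ _ _ huv hvw huw
    · obtain ⟨rfl, rfl, rfl⟩ : p = _ ∧ q = _ ∧ r = _ := by simpa [heapVars] using h
      have := hX.heap a b c f hf hba hbc hab hbc'
      have hfp : f ∈ G.pos.edgeSet := by
        obtain ⟨a, b, c, d, -, rfl, -, hcd, -, -⟩ := (hD.1 _ hf).exists_nodes
        exact hcd
      rw [hX.edge_pos _ hfp, hX.x_pos hab, hX.x_pos hbc'] at this
      exact this

open scoped Classical in
theorem weight_eq_zero {p : G.LPVar} (h : ∀ e : Sym2 V, ¬ e.IsDiag → G.edgeVar e ≠ p) :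
    (G.coverProgram 𝒟).w p = 0 := by
  simp only [coverProgram, Nat.cast_eq_zero, Finset.card_eq_zero]
  refine Finset.filter_eq_empty_iff.2 ?_
  rintro e - ⟨h1, h2⟩
  exact h e h1 h2

/-- By consistency no negative edge lies inside a supernode, so the variable X⁻_AA has weight 0. The
equation X⁻_AA = 1 can then be imposed at no cost. The next lemma does the same for X⁺ on hostile
pairs. -/
theorem loose_diag (hG : G.IsConsistent) (A : G.Supernode) :
    (G.coverProgram 𝒟).Loose (false, s(A, A)) := by
  refine ⟨?_, weight_eq_zero fun e he h => ?_⟩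
  · rintro (⟨h, -⟩ | ⟨-, B, C, h, hBC⟩)
    · simp at h
    · obtain ⟨b, c, rfl, rfl, hbc⟩ := hBC
      have h1 : A = G.super b ∧ A = G.super c := by
        rcases Sym2.eq_iff.1 h with ⟨h1, h2⟩ | ⟨h1, h2⟩ <;> exact ⟨by assumption, by assumption⟩
      exact hG.super_ne ⟨b, c, rfl, rfl, hbc⟩ (h1.1.symm.trans h1.2)
  · induction e with
    | _ u v =>
      by_cases hp : s(u, v) ∈ G.pos.edgeSet
      · rw [edgeVar_of_pos hp] at h
        simp at h
      · rw [edgeVar_of_not_pos hp] at h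
        simp only [Sym2.map_mk, Prod.mk.injEq, true_and] at h
        have h1 : G.super u = A ∧ G.super v = A := by
          rcases Sym2.eq_iff.1 h with ⟨h1, h2⟩ | ⟨h1, h2⟩ <;> exact ⟨by assumption, by assumption⟩
        exact hp (hG.1 u v (by simpa using he) (h1.1.trans h1.2.symm))

theorem loose_hostile (hG : G.IsConsistent) {A B : G.Supernode} (hAB : G.HostilePair A B) :
    (G.coverProgram 𝒟).Loose (true, s(A, B)) := by
  have hne : A ≠ B := by
    obtain ⟨a, b, rfl, rfl, hab⟩ := hAB
    exact hG.super_ne ⟨a, b, rfl, rfl, hab⟩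
  refine ⟨?_, weight_eq_zero fun e he h => ?_⟩
  · rintro (⟨-, h⟩ | ⟨h, -⟩)
    · exact hne (by simpa using h)
    · simp at h
  · induction e with
    | _ u v =>
      by_cases hp : s(u, v) ∈ G.pos.edgeSet
      · rw [edgeVar_of_pos hp] at h
        simp only [Sym2.map_mk, Prod.mk.injEq, true_and] at h
        rcases Sym2.eq_iff.1 h with ⟨h1, h2⟩ | ⟨h1, h2⟩
        · exact hG.not_pos (u := u) (v := v) (by rw [h1, h2]; exact hAB) hp
        · exact hG.not_pos (u := u) (v := v) (by rw [h1, h2]; exact hAB.symm) hp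
      · rw [edgeVar_of_not_pos hp] at h
        simp at h

theorem triVars_mem (u v w : V) : G.triVars u v w ∈ (G.coverProgram 𝒟).con :=
  Or.inl ⟨u, v, w, rfl⟩

/-- The equations X = 1 concern loose variables and come from `hloose`; the constraint X⁺ + X⁻ ≥ 1
is the triangle constraint of u, u, v, in which X⁺ vanishes on the diagonal. -/
theorem lpPoint_feasible (hG : G.IsConsistent) {x : G.LPVar → ℝ}
    (hx : (G.coverProgram 𝒟).Feasible x) (hloose : ∀ p, (G.coverProgram 𝒟).Loose p → x p = 1)
    (hD : G.IsEdgeDisjointDangerous 𝒟) :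
    G.IsLPFeasible 𝒟 (G.lpPoint x) := by
  have hdiag : ∀ A, x (true, s(A, A)) = 0 := fun A => hx.zero _ (Or.inl ⟨rfl, by simp⟩)
  constructor
  · intro e he; simp [lpPoint, edgeVar_of_pos he]
  · intro e he; simp [lpPoint, edgeVar_of_not_pos (not_pos_of_neg he)]
  · intro A
    exact ⟨hdiag A, hloose _ (loose_diag hG A)⟩
  · intro A B hAB
    exact ⟨hx.zero _ (Or.inr ⟨rfl, A, B, rfl, hAB⟩), hloose _ (loose_hostile hG hAB)⟩
  · intro A B C _ _ _
    obtain ⟨u, rfl⟩ := super_surjective A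
    obtain ⟨v, rfl⟩ := super_surjective B
    obtain ⟨w, rfl⟩ := super_surjective C
    exact hx.cover _ _ _ (triVars_mem u v w)
  · intro A B
    obtain ⟨u, rfl⟩ := super_surjective A
    obtain ⟨v, rfl⟩ := super_surjective B
    have := hx.cover _ _ _ (triVars_mem u u v)
    rw [hdiag, zero_add] at this
    exact this
  · intro A B
    exact ⟨hx.nonneg _, hx.nonneg _⟩
  · intro a b c f hf hba hbc hab hbc'
    have := hx.cover _ _ _ (Or.inr ⟨a, b, c, f, hf, hba, hbc, hab, hbc', rfl⟩)
    have hfp : f ∈ G.pos.edgeSet := by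
      obtain ⟨a, b, c, d, -, rfl, -, hcd, -, -⟩ := (hD.1 _ hf).exists_nodes
      exact hcd
    simp only [lpPoint]
    rw [edgeVar_of_pos hfp, edgeVar_of_pos (e := s(a, b)) hab, edgeVar_of_pos (e := s(b, c)) hbc']
    exact this

theorem coverProgram_feasible (hD : G.IsEdgeDisjointDangerous 𝒟)
    (h : ∃ 𝒞 : V → V, G.IsFeasible 𝒞) : ∃ x, (G.coverProgram 𝒟).Feasible x := by
  obtain ⟨𝒞, h𝒞⟩ := h
  obtain ⟨φ, hφ⟩ := exists_superMap h𝒞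
  exact ⟨_, lpValues_feasible hD (clusterPoint_isLPFeasible hD h𝒞 hφ)⟩

/-- The weights count edges; the added 1 makes the bound exceed 1. Triangle constraints repeat a
variable only if the outer supernodes coincide, and then X⁻ is loose. In a HEAP constraint, the edge
ρ(ac) joins one of S(a), S(c) to a supernode hostile to the other. It thus cannot run between the
same supernodes as ab or bc, which are positive. -/
theorem coverProgram_regular (hG : G.IsConsistent) (hD : G.IsEdgeDisjointDangerous 𝒟) :
    (G.coverProgram 𝒟).Regular ((Fintype.card V : ℝ) * Fintype.card V + 1) := by
  classical
  constructor
  · intro p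
    simp only [coverProgram]
    rcases Nat.eq_zero_or_pos (Finset.univ.filter fun e : Sym2 V =>
      ¬ e.IsDiag ∧ G.edgeVar e = p).card with h | h
    · left; rw [h]; simp
    · right; exact_mod_cast h
  · have h1 := cost_coverProgram (G := G) (𝒟 := 𝒟) (fun _ => 1)
    simp only [CoverProgram.cost, mul_one, Finset.sum_const, nsmul_eq_mul] at h1
    rw [h1]
    have h2 : (Finset.univ.filter fun e : Sym2 V => ¬ e.IsDiag).card ≤
        Fintype.card V * Fintype.card V := by
      rw [← Fintype.card_prod]
      refine (Finset.card_le_univ _).trans ?_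
      exact Fintype.card_le_of_surjective (fun q : V × V => s(q.1, q.2))
        (fun e => by induction e with | _ u v => exact ⟨(u, v), rfl⟩)
    have h3 : ((Finset.univ.filter fun e : Sym2 V => ¬ e.IsDiag).card : ℝ) ≤
        (Fintype.card V : ℝ) * Fintype.card V := by exact_mod_cast h2
    linarith
  · rintro p q r (⟨u, v, w, h⟩ | ⟨a, b, c, f, hf, hba, hbc, hab, hbc', h⟩)
    · obtain ⟨rfl, rfl, rfl⟩ : p = _ ∧ q = _ ∧ r = _ := by simpa [triVars] using h
      by_cases huw : G.super u = G.super w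
      · right; right; right
        rw [huw]; exact loose_diag hG _
      · left
        refine ⟨?_, by simp, by simp⟩
        simp only [ne_eq, Prod.mk.injEq, true_and, Sym2.eq_iff]
        rintro (⟨h1, h2⟩ | ⟨h1, -⟩)
        · exact huw (h1.trans h2)
        · exact huw h1
    · obtain ⟨rfl, rfl, rfl⟩ : p = _ ∧ q = _ ∧ r = _ := by simpa [heapVars] using h
      left
      obtain ⟨a', c', c'', d, hac, rfl, hac', hcd, h3, h4⟩ := (hD.1 _ hf).exists_nodes
      have hAC : G.super a' ≠ G.super c' := fun h => hG.not_pos (by rw [← h3, ← h]; exact h4) hcd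
      have hcd' : G.super c'' ≠ G.super d := fun h => hG.not_pos (by rw [h3, h]; exact h4) hac'
      simp only [ne_eq, Prod.mk.injEq, true_and, Sym2.eq_iff, Sym2.map_mk, ← h3]
      rw [← h3] at hcd'
      rcases Sym2.eq_iff.1 hac with ⟨rfl, rfl⟩ | ⟨rfl, rfl⟩
      · have hdb : G.super d ≠ G.super b := fun h => hG.not_pos (u := a) (v := b) (h ▸ h4) hab
        have hda := hG.super_ne h4
        refine ⟨?_, ?_, ?_⟩ <;> rintro (⟨h5, h6⟩ | ⟨h5, h6⟩)
        · exact hba h5.symm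
        · exact hAC h5
        · exact hbc h5
        · exact hdb h5.symm
        · exact hAC h5
        · exact hda h5
      · have hdb : G.super d ≠ G.super b := fun h =>
          hG.not_pos (u := c) (v := b) (h ▸ h4) hbc'.symm
        have hda := hG.super_ne h4
        refine ⟨?_, ?_, ?_⟩ <;> rintro (⟨h5, h6⟩ | ⟨h5, h6⟩)
        · exact hba h5.symm
        · exact hAC h5.symm
        · exact hba h5
        · exact hdb h5.symm
        · exact hdb h6.symm
        · exact hba h6

theorem lpPoint_isLPApprox (hG : G.IsConsistent) (hD : G.IsEdgeDisjointDangerous 𝒟)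
    {x : G.LPVar → ℝ} (hx : (G.coverProgram 𝒟).Feasible x)
    (hloose : ∀ p, (G.coverProgram 𝒟).Loose p → x p = 1) {α : ℝ}
    (h : ∀ x', (G.coverProgram 𝒟).Feasible x' →
      (G.coverProgram 𝒟).cost x ≤ α * (G.coverProgram 𝒟).cost x') :
    G.IsLPApprox 𝒟 α (G.lpPoint x) := by
  refine ⟨lpPoint_feasible hG hx hloose hD, fun X' hX' => ?_⟩
  have := h _ (lpValues_feasible hD hX')
  rwa [cost_lpPoint, cost_lpValues hX'] at this

end

end CCInstance


namespace RealRAM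

open CCInstance

variable {n : ℕ} {G : CCInstance (Fin n)} {lab : Fin n → Fin n}

/-! ## Tables of linear program variables -/

/-- The label of a supernode. -/
noncomputable def labelOf (lab : Fin n → Fin n) (A : G.Supernode) : ℕ := lab (Quot.out A)

/-- The address of a variable of the linear program. -/
noncomputable def address (lab : Fin n → Fin n) (p : G.LPVar) : ℕ × ℕ :=
  ((if p.1 then 0 else n) + (p.2.map (labelOf lab)).inf, (p.2.map (labelOf lab)).sup)

/-- The labels determine the supernodes. -/
def IsLabeling (G : CCInstance (Fin n)) (lab : Fin n → Fin n) : Prop :=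
  ∀ u v, lab u = lab v ↔ G.super u = G.super v

theorem labelOf_super (h : IsLabeling G lab) (u : Fin n) :
    labelOf (G := G) lab (G.super u) = lab u := by
  rw [labelOf, Fin.val_inj, h]
  exact Quot.out_eq _

theorem labelOf_injective (h : IsLabeling G lab) :
    Function.Injective (labelOf (G := G) lab) := by
  intro A B hAB
  obtain ⟨u, rfl⟩ := super_surjective A
  obtain ⟨v, rfl⟩ := super_surjective B
  rw [labelOf_super h, labelOf_super h, Fin.val_inj] at hAB
  exact (h u v).1 hAB

theorem address_mk (h : IsLabeling G lab) (b : Bool) (u v : Fin n) :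
    address lab ((b, s(G.super u, G.super v)) : G.LPVar) =
      ((if b then 0 else n) + min (lab u).1 (lab v).1, max (lab u).1 (lab v).1) := by
  simp [address, labelOf_super h]

/-- The row is below n exactly for the positive sign, and an unordered pair is determined by its
minimum and maximum. -/
theorem address_injective (h : IsLabeling G lab) : Function.Injective (address (G := G) lab) := by
  rintro ⟨b, e⟩ ⟨b', e'⟩ hp
  have hlt : ∀ e : Sym2 G.Supernode, (e.map (labelOf lab)).inf < n := by
    intro e
    induction e with
    | _ A B =>
      rw [Sym2.map_mk, Sym2.inf_mk]
      exact lt_of_le_of_lt inf_le_left (Fin.is_lt _)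
  have h1 := hlt e
  have h2 := hlt e'
  simp only [address, Prod.mk.injEq] at hp
  have hb : b = b' := by
    cases b <;> cases b' <;> simp at hp ⊢ <;> omega
  subst hb
  have := Sym2.inf_eq_inf_and_sup_eq_sup.1 ⟨Nat.add_left_cancel hp.1, hp.2⟩
  rw [Sym2.map.injective (labelOf_injective h) this]

/-- The array `a` contains the values `x` of the variables. -/
def HasTable (lab : Fin n → Fin n) (a : ℕ) (x : G.LPVar → ℝ) (m : Mem) : Prop :=
  ∀ p, m.num a (address lab p).1 (address lab p).2 = x p

theorem HasTable.of_eq {a : ℕ} {x : G.LPVar → ℝ} {m m' : Mem} (h : HasTable lab a x m)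
    (h' : m'.num a = m.num a) : HasTable lab a x m' := by
  unfold HasTable; rw [h']; exact h

theorem address_eq_iff (h : IsLabeling G lab) {p q : G.LPVar} :
    ((address lab p).1 = (address lab q).1 ∧ (address lab p).2 = (address lab q).2) ↔ p = q := by
  rw [← Prod.ext_iff]
  exact (address_injective h).eq_iff

/-- The address of a variable, given expressions for two nodes. -/
abbrev rowE (b : Bool) (u v : IExp) : IExp :=
  .add (if b then .lit 0 else sc 0) (.sub (col 5 u) (.sub (col 5 u) (col 5 v)))

/-- The second part of the address. -/
abbrev colE (u v : IExp) : IExp := .add (col 5 u) (.sub (col 5 v) (col 5 u))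

/-- An entry of a table of variables. -/
abbrev varE (a : ℕ) (b : Bool) (u v : IExp) : NExp := .cell a (rowE b u v) (colE u v)

/-- Assignment to an entry of a table of variables. -/
abbrev setVar (a : ℕ) (b : Bool) (u v : IExp) (e : NExp) : Prog :=
  .setNum a (rowE b u v) (colE u v) e

/-- With truncated subtraction, a − (a − b) is the minimum; likewise a + (b − a) is the maximum. -/
theorem rowE_eval {m : Mem} (h : IsLabeling G lab) (hl : HasLabels G lab m) (hn : m.idx 0 0 0 = n)
    (b : Bool) {u v : IExp} {u' v' : Fin n} (hu : u.eval m = u') (hv : v.eval m = v') :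
    (rowE b u v).eval m = (address lab ((b, s(G.super u', G.super v')) : G.LPVar)).1 := by
  rw [address_mk h]
  cases b <;> simp [hu, hv, hl.cell, hn] <;> omega

theorem colE_eval {m : Mem} (h : IsLabeling G lab) (hl : HasLabels G lab m)
    (b : Bool) {u v : IExp} {u' v' : Fin n} (hu : u.eval m = u') (hv : v.eval m = v') :
    (colE u v).eval m = (address lab ((b, s(G.super u', G.super v')) : G.LPVar)).2 := by
  rw [address_mk h]
  simp [hu, hv, hl.cell]
  omega

/-- The data computed before the linear program is solved. -/
structure HasData (G : CCInstance (Fin n)) (lab : Fin n → Fin n) (𝒟 : Set (Sym2 (Sym2 (Fin n))))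
    (m : Mem) : Prop where
  input : HasInput G m
  labels : HasLabels G lab m
  hostile : HasHostile G lab m
  matching : HasMatching 𝒟 m

variable {𝒟 : Set (Sym2 (Sym2 (Fin n)))}

theorem HasData.of_same {m m' : Mem} {I N : List ℕ} (h : HasData G lab 𝒟 m)
    (hs : SameExcept I N m m') (hI : ∀ a ∈ I, 10 ≤ a) : HasData G lab 𝒟 m' := by
  have key : ∀ a < 10, m'.idx a = m.idx a := fun a ha =>
    hs.1 a fun h' => by have := hI a h'; omega
  refine ⟨h.input.of_same hs fun a ha => by have := hI a ha; omega, h.labels.of_eq (key 5 (by norm_num)),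
    ?_, h.matching.of_eq (key 7 (by norm_num)) (key 8 (by norm_num)) (key 9 (by norm_num))⟩
  unfold HasHostile
  rw [key 6 (by norm_num)]
  exact h.hostile

theorem HasData.labeling {m : Mem} (h : HasData G lab 𝒟 m) : IsLabeling G lab := h.labels.iff

theorem HasData.varE_eval {m : Mem} (h : HasData G lab 𝒟 m) {a : ℕ} {x : G.LPVar → ℝ}
    (hx : HasTable lab a x m) (b : Bool) {u v : IExp} {u' v' : Fin n} (hu : u.eval m = u')
    (hv : v.eval m = v') : (varE a b u v).eval m = x (b, s(G.super u', G.super v')) := by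
  rw [NExp.eval, rowE_eval h.labeling h.labels h.input.size b hu hv,
    colE_eval h.labeling h.labels b hu hv, hx]

theorem HasData.exec_setVar {m : Mem} (h : HasData G lab 𝒟 m) (a : ℕ) (b : Bool) {u v : IExp}
    {u' v' : Fin n} (hu : u.eval m = u') (hv : v.eval m = v') (e : NExp) :
    (setVar a b u v e).exec m = m.writeNum a
      (address lab ((b, s(G.super u', G.super v')) : G.LPVar)).1
      (address lab ((b, s(G.super u', G.super v')) : G.LPVar)).2 (e.eval m) := by
  rw [Prog.exec, rowE_eval h.labeling h.labels h.input.size b hu hv,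
    colE_eval h.labeling h.labels b hu hv]

/-- Two nested loops over all nodes around the programs `P` and `P'` for the two signs. -/
def fillP (P P' : Prog) : Prog := forP 20 (forP 21 (.seq P P'))

/-- Looping over node pairs writes a variable once for every pair of representatives. This does no
harm, since the written value depends only on the variable. -/
theorem fillP_spec {m : Mem} (h : HasData G lab 𝒟 m) (h1 : 1 ≤ n) {P P' : Prog} {N : List ℕ} {c : ℕ}
    (g : ℕ → G.LPVar → ℝ) {Q : Mem → ℕ → Prop}
    (hP : P.loopFree = true) (hP' : P'.loopFree = true) (hI : P.idxWrites = []) (hI' : P'.idxWrites = [])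
    (hN : ∀ a ∈ P.numWrites ++ P'.numWrites, a ∈ N) (hc : P.maxSteps + P'.maxSteps ≤ c)
    (hexec : ∀ u v : Fin n, ∀ m', SameExcept [20, 21] N m m' → m'.idx 20 0 0 = u →
      m'.idx 21 0 0 = v → HasData G lab 𝒟 m' → ∀ a ∈ N, ∀ i j,
      ((P.exec m').num a i j =
        if i = (address lab ((true, s(G.super u, G.super v)) : G.LPVar)).1 ∧
          j = (address lab ((true, s(G.super u, G.super v)) : G.LPVar)).2 then
          g a (true, s(G.super u, G.super v)) else m'.num a i j) ∧
      ((P'.exec m').num a i j =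
        if i = (address lab ((false, s(G.super u, G.super v)) : G.LPVar)).1 ∧
          j = (address lab ((false, s(G.super u, G.super v)) : G.LPVar)).2 then
          g a (false, s(G.super u, G.super v)) else m'.num a i j))
    (final : ∀ m' T, SameExcept [20, 21] N m m' → T ≤ (c + 56) * n ^ 2 →
      (∀ a ∈ N, HasTable lab a (g a) m') → Q m' T) :
    Yields (fillP P P') m Q := by
  classical
  have hl := h.labeling
  refine yields_table (n := n) (c := c) (fun S m' => ∀ a ∈ N, ∀ b : Bool, ∀ u v, (u, v) ∈ S →
    m'.num a (address lab ((b, s(G.super u, G.super v)) : G.LPVar)).1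
      (address lab ((b, s(G.super u, G.super v)) : G.LPVar)).2 = g a (b, s(G.super u, G.super v)))
    h.input.size h1 ?_ ?_ ?_ ?_ ?_ ?_ ?_ ?_ ?_
  · simp [Prog.idxWrites, hI, hI']
  · simp [Prog.idxWrites, hI, hI']
  · simp [Prog.idxWrites, hI, hI']
  · simp [Prog.loopFree, hP, hP']
  · exact hc
  · intro S m1 m2 _ hn hI
    rw [hn]; exact hI
  · simp
  · intro u v S _ m' hs hu hv h0 hI' a ha b u' v' huv
    have hs' : SameExcept [20, 21] N m m' := hs.mono (by simp [Prog.idxWrites, *]) hN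
    have hd' := h.of_same hs' (by decide)
    obtain ⟨T, -, hr⟩ := run_exec hP m'
    have hs2 : SameExcept [20, 21] N m' (P.exec m') :=
      hr.sameExcept.mono (by simp [hI]) fun a ha => hN a (by simp [ha])
    have hidx : (P.exec m').idx = m'.idx := funext fun a => hr.sameExcept.1 a (by simp [hI])
    have e1 := (hexec u v m' hs' hu hv hd' a ha
      (address lab ((b, s(G.super u', G.super v')) : G.LPVar)).1
      (address lab ((b, s(G.super u', G.super v')) : G.LPVar)).2).1
    have e2 := (hexec u v (P.exec m') (hs'.trans hs2) (by rw [hidx, hu]) (by rw [hidx, hv])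
      (hd'.of_same hs2 (by decide)) a ha
      (address lab ((b, s(G.super u', G.super v')) : G.LPVar)).1
      (address lab ((b, s(G.super u', G.super v')) : G.LPVar)).2).2
    rw [if_congr (address_eq_iff hl) rfl rfl] at e1 e2
    rw [Prog.exec, e2, e1]
    split_ifs with h3 h4
    · rw [h3]
    · rw [h4]
    · rcases huv with huv | huv
      · obtain ⟨rfl, rfl⟩ : u' = u ∧ v' = v := by simpa using huv
        cases b
        · exact (h3 rfl).elim
        · exact (h4 rfl).elim
      · exact hI' a ha b u' v' huv
  · intro m' T hs hT hI3
    refine final m' T (hs.mono ?_ ?_) hT ?_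
    · simp [forP, Prog.idxWrites, hI, hI']
    · intro a ha
      exact hN a (by simpa [forP, Prog.numWrites] using ha)
    · rintro a ha ⟨b, e⟩
      induction e with
      | _ A B =>
        obtain ⟨u, rfl⟩ := super_surjective A
        obtain ⟨v, rfl⟩ := super_surjective B
        exact hI3 a ha b u v (Set.mem_univ _)

end RealRAM


namespace RealRAM

open CCInstance

variable {n : ℕ} {G : CCInstance (Fin n)} {lab : Fin n → Fin n} {𝒟 : Set (Sym2 (Sym2 (Fin n)))}

/-! ## Sums over the pairs of distinct nodes -/

open scoped Classical in
/-- The sum over the ordered pairs in `S`. -/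
noncomputable def pairSum (S : Set (Fin n × Fin n)) (f : Sym2 (Fin n) → ℝ) : ℝ :=
  ∑ q : Fin n × Fin n with q ∈ S ∧ q.1 < q.2, f s(q.1, q.2)

theorem pairSum_empty (f : Sym2 (Fin n) → ℝ) : pairSum ∅ f = 0 := by simp [pairSum]

theorem pairSum_insert {S : Set (Fin n × Fin n)} {u v : Fin n} (h : (u, v) ∉ S)
    (f : Sym2 (Fin n) → ℝ) :
    pairSum (insert (u, v) S) f = pairSum S f + if u < v then f s(u, v) else 0 := by
  classical
  rw [pairSum, pairSum]
  split_ifs with huv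
  · rw [add_comm, ← Finset.sum_insert (f := fun q : Fin n × Fin n => f s(q.1, q.2)) (a := (u, v))
      (by simp [h])]
    congr 1
    ext ⟨a, b⟩
    simp only [Set.mem_insert_iff, Prod.mk.injEq, Finset.mem_filter, Finset.mem_univ, true_and,
      Finset.mem_insert]
    constructor
    · rintro ⟨h1 | h1, h2⟩
      · exact Or.inl h1
      · exact Or.inr ⟨h1, h2⟩
    · rintro (⟨rfl, rfl⟩ | ⟨h1, h2⟩)
      · exact ⟨Or.inl ⟨rfl, rfl⟩, huv⟩
      · exact ⟨Or.inr h1, h2⟩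
  · rw [add_zero]
    congr 1
    ext ⟨a, b⟩
    simp only [Set.mem_insert_iff, Prod.mk.injEq, Finset.mem_filter, Finset.mem_univ, true_and]
    constructor
    · rintro ⟨⟨rfl, rfl⟩ | h1, h2⟩
      · exact (huv h2).elim
      · exact ⟨h1, h2⟩
    · rintro ⟨h1, h2⟩
      exact ⟨Or.inr h1, h2⟩

open scoped Classical in
theorem pairSum_univ (f : Sym2 (Fin n) → ℝ) :
    pairSum Set.univ f = ∑ e : Sym2 (Fin n) with ¬ e.IsDiag, f e := by
  have := Finset.sum_sym2_filter_not_isDiag (Finset.univ : Finset (Fin n)) f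
  rw [pairSum]
  convert this.symm using 2
  · ext ⟨a, b⟩
    simp only [Set.mem_univ, true_and, Finset.mem_filter, Finset.mem_univ, Finset.mem_offDiag]
    exact ⟨fun h => ⟨h.ne, h⟩, fun h => h.2⟩
  · ext e; simp

/-! ## Parameters and weights -/

/-- Compute the parameters of the multiplicative weights method. -/
def paramP : Prog :=
  .seq (setRsc 10 (.div (rsc 0) (.ofIdx (.lit 12))))
  (.seq (setRsc 11 (.add (.mul (.ofIdx (sc 0)) (.ofIdx (sc 0))) (.ofIdx (.lit 1))))
  (.seq (setRsc 12 (.mul (.ofIdx (.lit 3)) (rsc 11)))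
  (.seq (setRsc 17 (.ofIdx (.lit 0)))
  (.seq (.loop (.ltNum (.mul (rsc 17) (rsc 10)) (.ofIdx (.lit 1)))
    (.seq (setRsc 12 (.mul (rsc 12) (rsc 11))) (setRsc 17 (.add (rsc 17) (.ofIdx (.lit 1))))))
  (setRsc 18 (.mul (.ofIdx (.lit 2)) (rsc 12)))))))

/-- Reals cannot be rounded, so 1/η is not available as an integer; a real counter is raised until
kη ≥ 1 while M is multiplied up. The threshold is Θ = 3M·Mᵏ, and loose variables get length 2Θ. -/
theorem paramP_spec {m : Mem} {ε η M : ℝ} (hε : m.num 0 0 0 = ε) (hn : m.idx 0 0 0 = n)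
    (hε0 : 0 < ε) (hη : η = ε / 12) (hM : M = n * n + 1) :
    Yields paramP m fun m' T => ∃ k : ℕ, 1 ≤ k * η ∧ k * η ≤ 1 + η ∧ T ≤ 60 * k + 300 ∧
      m'.num 10 0 0 = η ∧ m'.num 11 0 0 = M ∧ m'.num 12 0 0 = 3 * M * M ^ k ∧ m'.num 18 0 0 = 2 * (3 * M * M ^ k) := by
  have hη0 : 0 < η := by rw [hη]; positivity
  refine yields_seq (yields_exec rfl fun T1 hT1 => yields_seq (yields_exec rfl fun T2 hT2 =>
    yields_seq (yields_exec rfl fun T3 hT3 => yields_seq (yields_exec rfl fun T4 hT4 =>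
      yields_seq ?_))))
  have hT1' : T1 ≤ 20 := hT1.trans (by decide)
  have hT2' : T2 ≤ 20 := hT2.trans (by decide)
  have hT3' : T3 ≤ 20 := hT3.trans (by decide)
  have hT4' : T4 ≤ 20 := hT4.trans (by decide)
  refine yields_loop (60 * ⌈(1 + η) / η⌉₊) (fun m' T => ∃ k : ℕ, k * η ≤ 1 + η ∧ T ≤ 60 * k ∧
    m'.num 10 0 0 = η ∧ m'.num 11 0 0 = M ∧ m'.num 17 0 0 = k ∧ m'.num 12 0 0 = 3 * M * M ^ k)
    ?_ ?_ ?_ ?_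
  · rintro m' T ⟨k, hk, hT, -⟩
    refine hT.trans (Nat.mul_le_mul_left _ ?_)
    have : (k : ℝ) ≤ ⌈(1 + η) / η⌉₊ := le_trans (by rwa [le_div_iff₀ hη0]) (Nat.le_ceil _)
    exact_mod_cast this
  · refine ⟨0, by simp; positivity, by simp, ?_⟩
    simp [hε, hη, hn, hM]
  · rintro m' T - ⟨k, hk, hT, e10, e11, e17, e12⟩ htest
    simp only [Test.holds, NExp.eval, IExp.eval, e17, e10, Nat.cast_one] at htest
    refine yields_exec rfl fun T' hT' => ⟨k + 1, ?_, ?_, ?_⟩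
    · push_cast; linarith
    · have hT'' : T' ≤ 30 := hT'.trans (by decide)
      simp only [Test.steps, NExp.steps, IExp.steps]
      omega
    · simp [e10, e11, e17, e12, pow_succ, mul_assoc]
  · rintro m' T - ⟨k, hk, hT, e10, e11, e17, e12⟩ htest
    simp only [Test.holds, NExp.eval, IExp.eval, e17, e10, Nat.cast_one, not_lt] at htest
    refine yields_exec rfl fun T' hT' => ⟨k, htest, hk, ?_, ?_⟩
    · have hT'' : T' ≤ 20 := hT'.trans (by decide)
      simp only [Test.steps, NExp.steps, IExp.steps]
      omega
    · simp [e10, e11, e12]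

/-- The body of the computation of the weights. -/
def weightStep : Prog :=
  .branch (.ltIdx (sc 20) (sc 21)) (.branch (posI (.cell 1 (sc 20) (sc 21)))
    (setVar 1 true (sc 20) (sc 21) (.add (varE 1 true (sc 20) (sc 21)) (.ofIdx (.lit 1))))
    (setVar 1 false (sc 20) (sc 21) (.add (varE 1 false (sc 20) (sc 21)) (.ofIdx (.lit 1))))) .skip

/-- Compute the weights of the variables. -/
def weightsP : Prog := forP 20 (forP 21 weightStep)

theorem edgeVar_mk {V : Type*} {G : CCInstance V} (u v : V) [Decidable (G.pos.Adj u v)] :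
    G.edgeVar s(u, v) = (decide (G.pos.Adj u v), s(G.super u, G.super v)) := by
  simp [edgeVar]

theorem HasTable.write {a : ℕ} {x : G.LPVar → ℝ} {m : Mem} (h : IsLabeling G lab)
    (hx : HasTable lab a x m) [DecidableEq G.LPVar] (p : G.LPVar) (r : ℝ) :
    HasTable lab a (Function.update x p r)
      (m.writeNum a (address lab p).1 (address lab p).2 r) := by
  intro q
  rw [Mem.writeNum_num, Function.update_apply, hx q]
  refine if_congr ?_ rfl rfl
  rw [← address_eq_iff h]
  simp

theorem weightsP_spec {m : Mem} (h : HasData G lab 𝒟 m) (h1 : 1 ≤ n)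
    (hw : ∀ i j, m.num 1 i j = 0) :
    Yields weightsP m fun m' T => T ≤ 200 * n ^ 2 ∧ HasTable lab 1 (G.coverProgram 𝒟).w m' := by
  classical
  refine yields_table (n := n) (c := 100) (fun S m' => HasTable lab 1
    (fun p : G.LPVar => pairSum S fun e => if G.edgeVar e = p then 1 else 0) m')
    h.input.size h1 (by decide) (by decide) (by decide) (by decide) (by decide) ?_ ?_ ?_ ?_
  · intro S m1 m2 _ hn hI
    exact hI.of_eq (by rw [hn])
  · intro p
    simp only [pairSum_empty, hw]
  · intro u v S huv m' hs hu hv h0 hI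
    have hd := h.of_same hs (by decide)
    have hpos := hd.input.pos u v
    rw [weightStep, Prog.exec]
    simp only [Test.holds, IExp.eval, hu, hv, Fin.lt_def.symm]
    simp only [pairSum_insert huv]
    by_cases huv' : u < v
    · simp only [if_pos huv']
      have key : ∀ b : Bool, G.edgeVar s(u, v) = (b, s(G.super u, G.super v)) →
          HasTable lab 1 (fun p : G.LPVar => (pairSum S fun e => if G.edgeVar e = p then 1 else 0) +
            if G.edgeVar s(u, v) = p then 1 else 0)
          ((setVar 1 b (sc 20) (sc 21) (.add (varE 1 b (sc 20) (sc 21)) (.ofIdx (.lit 1)))).exec m') := by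
        intro b hb
        rw [hd.exec_setVar 1 b (u := sc 20) (v := sc 21) hu hv, NExp.eval,
          hd.varE_eval hI b (u := sc 20) (v := sc 21) hu hv]
        convert hI.write hd.labeling (b, s(G.super u, G.super v)) _ using 1
        funext p
        rw [Function.update_apply, hb]
        by_cases hp : p = (b, s(G.super u, G.super v))
        · subst hp; simp
        · rw [if_neg hp, if_neg (Ne.symm hp), add_zero]
      rw [Prog.exec]
      simp only [Test.holds, IExp.eval, hu, hv, hpos]
      by_cases hadj : G.pos.Adj u v
      · rw [if_pos hadj]; exact key true (by simp [edgeVar_mk, hadj])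
      · rw [if_neg hadj]; exact key false (by simp [edgeVar_mk, hadj])
    · simp only [if_neg huv', add_zero]
      exact hI
  · intro m' T hs hT hI
    refine ⟨hT.trans (Nat.mul_le_mul_right _ (by norm_num)), fun p => ?_⟩
    rw [hI p, coverProgram]
    simp only [pairSum_univ, Finset.sum_ite, Finset.sum_const_zero, add_zero, Finset.sum_const, nsmul_eq_mul,
      mul_one, Finset.filter_filter]
    congr!

/-- The value of the variable of a node pair, depending on its sign, is added to the scalar 14. -/
def costStep : Prog :=
  .branch (.ltIdx (sc 20) (sc 21)) (.branch (posI (.cell 1 (sc 20) (sc 21)))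
    (setRsc 14 (.add (rsc 14) (varE 2 true (sc 20) (sc 21))))
    (setRsc 14 (.add (rsc 14) (varE 2 false (sc 20) (sc 21))))) .skip

/-- Compute the total weighted length. -/
def costP : Prog := .seq (setRsc 14 (.ofIdx (.lit 0))) (forP 20 (forP 21 costStep))

theorem costP_spec {m : Mem} (h : HasData G lab 𝒟 m) (h1 : 1 ≤ n) {L : G.LPVar → ℝ}
    (hL : HasTable lab 2 L m) :
    Yields costP m fun m' T => T ≤ 200 * n ^ 2 ∧ m'.num 14 0 0 = (G.coverProgram 𝒟).cost L := by
  classical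
  refine yields_seq (yields_exec rfl fun T hT => ?_)
  have hT' : T ≤ 10 := hT.trans (by decide)
  refine yields_table (n := n) (c := 100) (fun S m' => m'.num 14 0 0 =
      pairSum S fun e => L (G.edgeVar e))
    (by simp [h.input.size]) h1 (by decide) (by decide) (by decide) (by decide) (by decide) ?_ ?_ ?_ ?_
  · intro S m1 m2 _ hn hI
    rw [hn]; exact hI
  · simp [pairSum_empty]
  · intro u v S huv m' hs hu hv h0 hI
    have hd := (h.of_same (m' := (setRsc 14 (.ofIdx (.lit 0))).exec m) (I := []) (N := [14])
      ⟨fun _ _ => rfl, fun a ha => by funext i j; simp at ha; simp [ha]⟩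
        (by decide)).of_same hs (by decide)
    have hL' : HasTable lab 2 L m' := hL.of_eq (by
      rw [hs.2 2 (by decide)]; funext i j; simp)
    have hpos := hd.input.pos u v
    rw [costStep, Prog.exec]
    simp only [Test.holds, IExp.eval, hu, hv, Fin.lt_def.symm]
    rw [pairSum_insert huv]
    by_cases huv' : u < v
    · simp only [if_pos huv']
      rw [Prog.exec]
      simp only [Test.holds, IExp.eval, hu, hv, hpos]
      by_cases hadj : G.pos.Adj u v
      · rw [if_pos hadj, Prog.exec, NExp.eval, hd.varE_eval hL' true (u := sc 20) (v := sc 21) hu hv,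
          edgeVar_mk]
        simp [hI, hadj]
      · rw [if_neg hadj, Prog.exec, NExp.eval, hd.varE_eval hL' false (u := sc 20) (v := sc 21) hu hv,
          edgeVar_mk]
        simp [hI, hadj]
    · simp only [if_neg huv', add_zero]
      exact hI
  · intro m' T' hs hT2 hI
    refine ⟨?_, by rw [hI, pairSum_univ, cost_coverProgram]; congr!⟩
    have : 1 ≤ n ^ 2 := Nat.one_le_pow _ _ h1
    omega

end RealRAM


namespace RealRAM

open CCInstance

variable {n : ℕ} {G : CCInstance (Fin n)} {lab : Fin n → Fin n} {𝒟 : Set (Sym2 (Sym2 (Fin n)))}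

/-! ## Initial lengths and candidate solutions -/

theorem HasData.of_idx {m m' : Mem} (h : HasData G lab 𝒟 m) (h' : m'.idx = m.idx) :
    HasData G lab 𝒟 m' := by
  refine ⟨h.input.congr fun a _ => by rw [h'], h.labels.of_eq (by rw [h']), ?_,
    h.matching.of_eq (by rw [h']) (by rw [h']) (by rw [h'])⟩
  unfold HasHostile
  rw [h']
  exact h.hostile

/-- Initialize the length and the rate of a variable; `z` tests whether it is fixed to zero. -/
def initVar (b : Bool) (z : Test) : Prog :=
  .branch z
    (.seq (setVar 2 b (sc 20) (sc 21) (.ofIdx (.lit 0)))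
      (setVar 3 b (sc 20) (sc 21) (.ofIdx (.lit 0))))
    (.seq (setVar 3 b (sc 20) (sc 21) (.div (.ofIdx (.lit 1)) (varE 1 b (sc 20) (sc 21))))
      (.branch (.ltNum (varE 1 b (sc 20) (sc 21)) (.ofIdx (.lit 1)))
        (setVar 2 b (sc 20) (sc 21) (rsc 18))
        (setVar 2 b (sc 20) (sc 21) (.div (.ofIdx (.lit 1)) (varE 1 b (sc 20) (sc 21))))))

/-- Since weights are 0 or at least 1, the test w < 1 detects loose variables. Their rate is 1/0 =
0, both in the program and in the definition. -/
theorem exec_initVar {m : Mem} {M big : ℝ} (h : HasData G lab 𝒟 m) {b : Bool} {z : Test}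
    {u v : Fin n} (hu : m.idx 20 0 0 = u) (hv : m.idx 21 0 0 = v)
    (hS : (G.coverProgram 𝒟).Regular M)
    (hw : HasTable lab 1 (G.coverProgram 𝒟).w m) (hbig : m.num 18 0 0 = big)
    (hz : z.holds m ↔ (b, s(G.super u, G.super v)) ∈ (G.coverProgram 𝒟).zero) (a : ℕ)
    (ha : a ∈ [2, 3]) (i j : ℕ) :
    ((initVar b z).exec m).num a i j =
      if i = (address lab ((b, s(G.super u, G.super v)) : G.LPVar)).1 ∧
          j = (address lab ((b, s(G.super u, G.super v)) : G.LPVar)).2 then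
        (if a = 2 then (G.coverProgram 𝒟).init big else (G.coverProgram 𝒟).rate)
          (b, s(G.super u, G.super v))
      else m.num a i j := by
  classical
  rw [initVar, Prog.exec, hz]
  set p : G.LPVar := (b, s(G.super u, G.super v)) with hp
  set S := G.coverProgram 𝒟
  have hu' : (sc 20).eval m = u := hu
  have hv' : (sc 21).eval m = v := hv
  have hwv : (varE 1 b (sc 20) (sc 21)).eval m = S.w p := h.varE_eval hw b hu' hv'
  by_cases hzero : p ∈ S.zero
  · rw [if_pos hzero, Prog.exec, h.exec_setVar 2 b hu' hv',
      (h.of_idx (Mem.writeNum_idx _ _ _ _ _)).exec_setVar 3 b (u := sc 20) (v := sc 21) (u' := u) (v' := v) hu' hv']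
    have e1 : S.init big p = 0 := by simp [CoverProgram.init, hzero]
    have e2 : S.rate p = 0 := by simp [CoverProgram.rate, hzero]
    simp only [List.mem_cons, List.not_mem_nil, or_false] at ha
    rcases ha with rfl | rfl <;> simp [e1, e2, ← hp]
  · rw [if_neg hzero, Prog.exec, h.exec_setVar 3 b hu' hv', Prog.exec, NExp.eval, hwv, ← hp]
    set m2 := m.writeNum 3 (address lab p).1 (address lab p).2
      ((NExp.ofIdx (IExp.lit 1)).eval m / S.w p) with hm2
    have h2 : HasData G lab 𝒟 m2 := h.of_idx (Mem.writeNum_idx _ _ _ _ _)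
    have hwv2 : (varE 1 b (sc 20) (sc 21)).eval m2 = S.w p :=
      h2.varE_eval (u' := u) (v' := v) (hw.of_eq (by funext i j; simp [hm2])) b hu' hv'
    have e2 : S.rate p = 1 / S.w p := by simp [CoverProgram.rate, hzero]
    have e18 : (rsc 18).eval m2 = big := by simp [hm2, hbig]
    simp only [List.mem_cons, List.not_mem_nil, or_false] at ha
    by_cases hw0 : S.w p = 0
    · have e1 : S.init big p = big := by simp [CoverProgram.init, hzero, hw0]
      rw [if_pos (by rw [Test.holds, hwv2, hw0]; simp),
        h2.exec_setVar 2 b (u := sc 20) (v := sc 21) (u' := u) (v' := v) hu' hv', e18, ← hp]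
      rcases ha with rfl | rfl <;> simp [e1, e2, hm2]
    · have e1 : S.init big p = 1 / S.w p := by simp [CoverProgram.init, hzero, hw0]
      have := (hS.weight p).resolve_left hw0
      rw [if_neg (by rw [Test.holds, hwv2]; simpa using this),
        h2.exec_setVar 2 b (u := sc 20) (v := sc 21) (u' := u) (v' := v) hu' hv', NExp.eval, hwv2, ← hp]
      rcases ha with rfl | rfl <;> simp [e1, e2, hm2]

/-- Initialize the lengths and the rates. -/
def initP : Prog :=
  fillP (initVar true (eqI (col 5 (sc 20)) (col 5 (sc 21))))
    (initVar false (posI (.cell 6 (col 5 (sc 20)) (col 5 (sc 21)))))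

theorem initP_spec {m : Mem} {M big : ℝ} (h : HasData G lab 𝒟 m) (h1 : 1 ≤ n)
    (hS : (G.coverProgram 𝒟).Regular M)
    (hw : HasTable lab 1 (G.coverProgram 𝒟).w m) (hbig : m.num 18 0 0 = big) :
    Yields initP m fun m' T => T ≤ 1100 * n ^ 2 ∧
      HasTable lab 2 ((G.coverProgram 𝒟).init big) m' ∧
      HasTable lab 3 (G.coverProgram 𝒟).rate m' := by
  refine fillP_spec h h1 (N := [2, 3]) (c := 1000)
    (fun a => if a = 2 then (G.coverProgram 𝒟).init big else (G.coverProgram 𝒟).rate)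
    (by decide) (by decide) (by decide) (by decide) (by decide) (by decide) ?_ ?_
  · intro u v m' hs hu hv hd a ha i j
    have hw' : HasTable lab 1 (G.coverProgram 𝒟).w m' := hw.of_eq (hs.2 1 (by decide))
    have hbig' : m'.num 18 0 0 = big := by rw [hs.2 18 (by decide), hbig]
    refine ⟨exec_initVar hd hu hv hS hw' hbig' ?_ a ha i j,
      exec_initVar hd hu hv hS hw' hbig' ?_ a ha i j⟩
    · rw [eqI_holds]
      simp only [IExp.eval, hu, hv, hd.labels.cell, Fin.val_inj, hd.labels.iff]
      simp [coverProgram]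
    · simp only [Test.holds, IExp.eval, hu, hv, hd.labels.cell]
      rw [hd.hostile]
      simp only [coverProgram, Set.mem_ofPred_eq, Bool.false_eq_true, false_and, true_and, false_or]
      constructor
      · intro hh; exact ⟨_, _, rfl, hh⟩
      · rintro ⟨A, B, hAB, hh⟩
        rcases Sym2.eq_iff.1 hAB with ⟨e1, e2⟩ | ⟨e1, e2⟩
        · rwa [e1, e2]
        · rw [e1, e2]; exact hh.symm
  · intro m' T hs hT ht
    refine ⟨hT.trans (Nat.mul_le_mul_right _ (by norm_num)), ?_, ?_⟩
    · simpa using ht 2 (by decide)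
    · simpa using ht 3 (by decide)

/-- Set a variable of the best solution to `e` if `t` holds, and to `e'` otherwise. -/
def bestVar (b : Bool) (t : Test) (e e' : NExp) : Prog :=
  .branch t (setVar 4 b (sc 20) (sc 21) e) (setVar 4 b (sc 20) (sc 21) e')

theorem exec_bestVar {m : Mem} (h : HasData G lab 𝒟 m) {b : Bool} {t : Test} {e e' : NExp} {x : ℝ}
    {u v : Fin n} (hu : m.idx 20 0 0 = u) (hv : m.idx 21 0 0 = v)
    (ht : t.holds m → e.eval m = x) (ht' : ¬ t.holds m → e'.eval m = x) (a : ℕ)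
    (ha : a ∈ [4]) (i j : ℕ) :
    ((bestVar b t e e').exec m).num a i j =
      if i = (address lab ((b, s(G.super u, G.super v)) : G.LPVar)).1 ∧
          j = (address lab ((b, s(G.super u, G.super v)) : G.LPVar)).2 then x
      else m.num a i j := by
  obtain rfl : a = 4 := by simpa using ha
  rw [bestVar, Prog.exec]
  by_cases hb : t.holds m
  · rw [if_pos hb, h.exec_setVar 4 b (u := sc 20) (v := sc 21) hu hv, ht hb]; simp
  · rw [if_neg hb, h.exec_setVar 4 b (u := sc 20) (v := sc 21) hu hv, ht' hb]; simp

/-- A program that sets the best solution to a function of the lengths. -/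
def bestP (t : NExp → Test) (e e' : NExp → NExp) : Prog :=
  fillP (bestVar true (t (varE 2 true (sc 20) (sc 21))) (e (varE 2 true (sc 20) (sc 21)))
      (e' (varE 2 true (sc 20) (sc 21))))
    (bestVar false (t (varE 2 false (sc 20) (sc 21))) (e (varE 2 false (sc 20) (sc 21)))
      (e' (varE 2 false (sc 20) (sc 21))))

theorem bestP_spec {m : Mem} (h : HasData G lab 𝒟 m) (h1 : 1 ≤ n) {L : G.LPVar → ℝ}
    (hL : HasTable lab 2 L m) {t : NExp → Test} {e e' : NExp → NExp} {g : ℝ → ℝ} {c : ℕ}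
    (hc : ∀ b b', (bestVar b (t (varE 2 b (sc 20) (sc 21))) (e (varE 2 b (sc 20) (sc 21)))
      (e' (varE 2 b (sc 20) (sc 21)))).maxSteps +
      (bestVar b' (t (varE 2 b' (sc 20) (sc 21))) (e (varE 2 b' (sc 20) (sc 21)))
      (e' (varE 2 b' (sc 20) (sc 21)))).maxSteps ≤ c)
    (hg : ∀ m' f y, (∀ a, a ≠ 4 → m'.num a = m.num a) → f.eval m' = y →
      ((t f).holds m' → (e f).eval m' = g y) ∧ (¬ (t f).holds m' → (e' f).eval m' = g y)) :
    Yields (bestP t e e') m fun m' T => T ≤ (c + 56) * n ^ 2 ∧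
      HasTable lab 4 (fun p => g (L p)) m' := by
  refine fillP_spec h h1 (N := [4]) (c := c) (fun _ p => g (L p))
    (by rfl) (by rfl) (by rfl) (by rfl) ?_ (hc true false) ?_ ?_
  · simp [bestVar, Prog.numWrites]
  · intro u v m' hs hu hv hd a ha i j
    have hL' : HasTable lab 2 L m' := hL.of_eq (hs.2 2 (by decide))
    have key := fun b : Bool => hg m' _ _ (fun a ha => hs.2 a (by simpa using ha))
      (hd.varE_eval hL' b (u := sc 20) (v := sc 21) hu hv)
    exact ⟨exec_bestVar hd hu hv (key true).1 (key true).2 a ha i j,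
      exec_bestVar hd hu hv (key false).1 (key false).2 a ha i j⟩
  · intro m' T hs hT ht
    exact ⟨hT, ht 4 (by decide)⟩

/-- Copy the scaled lengths, truncated at one. -/
def copyP : Prog :=
  bestP (fun f => .ltNum f (rsc 13)) (fun f => .div f (rsc 13)) (fun _ => .ofIdx (.lit 1))

theorem copyP_spec {m : Mem} (h : HasData G lab 𝒟 m) (h1 : 1 ≤ n) {L : G.LPVar → ℝ} {α : ℝ}
    (hL : HasTable lab 2 L m) (hα : m.num 13 0 0 = α) (hα0 : 0 < α) :
    Yields copyP m fun m' T => T ≤ 500 * n ^ 2 ∧ HasTable lab 4 (fun p => min 1 (L p / α)) m' := by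
  refine (bestP_spec h h1 hL (g := fun y => min 1 (y / α)) (c := 400) (by decide) ?_).mono ?_
  · intro m' f y hs hf
    have e : m'.num 13 0 0 = α := by rw [hs 13 (by decide)]; exact hα
    simp only [Test.holds, hf, NExp.eval, IExp.eval, e]
    refine ⟨fun hy => ?_, fun hy => ?_⟩
    · rw [min_eq_right]
      rw [div_le_one hα0]; exact hy.le
    · rw [min_eq_left]
      · simp
      · rw [le_div_iff₀ hα0]; linarith
  · rintro m' T ⟨hT, ht⟩
    exact ⟨hT.trans (Nat.mul_le_mul_right _ (by norm_num)), ht⟩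

/-- The solution of cost zero. -/
def trivialP : Prog :=
  bestP (fun f => .ltNum f (rsc 18)) (fun _ => .ofIdx (.lit 0)) (fun _ => .ofIdx (.lit 1))

theorem trivialP_spec {m : Mem} (h : HasData G lab 𝒟 m) (h1 : 1 ≤ n) {L : G.LPVar → ℝ} {big : ℝ}
    (hL : HasTable lab 2 L m) (hbig : m.num 18 0 0 = big) :
    Yields trivialP m fun m' T => T ≤ 500 * n ^ 2 ∧
      HasTable lab 4 (fun p => if L p < big then 0 else 1) m' := by
  refine (bestP_spec h h1 hL (g := fun y => if y < big then 0 else 1) (c := 400) (by decide) ?_).mono ?_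
  · intro m' f y hs hf
    have e : m'.num 18 0 0 = big := by rw [hs 18 (by decide)]; exact hbig
    simp only [Test.holds, hf, NExp.eval, IExp.eval, e]
    exact ⟨fun hy => by simp [hy], fun hy => by simp [hy]⟩
  · rintro m' T ⟨hT, ht⟩
    exact ⟨hT.trans (Nat.mul_le_mul_right _ (by norm_num)), ht⟩

end RealRAM


/-! ### Monotonicity of the lengths and standing assumptions -/

namespace CoverProgram

variable {ι : Type*} [Fintype ι]

theorem le_update [DecidableEq ι] {S : CoverProgram ι} {M η : ℝ} {L : ι → ℝ} (hS : S.Regular M)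
    (hη : 0 ≤ η) (hL : ∀ t, 0 ≤ L t) (p q r t : ι) : L t ≤ S.update η L p q r t := by
  rw [update]
  split_ifs
  · refine le_mul_of_one_le_right (hL t) ?_
    have h1 := rate_nonneg hS t
    have h2 : 0 ≤ max (S.rate p) (max (S.rate q) (S.rate r)) := le_max_of_le_left (rate_nonneg hS p)
    have : 0 ≤ η * S.rate t / max (S.rate p) (max (S.rate q) (S.rate r)) := by positivity
    linarith
  · exact le_rfl

/-- The standing assumptions of the multiplicative weights method. -/
structure Admissible (S : CoverProgram ι) (M η big : ℝ) : Prop where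
  regular : S.Regular M
  feasible : ∃ x, S.Feasible x
  eta_pos : 0 < η
  eta_le : η ≤ 1
  one_lt : 1 < M
  one_le_big : 1 ≤ big

theorem Admissible.log_pos {S : CoverProgram ι} {M η big : ℝ} (h : S.Admissible M η big) :
    0 < Real.log (1 + η) := Real.log_pos (by linarith [h.eta_pos])

end CoverProgram

namespace RealRAM

open CCInstance

variable {n : ℕ} {G : CCInstance (Fin n)} {lab : Fin n → Fin n} {𝒟 : Set (Sym2 (Sym2 (Fin n)))}

/-! ## The multiplicative weights method -/

theorem IExp.eval_congr {m m' : Mem} (h : m'.idx = m.idx) (e : IExp) : e.eval m' = e.eval m := by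
  induction e with
  | lit => rfl
  | cell a i j hi hj => simp [hi, hj, h]
  | add e f he hf => simp [he, hf]
  | sub e f he hf => simp [he, hf]

/-- The memory in the course of the method: the lengths `L`, the rates, and the parameters. -/
structure Stage (lab : Fin n → Fin n) (S : CoverProgram G.LPVar) (η big α b : ℝ)
    (L : G.LPVar → ℝ) (m : Mem) : Prop where
  length : HasTable lab 2 L m
  rate : HasTable lab 3 S.rate m
  eta : m.num 10 0 0 = η
  alpha : m.num 13 0 0 = α
  lengths : S.Lengths big L
  progress : S.Progress η big b L
  bound : b * α ≤ S.cost L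

/-- The pair of expressions `A` evaluates to the address of the variable `p`. -/
def IsAt (lab : Fin n → Fin n) (m : Mem) (A : IExp × IExp) (p : G.LPVar) : Prop :=
  A.1.eval m = (address lab p).1 ∧ A.2.eval m = (address lab p).2

theorem IsAt.congr {m m' : Mem} {A : IExp × IExp} {p : G.LPVar} (h : IsAt lab m A p)
    (h' : m'.idx = m.idx) : IsAt lab m' A p :=
  ⟨(IExp.eval_congr h' _).trans h.1, (IExp.eval_congr h' _).trans h.2⟩

theorem IsAt.cell {m : Mem} {A : IExp × IExp} {p : G.LPVar} (h : IsAt lab m A p) {a : ℕ}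
    {x : G.LPVar → ℝ} (hx : HasTable lab a x m) : (NExp.cell a A.1 A.2).eval m = x p := by
  rw [NExp.eval, h.1, h.2, hx]

/-- The test whether the constraint for the variables at `A`, `B`, `C` is violated. -/
def relaxTest (A B C : IExp × IExp) : Test :=
  .ltNum (.add (.add (.cell 2 A.1 A.2) (.cell 2 B.1 B.2)) (.cell 2 C.1 C.2))
    (.mul (.add (.ofIdx (.lit 1)) (rsc 10)) (rsc 13))

/-- The largest rate. -/
def maxRateP (A B C : IExp × IExp) : Prog :=
  .seq (setRsc 16 (.cell 3 A.1 A.2))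
  (.seq (.branch (.ltNum (rsc 16) (.cell 3 B.1 B.2)) (setRsc 16 (.cell 3 B.1 B.2)) .skip)
    (.branch (.ltNum (rsc 16) (.cell 3 C.1 C.2)) (setRsc 16 (.cell 3 C.1 C.2)) .skip))

/-- The update of the length at `A`. -/
def scaleP (A : IExp × IExp) : Prog :=
  .setNum 2 A.1 A.2 (.mul (.cell 2 A.1 A.2) (.add (.ofIdx (.lit 1))
    (.div (.mul (rsc 10) (.cell 3 A.1 A.2)) (rsc 16))))

/-- The update of the lengths. -/
def relaxBody (A B C : IExp × IExp) : Prog :=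
  .seq (maxRateP A B C) (.seq (scaleP A) (.seq (scaleP B) (scaleP C)))

/-- Update the lengths until the constraint is satisfied. -/
def relaxP (A B C : IExp × IExp) : Prog := .loop (relaxTest A B C) (relaxBody A B C)

theorem exec_maxRateP {m : Mem} {A B C : IExp × IExp} {p q r : G.LPVar} {x : G.LPVar → ℝ}
    (hA : IsAt lab m A p) (hB : IsAt lab m B q) (hC : IsAt lab m C r) (hx : HasTable lab 3 x m) :
    (maxRateP A B C).exec m = m.writeNum 16 0 0 (max (x p) (max (x q) (x r))) := by
  have hw : ∀ y y', (m.writeNum 16 0 0 y).writeNum 16 0 0 y' = m.writeNum 16 0 0 y' := by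
    intro y y'
    simp only [Mem.writeNum, Mem.mk.injEq, true_and]
    funext a i j
    split_ifs <;> rfl
  have e : ∀ y, HasTable lab 3 x (m.writeNum 16 0 0 y) := fun y =>
    hx.of_eq (by funext i j; simp)
  have eB : ∀ y, (NExp.cell 3 B.1 B.2).eval (m.writeNum 16 0 0 y) = x q := fun y =>
    (hB.congr (Mem.writeNum_idx _ _ _ _ _)).cell (e y)
  have eC : ∀ y, (NExp.cell 3 C.1 C.2).eval (m.writeNum 16 0 0 y) = x r := fun y =>
    (hC.congr (Mem.writeNum_idx _ _ _ _ _)).cell (e y)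
  have es : ∀ y, (rsc 16).eval (m.writeNum 16 0 0 y) = y := fun y => by simp
  have e1 : ∀ y, Prog.exec (setRsc 16 (.cell 3 B.1 B.2)) (m.writeNum 16 0 0 y) =
      m.writeNum 16 0 0 (x q) := fun y => by rw [Prog.exec, eB]; exact hw _ _
  have e2 : ∀ y, Prog.exec (setRsc 16 (.cell 3 C.1 C.2)) (m.writeNum 16 0 0 y) =
      m.writeNum 16 0 0 (x r) := fun y => by rw [Prog.exec, eC]; exact hw _ _
  have e0 : Prog.exec (setRsc 16 (.cell 3 A.1 A.2)) m = m.writeNum 16 0 0 (x p) := by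
    rw [Prog.exec, hA.cell hx]; rfl
  have e3 : ∀ y, Prog.exec (.branch (.ltNum (rsc 16) (.cell 3 B.1 B.2))
      (setRsc 16 (.cell 3 B.1 B.2)) .skip) (m.writeNum 16 0 0 y) =
      m.writeNum 16 0 0 (max y (x q)) := by
    intro y
    rw [Prog.exec, Test.holds, eB, es, e1]
    split_ifs with h
    · rw [max_eq_right h.le]
    · rw [max_eq_left (not_lt.1 h)]; rfl
  have e4 : ∀ y, Prog.exec (.branch (.ltNum (rsc 16) (.cell 3 C.1 C.2))
      (setRsc 16 (.cell 3 C.1 C.2)) .skip) (m.writeNum 16 0 0 y) =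
      m.writeNum 16 0 0 (max y (x r)) := by
    intro y
    rw [Prog.exec, Test.holds, eC, es, e2]
    split_ifs with h
    · rw [max_eq_right h.le]
    · rw [max_eq_left (not_lt.1 h)]; rfl
  have hseq : ∀ (P P' : Prog) (m : Mem), Prog.exec (.seq P P') m = P'.exec (P.exec m) :=
    fun _ _ _ => rfl
  rw [maxRateP, hseq, hseq, e0, e3, e4, max_assoc]

theorem exec_scaleP {m : Mem} {A : IExp × IExp} {p : G.LPVar} {L x : G.LPVar → ℝ} {η s : ℝ}
    (h : IsLabeling G lab) [DecidableEq G.LPVar]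
    (hA : IsAt lab m A p) (hL : HasTable lab 2 L m) (hx : HasTable lab 3 x m)
    (hη : m.num 10 0 0 = η) (hs : m.num 16 0 0 = s) :
    HasTable lab 2 (Function.update L p (L p * (1 + η * x p / s))) ((scaleP A).exec m) ∧
      ((scaleP A).exec m).idx = m.idx ∧ ∀ a, a ≠ 2 → ((scaleP A).exec m).num a = m.num a := by
  have e2 := hA.cell hL
  have e3 := hA.cell hx
  rw [NExp.eval] at e2 e3
  refine ⟨?_, rfl, fun a ha => ?_⟩
  · rw [scaleP, Prog.exec, hA.1, hA.2]
    convert hL.write h p _ using 3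
    simp [e2, e3, hη, hs]
  · funext i j
    simp [scaleP, ha]

/-- The three lengths are rescaled one after the other; because the variables are distinct, this is
the simultaneous update. -/
theorem exec_relaxBody {m : Mem} {A B C : IExp × IExp} {p q r : G.LPVar} {L : G.LPVar → ℝ} {η : ℝ}
    {S : CoverProgram G.LPVar} (h : IsLabeling G lab) [DecidableEq G.LPVar]
    (hA : IsAt lab m A p) (hB : IsAt lab m B q) (hC : IsAt lab m C r)
    (hL : HasTable lab 2 L m) (hx : HasTable lab 3 S.rate m)
    (hη : m.num 10 0 0 = η) (hpq : p ≠ q) (hqr : q ≠ r) (hpr : p ≠ r) :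
    HasTable lab 2 (S.update η L p q r) ((relaxBody A B C).exec m) ∧
      ((relaxBody A B C).exec m).idx = m.idx ∧
      ∀ a, a ≠ 2 → a ≠ 16 → ((relaxBody A B C).exec m).num a = m.num a := by
  rw [relaxBody, Prog.exec, exec_maxRateP hA hB hC hx]
  set s := max (S.rate p) (max (S.rate q) (S.rate r)) with hs
  set m1 := m.writeNum 16 0 0 s with hm1
  have i1 : m1.idx = m.idx := rfl
  have n1 : ∀ a, a ≠ 16 → m1.num a = m.num a := fun a ha => by funext i j; simp [hm1, ha]
  have s1 : m1.num 16 0 0 = s := by simp [hm1]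
  obtain ⟨t2, i2, n2⟩ := exec_scaleP h (hA.congr i1) (hL.of_eq (n1 2 (by decide)))
    (hx.of_eq (n1 3 (by decide))) (by rw [n1 10 (by decide), hη]) s1
  rw [Prog.exec]
  set m2 := (scaleP A).exec m1
  obtain ⟨t3, i3, n3⟩ := exec_scaleP h (hB.congr (i2.trans i1)) t2
    (hx.of_eq (by rw [n2 3 (by decide), n1 3 (by decide)]))
    (by rw [n2 10 (by decide), n1 10 (by decide), hη]) (by rw [n2 16 (by decide), s1])
  rw [Prog.exec]
  set m3 := (scaleP B).exec m2
  obtain ⟨t4, i4, n4⟩ := exec_scaleP h (hC.congr (i3.trans (i2.trans i1))) t3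
    (hx.of_eq (by rw [n3 3 (by decide), n2 3 (by decide), n1 3 (by decide)]))
    (by rw [n3 10 (by decide), n2 10 (by decide), n1 10 (by decide), hη])
    (by rw [n3 16 (by decide), n2 16 (by decide), s1])
  refine ⟨?_, i4.trans (i3.trans (i2.trans i1)), fun a h1 h2 => ?_⟩
  · convert t4 using 1
    funext t
    rw [CoverProgram.update, ← hs]
    simp only [Function.update_apply]
    by_cases h1 : t = p
    · subst h1; simp [hpq, hpr]
    · by_cases h2 : t = q
      · subst h2; simp [hpq.symm, hqr]
      · by_cases h3 : t = r
        · subst h3; simp [hpr.symm, hqr.symm]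
        · simp [h1, h2, h3]
  · rw [n4 a h1, n3 a h1, n2 a h1, n1 a h2]

theorem relaxTest_holds {m : Mem} {A B C : IExp × IExp} {p q r : G.LPVar} {L : G.LPVar → ℝ}
    {η big α b : ℝ} {S : CoverProgram G.LPVar} (hst : Stage lab S η big α b L m)
    (hA : IsAt lab m A p) (hB : IsAt lab m B q) (hC : IsAt lab m C r) :
    (relaxTest A B C).holds m ↔ L p + L q + L r < (1 + η) * α := by
  have e1 := hA.cell hst.length
  have e2 := hB.cell hst.length
  have e3 := hC.cell hst.length
  have e4 := hst.eta
  have e5 := hst.alpha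
  simp only [NExp.eval] at e1 e2 e3
  simp only [relaxTest, Test.holds, NExp.eval, IExp.eval, e1, e2, e3, e4, e5, Nat.cast_one]

/-- Each update is paid by an increase of the potential by log(1 + η); the extra term pays for the
final failing test. -/
theorem relaxP_spec {m : Mem} {A B C : IExp × IExp} {p q r : G.LPVar} {L : G.LPVar → ℝ}
    {M η big α b : ℝ} {S : CoverProgram G.LPVar} {K : ℕ} (h : IsLabeling G lab)
    (hS : S.Admissible M η big) (hα : 0 < α) (hαbig : (1 + η) * α ≤ big)
    (hst : Stage lab S η big α b L m)
    (hA : IsAt lab m A p) (hB : IsAt lab m B q) (hC : IsAt lab m C r) (hcon : (p, q, r) ∈ S.con)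
    (hK : (relaxBody A B C).maxSteps + (relaxTest A B C).steps + 1 ≤ K) :
    Yields (relaxP A B C) m fun m' T => ∃ L', Stage lab S η big α b L' m' ∧ (∀ t, L t ≤ L' t) ∧
      S.cost L ≤ S.cost L' ∧ (1 + η) * α ≤ L' p + L' q + L' r ∧
      T * Real.log (1 + η) ≤ K * (S.potential L' - S.potential L) + K * Real.log (1 + η) := by
  classical
  have hlog := hS.log_pos
  -- Termination comes from the absolute upper bound for the potential.
  refine yields_loop ⌊K * (M * Real.log (M * (2 * big)) - S.potential L) / Real.log (1 + η)⌋₊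
    (fun m' T => ∃ L', Stage lab S η big α b L' m' ∧ (∀ t, L t ≤ L' t) ∧
      S.cost L ≤ S.cost L' ∧
      T * Real.log (1 + η) ≤ K * (S.potential L' - S.potential L)) ?_ ?_ ?_ ?_
  · rintro m' T ⟨L', hst', -, -, hT⟩
    refine Nat.le_floor ?_
    rw [le_div_iff₀ hlog]
    refine hT.trans ?_
    gcongr
    exact CoverProgram.potential_le hS.regular hS.one_lt.le hS.one_le_big hst'.lengths
  · exact ⟨L, hst, fun _ => le_rfl, le_rfl, by simp⟩
  · rintro m' T hs ⟨L', hst', hLL, hcost, hT⟩ htest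
    have hidx : m'.idx = m.idx := funext fun a => hs.1 a (by
      simp [relaxBody, maxRateP, scaleP, Prog.idxWrites])
    have hA' := hA.congr hidx
    have hB' := hB.congr hidx
    have hC' := hC.congr hidx
    have hviol := (relaxTest_holds hst' hA' hB' hC').1 htest
    obtain ⟨u1, u2, u3, u4, hpq, hqr, hpr, -⟩ := CoverProgram.update_spec hS.regular hS.feasible
      hS.eta_pos hS.eta_le hα hαbig hst'.lengths hst'.progress hst'.bound hcon hviol
    obtain ⟨e1, e2, e3⟩ := exec_relaxBody (S := S) h hA' hB' hC' hst'.length hst'.rate hst'.eta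
      hpq hqr hpr
    refine yields_exec rfl fun T' hT' => ⟨S.update η L' p q r, ?_, fun t => (hLL t).trans ?_,
      hcost.trans u3, ?_⟩
    · exact ⟨e1, hst'.rate.of_eq (e3 3 (by decide) (by decide)),
        by rw [e3 10 (by decide) (by decide)]; exact hst'.eta,
        by rw [e3 13 (by decide) (by decide)]; exact hst'.alpha, u1, u2, hst'.bound.trans u3⟩
    · exact CoverProgram.le_update hS.regular hS.eta_pos.le
        (hst'.lengths.nonneg hS.regular (by linarith [hS.one_le_big])) p q r t
    · have hTK : (T' : ℝ) + (relaxTest A B C).steps + 1 ≤ K := by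
        exact_mod_cast le_trans (by omega) hK
      push_cast
      nlinarith
  · rintro m' T hs ⟨L', hst', hLL, hcost, hT⟩ htest
    have hidx : m'.idx = m.idx := funext fun a => hs.1 a (by
      simp [relaxBody, maxRateP, scaleP, Prog.idxWrites])
    have hviol : (1 + η) * α ≤ L' p + L' q + L' r := by
      rwa [relaxTest_holds hst' (hA.congr hidx) (hB.congr hidx) (hC.congr hidx), not_lt] at htest
    refine ⟨L', hst', hLL, hcost, hviol, ?_⟩
    have hTK : ((relaxTest A B C).steps : ℝ) + 1 ≤ K := by
      exact_mod_cast le_trans (by omega) hK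
    push_cast
    nlinarith

end RealRAM


/-! ### Sweeps over all constraints and phases -/

namespace RealRAM

open CCInstance

variable {n : ℕ} {G : CCInstance (Fin n)} {lab : Fin n → Fin n} {𝒟 : Set (Sym2 (Sym2 (Fin n)))}

theorem Stage.congr {S : CoverProgram G.LPVar} {η big α b : ℝ} {L : G.LPVar → ℝ} {m m' : Mem}
    (h : Stage lab S η big α b L m) (h2 : m'.num 2 = m.num 2) (h3 : m'.num 3 = m.num 3)
    (h10 : m'.num 10 = m.num 10) (h13 : m'.num 13 = m.num 13) :
    Stage lab S η big α b L m' :=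
  ⟨h.length.of_eq h2, h.rate.of_eq h3, by rw [h10]; exact h.eta, by rw [h13]; exact h.alpha,
    h.lengths, h.progress, h.bound⟩

/-- The address of the variable with sign `b` of a pair of nodes. -/
abbrev adrE (b : Bool) (u v : IExp) : IExp × IExp := (rowE b u v, colE u v)

theorem HasData.isAt {m : Mem} (h : HasData G lab 𝒟 m) (b : Bool) {u v : IExp} {u' v' : Fin n}
    (hu : u.eval m = u') (hv : v.eval m = v') :
    IsAt lab m (adrE b u v) ((b, s(G.super u', G.super v')) : G.LPVar) :=
  ⟨rowE_eval h.labeling h.labels h.input.size b hu hv, colE_eval h.labeling h.labels b hu hv⟩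

/-- Enforce the constraint of a triple of nodes. -/
def triP : Prog :=
  relaxP (adrE true (sc 20) (sc 21)) (adrE true (sc 21) (sc 22)) (adrE false (sc 20) (sc 22))

/-- The test whether there is a HEAP constraint for a triple of nodes. -/
def heapTest : Test :=
  .conj (posI (.cell 7 (sc 20) (sc 22)))
  (.conj (.neg (eqI (col 5 (sc 21)) (col 5 (sc 20))))
  (.conj (.neg (eqI (col 5 (sc 21)) (col 5 (sc 22))))
  (.conj (posI (.cell 1 (sc 20) (sc 21))) (posI (.cell 1 (sc 21) (sc 22))))))

/-- Enforce a HEAP constraint. -/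
def heapP : Prog :=
  relaxP (adrE true (sc 20) (sc 21)) (adrE true (sc 21) (sc 22))
    (adrE true (.cell 8 (sc 20) (sc 22)) (.cell 9 (sc 20) (sc 22)))

/-- Enforce all constraints. -/
def sweepP : Prog := forP 20 (forP 21 (forP 22 (.seq triP (.branch heapTest heapP .skip))))

/-- The lengths `L` satisfy the constraint `t` with right hand side `c`. -/
def Covers {ι : Type*} (c : ℝ) (L : ι → ℝ) (t : ι × ι × ι) : Prop := c ≤ L t.1 + L t.2.1 + L t.2.2

theorem Covers.mono {ι : Type*} {c : ℝ} {L L' : ι → ℝ} {t : ι × ι × ι} (h : Covers c L t)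
    (hL : ∀ p, L p ≤ L' p) : Covers c L' t := by
  have := hL t.1; have := hL t.2.1; have := hL t.2.2
  unfold Covers at *
  linarith

theorem heapVars_mem {V : Type*} [Fintype V] {G : CCInstance V} {𝒟 : Set (Sym2 (Sym2 V))}
    {u v w : V} {f : Sym2 V} (h1 : s(s(u, w), f) ∈ 𝒟)
    (h2 : G.super v ≠ G.super u) (h3 : G.super v ≠ G.super w) (h4 : G.pos.Adj u v)
    (h5 : G.pos.Adj v w) : G.heapVars u v w f ∈ (G.coverProgram 𝒟).con :=
  Or.inr ⟨u, v, w, f, h1, h2, h3, h4, h5, rfl⟩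

/-- Lengths never decrease, so a constraint brought to (1 + η)α stays there. One pass over the
triples therefore suffices, and its updates are charged to the potential. -/
theorem sweepP_spec {m : Mem} (h : HasData G lab 𝒟 m) (h1 : 1 ≤ n)
    (hD : G.IsEdgeDisjointDangerous 𝒟) {L : G.LPVar → ℝ} {M η big α b : ℝ}
    (hS : (G.coverProgram 𝒟).Admissible M η big) (hα : 0 < α) (hαbig : (1 + η) * α ≤ big)
    (hst : Stage lab (G.coverProgram 𝒟) η big α b L m) :
    Yields sweepP m fun m' T => ∃ L', Stage lab (G.coverProgram 𝒟) η big α b L' m' ∧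
      (G.coverProgram 𝒟).cost L ≤ (G.coverProgram 𝒟).cost L' ∧
      (∀ t ∈ (G.coverProgram 𝒟).con, Covers ((1 + η) * α) L' t) ∧
      T * Real.log (1 + η) ≤
        1000 * ((G.coverProgram 𝒟).potential L' - (G.coverProgram 𝒟).potential L) +
        3000 * n ^ 3 * Real.log (1 + η) := by
  set S := G.coverProgram 𝒟 with hSdef
  have hlog := hS.log_pos
  refine yields_forFin₃ (n := n) (fun W m' T => ∃ L', Stage lab S η big α b L' m' ∧
    S.cost L ≤ S.cost L' ∧ (∀ u v w, (u, v, w) ∈ W → Covers ((1 + η) * α) L' (G.triVars u v w) ∧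
      ∀ f, s(s(u, w), f) ∈ 𝒟 → G.super v ≠ G.super u → G.super v ≠ G.super w → G.pos.Adj u v →
        G.pos.Adj v w → Covers ((1 + η) * α) L' (G.heapVars u v w f)) ∧
    T * Real.log (1 + η) ≤ 1000 * (S.potential L' - S.potential L) +
      2100 * W.ncard * Real.log (1 + η))
    h.input.size h1 (by decide) (by decide) (by decide) (by decide) ?_ ?_ ?_ ?_
  · rintro W m1 m2 T _ hn ⟨L', hL', hI⟩
    exact ⟨L', hL'.congr (by rw [hn]) (by rw [hn]) (by rw [hn]) (by rw [hn]), hI⟩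
  · exact ⟨L, hst, le_rfl, by simp, by simp⟩
  · rintro u v w W hW m1 T hs hu hv hw h0 ⟨L1, hL1, hcost1, hcov1, hT1⟩
    have hd := h.of_same hs (by decide)
    refine yields_seq ((relaxP_spec (K := 1000) hd.labeling hS hα hαbig hL1
      (hd.isAt true (u := sc 20) (v := sc 21) hu hv) (hd.isAt true (u := sc 21) (v := sc 22) hv hw)
      (hd.isAt false (u := sc 20) (v := sc 22) hu hw) (triVars_mem u v w) (by decide)).frame.mono ?_)
    rintro m2 T2 ⟨⟨L2, hL2, hle2, hcost2, hcov2, hT2⟩, hs2⟩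
    have hd2 := hd.of_same hs2 (by decide)
    have hu2 : m2.idx 20 0 0 = u := by rw [hs2.1 20 (by decide), hu]
    have hv2 : m2.idx 21 0 0 = v := by rw [hs2.1 21 (by decide), hv]
    have hw2 : m2.idx 22 0 0 = w := by rw [hs2.1 22 (by decide), hw]
    have htest : heapTest.holds m2 ↔ s(u, w) ∈ dangerousEdges 𝒟 ∧ G.super v ≠ G.super u ∧
        G.super v ≠ G.super w ∧ G.pos.Adj u v ∧ G.pos.Adj v w := by
      rw [heapTest, ← hd2.matching.matched, ← hd2.input.pos, ← hd2.input.pos]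
      simp only [Test.holds, IExp.eval, hu2, hv2, hw2, hd2.labels.cell]
      rw [ne_eq, ne_eq, ← hd2.labels.iff, ← hd2.labels.iff, ← Fin.val_inj, ← Fin.val_inj]
      constructor
      · rintro ⟨e1, e2, e3, e4⟩; exact ⟨e1, by omega, by omega, e4⟩
      · rintro ⟨e1, e2, e3, e4⟩; exact ⟨e1, by omega, by omega, e4⟩
    have hsteps : heapTest.steps ≤ 90 := by decide
    have hcard := Set.ncard_insert_of_notMem hW
    refine yields_branch_skip (fun hb => ?_) (fun hb => ?_)
    · obtain ⟨b1, b2, b3, b4, b5⟩ := htest.1 hb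
      obtain ⟨c, d, hc, hd', hcd⟩ := hd2.matching.partner u w b1
      refine (relaxP_spec (K := 1000) hd2.labeling hS hα hαbig hL2
        (hd2.isAt true (u := sc 20) (v := sc 21) hu2 hv2)
        (hd2.isAt true (u := sc 21) (v := sc 22) hv2 hw2)
        (hd2.isAt true (u := .cell 8 (sc 20) (sc 22)) (v := .cell 9 (sc 20) (sc 22)) (u' := c)
          (v' := d) (by simp [hu2, hw2, hc]) (by simp [hu2, hw2, hd']))
        (heapVars_mem (f := s(c, d)) hcd b2 b3 b4 b5) (by decide)).mono ?_
      rintro m3 T3 ⟨L3, hL3, hle3, hcost3, hcov3, hT3⟩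
      refine ⟨L3, hL3, hcost1.trans (hcost2.trans hcost3), ?_, ?_⟩
      · intro u' v' w' hmem
        rcases hmem with hmem | hmem
        · obtain ⟨rfl, rfl, rfl⟩ : u' = u ∧ v' = v ∧ w' = w := by simpa using hmem
          refine ⟨Covers.mono hcov2 hle3, fun f hf _ _ _ _ => ?_⟩
          -- The stored partner is the only one, by edge-disjointness, so no other HEAP constraint
          -- exists for this triple.
          have hff := hD.2 _ hf _ hcd s(u', w') (Sym2.mem_mk_left _ _) (Sym2.mem_mk_left _ _)
          obtain rfl := Sym2.congr_right.1 hff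
          exact hcov3
        · obtain ⟨e1, e2⟩ := hcov1 u' v' w' hmem
          refine ⟨(e1.mono hle2).mono hle3, fun f f1 f2 f3 f4 f5 =>
            ((e2 f f1 f2 f3 f4 f5).mono hle2).mono hle3⟩
      · rw [hcard]
        have : (heapTest.steps : ℝ) ≤ 90 := by exact_mod_cast hsteps
        have := mul_le_mul_of_nonneg_right this hlog.le
        push_cast at hT2 hT3 ⊢
        linarith
    · refine ⟨L2, hL2, hcost1.trans hcost2, ?_, ?_⟩
      · intro u' v' w' hmem
        rcases hmem with hmem | hmem
        · obtain ⟨rfl, rfl, rfl⟩ : u' = u ∧ v' = v ∧ w' = w := by simpa using hmem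
          refine ⟨hcov2, fun f hf f2 f3 f4 f5 => ?_⟩
          exact (hb (htest.2 ⟨⟨f, hf⟩, f2, f3, f4, f5⟩)).elim
        · obtain ⟨e1, e2⟩ := hcov1 u' v' w' hmem
          exact ⟨e1.mono hle2, fun f f1 f2 f3 f4 f5 => (e2 f f1 f2 f3 f4 f5).mono hle2⟩
      · rw [hcard]
        have : (heapTest.steps : ℝ) ≤ 90 := by exact_mod_cast hsteps
        have := mul_le_mul_of_nonneg_right this hlog.le
        push_cast at hT2 ⊢
        linarith
  · rintro m' T T' hs hT ⟨L', hL', hcost, hcov, hT'⟩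
    refine ⟨L', hL', hcost, ?_, ?_⟩
    · rintro t (⟨u, v, w, rfl⟩ | ⟨u, v, w, f, f1, f2, f3, f4, f5, rfl⟩)
      · exact (hcov u v w (Set.mem_univ _)).1
      · exact (hcov u v w (Set.mem_univ _)).2 f f1 f2 f3 f4 f5
    · rw [Set.ncard_univ, Nat.card_eq_fintype_card] at hT'
      simp only [Fintype.card_prod, Fintype.card_fin] at hT'
      have hT2 : (T : ℝ) ≤ T' + 84 * n ^ 3 := by exact_mod_cast hT
      have hT3 := mul_le_mul_of_nonneg_right hT2 hlog.le
      have h3 : (0 : ℝ) ≤ n ^ 3 * Real.log (1 + η) := by positivity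
      push_cast at hT'
      linarith

/-- One phase of the method. -/
def phaseP : Prog :=
  .seq sweepP (.seq (setRsc 13 (.mul (.add (.ofIdx (.lit 1)) (rsc 10)) (rsc 13)))
  (.seq costP (.branch (.ltNum (rsc 14) (.mul (rsc 15) (rsc 13)))
    (.seq (setRsc 15 (.div (rsc 14) (rsc 13))) copyP) .skip)))

/-- The memory between two phases. -/
structure PhaseInv (lab : Fin n → Fin n) (S : CoverProgram G.LPVar) (η big α b : ℝ)
    (L : G.LPVar → ℝ) (m : Mem) : Prop extends Stage lab S η big α b L m where
  cover : ∀ t ∈ S.con, Covers α L t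
  total : m.num 14 0 0 = S.cost L
  best : m.num 15 0 0 = b
  solution : ∃ x, HasTable lab 4 x m ∧ S.Feasible x ∧ (∀ p, S.Loose p → x p = 1) ∧ S.cost x ≤ b

/-- Only the convention log 0 = 0 needs care: either some free variable makes the total at least 1,
or the total is 0 for all admissible lengths. -/
theorem cost_init_pos {S : CoverProgram G.LPVar} {M η big : ℝ} (hS : S.Admissible M η big)
    {L : G.LPVar → ℝ} (hL : S.Lengths big L) (hle : S.cost (S.init big) ≤ S.cost L) :
    Real.log (S.cost (S.init big)) ≤ Real.log (S.cost L) := by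
  have h0 : 0 ≤ S.cost (S.init big) := Finset.sum_nonneg fun p _ =>
    (CoverProgram.init_lengths hS.one_le_big).weight_mul_nonneg hS.regular
      (by linarith [hS.one_le_big]) p
  by_cases h : S.cost (S.init big) = 0
  · rw [h, Real.log_zero]
    by_cases h' : ∃ p, S.Free p
    · obtain ⟨p, hp⟩ := h'
      have h1 := (hL.free p hp).1
      have h2 := Finset.single_le_sum (f := fun p => S.w p * L p)
        (fun t _ => hL.weight_mul_nonneg hS.regular (by linarith [hS.one_le_big]) t)
        (Finset.mem_univ p)
      exact Real.log_nonneg (h1.trans h2)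
    · have : S.cost L = 0 := by
        refine Finset.sum_eq_zero fun p _ => ?_
        rcases hS.regular.cases p with h1 | h1 | h1
        · rw [hL.zero p h1, mul_zero]
        · rw [h1.2, zero_mul]
        · exact (h' ⟨p, h1⟩).elim
      rw [this, Real.log_zero]
  · exact Real.log_le_log (lt_of_le_of_ne h0 (Ne.symm h)) hle

/-- After a sweep all constraints have length at least (1 + η)α, so the scaled and truncated lengths
are feasible. Keeping the cheaper of this solution and the old one restores the inequality between
b·α and the total length that updates in the next phase require. -/
theorem phaseP_spec {m : Mem} (h : HasData G lab 𝒟 m) (h1 : 1 ≤ n)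
    (hD : G.IsEdgeDisjointDangerous 𝒟) {L : G.LPVar → ℝ} {M η big α b : ℝ}
    (hS : (G.coverProgram 𝒟).Admissible M η big) (hα : 0 < α) (hαbig : (1 + η) * α ≤ big)
    (hst : PhaseInv lab (G.coverProgram 𝒟) η big α b L m)
    (hinit : (G.coverProgram 𝒟).cost ((G.coverProgram 𝒟).init big) ≤ (G.coverProgram 𝒟).cost L) :
    Yields phaseP m fun m' T => ∃ L' b',
      PhaseInv lab (G.coverProgram 𝒟) η big ((1 + η) * α) b' L' m' ∧
      (G.coverProgram 𝒟).cost L ≤ (G.coverProgram 𝒟).cost L' ∧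
      T * Real.log (1 + η) ≤
        1000 * ((G.coverProgram 𝒟).potential L' - (G.coverProgram 𝒟).potential L) +
        4000 * n ^ 3 * Real.log (1 + η) := by
  set S := G.coverProgram 𝒟 with hSdef
  have hlog := hS.log_pos
  have hη0 := hS.eta_pos
  have hα' : 0 < (1 + η) * α := by positivity
  refine yields_seq ((sweepP_spec h h1 hD hS hα hαbig hst.toStage).frame.mono ?_)
  rintro m1 T1 ⟨⟨L', hL', hcost, hcov, hT1⟩, hs1⟩
  refine yields_seq (yields_exec rfl fun T2 hT2 => yields_seq ?_)
  have hT2' : T2 ≤ 20 := hT2.trans (by decide)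
  set m2 := (setRsc 13 (.mul (.add (.ofIdx (.lit 1)) (rsc 10)) (rsc 13))).exec m1 with hm2
  have hd1 := h.of_same hs1 (by decide)
  have hd2 : HasData G lab 𝒟 m2 := hd1.of_idx rfl
  have n2 : ∀ a, a ≠ 13 → m2.num a = m1.num a := fun a ha => by funext i j; simp [hm2, ha]
  have a2 : m2.num 13 0 0 = (1 + η) * α := by simp [hm2, hL'.eta, hL'.alpha]
  refine (costP_spec hd2 h1 (hL'.length.of_eq (n2 2 (by decide)))).frame.mono ?_
  rintro m3 T3 ⟨⟨hT3, hc3⟩, hs3⟩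
  change m3.num 14 0 0 = S.cost L' at hc3
  have hd3 := hd2.of_same hs3 (by decide)
  have n3 : ∀ a, a ≠ 13 → a ≠ 14 → m3.num a = m1.num a := fun a ha ha' => by
    rw [hs3.2 a (by simp [costP, costStep, forP, Prog.numWrites, ha']), n2 a ha]
  have a3 : m3.num 13 0 0 = (1 + η) * α := by rw [hs3.2 13 (by decide), a2]
  have b3 : m3.num 15 0 0 = b := by
    rw [n3 15 (by decide) (by decide), hs1.2 15 (by decide)]; exact hst.best
  have hlen3 : HasTable lab 2 L' m3 := hL'.length.of_eq (n3 2 (by decide) (by decide))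
  have hp3 : (n : ℝ) ^ 2 ≤ n ^ 3 := by
    have : (1 : ℝ) ≤ n := by exact_mod_cast h1
    exact pow_le_pow_right₀ this (by norm_num)
  have hp3' : (1 : ℝ) ≤ n ^ 3 := by
    have : (1 : ℝ) ≤ n := by exact_mod_cast h1
    exact one_le_pow₀ this
  have hT3' : (T3 : ℝ) ≤ 200 * n ^ 2 := by exact_mod_cast hT3
  have hT2'' : (T2 : ℝ) ≤ 20 := by exact_mod_cast hT2'
  have htime : ∀ T4 : ℕ, (T4 : ℝ) ≤ 500 * n ^ 2 + 50 →
      ((T1 + (T2 + (T3 + T4)) : ℕ) : ℝ) * Real.log (1 + η) ≤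
        1000 * (S.potential L' - S.potential L) + 4000 * n ^ 3 * Real.log (1 + η) := by
    intro T4 hT4
    have : (T2 : ℝ) + T3 + T4 ≤ 1000 * n ^ 3 := by linarith
    have := mul_le_mul_of_nonneg_right this hlog.le
    push_cast
    linarith
  have hcan := CoverProgram.candidate_spec hS.regular hα' hαbig hL'.lengths
    (fun p q r hpqr => hcov _ hpqr)
  refine yields_branch_skip (fun hb => ?_) (fun hb => ?_)
  · simp only [Test.holds, NExp.eval, IExp.eval, a3, b3, hc3] at hb
    refine yields_seq (yields_exec rfl fun T4 hT4 => ?_)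
    have hT4' : T4 ≤ 20 := hT4.trans (by decide)
    set m4 := (setRsc 15 (.div (rsc 14) (rsc 13))).exec m3 with hm4
    have n4 : ∀ a, a ≠ 15 → m4.num a = m3.num a := fun a ha => by funext i j; simp [hm4, ha]
    have b4 : m4.num 15 0 0 = S.cost L' / ((1 + η) * α) := by simp [hm4, a3, hc3]
    refine (copyP_spec (m := m4) (hd3.of_idx rfl) h1 (hlen3.of_eq (n4 2 (by decide)))
      (by rw [n4 13 (by decide), a3]) hα').frame.mono ?_
    rintro m5 T5 ⟨⟨hT5, ht5⟩, hs5⟩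
    have n5 : ∀ a, a ≠ 4 → a ≠ 15 → m5.num a = m3.num a := fun a ha ha' => by
      rw [hs5.2 a (by simp [copyP, bestP, fillP, bestVar, forP, Prog.numWrites, ha]), n4 a ha']
    have hcL : 0 ≤ S.cost L' := Finset.sum_nonneg fun p _ =>
      hL'.lengths.weight_mul_nonneg hS.regular (by linarith [hS.one_le_big]) p
    have hst5 : Stage lab S η big ((1 + η) * α) (S.cost L' / ((1 + η) * α)) L' m5 :=
      ⟨hlen3.of_eq (n5 2 (by decide) (by decide)),
        hL'.rate.of_eq (by rw [n5 3 (by decide) (by decide), n3 3 (by decide) (by decide)]),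
        by rw [n5 10 (by decide) (by decide), n3 10 (by decide) (by decide)]; exact hL'.eta,
        by rw [n5 13 (by decide) (by decide), a3], hL'.lengths,
        hL'.progress.mono hη0 (by positivity) ((div_le_iff₀ hα').2 hb.le)
          (cost_init_pos hS hL'.lengths (hinit.trans hcost)),
        by rw [div_mul_cancel₀ _ hα'.ne']⟩
    refine ⟨L', _, ⟨hst5, hcov, by rw [n5 14 (by decide) (by decide), hc3],
      by rw [hs5.2 15 (by decide), b4], _, ht5, hcan⟩, hcost, ?_⟩
    refine htime _ ?_
    have e1 : (T4 : ℝ) ≤ 20 := by exact_mod_cast hT4'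
    have e2 : (T5 : ℝ) ≤ 500 * n ^ 2 := by exact_mod_cast hT5
    simp only [Test.steps, NExp.steps, IExp.steps]
    push_cast
    linarith
  · simp only [Test.holds, NExp.eval, IExp.eval, a3, b3, hc3, not_lt] at hb
    obtain ⟨x, hx1, hx2⟩ := hst.solution
    have hst5 : Stage lab S η big ((1 + η) * α) b L' m3 :=
      ⟨hlen3, hL'.rate.of_eq (n3 3 (by decide) (by decide)),
        by rw [n3 10 (by decide) (by decide)]; exact hL'.eta, a3, hL'.lengths, hL'.progress, hb⟩
    refine ⟨L', b, ⟨hst5, hcov, hc3, b3, x, hx1.of_eq ?_, hx2⟩, hcost, htime _ ?_⟩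
    · rw [n3 4 (by decide) (by decide), hs1.2 4 (by decide)]
    · simp only [Test.steps, NExp.steps, IExp.steps]
      push_cast
      have : (0 : ℝ) ≤ n ^ 2 := by positivity
      linarith

end RealRAM


/-! ### The complete solver of the covering program and its running time -/

namespace RealRAM

open CCInstance

variable {n : ℕ} {G : CCInstance (Fin n)} {lab : Fin n → Fin n} {𝒟 : Set (Sym2 (Sym2 (Fin n)))}

/-- The main loop of the method. -/
def phasesP : Prog := .loop (.ltNum (rsc 13) (rsc 12)) phaseP

/-- Each phase multiplies α by 1 + η, starting from 1/M and ending below 2Θ or at it. So log(αM)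
counts the phases, of cubic cost each, and the potential counts the updates. -/
theorem phasesP_spec {m : Mem} (h : HasData G lab 𝒟 m) (h1 : 1 ≤ n)
    (hD : G.IsEdgeDisjointDangerous 𝒟) {L : G.LPVar → ℝ} {M η Θ b : ℝ}
    (hS : (G.coverProgram 𝒟).Admissible M η (2 * Θ)) (hΘ : 1 ≤ Θ)
    (hst : PhaseInv lab (G.coverProgram 𝒟) η (2 * Θ) (1 / M) b L m)
    (hinit : (G.coverProgram 𝒟).cost ((G.coverProgram 𝒟).init (2 * Θ)) ≤ (G.coverProgram 𝒟).cost L)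
    (h12 : m.num 12 0 0 = Θ) :
    Yields phasesP m fun m' T => ∃ α b' L',
      PhaseInv lab (G.coverProgram 𝒟) η (2 * Θ) α b' L' m' ∧ Θ ≤ α ∧
      T * Real.log (1 + η) ≤
        1000 * (M * Real.log (M * (2 * (2 * Θ))) - (G.coverProgram 𝒟).potential L) +
        4100 * n ^ 3 * Real.log (2 * Θ * M) + 10 * Real.log (1 + η) := by
  set S := G.coverProgram 𝒟 with hSdef
  have hlog := hS.log_pos
  have hη0 := hS.eta_pos
  have hη1 := hS.eta_le
  have hM := hS.one_lt
  have hM0 : 0 < M := by linarith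
  have hn3 : (1 : ℝ) ≤ n ^ 3 := by
    have : (1 : ℝ) ≤ n := by exact_mod_cast h1
    exact one_le_pow₀ this
  have hmono : ∀ {α : ℝ} {L' : G.LPVar → ℝ}, 0 < α → α ≤ 2 * Θ → S.Lengths (2 * Θ) L' →
      1000 * (S.potential L' - S.potential L) + 4100 * n ^ 3 * Real.log (α * M) ≤
      1000 * (M * Real.log (M * (2 * (2 * Θ))) - S.potential L) +
        4100 * n ^ 3 * Real.log (2 * Θ * M) := by
    intro α L' hα hα2 hL'
    have := CoverProgram.potential_le hS.regular hM.le hS.one_le_big hL'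
    gcongr
  refine yields_loop ⌊(1000 * (M * Real.log (M * (2 * (2 * Θ))) - S.potential L) +
        4100 * n ^ 3 * Real.log (2 * Θ * M)) / Real.log (1 + η)⌋₊
    (fun m' T => ∃ α b' L', PhaseInv lab S η (2 * Θ) α b' L' m' ∧ 0 < α ∧ α ≤ 2 * Θ ∧
      S.cost (S.init (2 * Θ)) ≤ S.cost L' ∧
      T * Real.log (1 + η) ≤ 1000 * (S.potential L' - S.potential L) +
        4100 * n ^ 3 * Real.log (α * M)) ?_ ?_ ?_ ?_
  · rintro m' T ⟨α, b', L', hI, hα, hα2, -, hT⟩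
    refine Nat.le_floor ?_
    rw [le_div_iff₀ hlog]
    exact hT.trans (hmono hα hα2 hI.lengths)
  · refine ⟨1 / M, b, L, hst, by positivity, ?_, hinit, ?_⟩
    · rw [div_le_iff₀ hM0]; nlinarith
    · rw [one_div_mul_cancel hM0.ne']; simp
  · rintro m' T hs ⟨α, b', L', hI, hα, hα2, hin, hT⟩ htest
    have hd := h.of_same hs (by decide)
    have h12' : m'.num 12 0 0 = Θ := by rw [hs.2 12 (by decide), h12]
    simp only [Test.holds, NExp.eval, IExp.eval, hI.alpha, h12'] at htest
    -- A phase starts only with α < Θ, and η ≤ 1. Hence the length 2Θ of loose variables is always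
    -- large enough.
    have hα3 : (1 + η) * α ≤ 2 * Θ := by nlinarith
    refine (phaseP_spec hd h1 hD hS hα hα3 hI hin).mono ?_
    rintro m'' T' ⟨L'', b'', hI', hcost, hT'⟩
    refine ⟨(1 + η) * α, b'', L'', hI', by positivity, hα3, hin.trans hcost, ?_⟩
    rw [mul_assoc (1 + η), Real.log_mul (by positivity) (by positivity)]
    have h4 : (11 : ℝ) * Real.log (1 + η) ≤ 100 * n ^ 3 * Real.log (1 + η) := by
      gcongr; linarith
    simp only [Test.steps, NExp.steps, IExp.steps]
    push_cast
    linarith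
  · rintro m' T hs ⟨α, b', L', hI, hα, hα2, hin, hT⟩ htest
    have h12' : m'.num 12 0 0 = Θ := by rw [hs.2 12 (by decide), h12]
    simp only [Test.holds, NExp.eval, IExp.eval, hI.alpha, h12', not_lt] at htest
    refine ⟨α, b', L', hI, htest, ?_⟩
    have := hmono hα hα2 hI.lengths
    simp only [Test.steps, NExp.steps, IExp.steps]
    push_cast
    linarith

/-- Compute an approximate solution of the linear program. -/
def solveP : Prog :=
  .seq paramP (.seq weightsP (.seq initP
  (.seq (setRsc 13 (.div (.ofIdx (.lit 1)) (rsc 11))) (.seq costP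
  (.seq (setRsc 15 (.div (rsc 14) (rsc 13))) (.seq copyP (.seq phasesP
  (.branch (.ltNum (.mul (.ofIdx (.lit 3)) (rsc 14)) (rsc 12)) trivialP .skip))))))))

/-- One factor 1/η comes from Θ = M^{O(1/η)} inside the logarithms, the other from division by log(1
+ η) ≥ η/2. -/
theorem solveP_time {ℓ η M Θ lg N : ℝ} {k : ℕ} {T : ℝ} (hη : 0 < η) (hη1 : η ≤ 1) (hN : 1 ≤ N)
    (hM : M = N * N + 1) (hΘ : Θ = 3 * M * M ^ k) (hk : k * η ≤ 1 + η) (hlg : lg = Real.log N)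
    (hℓ : ℓ = Real.log (1 + η))
    (hT : T * ℓ ≤ 1000 * (M * Real.log (M * (2 * (2 * Θ))) - 0) +
        4100 * N ^ 3 * Real.log (2 * Θ * M) + 10 * ℓ) :
    T ≤ 300000 * (η⁻¹ ^ 2 * N ^ 3 * (1 + lg)) := by
  have hM1 : 1 ≤ M := by nlinarith
  have hM2 : M ≤ 2 * N ^ 2 := by nlinarith
  have hlgM0 : 0 ≤ Real.log M := Real.log_nonneg hM1
  have hlg0 : 0 ≤ lg := by rw [hlg]; exact Real.log_nonneg hN
  have hlgM : Real.log M ≤ 2 * (1 + lg) := by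
    have h1 : Real.log M ≤ Real.log (2 * N ^ 2) := Real.log_le_log (by linarith) hM2
    rw [Real.log_mul (by norm_num) (by positivity), Real.log_pow, ← hlg] at h1
    have := Real.log_two_lt_d9
    push_cast at h1
    linarith
  have hℓ2 : η / 2 ≤ ℓ := by
    have h1 := Real.one_sub_inv_le_log_of_pos (show 0 < 1 + η by linarith)
    rw [← hℓ] at h1
    refine le_trans ?_ h1
    have : 1 - (1 + η)⁻¹ = η / (1 + η) := by field_simp; ring
    rw [this]
    gcongr
    linarith
  have hℓ1 : ℓ ≤ 1 := by
    have := Real.log_le_sub_one_of_pos (show 0 < 1 + η by linarith)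
    rw [← hℓ] at this; linarith
  set r := η⁻¹ with hr
  have hr1 : 1 ≤ r := (one_le_inv₀ hη).2 hη1
  have hηr : η * r = 1 := mul_inv_cancel₀ hη.ne'
  have hk' : (k : ℝ) + 2 ≤ 4 * r := by nlinarith
  have hlog12 : Real.log 12 ≤ 3 := by
    have h1 : Real.log 12 ≤ Real.log (2 ^ 4) := Real.log_le_log (by norm_num) (by norm_num)
    rw [Real.log_pow] at h1
    have := Real.log_two_lt_d9
    push_cast at h1
    linarith
  -- Both logarithms have arguments of at most 12·M^{k+2}, as M·4Θ equals this and 2ΘM is half of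
  -- it.
  have hbig : ∀ y, 0 < y → y ≤ 12 * M ^ (k + 2) → Real.log y ≤ 11 * r * (1 + lg) := by
    intro y hy hy'
    have h1 := Real.log_le_log hy hy'
    rw [Real.log_mul (by norm_num) (by positivity), Real.log_pow] at h1
    push_cast at h1
    have h2 : ((k : ℝ) + 2) * Real.log M ≤ 4 * r * (2 * (1 + lg)) := by gcongr
    nlinarith
  have hMk : 0 < M ^ k := by positivity
  have e1 := hbig (M * (2 * (2 * Θ))) (by rw [hΘ]; positivity) (by rw [hΘ]; apply le_of_eq; ring)
  have e2 := hbig (2 * Θ * M) (by rw [hΘ]; positivity) (by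
    rw [hΘ]
    have : 0 < M ^ (k + 2) := by positivity
    have e : 2 * (3 * M * M ^ k) * M = 6 * M ^ (k + 2) := by ring
    rw [e]; linarith)
  have hN3 : N ^ 2 ≤ N ^ 3 := pow_le_pow_right₀ hN (by norm_num)
  have hN1 : 1 ≤ N ^ 3 := one_le_pow₀ hN
  have hM3 : M ≤ 2 * N ^ 3 := by linarith
  have hW : 1 ≤ r * (1 + lg) := by nlinarith
  have hW3 : 1 ≤ N ^ 3 * (r * (1 + lg)) := by nlinarith
  have e3 : M * Real.log (M * (2 * (2 * Θ))) ≤ 2 * N ^ 3 * (11 * r * (1 + lg)) := by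
    refine (mul_le_mul_of_nonneg_left e1 (by linarith)).trans ?_
    gcongr
  have e4 : 4100 * N ^ 3 * Real.log (2 * Θ * M) ≤ 4100 * N ^ 3 * (11 * r * (1 + lg)) := by
    gcongr
  have e5 : T * ℓ ≤ 70000 * (N ^ 3 * (r * (1 + lg))) := by nlinarith
  by_cases hT0 : T ≤ 0
  · exact hT0.trans (by positivity)
  have e6 : T * (η / 2) ≤ 70000 * (N ^ 3 * (r * (1 + lg))) :=
    (mul_le_mul_of_nonneg_left hℓ2 (not_le.1 hT0).le).trans e5
  have e7 : T = 2 * r * (T * (η / 2)) := by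
    linear_combination -T * hηr
  rw [e7]
  refine (mul_le_mul_of_nonneg_left e6 (by positivity)).trans ?_
  have : 0 ≤ r ^ 2 * N ^ 3 * (1 + lg) := by positivity
  nlinarith

theorem solveP_total {ε η : ℝ} {k T1 T2 T3 T4 T5 T6 T7 T8 T9 : ℕ} (hη : η = ε / 12) (hε0 : 0 < ε)
    (hη1 : η ≤ 1) (h1 : 1 ≤ n) (hk : k * η ≤ 1 + η) (hT1 : T1 ≤ 60 * k + 300)
    (hT2 : T2 ≤ 200 * n ^ 2) (hT3 : T3 ≤ 1100 * n ^ 2) (hT4 : T4 ≤ 20) (hT5 : T5 ≤ 200 * n ^ 2)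
    (hT6 : T6 ≤ 20) (hT7 : T7 ≤ 500 * n ^ 2)
    (hT8 : (T8 : ℝ) ≤ 300000 * (η⁻¹ ^ 2 * (n : ℝ) ^ 3 * (1 + Real.log n))) (hT9 : T9 ≤ 600 * n ^ 2) :
    ((T1 + (T2 + (T3 + (T4 + (T5 + (T6 + (T7 + (T8 + T9))))))) : ℕ) : ℝ) ≤
      50000000 * (ε⁻¹ ^ 2 * (n : ℝ) ^ 3 * (1 + Real.log n)) := by
  have hn1 : (1 : ℝ) ≤ n := by exact_mod_cast h1
  have hη0 : 0 < η := by rw [hη]; positivity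
  have hlg0 : 0 ≤ Real.log n := Real.log_nonneg hn1
  have hr1 : 1 ≤ η⁻¹ := (one_le_inv₀ hη0).2 hη1
  have hηr : η * η⁻¹ = 1 := mul_inv_cancel₀ hη0.ne'
  have hkr : (k : ℝ) ≤ 2 * η⁻¹ := by nlinarith
  have hn23 : (n : ℝ) ^ 2 ≤ n ^ 3 := pow_le_pow_right₀ hn1 (by norm_num)
  have hn3 : (1 : ℝ) ≤ n ^ 3 := one_le_pow₀ hn1
  have hr2 : η⁻¹ ≤ η⁻¹ ^ 2 := le_self_pow₀ hr1 (by norm_num)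
  have x1 : η⁻¹ ^ 2 ≤ η⁻¹ ^ 2 * (n : ℝ) ^ 3 * (1 + Real.log n) := by
    rw [mul_assoc]
    refine le_mul_of_one_le_right (by positivity) ?_
    nlinarith
  have x2 : (n : ℝ) ^ 3 ≤ η⁻¹ ^ 2 * (n : ℝ) ^ 3 * (1 + Real.log n) := by
    have : η⁻¹ ^ 2 * (n : ℝ) ^ 3 * (1 + Real.log n) = n ^ 3 * (η⁻¹ ^ 2 * (1 + Real.log n)) := by ring
    rw [this]
    refine le_mul_of_one_le_right (by positivity) ?_
    nlinarith
  have hX : η⁻¹ ^ 2 * (n : ℝ) ^ 3 * (1 + Real.log n) =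
      144 * (ε⁻¹ ^ 2 * (n : ℝ) ^ 3 * (1 + Real.log n)) := by
    rw [hη, inv_div, div_eq_mul_inv]; ring
  have y1 : (T1 : ℝ) ≤ 60 * k + 300 := by exact_mod_cast hT1
  have y2 : (T2 : ℝ) ≤ 200 * n ^ 2 := by exact_mod_cast hT2
  have y3 : (T3 : ℝ) ≤ 1100 * n ^ 2 := by exact_mod_cast hT3
  have y4 : (T4 : ℝ) ≤ 20 := by exact_mod_cast hT4
  have y5 : (T5 : ℝ) ≤ 200 * n ^ 2 := by exact_mod_cast hT5
  have y6 : (T6 : ℝ) ≤ 20 := by exact_mod_cast hT6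
  have y7 : (T7 : ℝ) ≤ 500 * n ^ 2 := by exact_mod_cast hT7
  have y9 : (T9 : ℝ) ≤ 600 * n ^ 2 := by exact_mod_cast hT9
  push_cast
  linarith

/-- This is the reason for η = ε/12: the method loses three factors 1 + η. -/
theorem cube_le {ε : ℝ} (hε0 : 0 < ε) (hε1 : ε < 1) : (1 + ε / 12) ^ 3 ≤ 1 + ε / 3 := by
  have h1 : ε * ε ≤ ε := by nlinarith
  have h2 : ε * ε * ε ≤ ε := by nlinarith
  linarith

theorem log_large {η M D : ℝ} {k : ℕ} (hη : 0 ≤ η) (hM : 1 ≤ M) (hk : 1 ≤ k * η)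
    (hD : M ^ (k + 1) ≤ D) : (1 + η) * Real.log M ≤ η * Real.log D := by
  have h2 := Real.log_le_log (by positivity) hD
  rw [Real.log_pow] at h2
  have h3 := mul_le_mul_of_nonneg_left h2 hη
  have h4 := mul_le_mul_of_nonneg_right hk (Real.log_nonneg hM)
  push_cast at h3
  linarith

/-- When α has reached Θ, there are two outcomes. If the total length is below Θ/3, setting the
loose variables to 1 is feasible at cost 0. Otherwise the total is so large that the best recorded
solution is within (1 + η)³ of every feasible point. -/
theorem solveP_spec {m : Mem} (h : HasData G lab 𝒟 m) (h1 : 1 ≤ n) (hG : G.IsConsistent)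
    (hD : G.IsEdgeDisjointDangerous 𝒟) (hfeas : ∃ 𝒞 : Fin n → Fin n, G.IsFeasible 𝒞) {ε : ℝ}
    (hε0 : 0 < ε) (hε1 : ε < 1) (hε : m.num 0 0 0 = ε) (hw : ∀ i j, m.num 1 i j = 0) :
    Yields solveP m fun m' T => T ≤ 50000000 * (ε⁻¹ ^ 2 * (n : ℝ) ^ 3 * (1 + Real.log n)) ∧
      ∃ x : G.LPVar → ℝ, HasTable lab 4 x m' ∧ G.IsLPApprox 𝒟 (1 + ε / 3) (G.lpPoint x) := by
  set S := G.coverProgram 𝒟 with hSdef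
  set η := ε / 12 with hη
  have hη0 : 0 < η := by positivity
  have hη1 : η ≤ 1 := by linarith
  have hn1 : (1 : ℝ) ≤ n := by exact_mod_cast h1
  obtain ⟨M, hM⟩ : ∃ M : ℝ, M = n * n + 1 := ⟨_, rfl⟩
  have hM1 : 1 < M := by nlinarith
  have hreg : S.Regular M := by
    have := coverProgram_regular hG hD
    rwa [Fintype.card_fin, ← hM] at this
  refine yields_seq ((paramP_spec hε h.input.size hε0 hη hM).frame.mono ?_)
  rintro m1 T1 ⟨⟨k, hk1, hk2, hT1, a10, a11, a12, a18⟩, hs1⟩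
  obtain ⟨Θ, hΘ⟩ : ∃ Θ, Θ = 3 * M * M ^ k := ⟨_, rfl⟩
  rw [← hΘ] at a12 a18
  have hΘ1 : 1 ≤ Θ := by
    have : 1 ≤ M ^ k := one_le_pow₀ hM1.le
    rw [hΘ]; nlinarith
  have hS : S.Admissible M η (2 * Θ) :=
    ⟨hreg, coverProgram_feasible hD hfeas, hη0, hη1, hM1, by linarith⟩
  have hd1 := h.of_same hs1 (by decide)
  refine yields_seq ((weightsP_spec hd1 h1 (by rw [hs1.2 1 (by decide)]; exact hw)).frame.mono ?_)
  rintro m2 T2 ⟨⟨hT2, hw2⟩, hs2⟩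
  have hd2 := hd1.of_same hs2 (by decide)
  refine yields_seq ((initP_spec hd2 h1 hreg hw2
    (by rw [hs2.2 18 (by decide), a18])).frame.mono ?_)
  rintro m3 T3 ⟨⟨hT3, hL3, hr3⟩, hs3⟩
  have hd3 := hd2.of_same hs3 (by decide)
  refine yields_seq (yields_exec rfl fun T4 hT4 => ?_)
  have hT4' : T4 ≤ 20 := hT4.trans (by decide)
  set m4 := (setRsc 13 (.div (.ofIdx (.lit 1)) (rsc 11))).exec m3 with hm4
  have n4 : ∀ a, a ≠ 13 → m4.num a = m3.num a := fun a ha => by funext i j; simp [hm4, ha]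
  have hd4 : HasData G lab 𝒟 m4 := hd3.of_idx rfl
  have b11 : m3.num 11 0 0 = M := by rw [hs3.2 11 (by decide), hs2.2 11 (by decide), a11]
  have a13 : m4.num 13 0 0 = 1 / M := by simp [hm4, b11]
  refine yields_seq ((costP_spec hd4 h1 (hL3.of_eq (n4 2 (by decide)))).frame.mono ?_)
  rintro m5 T5 ⟨⟨hT5, hc5⟩, hs5⟩
  change m5.num 14 0 0 = S.cost (S.init (2 * Θ)) at hc5
  have hd5 := hd4.of_same hs5 (by decide)
  have b13 : m5.num 13 0 0 = 1 / M := by rw [hs5.2 13 (by decide), a13]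
  refine yields_seq (yields_exec rfl fun T6 hT6 => ?_)
  have hT6' : T6 ≤ 20 := hT6.trans (by decide)
  set m6 := (setRsc 15 (.div (rsc 14) (rsc 13))).exec m5 with hm6
  have n6 : ∀ a, a ≠ 15 → m6.num a = m5.num a := fun a ha => by funext i j; simp [hm6, ha]
  have hd6 : HasData G lab 𝒟 m6 := hd5.of_idx rfl
  have a15 : m6.num 15 0 0 = S.cost (S.init (2 * Θ)) / (1 / M) := by
    simp [hm6, hc5, b13]
  have hMpos : 0 < 1 / M := by have : 0 < M := by linarith
                               positivity
  have hL6 : HasTable lab 2 (S.init (2 * Θ)) m6 := hL3.of_eq (by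
    rw [n6 2 (by decide), hs5.2 2 (by decide), n4 2 (by decide)])
  refine yields_seq ((copyP_spec hd6 h1 hL6 (by rw [n6 13 (by decide), b13]) hMpos).frame.mono ?_)
  rintro m7 T7 ⟨⟨hT7, ht7⟩, hs7⟩
  have hd7 := hd6.of_same hs7 (by decide)
  have hlen : S.Lengths (2 * Θ) (S.init (2 * Θ)) := CoverProgram.init_lengths hS.one_le_big
  have hcov : ∀ t ∈ S.con, Covers (1 / M) (S.init (2 * Θ)) t := fun t ht =>
    CoverProgram.init_cover hreg hM1.le hS.feasible hS.one_le_big ht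
  have hcost0 : 0 ≤ S.cost (S.init (2 * Θ)) := Finset.sum_nonneg fun p _ =>
    hlen.weight_mul_nonneg hreg (by linarith) p
  have n7 : ∀ a, a ∉ [4, 13, 14, 15] → m7.num a = m3.num a := by
    intro a ha
    simp only [List.mem_cons, List.not_mem_nil, or_false, not_or] at ha
    rw [hs7.2 a (by simp [copyP, bestP, fillP, bestVar, forP, Prog.numWrites, ha.1]),
      n6 a ha.2.2.2, hs5.2 a (by simp [costP, costStep, forP, Prog.numWrites, ha.2.2.1]),
      n4 a ha.2.1]
  have hst7 : PhaseInv lab S η (2 * Θ) (1 / M) (S.cost (S.init (2 * Θ)) / (1 / M))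
      (S.init (2 * Θ)) m7 := by
    refine ⟨⟨hL3.of_eq (n7 2 (by decide)), hr3.of_eq (n7 3 (by decide)), ?_, ?_, hlen,
      CoverProgram.progress_init (by positivity) hreg, ?_⟩, hcov, ?_, ?_, _, ht7,
      CoverProgram.candidate_spec hreg hMpos ?_ hlen (fun p q r hpqr => hcov _ hpqr)⟩
    · rw [n7 10 (by decide), hs3.2 10 (by decide), hs2.2 10 (by decide), a10]
    · rw [hs7.2 13 (by decide), n6 13 (by decide), b13]
    · rw [div_mul_cancel₀ _ hMpos.ne']
    · rw [hs7.2 14 (by decide), n6 14 (by decide), hc5]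
    · rw [hs7.2 15 (by decide), a15]
    · have : 1 / M ≤ 1 := (div_le_one (by linarith)).2 hM1.le
      linarith
  refine yields_seq ((phasesP_spec hd7 h1 hD hS hΘ1 hst7 le_rfl (by
    rw [n7 12 (by decide), hs3.2 12 (by decide), hs2.2 12 (by decide), a12])).frame.mono ?_)
  rintro m8 T8 ⟨⟨α, b, L, hI, hαΘ, hT8⟩, hs8⟩
  have hd8 := hd7.of_same hs8 (by decide)
  have hpot : S.potential (S.init (2 * Θ)) = 0 := CoverProgram.potential_init hreg
  rw [← hSdef, hpot] at hT8
  have hT8' := solveP_time hη0 hη1 hn1 hM hΘ hk2 rfl rfl hT8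
  have htime := fun T9 hT9 => solveP_total (T9 := T9) hη hε0 hη1 h1 hk2 hT1 hT2 hT3 hT4' hT5 hT6' hT7
    hT8' hT9
  have hn2 : 1 ≤ n ^ 2 := Nat.one_le_pow _ _ h1
  have h12 : m8.num 12 0 0 = Θ := by
    rw [hs8.2 12 (by decide), n7 12 (by decide), hs3.2 12 (by decide), hs2.2 12 (by decide), a12]
  have hcostnn : ∀ x, S.Feasible x → 0 ≤ S.cost x := fun x hx =>
    Finset.sum_nonneg fun p _ => mul_nonneg (hreg.w_nonneg p) (hx.nonneg p)
  refine yields_branch_skip (fun hb => ?_) (fun hb => ?_)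
  · simp only [Test.holds, NExp.eval, IExp.eval, hI.total, h12] at hb
    push_cast at hb
    refine (trivialP_spec hd8 h1 hI.length (by
      rw [hs8.2 18 (by decide), n7 18 (by decide), hs3.2 18 (by decide), hs2.2 18 (by decide),
        a18])).mono ?_
    rintro m9 T9 ⟨hT9, ht9⟩
    obtain ⟨f1, f2, f3⟩ := CoverProgram.trivial_spec hreg (by linarith : 0 < Θ) (by linarith)
      hI.lengths (by linarith) (fun p q r hpqr => hαΘ.trans (hI.cover _ hpqr))
    refine ⟨htime _ ?_, _, ht9, lpPoint_isLPApprox hG hD f1 f2 fun x' hx' => ?_⟩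
    · simp only [Test.steps, NExp.steps, IExp.steps]
      omega
    · refine f3.le.trans (mul_nonneg (by positivity) (hcostnn x' hx'))
  · simp only [Test.holds, NExp.eval, IExp.eval, hI.total, h12] at hb
    push_cast at hb
    obtain ⟨x, hx1, hx2, hx3, hx4⟩ := hI.solution
    refine ⟨htime _ ?_, x, hx1, lpPoint_isLPApprox hG hD hx2 hx3 fun x' hx' => ?_⟩
    · simp only [Test.steps, NExp.steps, IExp.steps]
      omega
    -- Here D ≥ Θ/3 = M^{k+1}, and kη ≥ 1 turns this into the required bound.
    · have hlarge : (1 + η) * Real.log M ≤ η * Real.log (S.cost L) :=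
        log_large hη0.le hM1.le hk1 (by
          have : Θ = 3 * M ^ (k + 1) := by rw [hΘ]; ring
          linarith)
      have h5 := hI.progress.le_cost hreg hη0 hM1 (by linarith) hI.lengths hlarge hx'
      have h6 : (1 + η) ^ 3 ≤ 1 + ε / 3 := cube_le hε0 hε1
      exact hx4.trans (h5.trans (mul_le_mul_of_nonneg_right h6 (hcostnn x' hx')))

end RealRAM


namespace RealRAM

open CCInstance

variable {n : ℕ} {G : CCInstance (Fin n)} {lab : Fin n → Fin n} {𝒟 : Set (Sym2 (Sym2 (Fin n)))}

/-! ## The auxiliary graph and the budgets -/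

/-- Mark the pairs of labels of supernodes that are joined by an unmatched positive edge. -/
def joinP : Prog :=
  markP 11 (.conj (posI (.cell 1 (sc 20) (sc 21))) (.neg (posI (.cell 7 (sc 20) (sc 21)))))

/-- The array `11` marks the pairs of supernodes that are joined by an unmatched positive edge. -/
def HasJoined (G : CCInstance (Fin n)) (lab : Fin n → Fin n) (𝒟 : Set (Sym2 (Sym2 (Fin n))))
    (m : Mem) : Prop :=
  ∀ u v, 0 < m.idx 11 (lab u) (lab v) ↔ ∃ a b, G.super a = G.super u ∧ G.super b = G.super v ∧
    G.pos.Adj a b ∧ s(a, b) ∉ dangerousEdges 𝒟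

theorem joinP_spec {m : Mem} (h : HasData G lab 𝒟 m) (h1 : 1 ≤ n)
    (h11 : ∀ i j, m.idx 11 i j = 0) :
    Yields joinP m fun m' T => T ≤ 200 * n ^ 2 ∧ HasJoined G lab 𝒟 m' := by
  refine markP_spec h.input.size h1 h.labels (by norm_num) (by norm_num) (by decide) h11
    fun u v m' hs hu hv => ?_
  have hd := h.of_same hs (by decide)
  simp only [Test.holds, IExp.eval, hu, hv, hd.input.pos, hd.matching.matched]

/-- The disjunction of tests. -/
abbrev disj (t t' : Test) : Test := .neg (.conj (.neg t) (.neg t'))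

theorem disj_holds {t t' : Test} {m : Mem} : (disj t t').holds m ↔ t.holds m ∨ t'.holds m := by
  rw [Test.holds, Test.holds, Test.holds, Test.holds, not_and_or, not_not, not_not]

/-- The test whether two nodes are equal or joined by a positive edge of the auxiliary graph. -/
def adjTest : Test :=
  disj (eqI (col 5 (sc 20)) (col 5 (sc 21)))
    (.conj (posI (.cell 11 (col 5 (sc 20)) (col 5 (sc 21))))
      (.conj (.ltNum (varE 4 true (sc 20) (sc 21)) (varE 4 false (sc 20) (sc 21)))
        (.ltNum (varE 4 true (sc 20) (sc 21)) (.div (.ofIdx (.lit 2)) (.ofIdx (.lit 3))))))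

/-- Compute the auxiliary graph. -/
def adjP : Prog :=
  forP 20 (forP 21 (.branch adjTest (.setIdx 12 (sc 20) (sc 21) (.lit 1)) .skip))

open scoped Classical in
/-- The array `12` contains the adjacency matrix of `K`, with ones on the diagonal. -/
def HasAdj (K : SimpleGraph (Fin n)) (m : Mem) : Prop :=
  ∀ u v : Fin n, m.idx 12 u v = if u = v ∨ K.Adj u v then 1 else 0

theorem adjTest_holds {m : Mem} (h : HasData G lab 𝒟 m) (hj : HasJoined G lab 𝒟 m)
    {x : G.LPVar → ℝ} (hx : HasTable lab 4 x m) {u v : Fin n} (hu : m.idx 20 0 0 = u)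
    (hv : m.idx 21 0 0 = v) :
    adjTest.holds m ↔ u = v ∨ (G.auxGraph 𝒟 (G.lpPoint x)).Adj u v := by
  have e1 := h.varE_eval hx true (u := sc 20) (v := sc 21) hu hv
  have e2 := h.varE_eval hx false (u := sc 20) (v := sc 21) hu hv
  have h3 : Test.holds m (.conj (posI (.cell 11 (col 5 (sc 20)) (col 5 (sc 21))))
      (.conj (.ltNum (varE 4 true (sc 20) (sc 21)) (varE 4 false (sc 20) (sc 21)))
        (.ltNum (varE 4 true (sc 20) (sc 21)) (.div (.ofIdx (.lit 2)) (.ofIdx (.lit 3)))))) ↔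
      0 < m.idx 11 (lab u) (lab v) ∧ x (true, s(G.super u, G.super v)) <
      x (false, s(G.super u, G.super v)) ∧ x (true, s(G.super u, G.super v)) < 2 / 3 := by
    change _ ∧ NExp.eval m (varE 4 true (sc 20) (sc 21)) < NExp.eval m (varE 4 false (sc 20) (sc 21)) ∧
      NExp.eval m (varE 4 true (sc 20) (sc 21)) < _ ↔ _
    rw [e1, e2]
    simp only [Test.holds, NExp.eval, IExp.eval, hu, hv, h.labels.cell, Nat.cast_ofNat]
  rw [adjTest, disj_holds, eqI_holds, h3, hj]
  simp only [IExp.eval, hu, hv, h.labels.cell, Fin.val_inj, h.labels.iff, auxGraph, lpPoint, lt_min_iff]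
  by_cases huv : u = v
  · subst huv; simp
  · simp only [huv, false_or, ne_eq, not_false_eq_true, true_and]

theorem adjP_spec {m : Mem} (h : HasData G lab 𝒟 m) (h1 : 1 ≤ n) (hj : HasJoined G lab 𝒟 m)
    {x : G.LPVar → ℝ} (hx : HasTable lab 4 x m) (h12 : ∀ i j, m.idx 12 i j = 0) :
    Yields adjP m fun m' T => T ≤ 400 * n ^ 2 ∧ HasAdj (G.auxGraph 𝒟 (G.lpPoint x)) m' := by
  classical
  refine yields_table (n := n) (c := 300) (fun S m => ∀ u v : Fin n, m.idx 12 u v =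
    if (u, v) ∈ S ∧ (u = v ∨ (G.auxGraph 𝒟 (G.lpPoint x)).Adj u v) then 1 else 0)
    h.input.size h1 (by decide) (by decide) (by decide) (by decide) (by decide) ?_ ?_ ?_ ?_
  · intro S m m' h _ hI
    rw [h 12 (by decide) (by decide)]; exact hI
  · simp [h12]
  · intro u v S _ m' hs hu hv _ hI a b
    have hd := h.of_same hs (by decide)
    have hj' : HasJoined G lab 𝒟 m' := by unfold HasJoined; rw [hs.1 11 (by decide)]; exact hj
    rw [Prog.exec, adjTest_holds hd hj' (hx.of_eq (hs.2 4 (by decide))) hu hv]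
    simp only [Set.mem_insert_iff, Prod.mk.injEq]
    by_cases hab : a = u ∧ b = v
    · obtain ⟨rfl, rfl⟩ := hab
      split_ifs with h2 h3 h3
      · simp [hu, hv]
      · simp [h2] at h3
      · simp [h2] at h3
      · rw [Prog.exec, hI, if_neg (by tauto)]
    · have hab' : ¬ (a.1 = u.1 ∧ b.1 = v.1) := by simpa [Fin.val_inj] using hab
      have : ∀ t : Mem, (t = (Prog.setIdx 12 (sc 20) (sc 21) (.lit 1)).exec m' ∨ t = m') →
          t.idx 12 a b = m'.idx 12 a b := by
        rintro t (rfl | rfl)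
        · simp [hu, hv, hab']
        · rfl
      rw [this _ (by split_ifs <;> simp), hI]
      simp [hab]
  · intro m' T _ hT hI
    refine ⟨hT.trans (Nat.mul_le_mul_right _ (by norm_num)), fun u v => ?_⟩
    rw [hI]
    simp only [Set.mem_univ, true_and]

/-- The test whether a pair of nodes is balanced. -/
def balancedTest : Test :=
  .conj (posI (.cell 7 (sc 20) (sc 21))) (.conj (posI (.cell 1 (sc 20) (sc 21)))
    (.conj (.neg (posI (.cell 12 (sc 20) (sc 21))))
      (.neg (posI (.cell 12 (.cell 8 (sc 20) (sc 21)) (.cell 9 (sc 20) (sc 21)))))))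

/-- Compute the budgets. -/
def budgetP : Prog :=
  forP 20 (forP 21 (.branch balancedTest (.setNum 5 (sc 20) (sc 21) (.ofIdx (.lit 2)))
    (.branch (posI (.cell 1 (sc 20) (sc 21)))
      (.setNum 5 (sc 20) (sc 21) (.mul (.ofIdx (.lit 3)) (varE 4 true (sc 20) (sc 21))))
      (.setNum 5 (sc 20) (sc 21) (.mul (.ofIdx (.lit 3)) (varE 4 false (sc 20) (sc 21)))))))

/-- The array `5` contains the values `y` of the pairs of distinct nodes. -/
def HasWeights (y : Sym2 (Fin n) → ℝ) (m : Mem) : Prop :=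
  ∀ u v : Fin n, u ≠ v → m.num 5 u v = y s(u, v)

theorem balancedTest_holds {m : Mem} (hD : G.IsEdgeDisjointDangerous 𝒟) (h : HasData G lab 𝒟 m)
    {K : SimpleGraph (Fin n)} (hK : HasAdj K m) {u v : Fin n} (hu : m.idx 20 0 0 = u)
    (hv : m.idx 21 0 0 = v) : balancedTest.holds m ↔ s(u, v) ∈ G.balancedEdges 𝒟 K := by
  classical
  have hK' : ∀ a b : Fin n, ¬ 0 < m.idx 12 a b ↔ Kᶜ.Adj a b := by
    intro a b
    rw [hK a b, SimpleGraph.compl_adj]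
    by_cases hab : a = b ∨ K.Adj a b
    · rw [if_pos hab]; simp; tauto
    · rw [if_neg hab]; simp; tauto
  simp only [balancedTest, Test.holds, IExp.eval, hu, hv, h.input.pos, h.matching.matched, hK',
    balancedEdges, Set.mem_ofPred_eq, Set.mem_inter_iff, SimpleGraph.mem_edgeSet]
  constructor
  · rintro ⟨h1, h2, h3, h4⟩
    obtain ⟨c, d, hc, hd, hcd⟩ := h.matching.partner u v h1
    rw [hc, hd, hK'] at h4
    obtain ⟨-, -, c', d', -, hf, -, hpos, -⟩ := (hD.1 _ hcd).exists_nodes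
    refine ⟨⟨h2, h3⟩, s(c, d), hcd, ?_, h4⟩
    rw [hf]; exact hpos
  · rintro ⟨⟨h2, h3⟩, f, hf, -, h4⟩
    obtain ⟨c, d, hc, hd, hcd⟩ := h.matching.partner u v ⟨f, hf⟩
    have hff := hD.2 _ hf _ hcd s(u, v) (Sym2.mem_mk_left _ _) (Sym2.mem_mk_left _ _)
    obtain rfl := Sym2.congr_right.1 hff
    refine ⟨⟨_, hf⟩, h2, h3, ?_⟩
    rw [hc, hd, hK']
    exact h4

theorem budgetP_spec {m : Mem} (hD : G.IsEdgeDisjointDangerous 𝒟) (h : HasData G lab 𝒟 m)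
    (h1 : 1 ≤ n) {x : G.LPVar → ℝ} (hx : HasTable lab 4 x m)
    (hK : HasAdj (G.auxGraph 𝒟 (G.lpPoint x)) m) :
    Yields budgetP m fun m' T => T ≤ 400 * n ^ 2 ∧ HasWeights (G.budget 𝒟 (G.lpPoint x)) m' := by
  classical
  refine yields_table (n := n) (c := 300) (fun S m => ∀ u v : Fin n, (u, v) ∈ S →
    m.num 5 u v = G.budget 𝒟 (G.lpPoint x) s(u, v))
    h.input.size h1 (by decide) (by decide) (by decide) (by decide) (by decide) ?_ ?_ ?_ ?_
  · intro S m m' _ h hI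
    rw [h]; exact hI
  · simp
  · intro u v S _ m' hs hu hv _ hI a b hab
    have hd := h.of_same hs (by decide)
    have hx' : HasTable lab 4 x m' := hx.of_eq (hs.2 4 (by decide))
    have hK' : HasAdj (G.auxGraph 𝒟 (G.lpPoint x)) m' := by
      unfold HasAdj; rw [hs.1 12 (by decide)]; exact hK
    have e1 := hd.varE_eval hx' true (u := sc 20) (v := sc 21) hu hv
    have e2 := hd.varE_eval hx' false (u := sc 20) (v := sc 21) hu hv
    have ex : (G.lpPoint x).x s(u, v) = x (decide (G.pos.Adj u v), s(G.super u, G.super v)) :=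
      congrArg x (edgeVar_mk u v)
    have key : ∀ e : NExp, e.eval m' = G.budget 𝒟 (G.lpPoint x) s(u, v) →
        ((Prog.setNum 5 (sc 20) (sc 21) e).exec m').num 5 a b =
          G.budget 𝒟 (G.lpPoint x) s(a, b) := by
      intro e he
      rw [Prog.exec, he, Mem.writeNum_num]
      simp only [IExp.eval, hu, hv, Fin.val_inj, true_and]
      split_ifs with hc
      · rw [hc.1, hc.2]
      · refine hI a b (hab.resolve_left fun h => hc (by simpa using h))
    rw [Prog.exec, balancedTest_holds hD hd hK' hu hv]
    split_ifs with hb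
    · exact key _ (by simp [NExp.eval, budget, hb])
    · rw [Prog.exec]
      simp only [Test.holds, IExp.eval, hu, hv, hd.input.pos]
      split_ifs with hp
      · refine key _ ?_
        rw [NExp.eval, e1, budget, if_neg hb, ex]
        simp [hp]
      · refine key _ ?_
        rw [NExp.eval, e2, budget, if_neg hb, ex]
        simp [hp]
  · intro m' T _ hT hI
    exact ⟨hT.trans (Nat.mul_le_mul_right _ (by norm_num)), fun u v _ => hI u v (Set.mem_univ _)⟩

end RealRAM


namespace RealRAM

open CCInstance

variable {n : ℕ} {G : CCInstance (Fin n)} {K : SimpleGraph (Fin n)} {y : Sym2 (Fin n) → ℝ}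

/-! ## Maintaining the pivot ratios -/

/-- The memory contains the instance, the auxiliary graph and the budgets. -/
structure HasGraph (G : CCInstance (Fin n)) (K : SimpleGraph (Fin n)) (y : Sym2 (Fin n) → ℝ)
    (m : Mem) : Prop where
  input : HasInput G m
  adj : HasAdj K m
  weights : HasWeights y m

theorem HasGraph.of_same {m m' : Mem} {I N : List ℕ} (h : HasGraph G K y m)
    (hs : SameExcept I N m m') (hI : ∀ a ∈ I, 4 ≤ a) (hI' : 12 ∉ I) (hN : 5 ∉ N) :
    HasGraph G K y m' := by
  refine ⟨h.input.of_same hs hI, ?_, ?_⟩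
  · unfold HasAdj; rw [hs.1 12 hI']; exact h.adj
  · unfold HasWeights; rw [hs.2 5 hN]; exact h.weights

/-- Addition or subtraction. -/
def addOrSub (σ : Bool) (e f : NExp) : NExp := if σ then .add e f else .sub e f

theorem addOrSub_eval (σ : Bool) (e f : NExp) (m : Mem) :
    (addOrSub σ e f).eval m = e.eval m + (if σ then 1 else -1) * f.eval m := by
  cases σ <;> simp [addOrSub, sub_eq_add_neg]

/-- The test whether the remaining node in scalar 27 forms a bad triple with the nodes in the
scalars 26 and 21. -/
def badTest : Test :=
  .conj (posI (col 13 (sc 27)))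
    (eqI (.add (.add (.cell 12 (sc 27) (sc 21)) (.cell 12 (sc 26) (sc 27))) (.cell 12 (sc 26) (sc 21)))
      (.lit 2))

/-- The test whether the auxiliary graph agrees with the instance. -/
def agreeTest : Test :=
  disj (.conj (posI (.cell 12 (sc 27) (sc 21))) (posI (.cell 1 (sc 27) (sc 21))))
    (.conj (.neg (posI (.cell 12 (sc 27) (sc 21)))) (.neg (posI (.cell 1 (sc 27) (sc 21)))))

/-- Update the ratio of the node in scalar 26. -/
def ratioStep (σ : Bool) : Prog :=
  .branch badTest
    (.seq (.setNum 8 (sc 26) (.lit 0) (addOrSub σ (.cell 8 (sc 26) (.lit 0)) (.cell 5 (sc 27) (sc 21))))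
      (.branch agreeTest
        (.setNum 7 (sc 26) (.lit 0) (addOrSub σ (.cell 7 (sc 26) (.lit 0)) (.ofIdx (.lit 1)))) .skip))
    .skip

/-- Update all ratios when the node in scalar 21 is added or removed. -/
def ratioP (σ : Bool) : Prog := forP 26 (forP 27 (ratioStep σ))

theorem HasAdj.pos {m : Mem} (h : HasAdj K m) (u v : Fin n) :
    0 < m.idx 12 u v ↔ u = v ∨ K.Adj u v := by
  rw [h u v]
  split_ifs with h1 <;> simp [h1]

/-- Bad means that exactly two of the three bits are 1. The ones on the diagonal do no harm: if p
equals u or w, the sum is 1 plus twice a bit, hence odd. -/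
theorem badTest_holds {m : Mem} (h : HasGraph G K y m) {R : Finset (Fin n)}
    (hR : ∀ u : Fin n, 0 < m.idx 13 u 0 ↔ u ∈ R) {p u w : Fin n} (hw : w ∉ R)
    (hp : m.idx 26 0 0 = p) (hu : m.idx 27 0 0 = u) (hw' : m.idx 21 0 0 = w) :
    badTest.holds m ↔ u ∈ R ∧ BadTriple K p u w := by
  classical
  rw [badTest, Test.holds, eqI_holds]
  simp only [Test.holds, IExp.eval, hp, hu, hw', hR, h.adj u w, h.adj p u, h.adj p w]
  refine and_congr_right fun huR => ?_
  have huw : u ≠ w := fun h => hw (h ▸ huR)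
  have hc := K.adj_comm u w
  by_cases h1 : p = u
  · subst h1
    have : ¬ BadTriple K p p w := fun h => h.1 rfl
    simp only [this, iff_false, true_or, if_true, huw, false_or]
    split_ifs <;> simp
  · by_cases h2 : p = w
    · subst h2
      have : ¬ BadTriple K p u p := fun h => h.2.1 rfl
      simp only [this, iff_false, true_or, if_true, huw, huw.symm, false_or, hc]
      split_ifs <;> simp
    · simp only [BadTriple, h1, h2, huw, ne_eq, not_false_eq_true, true_and, false_or]
      by_cases a1 : K.Adj u w <;> by_cases a2 : K.Adj p u <;> by_cases a3 : K.Adj p w <;>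
        simp [a1, a2, a3]

theorem agreeTest_holds {m : Mem} (h : HasGraph G K y m) {u w : Fin n} (huw : u ≠ w)
    (hu : m.idx 27 0 0 = u) (hw' : m.idx 21 0 0 = w) :
    agreeTest.holds m ↔ (s(u, w) ∈ K.edgeSet ↔ s(u, w) ∈ G.pos.edgeSet) := by
  rw [agreeTest, disj_holds]
  simp only [Test.holds, IExp.eval, hu, hw', h.adj.pos, h.input.pos, huw, false_or,
    SimpleGraph.mem_edgeSet]
  tauto

open scoped Classical in
/-- The sum over the nodes `u ∈ R` with `(p, u) ∈ S`. -/
noncomputable def rowSum (S : Set (Fin n × Fin n)) (R : Finset (Fin n)) (f : Fin n → Fin n → ℝ)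
    (p : Fin n) : ℝ := ∑ u ∈ R with (p, u) ∈ S, f p u

open scoped Classical in
theorem rowSum_insert {S : Set (Fin n × Fin n)} {R : Finset (Fin n)} {f : Fin n → Fin n → ℝ}
    {p u : Fin n} (h : (p, u) ∉ S) (q : Fin n) :
    rowSum (insert (p, u) S) R f q = rowSum S R f q + if q = p ∧ u ∈ R then f p u else 0 := by
  rw [rowSum, rowSum, Finset.sum_filter, Finset.sum_filter, ← sub_eq_iff_eq_add',
    ← Finset.sum_sub_distrib]
  have : ∀ v, ((if (q, v) ∈ insert (p, u) S then f q v else 0) - if (q, v) ∈ S then f q v else 0) =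
      if v = u then (if q = p then f p u else 0) else 0 := by
    intro v
    simp only [Set.mem_insert_iff, Prod.mk.injEq]
    by_cases h1 : q = p
    · subst h1
      by_cases h2 : v = u
      · subst h2; simp [h]
      · simp [h2]
    · simp [h1]
  trans ∑ v ∈ R, if v = u then (if q = p then f p u else 0) else 0
  · exact Finset.sum_congr rfl fun v _ => by convert this v
  rw [Finset.sum_ite_eq']
  by_cases h1 : q = p <;> by_cases h2 : u ∈ R <;> simp [h1, h2]

open scoped Classical in
-- A change of w affects, for every p, only the pairs uw with u ∈ R that form a bad triple with p;
-- there are at most n² such p and u. The sign σ distinguishes insertion from removal.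
theorem ratioP_spec {m : Mem} (σ : Bool) (h : HasGraph G K y m) (h1 : 1 ≤ n) {R : Finset (Fin n)}
    (hR : ∀ u : Fin n, 0 < m.idx 13 u 0 ↔ u ∈ R) {w : Fin n} (hw : w ∉ R)
    (hw' : m.idx 21 0 0 = w) {A B : Fin n → ℝ} (hA : ∀ p : Fin n, m.num 7 p 0 = A p)
    (hB : ∀ p : Fin n, m.num 8 p 0 = B p) :
    Yields (ratioP σ) m fun m' T => T ≤ 300 * n ^ 2 ∧
      (∀ p : Fin n, m'.num 7 p 0 = A p + (if σ then 1 else -1) *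
        ∑ u ∈ R, if BadTriple K p u w then G.agree K s(u, w) else 0) ∧
      (∀ p : Fin n, m'.num 8 p 0 = B p + (if σ then 1 else -1) *
        ∑ u ∈ R, if BadTriple K p u w then y s(u, w) else 0) := by
  set s : ℝ := if σ then 1 else -1 with hs
  set f : (Sym2 (Fin n) → ℝ) → Fin n → Fin n → ℝ :=
    fun g p u => if BadTriple K p u w then g s(u, w) else 0 with hf
  have hadd : ∀ (e f : NExp) (m : Mem), (addOrSub σ e f).eval m = e.eval m + s * f.eval m :=
    addOrSub_eval σ
  clear_value s
  have hW' : (ratioStep σ).idxWrites = [] := rfl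
  refine yields_table (n := n) (c := 200) (fun S m => (∀ p : Fin n, m.num 7 p 0 = A p + s *
    rowSum S R (f (G.agree K)) p) ∧ ∀ p : Fin n, m.num 8 p 0 = B p + s * rowSum S R (f y) p)
    h.input.size h1 (by simp [hW']) (by simp [hW']) (by simp [hW']) (by rfl) ?_ ?_ ?_ ?_ ?_
  · cases σ <;> decide
  · intro S m m' _ h hI
    rw [h]; exact hI
  · simp [rowSum, hA, hB]
  · rintro p u S hS m' hs' hp hu h0 ⟨hI7, hI8⟩
    have hg := h.of_same hs' (by simp [hW']) (by simp [hW']) (by simp [ratioStep, Prog.numWrites])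
    have hR' : ∀ u : Fin n, 0 < m'.idx 13 u 0 ↔ u ∈ R := by
      rw [hs'.1 13 (by simp [hW'])]; exact hR
    have hw2 : m'.idx 21 0 0 = w := by rw [hs'.1 21 (by simp [hW']), hw']
    rw [ratioStep, Prog.exec, badTest_holds hg hR' hw hp hu hw2]
    simp only [rowSum_insert hS]
    split_ifs with hb
    · obtain ⟨huR, hbad⟩ := hb
      have huw : u ≠ w := fun h => hw (h ▸ huR)
      have e5 := hg.weights u w huw
      rw [Prog.exec]
      set m2 := (Prog.setNum 8 (sc 26) (.lit 0) (addOrSub σ (.cell 8 (sc 26) (.lit 0))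
        (.cell 5 (sc 27) (sc 21)))).exec m' with hm2
      have hg2 : HasGraph G K y m2 := hg.of_same (I := []) (N := [8])
        ⟨fun _ _ => rfl, fun a ha => by funext i j; simp at ha; simp [hm2, ha]⟩
        (by simp) (by simp) (by simp)
      have n8 : ∀ q : Fin n, m2.num 8 q 0 = B q + s * (rowSum S R (f y) q +
          if q = p then f y p u else 0) := by
        intro q
        simp only [hm2, Prog.exec, Mem.writeNum_num, IExp.eval, hp, Fin.val_inj, true_and, and_true,
          hadd, NExp.eval, hu, hw2, e5]
        split_ifs with hq
        · rw [hI8 p, hq, hf]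
          simp only [if_pos hbad]
          ring
        · rw [hI8 q, add_zero]
      have n7 : ∀ q : Fin n, m2.num 7 q 0 = A q + s * rowSum S R (f (G.agree K)) q := by
        intro q
        rw [← hI7 q]
        simp [hm2]
      rw [Prog.exec, agreeTest_holds hg2 huw (by simpa [hm2] using hu) (by simpa [hm2] using hw2)]
      simp only [huR, and_true]
      split_ifs with ha
      · refine ⟨fun q => ?_, fun q => ?_⟩
        · simp only [Prog.exec, Mem.writeNum_num, IExp.eval, true_and, and_true, hadd,
            NExp.eval, Nat.cast_one]
          have e26 : m2.idx 26 0 0 = p := hp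
          simp only [e26, Fin.val_inj]
          split_ifs with hq
          · rw [n7 p, hq, hf]
            simp only [if_pos hbad, agree, if_pos ha]
            ring
          · rw [n7 q, add_zero]
        · rw [← n8 q]
          simp
      · refine ⟨fun q => ?_, n8⟩
        rw [Prog.exec, n7 q, hf]
        simp only [agree, if_neg ha, ite_self, add_zero]
    · have : ∀ g, (if u ∈ R then f g p u else 0) = 0 := by
        intro g
        split_ifs with h2
        · simp only [hf]
          exact if_neg fun h3 => hb ⟨h2, h3⟩
        · rfl
      simp only [ite_and, this, ite_self, add_zero, Prog.exec]
      exact ⟨hI7, hI8⟩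
  · rintro m' T _ hT ⟨hI7, hI8⟩
    refine ⟨hT.trans (Nat.mul_le_mul_right _ (by norm_num)), fun p => ?_, fun p => ?_⟩
    · rw [hI7 p]; simp [rowSum, hf]
    · rw [hI8 p]; simp [rowSum, hf]

open scoped Classical in
theorem ratioDen_insert_fin {R : Finset (Fin n)} (g : Sym2 (Fin n) → ℝ) {w : Fin n} (hw : w ∉ R)
    (p : Fin n) : ratioDen K g (insert w R) p = ratioDen K g R p +
      ∑ u ∈ R, if BadTriple K p u w then g s(u, w) else 0 := by
  convert ratioDen_insert g hw p

/-- The remaining nodes `R` and the pivot ratios. -/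
structure PivotState (G : CCInstance (Fin n)) (K : SimpleGraph (Fin n)) (y : Sym2 (Fin n) → ℝ)
    (R : Finset (Fin n)) (m : Mem) : Prop extends HasGraph G K y m where
  remaining : ∀ u : Fin n, 0 < m.idx 13 u 0 ↔ u ∈ R
  num : ∀ p : Fin n, m.num 7 p 0 = ratioDen K (G.agree K) R p
  den : ∀ p : Fin n, m.num 8 p 0 = ratioDen K y R p

theorem PivotState.of_same {m m' : Mem} {I N : List ℕ} {R : Finset (Fin n)}
    (h : PivotState G K y R m) (hs : SameExcept I N m m') (hI : ∀ a ∈ I, 4 ≤ a) (hI' : 12 ∉ I)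
    (hI'' : 13 ∉ I) (hN : 5 ∉ N) (hN' : 7 ∉ N) (hN'' : 8 ∉ N) : PivotState G K y R m' :=
  ⟨h.toHasGraph.of_same hs hI hI' hN, by rw [hs.1 13 hI'']; exact h.remaining,
    by rw [hs.2 7 hN']; exact h.num, by rw [hs.2 8 hN'']; exact h.den⟩

/-- Add the node in scalar 21 to the remaining nodes. -/
def addP : Prog := .seq (ratioP true) (.setIdx 13 (sc 21) (.lit 0) (.lit 1))

/-- Remove the node in scalar 21 from the remaining nodes. -/
def removeP : Prog := .seq (.setIdx 13 (sc 21) (.lit 0) (.lit 0)) (ratioP false)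

open scoped Classical in
theorem addP_spec {m : Mem} {R : Finset (Fin n)} (h : PivotState G K y R m) (h1 : 1 ≤ n) {w : Fin n}
    (hw : w ∉ R) (hw' : m.idx 21 0 0 = w) :
    Yields addP m fun m' T => T ≤ 310 * n ^ 2 ∧ PivotState G K y (insert w R) m' := by
  refine yields_seq ((ratioP_spec true h.toHasGraph h1 h.remaining hw hw' h.num h.den).frame.mono ?_)
  rintro m1 T1 ⟨⟨hT1, h7, h8⟩, hs⟩
  have hw1 : m1.idx 21 0 0 = w := by rw [hs.1 21 (by decide), hw']
  have hn2 : 1 ≤ n ^ 2 := Nat.one_le_pow _ _ h1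
  refine yields_exec rfl fun T2 hT2 => ⟨?_, ?_⟩
  · have : T2 ≤ 10 := hT2.trans (by decide)
    omega
  · have hg := (h.toHasGraph.of_same hs (by decide) (by decide) (by decide)).of_same (I := [13])
      (N := []) (m' := (Prog.setIdx 13 (sc 21) (.lit 0) (.lit 1)).exec m1)
      ⟨fun a ha => by funext i j; simp at ha; simp [ha], fun _ _ => rfl⟩
      (by simp) (by simp) (by simp)
    refine ⟨hg, fun u => ?_, fun p => ?_, fun p => ?_⟩
    · simp only [Prog.exec, Mem.writeIdx_idx, IExp.eval, hw1, Fin.val_inj, true_and, and_true,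
        Finset.mem_insert]
      split_ifs with hu
      · simp [hu]
      · rw [hs.1 13 (by decide), h.remaining]; simp [hu]
    · rw [ratioDen_insert_fin _ hw]
      exact (h7 p).trans (by simp)
    · rw [ratioDen_insert_fin _ hw]
      exact (h8 p).trans (by simp)

open scoped Classical in
-- The mark of w is cleared before the ratios are updated, whereas `addP` sets it afterwards: in
-- both cases the update sees the set without w.
theorem removeP_spec {m : Mem} {R : Finset (Fin n)} {w : Fin n}
    (h : PivotState G K y (insert w R) m) (h1 : 1 ≤ n)
    (hw : w ∉ R) (hw' : m.idx 21 0 0 = w) :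
    Yields removeP m fun m' T => T ≤ 310 * n ^ 2 ∧ PivotState G K y R m' := by
  refine yields_seq (yields_exec rfl fun T1 hT1 => ?_)
  set m1 := (Prog.setIdx 13 (sc 21) (.lit 0) (.lit 0)).exec m with hm1
  have hg : HasGraph G K y m1 := h.toHasGraph.of_same (I := [13]) (N := [])
      ⟨fun a ha => by funext i j; simp at ha; simp [hm1, ha], fun _ _ => rfl⟩
      (by simp) (by simp) (by simp)
  have hR : ∀ u : Fin n, 0 < m1.idx 13 u 0 ↔ u ∈ R := by
    intro u
    simp only [hm1, Prog.exec, Mem.writeIdx_idx, IExp.eval, hw', Fin.val_inj, true_and, and_true]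
    split_ifs with hu
    · simp [hu, hw]
    · rw [h.remaining]; simp [hu]
  refine (ratioP_spec false hg h1 hR hw (by simpa [hm1] using hw') h.num h.den).frame.mono ?_
  rintro m2 T2 ⟨⟨hT2, h7, h8⟩, hs⟩
  have hn2 : 1 ≤ n ^ 2 := Nat.one_le_pow _ _ h1
  refine ⟨?_, hg.of_same hs (by decide) (by decide) (by decide), ?_, fun p => ?_, fun p => ?_⟩
  · have : T1 ≤ 10 := hT1.trans (by decide)
    omega
  · rw [hs.1 13 (by decide)]; exact hR
  · rw [h7 p, ratioDen_insert_fin _ hw]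
    simp
  · rw [h8 p, ratioDen_insert_fin _ hw]
    simp

end RealRAM


namespace CCInstance

theorem PivotRun.step_of_mem {V : Type*} {K : SimpleGraph V} {rule : Finset V → V → Prop}
    {R R' : Finset V} {p : V} {𝒞 : V → V} (hp : p ∈ R) (hr : rule R p)
    (hR' : ∀ v, v ∈ R' ↔ v ∈ R ∧ ¬ (v = p ∨ K.Adj p v)) (h : PivotRun K rule R' 𝒞) :
    PivotRun K rule R (assignCluster K R p 𝒞) := by
  classical
  refine PivotRun.step R p 𝒞 hp hr ?_
  convert h
  ext v
  rw [Finset.mem_sdiff, mem_pivotCluster, hR']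
  tauto

end CCInstance

namespace RealRAM

open CCInstance

variable {n : ℕ} {G : CCInstance (Fin n)} {K : SimpleGraph (Fin n)} {y : Sym2 (Fin n) → ℝ}

/-! ## Pivot with ratio-minimizing pivots -/

/-- Compute the pivot ratios of the set of all nodes. -/
def startP : Prog := forP 21 addP

theorem PivotState.congr {m m' : Mem} {R : Finset (Fin n)} {i : ℕ} (h : PivotState G K y R m)
    (hi : 20 ≤ i) (h1 : ∀ a, a ≠ i → m'.idx a = m.idx a) (h2 : m'.num = m.num) :
    PivotState G K y R m' :=
  h.of_same (I := [i]) (N := []) ⟨fun a ha => h1 a (by simpa using ha), fun a _ => by rw [h2]⟩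
    (by simp; omega) (by simp; omega) (by simp; omega) (by simp) (by simp) (by simp)

theorem startP_spec {m : Mem} (h : HasGraph G K y m) (h1 : 1 ≤ n) (h13 : ∀ i j, m.idx 13 i j = 0)
    (h7 : ∀ i j, m.num 7 i j = 0) (h8 : ∀ i j, m.num 8 i j = 0) :
    Yields startP m fun m' T => T ≤ 400 * n ^ 3 ∧ PivotState G K y Finset.univ m' := by
  classical
  refine yields_forFin (n := n) (fun S m T => ∃ R : Finset (Fin n), (R : Set (Fin n)) = S ∧
    T ≤ 310 * n ^ 2 * R.card ∧ PivotState G K y R m) h.input.size h1 (by decide) (by decide)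
    ?_ ?_ ?_ ?_
  · rintro S m m' T ha hn ⟨R, hR, hT, hP⟩
    exact ⟨R, hR, hT, hP.congr (by norm_num) ha hn⟩
  · exact ⟨∅, by simp, by simp, h, by simp [h13], by simp [h7, ratioDen_empty],
      by simp [h8, ratioDen_empty]⟩
  · rintro k S hk m' T hs hi h0 ⟨R, hR, hT, hP⟩
    have hkR : k ∉ R := by simpa [← hR] using hk
    refine (addP_spec hP h1 hkR hi).mono ?_
    rintro m2 T2 ⟨hT2, hP2⟩
    refine ⟨insert k R, by simp [hR], ?_, by convert hP2⟩
    rw [Finset.card_insert_of_notMem hkR, mul_add]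
    omega
  · rintro m' T T' hs hT ⟨R, hR, hT', hP⟩
    obtain rfl : R = Finset.univ := by simpa using hR
    refine ⟨?_, hP⟩
    rw [Finset.card_univ, Fintype.card_fin] at hT'
    have : 310 * n ^ 2 * n = 310 * n ^ 3 := by ring
    have := Nat.le_self_pow (n := 3) (by norm_num) n
    omega

/-- The test whether the node in scalar 20 remains and improves on the pivot in scalar 24. -/
def betterTest : Test :=
  .conj (posI (col 13 (sc 20))) (.neg (.conj (posI (sc 23)) (.neg (.ltNum
    (.mul (.cell 7 (sc 20) (.lit 0)) (.cell 8 (sc 24) (.lit 0)))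
    (.mul (.cell 7 (sc 24) (.lit 0)) (.cell 8 (sc 20) (.lit 0)))))))

/-- Find a pivot of minimum ratio; scalar 23 says whether a node remains. -/
def chooseP : Prog :=
  .seq (setSc 23 (.lit 0))
    (forP 20 (.branch betterTest (.seq (setSc 23 (.lit 1)) (setSc 24 (sc 20))) .skip))

/-- Cross-multiplied comparison is not transitive when 0/0 occurs. It is if the first comparison is
strict: then c > 0, and d = 0 forces f = 0. So the search replaces its candidate only on strict
improvement. -/
theorem mul_le_mul_trans_of_lt {a b c d e f : ℝ} (ha : 0 ≤ a) (hb : 0 ≤ b) (hd : 0 ≤ d)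
    (he : 0 ≤ e) (hf : 0 ≤ f) (h : a * d < c * b) (h' : c * f ≤ e * d) :
    a * f ≤ e * b := by
  have hcb : 0 < c * b := (mul_nonneg ha hd).trans_lt h
  have hc' : 0 < c := pos_of_mul_pos_left hcb hb
  rcases hd.eq_or_lt with rfl | hd'
  · have : f = 0 := by
      have h2 : c * f ≤ 0 := by simpa using h'
      nlinarith
    rw [this, mul_zero]
    exact mul_nonneg he hb
  · refine le_of_mul_le_mul_right ?_ hd'
    calc a * f * d = a * d * f := by ring
      _ ≤ c * b * f := mul_le_mul_of_nonneg_right h.le hf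
      _ = c * f * b := by ring
      _ ≤ e * d * b := mul_le_mul_of_nonneg_right h' hb
      _ = e * b * d := by ring

theorem chooseP_spec {m : Mem} (hn : m.idx 0 0 0 = n) (h1 : 1 ≤ n) {R : Finset (Fin n)}
    (hR : ∀ u : Fin n, 0 < m.idx 13 u 0 ↔ u ∈ R) {A B : Fin n → ℝ}
    (hA : ∀ p : Fin n, m.num 7 p 0 = A p) (hB : ∀ p : Fin n, m.num 8 p 0 = B p)
    (hA0 : ∀ p, 0 ≤ A p) (hB0 : ∀ p, 0 ≤ B p) :
    Yields chooseP m fun m' T => T ≤ 200 * n ∧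
      ((m'.idx 23 0 0 = 0 ∧ R = ∅) ∨ (m'.idx 23 0 0 = 1 ∧ ∃ p ∈ R, m'.idx 24 0 0 = p ∧
        ∀ q ∈ R, A p * B q ≤ A q * B p)) := by
  classical
  refine yields_seq (yields_exec rfl fun T1 hT1 => ?_)
  have hT1' : T1 ≤ 10 := hT1.trans (by decide)
  set m1 := (setSc 23 (.lit 0)).exec m with hm1
  refine yields_forFin (n := n) (fun S m T => T ≤ 100 * S.ncard ∧
    ((m.idx 23 0 0 = 0 ∧ ∀ u ∈ S, u ∉ R) ∨ (m.idx 23 0 0 = 1 ∧ ∃ p ∈ R, m.idx 24 0 0 = p ∧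
      ∀ q ∈ S, q ∈ R → A p * B q ≤ A q * B p))) (by simpa [hm1] using hn) h1 (by decide) (by decide)
    ?_ ?_ ?_ ?_
  · rintro S m m' T ha hn ⟨hT, hI⟩
    rw [ha 23 (by decide), ha 24 (by decide)]
    exact ⟨hT, hI⟩
  · exact ⟨by simp, Or.inl ⟨by simp [hm1], by simp⟩⟩
  · rintro k S hk m' T hs hi h0 ⟨hT, hI⟩
    have hcard := Set.ncard_insert_of_notMem hk
    have hR' : 0 < m'.idx 13 k 0 ↔ k ∈ R := by
      rw [hs.1 13 (by decide), ← hR k]; simp [hm1]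
    have hA' : ∀ p : Fin n, m'.num 7 p 0 = A p := by
      intro p; rw [hs.2 7 (by decide), ← hA]; simp [hm1]
    have hB' : ∀ p : Fin n, m'.num 8 p 0 = B p := by
      intro p; rw [hs.2 8 (by decide), ← hB]; simp [hm1]
    refine yields_exec rfl fun T2 hT2 => ?_
    have hT2' : T2 ≤ 100 := hT2.trans (by decide)
    refine ⟨by omega, ?_⟩
    rw [Prog.exec]
    have hb : betterTest.holds m' ↔ k ∈ R ∧ (0 < m'.idx 23 0 0 →
        A k * m'.num 8 (m'.idx 24 0 0) 0 < m'.num 7 (m'.idx 24 0 0) 0 * B k) := by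
      simp only [betterTest, Test.holds, IExp.eval, NExp.eval, hi, hR', hA', hB', not_and, not_not]
    rcases hI with ⟨h23, hI⟩ | ⟨h23, p, hp, h24, hI⟩
    · split_ifs with ht
      · rw [hb] at ht
        refine Or.inr ⟨by simp [Prog.exec], k, ht.1, by simp [Prog.exec, hi], ?_⟩
        rintro q (rfl | hq) hqR
        · exact le_rfl
        · exact absurd hqR (hI q hq)
      · refine Or.inl ⟨h23, ?_⟩
        rintro q (rfl | hq)
        · exact fun hqR => ht (hb.2 ⟨hqR, by simp [h23]⟩)
        · exact hI q hq
    · simp only [h23, h24, hA', hB', zero_lt_one, true_imp_iff] at hb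
      split_ifs with ht
      · rw [hb] at ht
        refine Or.inr ⟨by simp [Prog.exec], k, ht.1, by simp [Prog.exec, hi], ?_⟩
        rintro q (rfl | hq) hqR
        · exact le_rfl
        · exact mul_le_mul_trans_of_lt (hA0 _) (hB0 _) (hB0 _) (hA0 _) (hB0 _) ht.2
            (hI q hq hqR)
      · refine Or.inr ⟨h23, p, hp, h24, ?_⟩
        rintro q (rfl | hq) hqR
        · exact not_lt.1 fun h => ht (hb.2 ⟨hqR, h⟩)
        · exact hI q hq hqR
  · rintro m' T T' hs hT ⟨hT', hI⟩
    rw [Set.ncard_univ, Nat.card_eq_fintype_card, Fintype.card_fin] at hT'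
    refine ⟨by omega, hI.imp (fun h => ⟨h.1, ?_⟩) (fun h => ⟨h.1, ?_⟩)⟩
    · exact Finset.eq_empty_of_forall_notMem fun u => h.2 u (Set.mem_univ u)
    · obtain ⟨p, hp, h24, hq⟩ := h.2
      exact ⟨p, hp, h24, fun q => hq q (Set.mem_univ q)⟩

/-- Output the cluster of the pivot in scalar 24. -/
def clusterP : Prog :=
  forP 21 (.branch (.conj (posI (col 13 (sc 21))) (posI (.cell 12 (sc 24) (sc 21))))
    (.seq (.setIdx 4 (sc 21) (.lit 0) (sc 24)) removeP) .skip)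

/-- The diagonal ones of the adjacency matrix put p into its own cluster. Every node that leaves
pays 400n² steps, enough for updating all ratios. -/
theorem clusterP_spec {m : Mem} {R : Finset (Fin n)} (h : PivotState G K y R m) (h1 : 1 ≤ n)
    {p : Fin n} (hp : m.idx 24 0 0 = p) :
    Yields clusterP m fun m' T => ∃ R' ⊆ R, (∀ v, v ∈ R' ↔ v ∈ R ∧ ¬ (v = p ∨ K.Adj p v)) ∧
      T + 400 * n ^ 2 * R'.card ≤ 400 * n ^ 2 * R.card + 100 * n ∧ PivotState G K y R' m' ∧
      (∀ v : Fin n, v ∈ R → v ∉ R' → m'.idx 4 v 0 = p) ∧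
      ∀ v : Fin n, v ∉ R → m'.idx 4 v 0 = m.idx 4 v 0 := by
  classical
  have hn2 : 1 ≤ n ^ 2 := Nat.one_le_pow _ _ h1
  refine yields_forFin (n := n) (fun S m' T => ∃ R' ⊆ R,
      (∀ v, v ∈ R' ↔ v ∈ R ∧ ¬ (v ∈ S ∧ (v = p ∨ K.Adj p v))) ∧
      T + 400 * n ^ 2 * R'.card ≤ 400 * n ^ 2 * R.card + 60 * S.ncard ∧ PivotState G K y R' m' ∧
      (∀ v : Fin n, v ∈ R → v ∉ R' → m'.idx 4 v 0 = p) ∧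
      ∀ v : Fin n, v ∉ R → m'.idx 4 v 0 = m.idx 4 v 0)
    h.input.size h1 (by decide) (by decide) ?_ ?_ ?_ ?_
  · rintro S m m' T ha hn ⟨R', hsub, hR', hT, hP, h4, h4'⟩
    rw [ha 4 (by decide)]
    exact ⟨R', hsub, hR', hT, hP.congr (by norm_num) ha hn, h4, h4'⟩
  · exact ⟨R, subset_rfl, by simp, by simp, h, fun v h h' => absurd h h', fun _ _ => rfl⟩
  · rintro k S hk m' T hs hi h0 ⟨R', hsub, hR', hT, hP, h4, h4'⟩
    have hcard := Set.ncard_insert_of_notMem hk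
    have hp' : m'.idx 24 0 0 = p := by rw [hs.1 24 (by decide), hp]
    have ht : (Test.conj (posI (col 13 (sc 21))) (posI (.cell 12 (sc 24) (sc 21)))).holds m' ↔
        k ∈ R' ∧ (k = p ∨ K.Adj p k) := by
      simp only [Test.holds, IExp.eval, hi, hp', hP.remaining, hP.adj.pos, eq_comm]
    refine yields_branch_skip (fun hb => ?_) (fun hb => ?_)
    · obtain ⟨hkR, hkp⟩ := ht.1 hb
      refine yields_seq (yields_exec rfl fun T2 hT2 => ?_)
      have hT2' : T2 ≤ 20 := hT2.trans (by decide)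
      set m2 := (Prog.setIdx 4 (sc 21) (.lit 0) (sc 24)).exec m' with hm2
      have hP2 : PivotState G K y R' m2 := hP.of_same (I := [4]) (N := [])
        ⟨fun a ha => by funext i j; simp at ha; simp [hm2, ha], fun _ _ => rfl⟩
        (by simp) (by simp) (by simp) (by simp) (by simp) (by simp)
      have hins : insert k (R'.erase k) = R' := Finset.insert_erase hkR
      have hcR : R'.card = (R'.erase k).card + 1 := by
        rw [← Finset.card_insert_of_notMem (Finset.notMem_erase k R'), hins]
      have hP3 : PivotState G K y (insert k (R'.erase k)) m2 := by rw [hins]; exact hP2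
      have hm4 : ∀ v : Fin n, m2.idx 4 v 0 = if v = k then p.1 else m'.idx 4 v 0 := by
        intro v
        simp [hm2, Prog.exec, hi, hp', Fin.val_inj]
      refine (removeP_spec (by convert hP3) h1 (Finset.notMem_erase k R')
        (by simpa [hm2] using hi)).frame.mono ?_
      rintro m3 T3 ⟨⟨hT3, hP4⟩, hs3⟩
      refine ⟨R'.erase k, (Finset.erase_subset _ _).trans hsub, fun v => ?_, ?_, hP4, ?_, ?_⟩
      · rw [Finset.mem_erase, hR', Set.mem_insert_iff]
        by_cases hv : v = k
        · subst hv; simp [hkp]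
        · simp [hv]
      · have hst : (Test.conj (posI (col 13 (sc 21))) (posI (.cell 12 (sc 24) (sc 21)))).steps ≤ 30 :=
          by decide
        rw [hcR, mul_add] at hT
        omega
      · intro v hv hv'
        rw [hs3.1 4 (by decide), hm4]
        split_ifs with hvk
        · rfl
        · exact h4 v hv fun h => hv' (Finset.mem_erase.2 ⟨hvk, h⟩)
      · intro v hv
        rw [hs3.1 4 (by decide), hm4, if_neg, h4' v hv]
        rintro rfl
        exact hv (hsub hkR)
    · refine ⟨R', hsub, fun v => ?_, ?_, hP, h4, h4'⟩
      · rw [Set.mem_insert_iff]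
        by_cases hv : v = k
        · subst hv
          have := hR' v
          have h2 := mt ht.2 hb
          tauto
        · simp [hv, hR']
      · have hst : (Test.conj (posI (col 13 (sc 21))) (posI (.cell 12 (sc 24) (sc 21)))).steps ≤ 30 :=
          by decide
        omega
  · rintro m' T T' hs hT ⟨R', hsub, hR', hT', hP, h4, h4'⟩
    rw [Set.ncard_univ, Nat.card_eq_fintype_card, Fintype.card_fin] at hT'
    exact ⟨R', hsub, by simpa using hR', by omega, hP, h4, h4'⟩

/-- Pivot. -/
def pivotP : Prog := forP 25 (.seq chooseP (.branch (posI (sc 23)) clusterP .skip))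

/-- Each round removes at least its pivot, so n rounds empty the set; rounds after that do nothing.
As runs are built from the last cluster backwards, the invariant says that any run on the remaining
nodes extends by the output so far to a run on all nodes. -/
theorem pivotP_spec {m : Mem} (h : PivotState G K y Finset.univ m) (h1 : 1 ≤ n)
    (hy : ∀ u v : Fin n, u ≠ v → 0 ≤ y s(u, v)) {rule : Finset (Fin n) → Fin n → Prop}
    (hrule : ∀ R, ∀ p ∈ R, (∀ q ∈ R, ratioDen K (G.agree K) R p * ratioDen K y R q ≤
      ratioDen K (G.agree K) R q * ratioDen K y R p) → rule R p) :
    Yields pivotP m fun m' T => T ≤ 1000 * n ^ 3 ∧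
      ∃ 𝒞, PivotRun K rule Finset.univ 𝒞 ∧ IsOutput m' 𝒞 := by
  classical
  refine yields_forFin (n := n) (fun S m T => ∃ (R : Finset (Fin n)) (out : Fin n → Fin n),
      PivotState G K y R m ∧ R.card + S.ncard ≤ n ∧ (∀ v : Fin n, v ∉ R → m.idx 4 v 0 = out v) ∧
      (∀ 𝒞', PivotRun K rule R 𝒞' →
        PivotRun K rule Finset.univ fun v => if v ∈ R then 𝒞' v else out v) ∧
      T + 400 * n ^ 2 * R.card ≤ 400 * n ^ 2 * n + 400 * n * S.ncard)
    h.input.size h1 (by decide) (by decide) ?_ ?_ ?_ ?_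
  · rintro S m m' T ha hn ⟨R, out, hP, hc, h4, hrun, hT⟩
    rw [ha 4 (by decide)]
    exact ⟨R, out, hP.congr (by norm_num) ha hn, hc, h4, hrun, hT⟩
  · exact ⟨Finset.univ, id, h, by simp, by simp, by simp, by simp⟩
  · rintro k S hk m' T hs hi h0 ⟨R, out, hP, hc, h4, hrun, hT⟩
    have hcard := Set.ncard_insert_of_notMem hk
    have hcard' : (insert k S).ncard ≤ n := by
      simpa using Set.ncard_le_card (insert k S)
    rw [hcard, mul_add, mul_one]
    rw [hcard] at hcard'
    refine yields_seq ((chooseP_spec h0 h1 hP.remaining hP.num hP.den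
      (fun p => ratioDen_nonneg (fun u v _ => agree_nonneg K _) R p)
      (fun p => ratioDen_nonneg hy R p)).frame.mono ?_)
    rintro m1 T1 ⟨⟨hT1, hI⟩, hs1⟩
    have hP1 : PivotState G K y R m1 := hP.of_same hs1 (by decide) (by decide) (by decide)
      (by decide) (by decide) (by decide)
    have hst : (posI (sc 23)).steps ≤ 10 := by decide
    refine yields_branch_skip (fun hb => ?_) (fun hb => ?_)
    · have hb' : 0 < m1.idx 23 0 0 := hb
      rcases hI with ⟨h23, -⟩ | ⟨-, p, hp, h24, hmin⟩
      · omega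
      refine (clusterP_spec hP1 h1 h24).mono ?_
      rintro m2 T2 ⟨R', hsub, hR', hT2, hP2, h5, h5'⟩
      have hlt : R'.card < R.card := Finset.card_lt_card
        ⟨hsub, fun h => by simpa using (hR' p).1 (h hp)⟩
      refine ⟨R', fun v => if v ∈ R then p else out v, hP2, by omega, fun v hv => ?_,
        fun 𝒞' h𝒞' => ?_, by omega⟩
      · by_cases hvR : v ∈ R
        · simp [hvR, h5 v hvR hv]
        · simp [hvR, h5' v hvR, hs1.1 4 (by decide), h4 v hvR]
      · convert hrun _ (PivotRun.step_of_mem hp (hrule R p hp hmin) hR' h𝒞') using 1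
        funext v
        simp only [assignCluster, mem_pivotCluster, hR']
        by_cases hvR : v ∈ R <;> by_cases hvp : v = p ∨ K.Adj p v <;> simp [hvR, hvp]
    · have hb' : ¬ 0 < m1.idx 23 0 0 := hb
      rcases hI with ⟨-, rfl⟩ | ⟨h23, -⟩
      · refine ⟨∅, out, hP1, by simpa using hcard', ?_, hrun, ?_⟩
        · rw [hs1.1 4 (by decide)]; exact h4
        · omega
      · omega
  · rintro m' T T' hs hT ⟨R, out, hP, hc, h4, hrun, hT'⟩
    rw [Set.ncard_univ, Nat.card_eq_fintype_card, Fintype.card_fin] at hc hT'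
    obtain rfl : R = ∅ := Finset.card_eq_zero.1 (by omega)
    refine ⟨?_, out, by simpa using hrun id PivotRun.done, fun v => h4 v (by simp)⟩
    have e1 : 400 * n ^ 2 * n = 400 * n ^ 3 := by ring
    have e2 : 400 * n * n = 400 * n ^ 2 := by ring
    have e3 : n ^ 2 ≤ n ^ 3 := Nat.pow_le_pow_right h1 (by norm_num)
    have e4 : n ≤ n ^ 3 := Nat.le_self_pow (by norm_num) n
    omega

end RealRAM


namespace RealRAM

open CCInstance

variable {n : ℕ} {G : CCInstance (Fin n)}

/-! ## The complete algorithm -/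

theorem hasInput_input (G : CCInstance (Fin n)) (ε : ℝ) : HasInput G (input G ε) := by
  have key : ∀ (p : Prop) [Decidable p], 0 < (if p then 1 else 0) ↔ p := fun p _ => by
    split_ifs with h <;> simp [h]
  refine ⟨by simp [input], fun u v => ?_, fun u v => ?_, fun u v => ?_⟩ <;>
  · unfold input
    dsimp only
    rw [if_neg (by simp), key]
    simp

theorem idx_input (G : CCInstance (Fin n)) (ε : ℝ) {a : ℕ} (ha : 4 ≤ a) (i j : ℕ) :
    (input G ε).idx a i j = 0 := by
  have h0 : a ≠ 0 := by omega
  have h1 : a ≠ 1 := by omega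
  have h2 : a ≠ 2 := by omega
  have h3 : a ≠ 3 := by omega
  simp [input, h0, h1, h2, h3]

theorem num_input (G : CCInstance (Fin n)) (ε : ℝ) {a : ℕ} (ha : a ≠ 0) (i j : ℕ) :
    (input G ε).num a i j = 0 := by
  simp [input, ha]

/-- The algorithm. -/
def coverRoundP : Prog :=
  .seq labelsP (.seq hostP (.seq matchP (.seq solveP (.seq joinP (.seq adjP (.seq budgetP
    (.seq startP pivotP)))))))

/-- All stages except the linear program take O(n³) steps, so the solver dominates. -/
theorem coverRoundP_spec (h1 : 1 ≤ n) (hG : G.IsConsistent)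
    (hfeas : ∃ 𝒞 : Fin n → Fin n, G.IsFeasible 𝒞) {ε : ℝ} (hε0 : 0 < ε) (hε1 : ε < 1) :
    Yields coverRoundP (input G ε) fun m T =>
      T ≤ 60000000 * (ε⁻¹ ^ 2 * (n : ℝ) ^ 3 * (1 + Real.log n)) ∧
      ∃ 𝒟 X 𝒞, G.IsMaximalDangerous 𝒟 ∧ G.IsLPApprox 𝒟 (1 + ε / 3) X ∧
        PivotRun (G.auxGraph 𝒟 X) (G.MinimizesRatio 𝒟 X) Finset.univ 𝒞 ∧ IsOutput m 𝒞 := by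
  set m0 := input G ε with hm0
  have i0 : HasInput G m0 := hasInput_input G ε
  refine yields_seq ((labelsP_spec i0 h1).frame.mono ?_)
  rintro m1 T1 ⟨⟨hT1, lab, l1⟩, s1⟩
  have i1 := i0.of_same s1 (by decide)
  refine yields_seq ((hostP_spec i1 h1 l1 fun i j => by
    rw [s1.1 6 (by decide)]; exact idx_input G ε (by norm_num) i j).frame.mono ?_)
  rintro m2 T2 ⟨⟨hT2, k2⟩, s2⟩
  have i2 := i1.of_same s2 (by decide)
  have l2 : HasLabels G lab m2 := l1.of_eq (s2.1 5 (by decide))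
  refine yields_seq ((matchP_spec i2 h1 l2 k2
    (fun i j => by
      rw [s2.1 7 (by decide), s1.1 7 (by decide)]; exact idx_input G ε (by norm_num) i j)
    (fun i j => by
      rw [s2.1 10 (by decide), s1.1 10 (by decide)]
      exact idx_input G ε (by norm_num) i j)).frame.mono ?_)
  rintro m3 T3 ⟨⟨hT3, 𝒟, hD, k3⟩, s3⟩
  have d3 : HasData G lab 𝒟 m3 := ⟨i2.of_same s3 (by decide), l2.of_eq (s3.1 5 (by decide)),
    by unfold HasHostile; rw [s3.1 6 (by decide)]; exact k2, k3⟩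
  have s03 : ∀ a, a ∉ labelsP.numWrites → a ∉ hostP.numWrites → a ∉ matchP.numWrites →
      m3.num a = m0.num a := fun a h1 h2 h3 => by rw [s3.2 a h3, s2.2 a h2, s1.2 a h1]
  have t03 : ∀ a, a ∉ labelsP.idxWrites → a ∉ hostP.idxWrites → a ∉ matchP.idxWrites →
      m3.idx a = m0.idx a := fun a h1 h2 h3 => by rw [s3.1 a h3, s2.1 a h2, s1.1 a h1]
  refine yields_seq ((solveP_spec d3 h1 hG hD.1 hfeas hε0 hε1
    (by rw [s03 0 (by decide) (by decide) (by decide)]; simp [hm0, input])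
    (fun i j => by
      rw [s03 1 (by decide) (by decide) (by decide)]
      exact num_input G ε (by norm_num) i j)).frame.mono ?_)
  rintro m4 T4 ⟨⟨hT4, x, k4, hX⟩, s4⟩
  have d4 : HasData G lab 𝒟 m4 := d3.of_same s4 (by decide)
  refine yields_seq ((joinP_spec d4 h1 fun i j => by
    rw [s4.1 11 (by decide), t03 11 (by decide) (by decide) (by decide)]
    exact idx_input G ε (by norm_num) i j).frame.mono ?_)
  rintro m5 T5 ⟨⟨hT5, k5⟩, s5⟩
  have d5 : HasData G lab 𝒟 m5 := d4.of_same s5 (by decide)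
  have x5 : HasTable lab 4 x m5 := k4.of_eq (s5.2 4 (by decide))
  refine yields_seq ((adjP_spec d5 h1 k5 x5 fun i j => by
    rw [s5.1 12 (by decide), s4.1 12 (by decide), t03 12 (by decide) (by decide) (by decide)]
    exact idx_input G ε (by norm_num) i j).frame.mono ?_)
  rintro m6 T6 ⟨⟨hT6, k6⟩, s6⟩
  have d6 : HasData G lab 𝒟 m6 := d5.of_same s6 (by decide)
  have x6 : HasTable lab 4 x m6 := x5.of_eq (s6.2 4 (by decide))
  refine yields_seq ((budgetP_spec hD.1 d6 h1 x6 k6).frame.mono ?_)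
  rintro m7 T7 ⟨⟨hT7, k7⟩, s7⟩
  have d7 : HasData G lab 𝒟 m7 := d6.of_same s7 (by decide)
  have a7 : HasAdj (G.auxGraph 𝒟 (G.lpPoint x)) m7 := by
    unfold HasAdj; rw [s7.1 12 (by decide)]; exact k6
  refine yields_seq ((startP_spec ⟨d7.input, a7, k7⟩ h1
    (fun i j => by
      rw [s7.1 13 (by decide), s6.1 13 (by decide), s5.1 13 (by decide), s4.1 13 (by decide),
        t03 13 (by decide) (by decide) (by decide)]
      exact idx_input G ε (by norm_num) i j)
    (fun i j => by
      rw [s7.2 7 (by decide), s6.2 7 (by decide), s5.2 7 (by decide), s4.2 7 (by decide),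
        s03 7 (by decide) (by decide) (by decide)]
      exact num_input G ε (by norm_num) i j)
    (fun i j => by
      rw [s7.2 8 (by decide), s6.2 8 (by decide), s5.2 8 (by decide), s4.2 8 (by decide),
        s03 8 (by decide) (by decide) (by decide)]
      exact num_input G ε (by norm_num) i j)).mono ?_)
  rintro m8 T8 ⟨hT8, k8⟩
  refine (pivotP_spec k8 h1 (fun u v huv => budget_nonneg hX.1 huv)
    (rule := G.MinimizesRatio 𝒟 (G.lpPoint x)) fun R p _ h q hq => by
      rw [ratioNum_eq_ratioDen, ratioNum_eq_ratioDen]; exact h q hq).mono ?_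
  rintro m9 T9 ⟨hT9, 𝒞, hrun, hout⟩
  refine ⟨?_, 𝒟, G.lpPoint x, 𝒞, hD, hX, hrun, hout⟩
  have hn : (1 : ℝ) ≤ n := by exact_mod_cast h1
  have hlog : 0 ≤ Real.log n := Real.log_nonneg hn
  have hε : 1 ≤ ε⁻¹ ^ 2 := one_le_pow₀ ((one_le_inv₀ hε0).2 hε1.le)
  have h3 : (n : ℝ) ^ 3 ≤ ε⁻¹ ^ 2 * (n : ℝ) ^ 3 * (1 + Real.log n) := by
    have h2 : (n : ℝ) ^ 3 ≤ ε⁻¹ ^ 2 * (n : ℝ) ^ 3 := le_mul_of_one_le_left (by positivity) hε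
    exact h2.trans (le_mul_of_one_le_right (by positivity) (by linarith))
  have h23 : n ^ 2 ≤ n ^ 3 := Nat.pow_le_pow_right h1 (by norm_num)
  have hsum : T1 + T2 + T3 + T5 + T6 + T7 + T8 + T9 ≤ 4000 * n ^ 3 := by omega
  have hsum' : ((T1 + T2 + T3 + T5 + T6 + T7 + T8 + T9 : ℕ) : ℝ) ≤ 4000 * (n : ℝ) ^ 3 := by
    exact_mod_cast hsum
  push_cast at hsum' ⊢
  linarith

end RealRAM


/-! ### The theorem -/

theorem theorem3p3 :
    -- the guarantees, for all maximal sets `𝒟` and all approximate solutions `X`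
    (∀ (V : Type*) [Fintype V] (G : CCInstance V), G.IsConsistent →
      (∃ 𝒞₀ : V → V, G.IsFeasible 𝒞₀) →
      ∀ ε : ℝ, 0 < ε → ε < 1 →
      ∀ 𝒟 : Set (Sym2 (Sym2 V)), G.IsMaximalDangerous 𝒟 →
      ∀ X : CCInstance.LPPoint G, G.IsLPApprox 𝒟 (1 + ε / 3) X →
        -- the auxiliary graph is pivot-safe
        G.IsPivotSafe (G.auxGraph 𝒟 X) ∧
        -- ratio-minimizing pivots
        (∀ 𝒞 : V → V,
          CCInstance.PivotRun (G.auxGraph 𝒟 X) (G.MinimizesRatio 𝒟 X) Finset.univ 𝒞 →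
            G.IsApproxClustering (3 + ε) 𝒞) ∧
        -- uniform random pivots
        (∀ 𝒞 ∈ (CCInstance.randomPivot (G.auxGraph 𝒟 X) Finset.univ).support,
          G.IsFeasible 𝒞) ∧
        (∀ 𝒞' : V → V, G.IsFeasible 𝒞' →
          G.expectedCost (CCInstance.randomPivot (G.auxGraph 𝒟 X) Finset.univ) ≤
            (3 + ε) * G.cost 𝒞')) ∧
    -- the running time of the deterministic algorithm
    (∃ (P : RealRAM.Prog) (c : ℝ) (k : ℕ), ∀ (n : ℕ), 1 ≤ n →
      ∀ G : CCInstance (Fin n), G.IsConsistent → (∃ 𝒞₀ : Fin n → Fin n, G.IsFeasible 𝒞₀) →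
      ∀ ε : ℝ, 0 < ε → ε < 1 →
        ∃ (𝒟 : Set (Sym2 (Sym2 (Fin n)))) (X : CCInstance.LPPoint G) (𝒞 : Fin n → Fin n)
          (m : RealRAM.Mem) (T : ℕ),
          G.IsMaximalDangerous 𝒟 ∧ G.IsLPApprox 𝒟 (1 + ε / 3) X ∧
          CCInstance.PivotRun (G.auxGraph 𝒟 X) (G.MinimizesRatio 𝒟 X) Finset.univ 𝒞 ∧
          RealRAM.Run P (RealRAM.input G ε) m T ∧ RealRAM.IsOutput m 𝒞 ∧
          (T : ℝ) ≤ c * (ε⁻¹ ^ 3 * (n : ℝ) ^ 3 * (1 + Real.log n) ^ k)) := by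
  refine ⟨?_, RealRAM.coverRoundP, 60000000, 1, ?_⟩
  · intro V _ G hG _ ε _ _ 𝒟 hD X hX
    refine ⟨CCInstance.auxGraph_isPivotSafe hG hD hX.1,
      fun 𝒞 h => CCInstance.isApproxClustering_of_pivotRun hG hD hX h, fun 𝒞 h => ?_,
      fun 𝒞' h => CCInstance.expectedCost_le hG hD hX h⟩
    exact (CCInstance.pivotRun_of_mem_support _ 𝒞 h).isFeasible
      (CCInstance.auxGraph_isPivotSafe hG hD hX.1)
  · intro n h1 G hG hfeas ε hε0 hε1
    obtain ⟨m, T, hrun, hT, 𝒟, X, 𝒞, hD, hX, hp, ho⟩ :=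
      RealRAM.coverRoundP_spec h1 hG hfeas hε0 hε1
    refine ⟨𝒟, X, 𝒞, m, T, hD, hX, hp, hrun, ho, hT.trans ?_⟩
    have hn : (1 : ℝ) ≤ n := by exact_mod_cast h1
    have hlog : 0 ≤ Real.log n := Real.log_nonneg hn
    rw [pow_one]
    -- The program achieves ε⁻², which is at most ε⁻³ because ε < 1.
    gcongr
    · exact (one_le_inv₀ hε0).2 hε1.le
    · norm_num
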